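/- Let $n\ge 2$ and $m\ge 1$, let $B_1$ be the open unit ball of $\mathbb{R}^n$, and for $\mathbf v\in W^{1,2}(B_1;\mathbb{R}^m)$ let $$M(\mathbf v):=\int_{B_1}\bigl(|\nabla \mathbf v|^2+2|\mathbf v|\bigr)\,dx-2\int_{\partial B_1}|\mathbf v|^2\,d\mathcal H^{n-1},$$ where the values of $\mathbf v$ on $\partial B_1$ are those of its trace. Let $$\mathbb H:=\Bigl\{\tfrac{\max(x\cdot\nu,0)^2}{2}\,\mathbf e:\ \nu\in\mathbb{R}^n,\ \mathbf e\in\mathbb{R}^m \text{ unit vectors}\Bigr\},$$ and let $\alpha_n/2:=M(\mathbf h)$ for $\mathbf h\in\mathbb H$; this value does not depend on the choice of $\mathbf h\in\mathbb H$. Then there exist $\kappa\in(0,1)$ and $\delta>0$, depending only on $n$ and $m$, such that the following holds. If $\mathbf c\in W^{1,2}(B_1;\mathbb{R}^m)$ is homogeneous of degree $2$ and satisfies $$\|\mathbf c-\mathbf h\|_{W^{1,2}(B_1;\mathbb{R}^m)}+\|\mathbf c-\mathbf h\|_{L^\infty(B_1;\mathbb{R}^m)}\le\delta\quad\text{for some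 }\mathbf h\in\mathbb H,$$ then there is $\mathbf v\in W^{1,2}(B_1;\mathbb{R}^m)$ with $\mathbf v=\mathbf c$ on $\partial B_1$, that is $\mathbf v-\mathbf c\in W^{1,2}_0(B_1;\mathbb{R}^m)$, such that $$M(\mathbf v)\le(1-\kappa)\,M(\mathbf c)+\kappa\,\frac{\alpha_n}{2}.$$ -/

import Mathlib

open MeasureTheory Filter Topology
open scoped ENNReal ContDiff

noncomputable section

/-- The Euclidean space `ℝᵏ`. -/
abbrev E (k : ℕ) : Type := EuclideanSpace ℝ (Fin k)

/-- The space `ℝⁿᵐ` of gradients, as `n` partial derivatives with values in `ℝᵐ`. Its norm is the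
Euclidean one, so that `‖G‖ ^ 2 = ∑ i, ‖G i‖ ^ 2`. -/
abbrev Grad (n m : ℕ) : Type := PiLp 2 (fun _ : Fin n => E m)

/-- The open unit ball `B₁` of `ℝⁿ`. -/
def unitBall (n : ℕ) : Set (E n) := Metric.ball 0 1

/-- Lebesgue measure on `B₁`. -/
def ballMeasure (n : ℕ) : Measure (E n) := volume.restrict (unitBall n)

/-- The surface measure on the unit sphere `∂B₁`, normalized so that integration in polar
coordinates `dx = r ^ (n - 1) dr dσ` holds; this is the usual `(n - 1)`-dimensional Hausdorff
measure on `∂B₁`. -/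
def sphereMeasure (n : ℕ) : Measure (Metric.sphere (0 : E n) 1) :=
  (volume : Measure (E n)).toSphere

/-- `u ∈ L²(B₁; ℝᵐ)` has the weak gradient `G ∈ L²(B₁; ℝⁿᵐ)`: one has
`∫ (∂ᵢ φ) u = - ∫ φ Gᵢ` for all `i` and all test functions `φ ∈ C_c^∞(B₁)`. -/
def HasWeakGradient {n m : ℕ} (u : E n → E m) (G : E n → Grad n m) : Prop :=
  MemLp u 2 (ballMeasure n) ∧ MemLp G 2 (ballMeasure n) ∧
    ∀ φ : E n → ℝ, ContDiff ℝ ∞ φ → HasCompactSupport φ → tsupport φ ⊆ unitBall n →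
      ∀ i : Fin n,
        ∫ x, (fderiv ℝ φ x (EuclideanSpace.single i 1)) • u x ∂(ballMeasure n) =
          - ∫ x, φ x • G x i ∂(ballMeasure n)

/-- Membership in the Sobolev space `W^{1,2}(B₁; ℝᵐ)`. -/
def MemW12 {n m : ℕ} (u : E n → E m) : Prop :=
  ∃ G : E n → Grad n m, HasWeakGradient u G

open Classical in
/-- The weak gradient `∇u` of `u ∈ W^{1,2}(B₁; ℝᵐ)` (unique up to null sets). -/
def weakGradient {n m : ℕ} (u : E n → E m) : E n → Grad n m :=
  if h : MemW12 u then h.choose else 0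

/-- The norm of `W^{1,2}(B₁; ℝᵐ)`; it is meant for `u` with `MemW12 u`. -/
def w12Norm {n m : ℕ} (u : E n → E m) : ℝ≥0∞ :=
  (eLpNorm u 2 (ballMeasure n) ^ 2 +
    eLpNorm (weakGradient u) 2 (ballMeasure n) ^ 2) ^ (1 / 2 : ℝ)

/-- The norm of `L^∞(B₁; ℝᵐ)`, equal to `∞` for unbounded functions. -/
def supNorm {n m : ℕ} (u : E n → E m) : ℝ≥0∞ := eLpNorm u ∞ (ballMeasure n)

/-- Membership in `W₀^{1,2}(B₁; ℝᵐ)`, the closure of `C_c^∞(B₁; ℝᵐ)` in `W^{1,2}(B₁; ℝᵐ)`. -/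
def MemW012 {n m : ℕ} (u : E n → E m) : Prop :=
  MemW12 u ∧ ∃ φ : ℕ → E n → E m,
    (∀ k, ContDiff ℝ ∞ (φ k) ∧ HasCompactSupport (φ k) ∧ tsupport (φ k) ⊆ unitBall n) ∧
    Tendsto (fun k => w12Norm (u - φ k)) atTop (𝓝 0)

/-- `g ∈ L²(∂B₁; ℝᵐ)` is the trace of `u ∈ W^{1,2}(B₁; ℝᵐ)`: there are functions `φ k`, smooth up
to the boundary, with `φ k → u` in `W^{1,2}(B₁; ℝᵐ)` and `φ k → g` in `L²(∂B₁; ℝᵐ)`. -/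
def IsTrace {n m : ℕ} (u : E n → E m) (g : Metric.sphere (0 : E n) 1 → E m) : Prop :=
  MemW12 u ∧ MemLp g 2 (sphereMeasure n) ∧ ∃ φ : ℕ → E n → E m,
    (∀ k, ContDiff ℝ ∞ (φ k)) ∧
    Tendsto (fun k => w12Norm (u - φ k)) atTop (𝓝 0) ∧
    Tendsto (fun k => eLpNorm (fun θ : Metric.sphere (0 : E n) 1 => φ k θ - g θ) 2 (sphereMeasure n)) atTop (𝓝 0)

open Classical in
/-- The trace on `∂B₁` of `u ∈ W^{1,2}(B₁; ℝᵐ)` (unique up to null sets). -/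
def trace {n m : ℕ} (u : E n → E m) : Metric.sphere (0 : E n) 1 → E m :=
  if h : ∃ g, IsTrace u g then h.choose else 0

/-- The balanced energy `M(u) = ∫_{B₁} (|∇u|² + 2|u|) - 2 ∫_{∂B₁} |u|²` of
`u ∈ W^{1,2}(B₁; ℝᵐ)`. -/
def balancedEnergy {n m : ℕ} (u : E n → E m) : ℝ :=
  (∫ x, (‖weakGradient u x‖ ^ 2 + 2 * ‖u x‖) ∂(ballMeasure n)) -
    2 * ∫ θ, ‖trace u θ‖ ^ 2 ∂(sphereMeasure n)

/-- The function `x ↦ max(x · ν, 0)² / 2 · e`. -/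
def halfPlane {n m : ℕ} (ν : E n) (e : E m) : E n → E m :=
  fun x => (max (inner ℝ x ν) 0 ^ 2 / 2) • e

/-- The class `ℍ` of half-plane solutions. -/
def halfPlaneSolutions (n m : ℕ) : Set (E n → E m) :=
  {h | ∃ (ν : E n) (e : E m), ‖ν‖ = 1 ∧ ‖e‖ = 1 ∧ h = halfPlane ν e}

/-- The constant `αₙ`, given by `αₙ / 2 = M(max(x · ν, 0)² / 2 · e)`, with the choice of the unit
vectors `ν` and `e` made explicit. -/
def alphaN {n m : ℕ} (ν : E n) (e : E m) : ℝ := 2 * balancedEnergy (halfPlane ν e)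

/-- `c` is homogeneous of degree `2` on `B₁`. -/
def IsHomogeneousTwo {n m : ℕ} (c : E n → E m) : Prop :=
  ∀ x ∈ unitBall n, ∀ t : ℝ, 0 < t → t ≤ 1 → c (t • x) = t ^ 2 • c x

end

open MeasureTheory Filter Topology
open scoped ENNReal ContDiff

noncomputable section

/-! For a map `u` homogeneous of degree two the trace term is a volume term: Euler's identity gives
∫_{∂B₁} |u|² = (n + 4) ∫_{B₁} |u|². Hence M(u) = E(u, u) + 2 ∫ |u| with the quadratic form E(u, u) =
∫ |∇u|² - 2 (n + 4) ∫ |u|². On |x|² Y, with Y a spherical harmonic of degree j, the Dirichlet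
integral is `eigen n j` times the L² norm squared, and `eigen n 2` equals 2 (n + 4): degree two is
the kernel of E and higher degrees are positive. For s = max(x·ν, 0)²/2 one has Δs = 1_{x·ν>0}, so
that h = s e satisfies E(w, h) = -∫_{x·ν>0} w·e for homogeneous w. In particular E(h, h) = -I and
M(h) = I, where I = ∫ s.

Given c near a half-plane solution with data ν₀, e₀, write c = (1 + a) h + ψ with h adapted to c
(`exists_adapted`): ν maximizes the correlation of c·e₀ with s, and (1 + a) I e = ∫_{x·ν>0} c. The
second choice gives every component of ψ zero mean on the half-ball, so ψ is E-orthogonal to h; the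
first makes the tangential moments of c·e₀ vanish. Then M(c) - I = -a² I + Q + 2P with Q = E(ψ, ψ)
and P = ∫ (|c| - 1_{x·ν>0} c·e) ≥ 0 (`adapted_energies`).

The competitor is v = c + ε ζ d, where ζ is a radial cutoff and d = a h - ψ. Here c + d = (1 + 2a)
h: the energy is concave along the ray through h, so one moves further away from h along it, while ψ
shrinks. Integrals of homogeneous functions against radial weights factor, so the cutoff enters the
first variation only through a constant A > 0. Convexity of the norm handles |v|, and the first
order change is at most -ε A (2a² I + 2(Q + P)). If Q + P ≥ c₁ ∫ |ψ|², then the second order term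
and M(c) - I are both bounded by multiples of a² I + Q + P, and it remains to take ε and then κ
small (`exists_improvement`).

The heart is this lower bound (`coercive_deficit`). P dominates a large multiple of ∫ |ψ|² over x·ν
≤ 0, where ψ = c is small, and half of the integral of |c - (c·e) e|² over x·ν > 0. So a scalar
estimate suffices, with the mass on the wrong side and the tangential moments as penalties
(`coercivity`). By compactness it reduces to functions vanishing for x·ν ≤ 0, whose spectrum is that
of the harmonics odd under the reflection in ν. Degree one is controlled by the zero mean, since s
has negative energy, a nonzero degree one part, and is E-orthogonal to such functions. Degree two
consists of the functions (x·ν)(x·τ) with τ orthogonal to ν, which the tangential moments detect.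
From degree three on there is a strict gap.

The spectral theory avoids spherical harmonics. The functions |x|² (x·b/|x|)^j span, and the
spherical operator is triangular on them with respect to the degree;
`TriangularData.eig_mul_norm_sq_le` extracts the gap from that alone. The same data give compactness
and the density of functions smooth up to the boundary, which is what makes traces exist. -/

/-- Smooth scalar functions with compact support in the unit ball. -/
def IsTest {n : ℕ} (φ : E n → ℝ) : Prop :=
  ContDiff ℝ ∞ φ ∧ HasCompactSupport φ ∧ tsupport φ ⊆ unitBall n

/-- The scalar function `f` has the weak gradient `g` on the unit ball. -/
def HasScalarGradient {n : ℕ} (f : E n → ℝ) (g : E n → E n) : Prop :=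
  MemLp f 2 (ballMeasure n) ∧ MemLp g 2 (ballMeasure n) ∧
    ∀ φ : E n → ℝ, IsTest φ → ∀ b : E n,
      ∫ x, fderiv ℝ φ x b * f x ∂(ballMeasure n) = - ∫ x, φ x * inner ℝ (g x) b ∂(ballMeasure n)

/-- Almost everywhere homogeneity of degree `d` on the unit ball. -/
def AEHomog {n : ℕ} {F : Type*} [AddCommGroup F] [Module ℝ F] (d : ℕ) (H : E n → F) : Prop :=
  ∀ t : ℝ, 0 < t → t ≤ 1 → ∀ᵐ x ∂(ballMeasure n), H (t • x) = t ^ d • H x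

/-! ### The ball measure, test functions and the fundamental lemma -/

instance isFiniteMeasure_ballMeasure (n : ℕ) : IsFiniteMeasure (ballMeasure n) :=
  ⟨by simpa [ballMeasure, unitBall] using measure_ball_lt_top⟩

theorem measurableSet_unitBall (n : ℕ) : MeasurableSet (unitBall n) := measurableSet_ball

theorem ae_mem_unitBall (n : ℕ) : ∀ᵐ x ∂(ballMeasure n), x ∈ unitBall n :=
  ae_restrict_mem (measurableSet_unitBall n)

theorem ae_norm_le_one (n : ℕ) : ∀ᵐ x ∂(ballMeasure n), ‖x‖ ≤ 1 := by
  filter_upwards [ae_mem_unitBall n] with x hx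
  simpa [unitBall] using le_of_lt (mem_ball_zero_iff.1 hx)

section Tests
variable {n : ℕ} {φ : E n → ℝ}

theorem IsTest.fderiv_apply (h : IsTest φ) (b : E n) : IsTest (fun x => fderiv ℝ φ x b) := by
  refine ⟨?_, ?_, ?_⟩
  · exact (h.1.fderiv_right (m := ∞) (by simp)).clm_apply contDiff_const
  · exact h.2.1.fderiv_apply (𝕜 := ℝ) b
  · exact (tsupport_fderiv_apply_subset ℝ b).trans h.2.2

theorem IsTest.mul_right (h : IsTest φ) {ψ : E n → ℝ} (hψ : ContDiff ℝ ∞ ψ) :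
    IsTest (fun x => φ x * ψ x) :=
  ⟨h.1.mul hψ, h.2.1.mul_right, (tsupport_mul_subset_left).trans h.2.2⟩

theorem IsTest.bounded (h : IsTest φ) : ∃ C, ∀ x, ‖φ x‖ ≤ C :=
  h.2.1.exists_bound_of_continuous h.1.continuous

theorem IsTest.fderiv_bounded (h : IsTest φ) : ∃ C, ∀ x, ‖fderiv ℝ φ x‖ ≤ C :=
  (h.2.1.fderiv (𝕜 := ℝ)).exists_bound_of_continuous (h.1.continuous_fderiv (by simp))

theorem IsTest.memLp (h : IsTest φ) (p : ℝ≥0∞) : MemLp φ p (ballMeasure n) := by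
  obtain ⟨C, hC⟩ := h.bounded
  exact MemLp.of_bound h.1.continuous.aestronglyMeasurable C (ae_of_all _ hC)

end Tests

theorem ContDiff.bounded_on_ball {n : ℕ} {F : Type*} [NormedAddCommGroup F] {f : E n → F}
    (hf : Continuous f) : ∃ C, ∀ x, ‖x‖ ≤ 1 → ‖f x‖ ≤ C := by
  obtain ⟨C, hC⟩ := (isCompact_closedBall (0 : E n) 1).exists_bound_of_continuousOn hf.continuousOn
  exact ⟨C, fun x hx => hC x (by simpa using hx)⟩

theorem Continuous.memLp_ball {n : ℕ} {F : Type*} [NormedAddCommGroup F] {f : E n → F}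
    (hf : Continuous f) (p : ℝ≥0∞) : MemLp f p (ballMeasure n) := by
  obtain ⟨C, hC⟩ := ContDiff.bounded_on_ball hf
  exact MemLp.of_bound hf.aestronglyMeasurable C ((ae_norm_le_one n).mono fun x hx => hC x hx)

theorem ae_eq_of_test {n : ℕ} {F : Type*} [NormedAddCommGroup F] [NormedSpace ℝ F]
    [CompleteSpace F] {f g : E n → F}
    (hf : Integrable f (ballMeasure n)) (hg : Integrable g (ballMeasure n))
    (h : ∀ φ : E n → ℝ, IsTest φ →
      ∫ x, φ x • f x ∂(ballMeasure n) = ∫ x, φ x • g x ∂(ballMeasure n)) :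
    f =ᵐ[ballMeasure n] g := by
  have hloc : LocallyIntegrableOn (fun x => f x - g x) (unitBall n) volume :=
    (IntegrableOn.locallyIntegrableOn (hf.sub hg))
  have := IsOpen.ae_eq_zero_of_integral_contDiff_smul_eq_zero (μ := volume) (U := unitBall n)
    Metric.isOpen_ball hloc (fun φ h1 h2 h3 => by
      have ht : IsTest φ := ⟨h1, h2, h3⟩
      obtain ⟨C, hC⟩ := ht.bounded
      have e : ∫ x, φ x • (f x - g x) = ∫ x, φ x • (f x - g x) ∂(ballMeasure n) := by
        rw [ballMeasure, setIntegral_eq_integral_of_forall_compl_eq_zero]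
        intro x hx
        have : φ x = 0 := image_eq_zero_of_notMem_tsupport (fun h => hx (h3 h))
        simp [this]
      rw [e]
      simp only [smul_sub]
      rw [integral_sub, h φ ht, sub_self]
      · exact hf.bdd_smul C ht.1.continuous.aestronglyMeasurable (ae_of_all _ hC)
      · exact hg.bdd_smul C ht.1.continuous.aestronglyMeasurable (ae_of_all _ hC))
  rw [Filter.EventuallyEq, ballMeasure, ae_restrict_iff' (measurableSet_unitBall n)]
  filter_upwards [this] with x hx hxU
  exact sub_eq_zero.1 (hx hxU)

/-! ### Calculus of scalar weak gradients -/

section Scalar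
variable {n : ℕ} {f f₁ f₂ : E n → ℝ} {g g₁ g₂ : E n → E n}

theorem MeasureTheory.MemLp.mul_integrable {α : Type*} [MeasurableSpace α] {μ : Measure α} {f h : α → ℝ}
    (hf : MemLp f 2 μ) (hh : MemLp h 2 μ) : Integrable (fun x => f x * h x) μ :=
  hf.integrable_mul hh

theorem MeasureTheory.MemLp.inner_integrable {α F : Type*} [MeasurableSpace α] {μ : Measure α}
    [NormedAddCommGroup F] [InnerProductSpace ℝ F] {f h : α → F}
    (hf : MemLp f 2 μ) (hh : MemLp h 2 μ) : Integrable (fun x => inner ℝ (f x) (h x)) μ := by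
  refine (hf.norm.integrable_mul hh.norm).mono' (hf.1.inner hh.1) (ae_of_all _ fun x => ?_)
  simpa using norm_inner_le_norm (𝕜 := ℝ) (f x) (h x)

theorem HasScalarGradient.add (h₁ : HasScalarGradient f₁ g₁) (h₂ : HasScalarGradient f₂ g₂) :
    HasScalarGradient (fun x => f₁ x + f₂ x) (fun x => g₁ x + g₂ x) := by
  refine ⟨h₁.1.add h₂.1, h₁.2.1.add h₂.2.1, fun φ hφ b => ?_⟩
  simp only [mul_add, inner_add_left]
  rw [integral_add, integral_add, h₁.2.2 φ hφ b, h₂.2.2 φ hφ b]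
  · ring
  · exact (hφ.memLp 2).mul_integrable (h₁.2.1.inner_const b)
  · exact (hφ.memLp 2).mul_integrable (h₂.2.1.inner_const b)
  · exact ((hφ.fderiv_apply b).memLp 2).mul_integrable h₁.1
  · exact ((hφ.fderiv_apply b).memLp 2).mul_integrable h₂.1

theorem HasScalarGradient.const_mul (a : ℝ) (h : HasScalarGradient f g) :
    HasScalarGradient (fun x => a * f x) (fun x => a • g x) := by
  refine ⟨h.1.const_mul a, h.2.1.const_smul a, fun φ hφ b => ?_⟩
  simp only [inner_smul_left, mul_left_comm _ a]
  simp only [RCLike.conj_to_real, mul_left_comm _ a]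
  rw [integral_const_mul, integral_const_mul, h.2.2 φ hφ b, mul_neg]

theorem HasScalarGradient.zero : HasScalarGradient (fun _ : E n => (0 : ℝ)) (fun _ => 0) :=
  ⟨MemLp.zero', MemLp.zero', fun φ hφ b => by simp⟩

theorem HasScalarGradient.congr (h : HasScalarGradient f₁ g₁) (hf : f₁ =ᵐ[ballMeasure n] f₂)
    (hg : g₁ =ᵐ[ballMeasure n] g₂) : HasScalarGradient f₂ g₂ := by
  refine ⟨h.1.ae_eq hf, h.2.1.ae_eq hg, fun φ hφ b => ?_⟩
  have e1 : (fun x => fderiv ℝ φ x b * f₂ x) =ᵐ[ballMeasure n] fun x => fderiv ℝ φ x b * f₁ x :=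
    hf.mono fun x hx => by simp only [hx]
  have e2 : (fun x => φ x * inner ℝ (g₂ x) b) =ᵐ[ballMeasure n]
      fun x => φ x * inner ℝ (g₁ x) b := hg.mono fun x hx => by simp only [hx]
  rw [integral_congr_ae e1, integral_congr_ae e2]
  exact h.2.2 φ hφ b

theorem HasScalarGradient.sub (h₁ : HasScalarGradient f₁ g₁) (h₂ : HasScalarGradient f₂ g₂) :
    HasScalarGradient (fun x => f₁ x - f₂ x) (fun x => g₁ x - g₂ x) := by
  simpa [sub_eq_add_neg] using h₁.add (h₂.const_mul (-1))

theorem HasScalarGradient.smul_test (h : HasScalarGradient f g) {φ : E n → ℝ} (hφ : IsTest φ) :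
    ∀ i : Fin n, ∫ x, fderiv ℝ φ x (EuclideanSpace.single i 1) * f x ∂(ballMeasure n)
      = - ∫ x, φ x * g x i ∂(ballMeasure n) := by
  intro i
  rw [h.2.2 φ hφ]
  simp [EuclideanSpace.inner_single_right]

/-- Bridges the coordinate form of the definition of the vector weak gradient and the version with
arbitrary directions `b`, by linearity in `b`. -/
theorem hasScalarGradient_of_single (hf : MemLp f 2 (ballMeasure n))
    (hg : MemLp g 2 (ballMeasure n))
    (h : ∀ φ : E n → ℝ, IsTest φ → ∀ i : Fin n,
      ∫ x, fderiv ℝ φ x (EuclideanSpace.single i 1) * f x ∂(ballMeasure n)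
        = - ∫ x, φ x * g x i ∂(ballMeasure n)) : HasScalarGradient f g := by
  refine ⟨hf, hg, fun φ hφ b => ?_⟩
  have hb : b = ∑ i, b i • EuclideanSpace.single i (1 : ℝ) := by
    ext j; simp [Finset.sum_apply, Pi.single_apply]
  have h1 : ∀ x, fderiv ℝ φ x b * f x
      = ∑ i, b i * (fderiv ℝ φ x (EuclideanSpace.single i 1) * f x) := by
    intro x
    conv_lhs => rw [hb]
    simp [map_sum, Finset.sum_mul, mul_assoc]
  have h2 : ∀ x, φ x * inner ℝ (g x) b = ∑ i, b i * (φ x * g x i) := by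
    intro x
    simp only [PiLp.inner_apply, Finset.mul_sum]
    exact Finset.sum_congr rfl fun i _ => by simp; ring
  simp only [h1, h2]
  have hgi : ∀ i, MemLp (fun x => g x i) 2 (ballMeasure n) := fun i => by
    simpa [EuclideanSpace.inner_single_right] using
      hg.inner_const (𝕜 := ℝ) (EuclideanSpace.single i (1 : ℝ))
  rw [integral_finsetSum, integral_finsetSum, ← Finset.sum_neg_distrib]
  · refine Finset.sum_congr rfl fun i _ => ?_
    rw [integral_const_mul, integral_const_mul, h φ hφ i, mul_neg]
  · exact fun i _ => ((hφ.memLp 2).mul_integrable (hgi i)).const_mul _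
  · exact fun i _ => (((hφ.fderiv_apply _).memLp 2).mul_integrable hf).const_mul _

theorem HasScalarGradient.unique (h₁ : HasScalarGradient f g₁) (h₂ : HasScalarGradient f g₂) :
    g₁ =ᵐ[ballMeasure n] g₂ := by
  have key : ∀ i : Fin n, ∀ᵐ x ∂(ballMeasure n), g₁ x i = g₂ x i := by
    intro i
    have hi : ∀ {g : E n → E n}, MemLp g 2 (ballMeasure n) →
        Integrable (fun x => g x i) (ballMeasure n) := fun {g} hg => by
      have : MemLp (fun x => g x i) 2 (ballMeasure n) := by
        simpa [EuclideanSpace.inner_single_right] using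
          hg.inner_const (𝕜 := ℝ) (EuclideanSpace.single i (1 : ℝ))
      exact this.integrable (by norm_num)
    refine ae_eq_of_test (hi h₁.2.1) (hi h₂.2.1) fun φ hφ => ?_
    have := (h₁.smul_test hφ i).symm.trans (h₂.smul_test hφ i)
    simpa using this
  filter_upwards [ae_all_iff.2 key] with x hx
  ext i
  exact hx i

/-- Smooth functions have their classical gradient as weak gradient. -/
theorem hasScalarGradient_of_contDiff {φ : E n → ℝ} (hφ : ContDiff ℝ ∞ φ) :
    HasScalarGradient φ (gradient φ) := by
  have hc : Continuous (gradient φ) := by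
    unfold gradient
    exact (LinearIsometryEquiv.continuous _).comp (hφ.continuous_fderiv (by simp))
  refine ⟨hφ.continuous.memLp_ball 2, hc.memLp_ball 2, fun ψ hψ b => ?_⟩
  have e1 : ∀ F : E n → ℝ, (∀ x, x ∉ tsupport ψ → F x = 0) →
      ∫ x, F x ∂(ballMeasure n) = ∫ x, F x := by
    intro F hF
    rw [ballMeasure, setIntegral_eq_integral_of_forall_compl_eq_zero]
    exact fun x hx => hF x fun h => hx (hψ.2.2 h)
  have z : ∀ x, x ∉ tsupport ψ → ψ x = 0 := fun x hx => image_eq_zero_of_notMem_tsupport hx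
  have z' : ∀ x, x ∉ tsupport ψ → fderiv ℝ ψ x b = 0 := fun x hx =>
    image_eq_zero_of_notMem_tsupport (f := fun x => fderiv ℝ ψ x b)
      fun h => hx ((tsupport_fderiv_apply_subset ℝ b) h)
  rw [e1 _ fun x hx => by simp [z' x hx], e1 _ fun x hx => by simp [z x hx]]
  have hg : ∀ x, inner ℝ (gradient φ x) b = fderiv ℝ φ x b := by
    intro x; simp [gradient]
  simp only [hg]
  have i1 : ∀ F : E n → ℝ, Continuous F → (∀ x, x ∉ tsupport ψ → F x = 0) →
      Integrable F volume := fun F hF h0 =>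
    hF.integrable_of_hasCompactSupport (HasCompactSupport.intro hψ.2.1 h0)
  have c1 := hψ.1.continuous
  have c2 := hφ.continuous
  have c3 : Continuous fun x => fderiv ℝ ψ x b := (hψ.fderiv_apply b).1.continuous
  have c4 : Continuous fun x => fderiv ℝ φ x b :=
    (hφ.continuous_fderiv (by simp)).clm_apply continuous_const
  have := integral_mul_fderiv_eq_neg_fderiv_mul_of_integrable (μ := volume) (f := ψ) (g := φ)
    (v := b) (i1 _ (c3.mul c2) fun x hx => by simp [z' x hx])
    (i1 _ (c1.mul c4) fun x hx => by simp [z x hx]) (i1 _ (c1.mul c2) fun x hx => by simp [z x hx])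
    (fun x _ => hψ.1.differentiable (by simp) x) (fun x _ => hφ.differentiable (by simp) x)
  rw [this, neg_neg]

/-- Weak gradients pass to limits in `L²` tested against bounded functions. -/
theorem hasScalarGradient_of_tendsto {ι : Type*} {l : Filter ι} [l.NeBot]
    {F : ι → E n → ℝ} {G : ι → E n → E n} (h : ∀ k, HasScalarGradient (F k) (G k))
    (hf : MemLp f 2 (ballMeasure n)) (hg : MemLp g 2 (ballMeasure n))
    (hF : ∀ φ : E n → ℝ, IsTest φ → Tendsto (fun k => ∫ x, φ x * F k x ∂(ballMeasure n)) l
      (𝓝 (∫ x, φ x * f x ∂(ballMeasure n))))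
    (hG : ∀ φ : E n → ℝ, IsTest φ → ∀ b, Tendsto
      (fun k => ∫ x, φ x * inner ℝ (G k x) b ∂(ballMeasure n)) l
      (𝓝 (∫ x, φ x * inner ℝ (g x) b ∂(ballMeasure n)))) : HasScalarGradient f g := by
  refine ⟨hf, hg, fun φ hφ b => ?_⟩
  refine tendsto_nhds_unique (hF _ (hφ.fderiv_apply b)) ?_
  simp only [(h _).2.2 φ hφ b]
  exact (hG φ hφ b).neg

end Scalar

/-! ### Homogeneous functions integrated against radial weights -/

section Homogeneous
variable {n : ℕ}

open scoped Pointwise in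
theorem smul_unitBall_eq_ball {t : ℝ} (ht : 0 < t) : t • unitBall n = Metric.ball (0 : E n) t := by
  rw [unitBall, smul_unitBall_of_pos ht]

theorem setIntegral_ball_comp_smul {F : Type*} [NormedAddCommGroup F] [NormedSpace ℝ F]
    (f : E n → F) {t : ℝ} (ht : 0 < t) :
    ∫ x, f (t • x) ∂(ballMeasure n) = (t ^ n)⁻¹ • ∫ x in Metric.ball (0 : E n) t, f x := by
  rw [ballMeasure, Measure.setIntegral_comp_smul_of_pos _ _ _ ht, smul_unitBall_eq_ball ht]
  simp

theorem ball_subset_unitBall {t : ℝ} (ht : t ≤ 1) : Metric.ball (0 : E n) t ⊆ unitBall n :=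
  Metric.ball_subset_ball ht

theorem AEHomog.setIntegral_ball {d : ℕ} {H : E n → ℝ} (h : AEHomog d H) {t : ℝ} (ht : 0 < t)
    (ht1 : t ≤ 1) :
    ∫ x in Metric.ball (0 : E n) t, H x = t ^ (n + d) * ∫ x, H x ∂(ballMeasure n) := by
  have h1 := setIntegral_ball_comp_smul H ht
  rw [integral_congr_ae (h t ht ht1)] at h1
  simp only [smul_eq_mul] at h1
  rw [integral_const_mul] at h1
  have : t ^ n ≠ 0 := by positivity
  rw [pow_add, mul_assoc, h1, mul_inv_cancel_left₀ this]

theorem AEHomog.add {F : Type*} [AddCommGroup F] [Module ℝ F] {d : ℕ} {H K : E n → F}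
    (hH : AEHomog d H) (hK : AEHomog d K) : AEHomog d (fun x => H x + K x) := fun t h0 h1 => by
  filter_upwards [hH t h0 h1, hK t h0 h1] with x h2 h3
  rw [h2, h3, smul_add]

theorem AEHomog.const_smul {F : Type*} [AddCommGroup F] [Module ℝ F] {d : ℕ} {H : E n → F}
    (hH : AEHomog d H) (a : ℝ) : AEHomog d (fun x => a • H x) := fun t h0 h1 => by
  filter_upwards [hH t h0 h1] with x h2
  rw [h2, smul_comm]

theorem AEHomog.sub {F : Type*} [AddCommGroup F] [Module ℝ F] {d : ℕ} {H K : E n → F}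
    (hH : AEHomog d H) (hK : AEHomog d K) : AEHomog d (fun x => H x - K x) := fun t h0 h1 => by
  filter_upwards [hH t h0 h1, hK t h0 h1] with x h2 h3
  rw [h2, h3, smul_sub]

theorem AEHomog.mul {d e : ℕ} {H K : E n → ℝ}
    (hH : AEHomog d H) (hK : AEHomog e K) : AEHomog (d + e) (fun x => H x * K x) :=
  fun t h0 h1 => by
    filter_upwards [hH t h0 h1, hK t h0 h1] with x h2 h3
    rw [h2, h3, smul_eq_mul, smul_eq_mul, smul_eq_mul, pow_add]
    ring

theorem AEHomog.inner {F : Type*} [NormedAddCommGroup F] [InnerProductSpace ℝ F] {d e : ℕ}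
    {H K : E n → F} (hH : AEHomog d H) (hK : AEHomog e K) :
    AEHomog (d + e) (fun x => inner ℝ (H x) (K x)) := fun t h0 h1 => by
  filter_upwards [hH t h0 h1, hK t h0 h1] with x h2 h3
  rw [h2, h3, real_inner_smul_left, real_inner_smul_right, smul_eq_mul, pow_add]
  ring

theorem AEHomog.norm {F : Type*} [NormedAddCommGroup F] [NormedSpace ℝ F] {d : ℕ}
    {H : E n → F} (hH : AEHomog d H) : AEHomog d (fun x => ‖H x‖) := fun t h0 h1 => by
  filter_upwards [hH t h0 h1] with x h2
  rw [h2, norm_smul, Real.norm_of_nonneg (by positivity), smul_eq_mul]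

theorem AEHomog.of_forall {F : Type*} [AddCommGroup F] [Module ℝ F] {d : ℕ} {H : E n → F}
    (h : ∀ t : ℝ, 0 < t → ∀ x, H (t • x) = t ^ d • H x) : AEHomog d H :=
  fun t h0 _ => ae_of_all _ (h t h0)

/-- A substitute for polar coordinates which needs homogeneity only almost everywhere for each
dilation: the mass of `H` in the ball of radius `t` is `t ^ (n + d)` times the total mass, and this
determines the law of `‖x‖` under the density `H`. -/
theorem map_norm_withDensity_eq {d : ℕ} (hd : 0 < n + d) {H : E n → ℝ} (h : AEHomog d H)
    (hi : Integrable H (ballMeasure n)) (h0 : ∀ x, 0 ≤ H x) :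
    ((ballMeasure n).withDensity (fun x => ENNReal.ofReal (H x))).map (fun x => ‖x‖) =
      ENNReal.ofReal (∫ x, H x ∂(ballMeasure n)) • ((volume.restrict (Set.Ioc (0:ℝ) 1)).withDensity
        (fun r => ENNReal.ofReal (((n + d : ℕ) : ℝ) * r ^ (n + d - 1)))) := by
  set I := ∫ x, H x ∂(ballMeasure n) with hI
  have hI0 : 0 ≤ I := integral_nonneg h0
  have : IsFiniteMeasure ((ballMeasure n).withDensity (fun x => ENNReal.ofReal (H x))) :=
    isFiniteMeasure_withDensity_ofReal hi.2
  have hN : ((n + d : ℕ) : ℝ) ≠ 0 := by positivity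
  -- Finite measures on the line are compared on the tails `[t, ∞)`; only `0 < t ≤ 1` has content,
  -- where the tail is the total mass minus the mass of the ball of radius `t`.
  refine Measure.ext_of_Ici _ _ fun t => ?_
  have hm : MeasurableSet {x : E n | t ≤ ‖x‖} := measurableSet_le measurable_const measurable_norm
  rw [Measure.map_apply measurable_norm measurableSet_Ici]
  have hpre : (fun x : E n => ‖x‖) ⁻¹' Set.Ici t = {x : E n | t ≤ ‖x‖} := rfl
  rw [hpre, withDensity_apply _ hm, Measure.smul_apply, withDensity_apply _ measurableSet_Ici,
    Measure.restrict_restrict measurableSet_Ici,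
    ← ofReal_integral_eq_lintegral_ofReal hi.integrableOn (ae_of_all _ h0)]
  have hposr : ∀ s : ℝ, 0 ≤ s → ∫⁻ r in Set.Ioc s 1,
      ENNReal.ofReal (((n + d : ℕ) : ℝ) * r ^ (n + d - 1)) = ENNReal.ofReal (1 - s ^ (n + d)) ∨
      1 < s := by
    intro s hs
    rcases le_or_gt s 1 with h1 | h1
    · left
      rw [← ofReal_integral_eq_lintegral_ofReal]
      · rw [← intervalIntegral.integral_of_le h1, intervalIntegral.integral_const_mul,
          integral_pow]
        congr 1
        have e : n + d - 1 + 1 = n + d := by omega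
        have e' : ((n + d - 1 : ℕ) : ℝ) + 1 = ((n + d : ℕ) : ℝ) := by
          rw [← e]; push_cast; simp
        rw [e, e']
        field_simp
        simp
      · exact ((continuous_const.mul (continuous_pow _)).integrableOn_Icc).mono_set
          Set.Ioc_subset_Icc_self
      · filter_upwards [ae_restrict_mem measurableSet_Ioc] with r hr
        have : 0 ≤ r := hs.trans hr.1.le
        simp only [Pi.zero_apply]; positivity
    · exact Or.inr h1
  rcases le_or_gt t 0 with ht | ht
  · have e1 : {x : E n | t ≤ ‖x‖} = Set.univ := by
      ext x; simp [ht.trans (norm_nonneg x)]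
    have e2 : Set.Ici t ∩ Set.Ioc (0:ℝ) 1 = Set.Ioc 0 1 := by
      ext r; simp only [Set.mem_inter_iff, Set.mem_Ici, Set.mem_Ioc]
      exact ⟨fun h => h.2, fun h => ⟨ht.trans h.1.le, h⟩⟩
    rw [e1, e2, setIntegral_univ, (hposr 0 le_rfl).resolve_right (by norm_num)]
    simp [zero_pow hd.ne', hI]
  rcases le_or_gt t 1 with ht1 | ht1
  · have e2 : Set.Ici t ∩ Set.Ioc (0:ℝ) 1 = Set.Icc t 1 := by
      ext r; simp only [Set.mem_inter_iff, Set.mem_Ici, Set.mem_Ioc, Set.mem_Icc]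
      exact ⟨fun h => ⟨h.1, h.2.2⟩, fun h => ⟨h.1, ht.trans_le h.1, h.2⟩⟩
    rw [e2, setLIntegral_congr Ioc_ae_eq_Icc.symm, (hposr t ht.le).resolve_right (by linarith)]
    have e3 : ∫ x in {x : E n | t ≤ ‖x‖}, H x ∂(ballMeasure n) = I - t ^ (n + d) * I := by
      have hs := integral_add_compl hm hi
      have e4 : ∫ x in {x : E n | t ≤ ‖x‖}ᶜ, H x ∂(ballMeasure n) = t ^ (n + d) * I := by
        rw [hI, ← h.setIntegral_ball ht ht1, ballMeasure, Measure.restrict_restrict hm.compl]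
        congr 2
        ext x
        simp only [Set.mem_inter_iff, Set.mem_compl_iff, Set.mem_ofPred_eq, not_le, unitBall,
          mem_ball_zero_iff]
        exact ⟨fun h => h.1, fun h => ⟨h, h.trans_le ht1⟩⟩
      rw [e4] at hs
      linarith
    rw [e3, smul_eq_mul, ← ENNReal.ofReal_mul hI0]
    congr 1; ring
  · have e2 : Set.Ici t ∩ Set.Ioc (0:ℝ) 1 = ∅ := by
      ext r; simp only [Set.mem_inter_iff, Set.mem_Ici, Set.mem_Ioc, Set.mem_empty_iff_false,
        iff_false]
      intro h; linarith [h.1, h.2.2]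
    have e3 : ∫ x in {x : E n | t ≤ ‖x‖}, H x ∂(ballMeasure n) = 0 := by
      rw [ballMeasure, Measure.restrict_restrict hm]
      have : {x : E n | t ≤ ‖x‖} ∩ unitBall n = ∅ := by
        ext x
        simp only [Set.mem_inter_iff, Set.mem_ofPred_eq, unitBall, mem_ball_zero_iff,
          Set.mem_empty_iff_false, iff_false]
        intro h; linarith [h.1, h.2]
      simp [this]
    simp [e2, e3]

/-- The mass of the weight `w(|x|)` against functions homogeneous of degree `d`. -/
def radialMass (n d : ℕ) (w : ℝ → ℝ) : ℝ :=
  ∫ r in (0:ℝ)..1, w r * (((n + d : ℕ) : ℝ) * r ^ (n + d - 1))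

theorem integral_radial_mul_of_nonneg {d : ℕ} (hd : 0 < n + d) {H : E n → ℝ} (h : AEHomog d H)
    (hi : Integrable H (ballMeasure n)) (h0 : ∀ x, 0 ≤ H x) {w : ℝ → ℝ} (hw : Continuous w) :
    ∫ x, w ‖x‖ * H x ∂(ballMeasure n) = radialMass n d w * ∫ x, H x ∂(ballMeasure n) := by
  have key := map_norm_withDensity_eq hd h hi h0
  have h1 : ∫ r, w r ∂(((ballMeasure n).withDensity
      (fun x => ENNReal.ofReal (H x))).map (fun x => ‖x‖)) = ∫ x, w ‖x‖ * H x ∂(ballMeasure n) := by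
    rw [integral_map measurable_norm.aemeasurable hw.aestronglyMeasurable,
      integral_withDensity_eq_integral_toReal_smul₀ hi.1.aemeasurable.ennreal_ofReal
        (ae_of_all _ fun _ => ENNReal.ofReal_lt_top)]
    refine integral_congr_ae (ae_of_all _ fun x => ?_)
    simp only
    rw [ENNReal.toReal_ofReal (h0 x), smul_eq_mul, mul_comm]
  rw [← h1, key, integral_smul_measure, ENNReal.toReal_ofReal (integral_nonneg h0),
    integral_withDensity_eq_integral_toReal_smul₀
      (by fun_prop) (ae_of_all _ fun _ => ENNReal.ofReal_lt_top), radialMass,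
    intervalIntegral.integral_of_le zero_le_one, smul_eq_mul, mul_comm]
  congr 1
  refine setIntegral_congr_fun measurableSet_Ioc fun r hr => ?_
  have : 0 ≤ r := hr.1.le
  rw [ENNReal.toReal_ofReal (by positivity), smul_eq_mul, mul_comm]

/-- Positive and negative parts of a homogeneous function are again homogeneous, so the sign
assumption is removed by splitting. This is the factorization by which every cutoff below disappears
from the identities. -/
theorem integral_radial_mul {d : ℕ} (hd : 0 < n + d) {H : E n → ℝ} (h : AEHomog d H)
    (hi : Integrable H (ballMeasure n)) {w : ℝ → ℝ} (hw : Continuous w) :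
    ∫ x, w ‖x‖ * H x ∂(ballMeasure n) = radialMass n d w * ∫ x, H x ∂(ballMeasure n) := by
  have hp : AEHomog d (fun x => max (H x) 0) := fun t ht ht1 => by
    filter_upwards [h t ht ht1] with x hx
    have : 0 ≤ t ^ d := by positivity
    rw [hx, smul_eq_mul, smul_eq_mul, mul_max_of_nonneg _ _ this, mul_zero]
  have hm : AEHomog d (fun x => max (-H x) 0) := fun t ht ht1 => by
    filter_upwards [h t ht ht1] with x hx
    have : 0 ≤ t ^ d := by positivity
    rw [hx, smul_eq_mul, smul_eq_mul, mul_max_of_nonneg _ _ this, mul_zero, mul_neg]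
  have e : ∀ x, H x = max (H x) 0 - max (-H x) 0 := fun x => by
    rcases le_total (H x) 0 with h | h
    · rw [max_eq_right h, max_eq_left (by linarith)]; ring
    · rw [max_eq_left h, max_eq_right (by linarith)]; ring
  have ip : Integrable (fun x => max (H x) 0) (ballMeasure n) := hi.pos_part
  have im : Integrable (fun x => max (-H x) 0) (ballMeasure n) := hi.neg_part
  obtain ⟨C, hC⟩ := ContDiff.bounded_on_ball (n := n) (hw.comp continuous_norm)
  have hwb : ∀ {K : E n → ℝ}, Integrable K (ballMeasure n) →
      Integrable (fun x => w ‖x‖ * K x) (ballMeasure n) := fun hK =>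
    hK.bdd_mul (c := C) (hw.comp continuous_norm).aestronglyMeasurable
      ((ae_norm_le_one n).mono fun x hx => hC x hx)
  calc ∫ x, w ‖x‖ * H x ∂(ballMeasure n)
      = ∫ x, (w ‖x‖ * max (H x) 0 - w ‖x‖ * max (-H x) 0) ∂(ballMeasure n) := by
        refine integral_congr_ae (ae_of_all _ fun x => ?_)
        simp only
        rw [← mul_sub, ← e]
    _ = radialMass n d w * ∫ x, (max (H x) 0 - max (-H x) 0) ∂(ballMeasure n) := by
        rw [integral_sub (hwb ip) (hwb im), integral_sub ip im,
          integral_radial_mul_of_nonneg hd hp ip (fun x => le_max_right _ _) hw,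
          integral_radial_mul_of_nonneg hd hm im (fun x => le_max_right _ _) hw]
        ring
    _ = _ := by simp only [← e]

theorem radialMass_pow (hn : 0 < n) (d k : ℕ) :
    radialMass n d (fun r => r ^ k) = ((n + d : ℕ) : ℝ) / ((n + d + k : ℕ) : ℝ) := by
  have : ∀ r : ℝ, r ^ k * (((n + d : ℕ) : ℝ) * r ^ (n + d - 1))
      = ((n + d : ℕ) : ℝ) * r ^ (n + d + k - 1) := by
    intro r
    rw [mul_left_comm, ← pow_add]
    congr 2; omega
  unfold radialMass
  simp only [this]
  rw [intervalIntegral.integral_const_mul, integral_pow]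
  have e : n + d + k - 1 + 1 = n + d + k := by omega
  have e' : ((n + d + k - 1 : ℕ) : ℝ) + 1 = ((n + d + k : ℕ) : ℝ) := by
    rw [← e]; push_cast; simp
  rw [e, e', one_pow, zero_pow (by omega)]
  ring

end Homogeneous

/-! ### Homogeneity of the weak gradient and Euler's identity -/

section Euler
variable {n : ℕ}

/-- The scalar function `f` belongs to `W^{1,2}`, has weak gradient `g`, and is homogeneous of
degree two. -/
def IsHomogeneousPair (f : E n → ℝ) (g : E n → E n) : Prop :=
  HasScalarGradient f g ∧ AEHomog 2 f

theorem IsTest.comp_inv_smul {φ : E n → ℝ} (hφ : IsTest φ) {t : ℝ} (ht : 0 < t) (ht1 : t ≤ 1) :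
    IsTest (fun x => φ (t⁻¹ • x)) ∧ ∀ x ∉ Metric.ball (0 : E n) t, φ (t⁻¹ • x) = 0 := by
  have hz : ∀ x ∉ Metric.ball (0 : E n) t, t⁻¹ • x ∉ tsupport φ := by
    intro x hx h
    have := hφ.2.2 h
    apply hx
    rw [unitBall, mem_ball_zero_iff, norm_smul, norm_inv, Real.norm_of_nonneg ht.le,
      inv_mul_lt_iff₀ ht, mul_one] at this
    simpa using this
  have hK : IsCompact ((fun x : E n => t • x) '' tsupport φ) :=
    hφ.2.1.isCompact.image (continuous_const_smul t)
  have hsup : tsupport (fun x => φ (t⁻¹ • x)) ⊆ (fun x : E n => t • x) '' tsupport φ := by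
    refine closure_minimal ?_ hK.isClosed
    intro x hx
    exact ⟨t⁻¹ • x, subset_tsupport _ hx, by simp [smul_smul, mul_inv_cancel₀ ht.ne']⟩
  refine ⟨⟨hφ.1.comp (contDiff_const_smul _), hK.of_isClosed_subset (isClosed_tsupport _) hsup,
    fun x hx => ?_⟩, fun x hx => image_eq_zero_of_notMem_tsupport (hz x hx)⟩
  obtain ⟨y, hy, rfl⟩ := hsup hx
  have h1 : ‖y‖ < 1 := by simpa [unitBall] using hφ.2.2 hy
  simp only [unitBall, mem_ball_zero_iff, norm_smul, Real.norm_of_nonneg ht.le]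
  nlinarith [norm_nonneg y]

theorem integral_eq_setIntegral_of_test {F : E n → ℝ} {t : ℝ} (ht1 : t ≤ 1)
    (h : ∀ x ∉ Metric.ball (0 : E n) t, F x = 0) :
    ∫ x in Metric.ball (0 : E n) t, F x = ∫ x, F x ∂(ballMeasure n) := by
  rw [ballMeasure]
  exact (setIntegral_eq_of_subset_of_forall_sdiff_eq_zero (measurableSet_unitBall n)
    (ball_subset_unitBall ht1) fun x hx => h x hx.2).symm

theorem fderiv_comp_inv_smul (φ : E n → ℝ) (t : ℝ) (x b : E n) :
    fderiv ℝ (fun x => φ (t⁻¹ • x)) x b = t⁻¹ * fderiv ℝ φ (t⁻¹ • x) b := by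
  have := fderiv_comp_smul (𝕜 := ℝ) (f := φ) t⁻¹ (x := x)
  rw [this]; simp

theorem MeasureTheory.MemLp.comp_smul_ball {F : Type*} [NormedAddCommGroup F] {g : E n → F} {p : ℝ≥0∞}
    (hg : MemLp g p (ballMeasure n)) {t : ℝ} (ht : 0 < t) (ht1 : t ≤ 1) :
    MemLp (fun x => g (t • x)) p (ballMeasure n) := by
  have h1 : MemLp g p (volume.restrict (Metric.ball (0 : E n) t)) :=
    hg.mono_measure (Measure.restrict_mono (ball_subset_unitBall ht1) le_rfl)
  have hmap : Measure.map (fun x : E n => t • x) (ballMeasure n)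
      = ENNReal.ofReal |(t ^ n)⁻¹| • volume.restrict (Metric.ball (0 : E n) t) := by
    have h2 := Measure.map_addHaar_smul (volume : Measure (E n)) ht.ne'
    have h3 : (fun x : E n => t • x) ⁻¹' (Metric.ball (0 : E n) t) = unitBall n := by
      ext x
      simp only [Set.mem_preimage, mem_ball_zero_iff, norm_smul, Real.norm_of_nonneg ht.le, unitBall]
      constructor <;> intro h
      · exact lt_of_mul_lt_mul_left (by simpa using h) ht.le
      · nlinarith
    rw [ballMeasure, ← h3, ← Measure.restrict_map (measurable_const_smul t) measurableSet_ball, h2,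
      Measure.restrict_smul]
    simp
  have h4 : MemLp g p (Measure.map (fun x : E n => t • x) (ballMeasure n)) := by
    rw [hmap]; exact h1.smul_measure (by simp)
  exact h4.comp_of_map (measurable_const_smul t).aemeasurable

/-- Weak gradients are unique, and `t⁻¹ • g (t • x)` is another weak gradient of the same function.
-/
theorem IsHomogeneousPair.gradient_homog {f : E n → ℝ} {g : E n → E n}
    (h : IsHomogeneousPair f g) : AEHomog 1 g := by
  intro t ht ht1
  have e1 : MemLp (fun x => g (t • x)) 2 (ballMeasure n) := h.1.2.1.comp_smul_ball ht ht1
  -- The test function is dilated to `φ (t⁻¹ • x)`, supported in the ball of radius `t`, so that the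
  -- change of variables never leaves the unit ball.
  have key : HasScalarGradient f (fun x => t⁻¹ • g (t • x)) := by
    refine ⟨h.1.1, e1.const_smul (t⁻¹ : ℝ), fun φ hφ b => ?_⟩
    obtain ⟨hT, hz⟩ := hφ.comp_inv_smul ht ht1
    have a1 := h.1.2.2 _ hT b
    have a2 : ∫ x, φ (t⁻¹ • x) * inner ℝ (g x) b ∂(ballMeasure n)
        = t ^ n * ∫ x, φ x * inner ℝ (g (t • x)) b ∂(ballMeasure n) := by
      have := setIntegral_ball_comp_smul (fun x => φ (t⁻¹ • x) * inner ℝ (g x) b) ht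
      simp only [smul_smul, inv_mul_cancel₀ ht.ne', one_smul] at this
      rw [integral_eq_setIntegral_of_test ht1 (fun x hx => by rw [hz x hx, zero_mul])] at this
      rw [this, smul_eq_mul, mul_inv_cancel_left₀ (by positivity)]
    have a3 : ∫ x, fderiv ℝ (fun x => φ (t⁻¹ • x)) x b * f x ∂(ballMeasure n)
        = t ^ n * (t * ∫ x, fderiv ℝ φ x b * f x ∂(ballMeasure n)) := by
      have hz' := ((hφ.fderiv_apply b).comp_inv_smul ht ht1).2
      have := setIntegral_ball_comp_smul (fun x => fderiv ℝ φ (t⁻¹ • x) b * f x) ht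
      simp only [smul_smul, inv_mul_cancel₀ ht.ne', one_smul] at this
      rw [integral_eq_setIntegral_of_test ht1 (fun x hx => by rw [hz' x hx, zero_mul])] at this
      have h5 : ∫ x, fderiv ℝ φ x b * f (t • x) ∂(ballMeasure n)
          = t ^ 2 * ∫ x, fderiv ℝ φ x b * f x ∂(ballMeasure n) := by
        rw [← integral_const_mul]
        refine integral_congr_ae ?_
        filter_upwards [h.2 t ht ht1] with x hx
        rw [hx, smul_eq_mul]; ring
      rw [h5, smul_eq_mul] at this
      simp only [fderiv_comp_inv_smul φ, mul_assoc]
      rw [integral_const_mul]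
      have h6 : ∫ x, fderiv ℝ φ (t⁻¹ • x) b * f x ∂(ballMeasure n)
        = t ^ n * (t ^ 2 * ∫ x, fderiv ℝ φ x b * f x ∂(ballMeasure n)) := by
        rw [this, mul_inv_cancel_left₀ (by positivity)]
      rw [h6]; field_simp
    rw [a2, a3] at a1
    have htn : t ^ n ≠ 0 := by positivity
    have a4 : t * ∫ x, fderiv ℝ φ x b * f x ∂(ballMeasure n)
        = - ∫ x, φ x * inner ℝ (g (t • x)) b ∂(ballMeasure n) := by
      apply mul_left_cancel₀ htn; rw [a1]; ring
    have a5 : ∫ x, φ x * inner ℝ (t⁻¹ • g (t • x)) b ∂(ballMeasure n)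
        = t⁻¹ * ∫ x, φ x * inner ℝ (g (t • x)) b ∂(ballMeasure n) := by
      rw [← integral_const_mul]
      refine integral_congr_ae (ae_of_all _ fun x => ?_)
      simp only [real_inner_smul_left]; ring
    rw [a5, ← mul_neg, ← a4, inv_mul_cancel_left₀ ht.ne']
  filter_upwards [h.1.unique key] with x hx
  rw [hx, smul_smul, pow_one, mul_inv_cancel₀ ht.ne', one_smul]

/-- The weak form of Euler's identity. -/
theorem AEHomog.integral_fderiv_self {d : ℕ} {f : E n → ℝ} (h : AEHomog d f)
    (hi : Integrable f (ballMeasure n)) {φ : E n → ℝ} (hφ : IsTest φ) :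
    ∫ x, fderiv ℝ φ x x * f x ∂(ballMeasure n)
      = - ((n + d : ℕ) : ℝ) * ∫ x, φ x * f x ∂(ballMeasure n) := by
  obtain ⟨C, hC⟩ := hφ.fderiv_bounded
  obtain ⟨C₀, hC₀⟩ := hφ.bounded
  have hcd : Continuous (fderiv ℝ φ) := hφ.1.continuous_fderiv (by simp)
  -- The function `t ↦ ∫ φ (t • x) * f x` is differentiated at `t = 1` in two ways: here under the
  -- integral sign, below through the closed form that homogeneity provides.
  have hder := hasDerivAt_integral_of_dominated_loc_of_deriv_le (μ := ballMeasure n)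
    (F := fun t x => φ (t • x) * f x) (F' := fun t x => fderiv ℝ φ (t • x) x * f x)
    (x₀ := (1:ℝ)) (s := Set.univ) (bound := fun x => C * ‖f x‖) univ_mem
    (Eventually.of_forall fun t => by
      have : Continuous fun x : E n => φ (t • x) := hφ.1.continuous.comp (continuous_const_smul t)
      exact this.aestronglyMeasurable.mul hi.1)
    (by
      simp only [one_smul]
      exact hi.bdd_mul hφ.1.continuous.aestronglyMeasurable (ae_of_all _ hC₀))
    (by
      simp only [one_smul]
      exact (hcd.clm_apply continuous_id).aestronglyMeasurable.mul hi.1)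
    (by
      filter_upwards [ae_norm_le_one n] with x hx t _
      rw [norm_mul]
      gcongr
      calc ‖fderiv ℝ φ (t • x) x‖ ≤ ‖fderiv ℝ φ (t • x)‖ * ‖x‖ := ContinuousLinearMap.le_opNorm _ _
        _ ≤ C * 1 := mul_le_mul (hC _) hx (norm_nonneg _) ((norm_nonneg _).trans (hC 0))
        _ = C := mul_one C)
    (hi.norm.const_mul C)
    (ae_of_all _ fun x t _ => by
      have h1 : HasDerivAt (fun t : ℝ => t • x) x t := by
        simpa using (hasDerivAt_id t).smul_const x
      have h2 := (hφ.1.differentiable (by simp) (t • x)).hasFDerivAt.comp_hasDerivAt t h1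
      exact h2.mul_const _)
  have hder := hder.2
  simp only [one_smul] at hder
  -- The support of `φ` lies in a smaller ball of radius `r`, so for `r < t ≤ 1` the dilated test
  -- function is still supported in the unit ball.
  obtain ⟨r, hr0, hr1, hr⟩ : ∃ r : ℝ, 0 < r ∧ r < 1 ∧ tsupport φ ⊆ Metric.ball 0 r := by
    obtain ⟨r, hr0, hr⟩ := exists_pos_lt_subset_ball (x := (0 : E n)) (r := 1) one_pos
      (isClosed_tsupport φ) hφ.2.2
    exact ⟨r, hr0.1, hr0.2, hr⟩
  have hval : ∀ t ∈ Set.Ioc r 1, ∫ x, φ (t • x) * f x ∂(ballMeasure n)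
      = (t ^ (n + d))⁻¹ * ∫ x, φ x * f x ∂(ballMeasure n) := by
    intro t ht
    have ht0 : 0 < t := hr0.trans ht.1
    have h1 := setIntegral_ball_comp_smul (fun x => φ x * f x) ht0
    rw [integral_eq_setIntegral_of_test ht.2 (fun x hx => by
      have : φ x = 0 := image_eq_zero_of_notMem_tsupport fun hh =>
        hx (Metric.ball_subset_ball ht.1.le (hr hh))
      rw [this, zero_mul])] at h1
    have h2 : ∫ x, φ (t • x) * f (t • x) ∂(ballMeasure n)
        = t ^ d * ∫ x, φ (t • x) * f x ∂(ballMeasure n) := by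
      rw [← integral_const_mul]
      refine integral_congr_ae ?_
      filter_upwards [h t ht0 ht.2] with x hx
      rw [hx, smul_eq_mul]; ring
    rw [h2, smul_eq_mul] at h1
    have : t ^ d ≠ 0 := by positivity
    apply mul_left_cancel₀ this
    rw [h1, pow_add]; field_simp
  have hpow : HasDerivAt (fun t : ℝ => (t ^ (n + d))⁻¹ * ∫ x, φ x * f x ∂(ballMeasure n))
      (- ((n + d : ℕ) : ℝ) * ∫ x, φ x * f x ∂(ballMeasure n)) 1 := by
    have := ((hasDerivAt_pow (n + d) (1:ℝ)).inv (by simp)).mul_const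
      (∫ x, φ x * f x ∂(ballMeasure n))
    simpa using this
  -- Homogeneity is available only for `t ≤ 1`; left derivatives at `1` are enough to identify the
  -- two values.
  have hU : UniqueDiffWithinAt ℝ (Set.Iic (1:ℝ)) 1 := uniqueDiffWithinAt_Iic 1
  have hev : (fun t : ℝ => ∫ x, φ (t • x) * f x ∂(ballMeasure n)) =ᶠ[𝓝[Set.Iic 1] 1]
      fun t : ℝ => (t ^ (n + d))⁻¹ * ∫ x, φ x * f x ∂(ballMeasure n) := by
    filter_upwards [Ioc_mem_nhdsLE hr1] with t ht using hval t ht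
  exact hU.eq_deriv _ (hder.hasDerivWithinAt)
    (hpow.hasDerivWithinAt.congr_of_eventuallyEq hev (hval 1 ⟨hr1, le_rfl⟩))

/-- Testing the weak gradient with the functions `φ x * x i` and summing over `i` produces `-n ∫ φ f
- ∫ (x·∇φ) f`, and `AEHomog.integral_fderiv_self` with `d = 2` turns the last term into `(n + 2) ∫ φ
f`. -/
theorem IsHomogeneousPair.euler {f : E n → ℝ} {g : E n → E n} (h : IsHomogeneousPair f g) :
    ∀ᵐ x ∂(ballMeasure n), inner ℝ (g x) x = 2 * f x := by
  have hgi : Integrable (fun x => inner ℝ (g x) x) (ballMeasure n) :=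
    h.1.2.1.inner_integrable (continuous_id.memLp_ball 2)
  have hfi : Integrable f (ballMeasure n) := h.1.1.integrable (by norm_num)
  refine ae_eq_of_test hgi (hfi.const_mul 2) fun φ hφ => ?_
  have hco : ∀ i : Fin n, ContDiff ℝ ∞ (fun x : E n => x i) := fun i => contDiff_piLp_apply 2
  have hT : ∀ i : Fin n, IsTest (fun x => φ x * x i) := fun i => hφ.mul_right (hco i)
  have e1 : ∀ x, φ x • inner ℝ (g x) x = ∑ i, φ x * x i * g x i := by
    intro x
    simp only [PiLp.inner_apply, smul_eq_mul, Finset.mul_sum]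
    exact Finset.sum_congr rfl fun i _ => by simp; ring
  have hgi2 : ∀ i, MemLp (fun x => g x i) 2 (ballMeasure n) := fun i => by
    simpa [EuclideanSpace.inner_single_right] using
      h.1.2.1.inner_const (𝕜 := ℝ) (EuclideanSpace.single i (1 : ℝ))
  have e2 : ∀ (i : Fin n) (x : E n), fderiv ℝ (fun x => φ x * x i) x (EuclideanSpace.single i 1)
      = φ x + x i * fderiv ℝ φ x (EuclideanSpace.single i 1) := by
    intro i x
    rw [fderiv_fun_mul (hφ.1.differentiable (by simp) x) ((hco i).differentiable (by simp) x)]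
    have : fderiv ℝ (fun x : E n => x i) x = EuclideanSpace.proj i :=
      (EuclideanSpace.proj (𝕜 := ℝ) i : E n →L[ℝ] ℝ).fderiv
    simp [this]
  have e3 : ∀ x : E n, ∑ i, fderiv ℝ (fun x => φ x * x i) x (EuclideanSpace.single i 1) * f x
      = n * (φ x * f x) + fderiv ℝ φ x x * f x := by
    intro x
    have hb : x = ∑ i, x i • EuclideanSpace.single i (1 : ℝ) := by
      ext j; simp [Finset.sum_apply, Pi.single_apply]
    have : fderiv ℝ φ x x = ∑ i, x i * fderiv ℝ φ x (EuclideanSpace.single i 1) := by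
      conv_lhs => rw [hb, map_sum]
      rw [← hb]
      simp
    simp only [e2, ← Finset.sum_mul, Finset.sum_add_distrib, this]
    simp; ring
  simp only [e1]
  rw [integral_finsetSum _ fun i _ => ((hT i).memLp 2).mul_integrable (hgi2 i)]
  have e4 : ∀ i, ∫ x, φ x * x i * g x i ∂(ballMeasure n)
      = - ∫ x, fderiv ℝ (fun x => φ x * x i) x (EuclideanSpace.single i 1) * f x
        ∂(ballMeasure n) := fun i => by
    rw [h.1.smul_test (hT i) i, neg_neg]
  simp only [e4]
  rw [Finset.sum_neg_distrib, ← integral_finsetSum _ fun i _ =>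
    (((hT i).fderiv_apply _).memLp 2).mul_integrable h.1.1]
  simp only [e3]
  have hφf : Integrable (fun x => φ x * f x) (ballMeasure n) := (hφ.memLp 2).mul_integrable h.1.1
  have hdx : MemLp (fun x => fderiv ℝ φ x x) 2 (ballMeasure n) :=
    ((hφ.1.continuous_fderiv (by simp)).clm_apply continuous_id).memLp_ball 2
  rw [integral_add (hφf.const_mul _) (hdx.mul_integrable h.1.1), integral_const_mul,
    h.2.integral_fderiv_self hfi hφ]
  have : ∀ x, φ x • (2 * f x) = 2 * (φ x * f x) := fun x => by simp; ring
  simp only [this]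
  rw [integral_const_mul]
  push_cast; ring

end Euler

/-! ### Inner products and Cauchy–Schwarz in L² -/

section LTwo
variable {α F : Type*} [MeasurableSpace α] {μ : Measure α} [NormedAddCommGroup F]
  [InnerProductSpace ℝ F]

theorem inner_toLp {f g : α → F} (hf : MemLp f 2 μ) (hg : MemLp g 2 μ) :
    inner ℝ (hf.toLp f) (hg.toLp g) = ∫ x, inner ℝ (f x) (g x) ∂μ := by
  rw [L2.inner_def]
  refine integral_congr_ae ?_
  filter_upwards [hf.coeFn_toLp, hg.coeFn_toLp] with x h1 h2
  rw [h1, h2]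

theorem norm_toLp_sq {f : α → F} (hf : MemLp f 2 μ) :
    ‖hf.toLp f‖ ^ 2 = ∫ x, ‖f x‖ ^ 2 ∂μ := by
  rw [← real_inner_self_eq_norm_sq, inner_toLp]
  simp only [real_inner_self_eq_norm_sq]

theorem MeasureTheory.MemLp.integrable_norm_sq {f : α → F} (hf : MemLp f 2 μ) :
    Integrable (fun x => ‖f x‖ ^ 2) μ := by
  simpa only [real_inner_self_eq_norm_sq] using hf.inner_integrable hf

theorem MeasureTheory.MemLp.integrable_sq' {f : α → ℝ} (hf : MemLp f 2 μ) :
    Integrable (fun x => f x ^ 2) μ := by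
  simpa only [sq] using hf.mul_integrable hf

theorem sq_integral_inner_le {f g : α → F} (hf : MemLp f 2 μ) (hg : MemLp g 2 μ) :
    (∫ x, inner ℝ (f x) (g x) ∂μ) ^ 2 ≤ (∫ x, ‖f x‖ ^ 2 ∂μ) * ∫ x, ‖g x‖ ^ 2 ∂μ := by
  rw [← inner_toLp hf hg, ← norm_toLp_sq hf, ← norm_toLp_sq hg, ← mul_pow]
  exact sq_le_sq.2 (by
    rw [abs_of_nonneg (a := ‖hf.toLp f‖ * ‖hg.toLp g‖) (by positivity)]
    exact abs_real_inner_le_norm _ _)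

theorem sq_integral_mul_le {f g : α → ℝ} (hf : MemLp f 2 μ) (hg : MemLp g 2 μ) :
    (∫ x, f x * g x ∂μ) ^ 2 ≤ (∫ x, f x ^ 2 ∂μ) * ∫ x, g x ^ 2 ∂μ := by
  have := sq_integral_inner_le hf hg
  simpa [mul_comm] using this

theorem tendsto_integral_mul_of_sq {ι : Type*} {l : Filter ι} {F : ι → α → ℝ} {f h : α → ℝ}
    (hF : ∀ k, MemLp (F k) 2 μ) (hf : MemLp f 2 μ) (hh : MemLp h 2 μ)
    (hlim : Tendsto (fun k => ∫ x, (F k x - f x) ^ 2 ∂μ) l (𝓝 0)) :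
    Tendsto (fun k => ∫ x, h x * F k x ∂μ) l (𝓝 (∫ x, h x * f x ∂μ)) := by
  have h1 : Tendsto (fun k => ∫ x, h x * (F k x - f x) ∂μ) l (𝓝 0) := by
    have h2 : Tendsto (fun k => (∫ x, h x * (F k x - f x) ∂μ) ^ 2) l (𝓝 0) := by
      refine squeeze_zero (fun k => sq_nonneg _)
        (fun k => sq_integral_mul_le hh ((hF k).sub hf)) ?_
      simpa using hlim.const_mul (∫ x, h x ^ 2 ∂μ)
    have h3 := h2.sqrt
    simp only [Real.sqrt_sq_eq_abs, Real.sqrt_zero] at h3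
    exact (tendsto_zero_iff_abs_tendsto_zero _).2 h3
  have h4 := h1.add_const (∫ x, h x * f x ∂μ)
  rw [zero_add] at h4
  refine h4.congr fun k => ?_
  rw [← integral_add]
  · refine integral_congr_ae (ae_of_all _ fun x => ?_); simp only; ring
  · exact hh.mul_integrable ((hF k).sub hf)
  · exact hh.mul_integrable hf

end LTwo

/-! ### Limits of functions smooth up to the boundary -/

section Approx
variable {n : ℕ}

/-- The pair `(f, g)` is a limit in `L²` of pairs `(φ, ∇φ)` with `φ` smooth. -/
def IsSmoothLimit (f : E n → ℝ) (g : E n → E n) : Prop :=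
  MemLp f 2 (ballMeasure n) ∧ MemLp g 2 (ballMeasure n) ∧ ∀ ε > 0, ∃ φ : E n → ℝ,
    ContDiff ℝ ∞ φ ∧ ∫ x, (φ x - f x) ^ 2 ∂(ballMeasure n) < ε ∧
      ∫ x, ‖gradient φ x - g x‖ ^ 2 ∂(ballMeasure n) < ε

theorem continuous_gradient {φ : E n → ℝ} (hφ : ContDiff ℝ ∞ φ) : Continuous (gradient φ) := by
  unfold gradient
  exact (LinearIsometryEquiv.continuous _).comp (hφ.continuous_fderiv (by simp))

theorem integral_add_sq_le {F : Type*} [NormedAddCommGroup F] [InnerProductSpace ℝ F]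
    {α : Type*} [MeasurableSpace α] {μ : Measure α} {f g : α → F}
    (hf : MemLp f 2 μ) (hg : MemLp g 2 μ) :
    ∫ x, ‖f x + g x‖ ^ 2 ∂μ ≤ 2 * ∫ x, ‖f x‖ ^ 2 ∂μ + 2 * ∫ x, ‖g x‖ ^ 2 ∂μ := by
  rw [← integral_const_mul, ← integral_const_mul, ← integral_add
    (hf.integrable_norm_sq.const_mul 2) (hg.integrable_norm_sq.const_mul 2)]
  refine integral_mono (hf.add hg).integrable_norm_sq
    ((hf.integrable_norm_sq.const_mul 2).add (hg.integrable_norm_sq.const_mul 2)) fun x => ?_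
  have h1 := norm_add_le (f x) (g x)
  have h2 : ‖f x + g x‖ ^ 2 ≤ (‖f x‖ + ‖g x‖) ^ 2 := by gcongr
  beta_reduce
  nlinarith [sq_nonneg (‖f x‖ - ‖g x‖)]

theorem IsSmoothLimit.add {f₁ f₂ : E n → ℝ} {g₁ g₂ : E n → E n} (h₁ : IsSmoothLimit f₁ g₁)
    (h₂ : IsSmoothLimit f₂ g₂) :
    IsSmoothLimit (fun x => f₁ x + f₂ x) (fun x => g₁ x + g₂ x) := by
  refine ⟨h₁.1.add h₂.1, h₁.2.1.add h₂.2.1, fun ε hε => ?_⟩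
  obtain ⟨φ₁, c₁, a₁, b₁⟩ := h₁.2.2 (ε / 4) (by positivity)
  obtain ⟨φ₂, c₂, a₂, b₂⟩ := h₂.2.2 (ε / 4) (by positivity)
  refine ⟨fun x => φ₁ x + φ₂ x, c₁.add c₂, ?_, ?_⟩
  · have := integral_add_sq_le ((c₁.continuous.memLp_ball 2).sub h₁.1)
      ((c₂.continuous.memLp_ball 2).sub h₂.1)
    simp only [Pi.sub_apply, Real.norm_eq_abs, sq_abs] at this
    have e : ∀ x, φ₁ x + φ₂ x - (f₁ x + f₂ x) = φ₁ x - f₁ x + (φ₂ x - f₂ x) := fun x => by ring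
    simp only [e]
    linarith
  · have := integral_add_sq_le (((continuous_gradient c₁).memLp_ball 2).sub h₁.2.1)
      (((continuous_gradient c₂).memLp_ball 2).sub h₂.2.1)
    simp only [Pi.sub_apply] at this
    have e : ∀ x, gradient (fun x => φ₁ x + φ₂ x) x - (g₁ x + g₂ x)
        = gradient φ₁ x - g₁ x + (gradient φ₂ x - g₂ x) := fun x => by
      unfold gradient
      rw [fderiv_fun_add (c₁.differentiable (by simp) x) (c₂.differentiable (by simp) x), map_add]
      abel
    simp only [e]
    linarith

theorem IsSmoothLimit.const_mul {f : E n → ℝ} {g : E n → E n} (a : ℝ) (h : IsSmoothLimit f g) :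
    IsSmoothLimit (fun x => a * f x) (fun x => a • g x) := by
  refine ⟨h.1.const_mul a, h.2.1.const_smul a, fun ε hε => ?_⟩
  obtain ⟨φ, c, h1, h2⟩ := h.2.2 (ε / (a ^ 2 + 1)) (by positivity)
  have key : ∀ I : ℝ, 0 ≤ I → I < ε / (a ^ 2 + 1) → a ^ 2 * I < ε := fun I h0 h => by
    rw [lt_div_iff₀ (by positivity)] at h
    nlinarith [sq_nonneg a]
  refine ⟨fun x => a * φ x, contDiff_const.mul c, ?_, ?_⟩
  · have e : ∀ x, (a * φ x - a * f x) ^ 2 = a ^ 2 * (φ x - f x) ^ 2 := fun x => by ring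
    simp only [e]
    rw [integral_const_mul]
    exact key _ (integral_nonneg fun x => sq_nonneg _) h1
  · have e : ∀ x, ‖gradient (fun x => a * φ x) x - a • g x‖ ^ 2
        = a ^ 2 * ‖gradient φ x - g x‖ ^ 2 := fun x => by
      unfold gradient
      rw [fderiv_const_mul (c.differentiable (by simp) x), map_smul, ← smul_sub, norm_smul,
        mul_pow, Real.norm_eq_abs, sq_abs]
    simp only [e]
    rw [integral_const_mul]
    exact key _ (integral_nonneg fun x => sq_nonneg _) h2

theorem IsSmoothLimit.zero : IsSmoothLimit (fun _ : E n => (0 : ℝ)) (fun _ => 0) :=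
  ⟨MemLp.zero', MemLp.zero', fun ε hε => ⟨fun _ => 0, contDiff_const, by simpa, by
    simpa [gradient] using hε⟩⟩

theorem IsSmoothLimit.of_limit {f : E n → ℝ} {g : E n → E n} (hf : MemLp f 2 (ballMeasure n))
    (hg : MemLp g 2 (ballMeasure n))
    (h : ∀ ε > 0, ∃ F : E n → ℝ, ∃ G : E n → E n, IsSmoothLimit F G ∧
      ∫ x, (F x - f x) ^ 2 ∂(ballMeasure n) < ε ∧
      ∫ x, ‖G x - g x‖ ^ 2 ∂(ballMeasure n) < ε) : IsSmoothLimit f g := by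
  refine ⟨hf, hg, fun ε hε => ?_⟩
  obtain ⟨F, G, hFG, h1, h2⟩ := h (ε / 4) (by positivity)
  obtain ⟨φ, c, h3, h4⟩ := hFG.2.2 (ε / 4) (by positivity)
  refine ⟨φ, c, ?_, ?_⟩
  · have := integral_add_sq_le ((c.continuous.memLp_ball 2).sub hFG.1) (hFG.1.sub hf)
    simp only [Pi.sub_apply, Real.norm_eq_abs, sq_abs, sub_add_sub_cancel] at this
    linarith
  · have := integral_add_sq_le (((continuous_gradient c).memLp_ball 2).sub hFG.2.1)
      (hFG.2.1.sub hg)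
    simp only [Pi.sub_apply, sub_add_sub_cancel] at this
    linarith

theorem IsSmoothLimit.hasScalarGradient {f : E n → ℝ} {g : E n → E n} (h : IsSmoothLimit f g) :
    HasScalarGradient f g := by
  choose φ hc h1 h2 using fun k : ℕ => h.2.2 (1 / ((k : ℝ) + 1)) (by positivity)
  have lim := tendsto_one_div_add_atTop_nhds_zero_nat (𝕜 := ℝ)
  have L1 : Tendsto (fun k => ∫ x, (φ k x - f x) ^ 2 ∂(ballMeasure n)) atTop (𝓝 0) :=
    squeeze_zero (fun k => integral_nonneg fun x => sq_nonneg _) (fun k => (h1 k).le) lim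
  have L2 : Tendsto (fun k => ∫ x, ‖gradient (φ k) x - g x‖ ^ 2 ∂(ballMeasure n)) atTop (𝓝 0) :=
    squeeze_zero (fun k => integral_nonneg fun x => sq_nonneg _) (fun k => (h2 k).le) lim
  refine hasScalarGradient_of_tendsto (fun k => hasScalarGradient_of_contDiff (hc k)) h.1 h.2.1
    (fun ψ hψ => tendsto_integral_mul_of_sq (fun k => (hc k).continuous.memLp_ball 2) h.1
      (hψ.memLp 2) L1) (fun ψ hψ b => ?_)
  refine tendsto_integral_mul_of_sq (fun k => ((continuous_gradient (hc k)).memLp_ball 2).inner_const b)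
    (h.2.1.inner_const b) (hψ.memLp 2) ?_
  have L3 := L2.const_mul (‖b‖ ^ 2)
  rw [mul_zero] at L3
  refine squeeze_zero (fun k => integral_nonneg fun x => sq_nonneg _) (fun k => ?_) L3
  rw [← integral_const_mul]
  have hm := ((continuous_gradient (hc k)).memLp_ball 2 (n := n)).sub h.2.1
  refine integral_mono ?_ (hm.integrable_norm_sq.const_mul _) fun x => ?_
  · have := (hm.inner_const (𝕜 := ℝ) b).integrable_sq'
    simpa [inner_sub_left] using this
  · simp only
    rw [← inner_sub_left, ← sq_abs, ← mul_pow, mul_comm]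
    gcongr
    exact abs_real_inner_le_norm _ _

/-- Bounded pointwise limits of smooth functions with bounded gradients. -/
theorem isSmoothLimit_of_bounded {f : E n → ℝ} {g : E n → E n} {φ : ℕ → E n → ℝ} {C : ℝ}
    (hc : ∀ k, ContDiff ℝ ∞ (φ k)) (h1 : ∀ k x, ‖x‖ ≤ 1 → |φ k x| ≤ C)
    (h2 : ∀ k x, ‖x‖ ≤ 1 → ‖gradient (φ k) x‖ ≤ C)
    (l1 : ∀ᵐ x ∂(ballMeasure n), Tendsto (fun k => φ k x) atTop (𝓝 (f x)))
    (l2 : ∀ᵐ x ∂(ballMeasure n), Tendsto (fun k => gradient (φ k) x) atTop (𝓝 (g x))) :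
    IsSmoothLimit f g := by
  have mf : AEStronglyMeasurable f (ballMeasure n) :=
    aestronglyMeasurable_of_tendsto_ae atTop (fun k => (hc k).continuous.aestronglyMeasurable) l1
  have mg : AEStronglyMeasurable g (ballMeasure n) :=
    aestronglyMeasurable_of_tendsto_ae atTop
      (fun k => (continuous_gradient (hc k)).aestronglyMeasurable) l2
  have bf : ∀ᵐ x ∂(ballMeasure n), ‖f x‖ ≤ C := by
    filter_upwards [l1, ae_norm_le_one n] with x hx hx1
    exact le_of_tendsto hx.norm (Eventually.of_forall fun k => h1 k x hx1)
  have bg : ∀ᵐ x ∂(ballMeasure n), ‖g x‖ ≤ C := by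
    filter_upwards [l2, ae_norm_le_one n] with x hx hx1
    exact le_of_tendsto hx.norm (Eventually.of_forall fun k => h2 k x hx1)
  have Mf : MemLp f 2 (ballMeasure n) := MemLp.of_bound mf C bf
  have Mg : MemLp g 2 (ballMeasure n) := MemLp.of_bound mg C bg
  have T1 : Tendsto (fun k => ∫ x, (φ k x - f x) ^ 2 ∂(ballMeasure n)) atTop (𝓝 0) := by
    have := tendsto_integral_of_dominated_convergence (μ := ballMeasure n)
      (F := fun k x => (φ k x - f x) ^ 2) (f := fun _ => 0) (fun _ => (2 * C) ^ 2)
      (fun k => ((hc k).continuous.aestronglyMeasurable.sub mf).pow 2) (integrable_const _)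
      (fun k => by
        filter_upwards [bf, ae_norm_le_one n] with x hx hx1
        rw [Real.norm_of_nonneg (sq_nonneg _), ← sq_abs]
        have := h1 k x hx1
        have h3 := abs_sub (φ k x) (f x)
        rw [Real.norm_eq_abs] at hx
        gcongr; linarith)
      (by
        filter_upwards [l1] with x hx
        simpa using (hx.sub_const (f x)).pow 2)
    simpa using this
  have T2 : Tendsto (fun k => ∫ x, ‖gradient (φ k) x - g x‖ ^ 2 ∂(ballMeasure n)) atTop (𝓝 0) := by
    have := tendsto_integral_of_dominated_convergence (μ := ballMeasure n)
      (F := fun k x => ‖gradient (φ k) x - g x‖ ^ 2) (f := fun _ => 0) (fun _ => (2 * C) ^ 2)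
      (fun k => ((continuous_gradient (hc k)).aestronglyMeasurable.sub mg).norm.pow 2)
      (integrable_const _)
      (fun k => by
        filter_upwards [bg, ae_norm_le_one n] with x hx hx1
        rw [Real.norm_of_nonneg (sq_nonneg _)]
        have := h2 k x hx1
        have h3 := norm_sub_le (gradient (φ k) x) (g x)
        gcongr; linarith)
      (by
        filter_upwards [l2] with x hx
        simpa using ((hx.sub_const (g x)).norm).pow 2)
    simpa using this
  refine ⟨Mf, Mg, fun ε hε => ?_⟩
  obtain ⟨k, hk1, hk2⟩ := ((T1.eventually (gt_mem_nhds hε)).and (T2.eventually (gt_mem_nhds hε))).exists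
  exact ⟨φ k, hc k, hk1, hk2⟩

end Approx

/-! ### The radial cutoff and its masses -/

section Cutoff

/-- A smooth bump on the real line, to be evaluated at `|x|²`. -/
def radialBump : ContDiffBump (1 / 2 : ℝ) := ⟨1 / 8, 1 / 4, by norm_num, by norm_num⟩

theorem radialBump_contDiff : ContDiff ℝ ∞ (radialBump : ℝ → ℝ) := radialBump.contDiff

theorem radialBump_eq_zero {s : ℝ} (hs : s ≤ 1 / 4 ∨ 3 / 4 ≤ s) : radialBump s = 0 := by
  apply radialBump.zero_of_le_dist
  rw [Real.dist_eq]
  show (1 / 4 : ℝ) ≤ _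
  rcases hs with h | h
  · rw [abs_of_nonpos (by linarith)]; linarith
  · rw [abs_of_nonneg (by linarith)]; linarith

variable {n : ℕ}

/-- A radial smooth cutoff supported in an annulus of the unit ball. -/
def cutoff (x : E n) : ℝ := radialBump (‖x‖ ^ 2)

theorem cutoff_nonneg (x : E n) : 0 ≤ cutoff x := radialBump.nonneg

theorem cutoff_le_one (x : E n) : cutoff x ≤ 1 := radialBump.le_one

theorem cutoff_eq_zero {x : E n} (hx : ‖x‖ ≤ 1 / 2) : cutoff x = 0 :=
  radialBump_eq_zero (Or.inl (by nlinarith [norm_nonneg x]))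

theorem isTest_cutoff : IsTest (cutoff : E n → ℝ) := by
  have hs : tsupport (cutoff : E n → ℝ) ⊆ {x | ‖x‖ ^ 2 ≤ 3 / 4} := by
    refine closure_minimal (fun x hx => ?_) (isClosed_le (by fun_prop) continuous_const)
    by_contra h
    exact hx (radialBump_eq_zero (Or.inr (by
      simp only [Set.mem_ofPred_eq, not_le] at h; exact h.le)))
  have hb : ∀ x : E n, ‖x‖ ^ 2 ≤ 3 / 4 → ‖x‖ < 1 := fun x hx => by
    nlinarith [norm_nonneg x]
  refine ⟨radialBump_contDiff.comp (contDiff_norm_sq ℝ), ?_, fun x hx => ?_⟩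
  · exact (isCompact_closedBall (0 : E n) 1).of_isClosed_subset (isClosed_tsupport _) fun x hx => by
      simpa using (hb x (hs hx)).le
  · simpa [unitBall] using hb x (hs hx)

theorem hasFDerivAt_cutoff (x : E n) : HasFDerivAt (cutoff : E n → ℝ)
    (deriv radialBump (‖x‖ ^ 2) • ((2 : ℝ) • innerSL ℝ x)) x := by
  have h1 : HasDerivAt (radialBump : ℝ → ℝ) (deriv radialBump (‖x‖ ^ 2)) (‖x‖ ^ 2) :=
    (radialBump_contDiff.differentiable (by simp) _).hasDerivAt
  have h2 := h1.comp_hasFDerivAt x (hasStrictFDerivAt_norm_sq x).hasFDerivAt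
  exact h2.congr_fderiv (by ext b; simp)

theorem fderiv_cutoff (x b : E n) :
    fderiv ℝ cutoff x b = 2 * deriv radialBump (‖x‖ ^ 2) * inner ℝ x b := by
  rw [(hasFDerivAt_cutoff x).fderiv]
  simp; ring

theorem continuous_deriv_radialBump : Continuous (deriv radialBump) :=
  radialBump_contDiff.continuous_deriv (by simp)

/-- The total mass of the cutoff against functions homogeneous of degree two. -/
def cutoffMass (n : ℕ) : ℝ := radialMass n 2 (fun r => radialBump (r ^ 2))

/-- Positivity allows the cutoff to be divided out of identities, and makes the first variation
along cut off directions effective. -/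
theorem cutoffMass_pos : 0 < cutoffMass n := by
  unfold cutoffMass radialMass
  have hc : Continuous fun r : ℝ => radialBump (r ^ 2) * (((n + 2 : ℕ) : ℝ) * r ^ (n + 2 - 1)) :=
    (radialBump.continuous.comp (continuous_pow 2)).mul (continuous_const.mul (continuous_pow _))
  refine intervalIntegral.integral_pos one_pos hc.continuousOn
    (fun r hr => mul_nonneg radialBump.nonneg (by have := hr.1; positivity)) ?_
  refine ⟨√(1 / 2), ⟨by positivity, by rw [Real.sqrt_le_one]; norm_num⟩, ?_⟩
  have : radialBump (√(1 / 2) ^ 2) = 1 := by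
    rw [Real.sq_sqrt (by norm_num)]
    exact radialBump.one_of_mem_closedBall (by simp [radialBump.rIn_pos.le])
  simp only [this]
  positivity

/-- An integration by parts in `r` without boundary terms, the bump vanishing at both ends. The
factor `-(n + 4)` so produced is how interior variations recover the boundary term of the energy. -/
theorem radialMass_deriv_radialBump :
    radialMass n 4 (fun r => 2 * deriv radialBump (r ^ 2)) = - ((n + 4 : ℕ) : ℝ) * cutoffMass n := by
  unfold cutoffMass radialMass
  have hd : ∀ r : ℝ, HasDerivAt (fun r : ℝ => radialBump (r ^ 2))
      (2 * r * deriv radialBump (r ^ 2)) r := fun r => by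
    have h1 : HasDerivAt (radialBump : ℝ → ℝ) (deriv radialBump (r ^ 2)) (r ^ 2) :=
      (radialBump_contDiff.differentiable (by simp) _).hasDerivAt
    have h2 : HasDerivAt (fun r : ℝ => r ^ 2) (2 * r) r := by simpa using hasDerivAt_pow 2 r
    have := HasDerivAt.comp (h := fun r : ℝ => r ^ 2) r h1 h2
    rwa [mul_comm] at this
  have hp : ∀ r : ℝ, HasDerivAt (fun r : ℝ => r ^ (n + 2)) (((n + 2 : ℕ) : ℝ) * r ^ (n + 1)) r :=
    fun r => hasDerivAt_pow (n + 2) r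
  have hcd := continuous_deriv_radialBump
  have hcb : Continuous (radialBump : ℝ → ℝ) := radialBump.continuous
  have := intervalIntegral.integral_mul_deriv_eq_deriv_mul (a := 0) (b := 1)
    (fun r _ => hp r) (fun r _ => hd r)
    (Continuous.intervalIntegrable (by fun_prop) _ _)
    (Continuous.intervalIntegrable (by fun_prop) _ _)
  have e1 : radialBump ((1:ℝ) ^ 2) = 0 := radialBump_eq_zero (Or.inr (by norm_num))
  have e0 : radialBump ((0:ℝ) ^ 2) = 0 := radialBump_eq_zero (Or.inl (by norm_num))
  rw [e1, e0] at this
  have ea : ∀ r : ℝ, 2 * deriv radialBump (r ^ 2) * (((n + 4 : ℕ) : ℝ) * r ^ (n + 4 - 1))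
      = ((n + 4 : ℕ) : ℝ) * (r ^ (n + 2) * (2 * r * deriv radialBump (r ^ 2))) := fun r => by
    have : n + 4 - 1 = n + 2 + 1 := by omega
    rw [this, pow_succ]; ring
  have eb : ∀ r : ℝ, radialBump (r ^ 2) * (((n + 2 : ℕ) : ℝ) * r ^ (n + 2 - 1))
      = ((n + 2 : ℕ) : ℝ) * r ^ (n + 1) * radialBump (r ^ 2) := fun r => by
    have : n + 2 - 1 = n + 1 := by omega
    rw [this]; ring
  simp only [ea, eb]
  rw [intervalIntegral.integral_const_mul, this]
  ring

theorem integral_cutoff_mul {H : E n → ℝ} (h : AEHomog 2 H) (hi : Integrable H (ballMeasure n)) :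
    ∫ x, cutoff x * H x ∂(ballMeasure n) = cutoffMass n * ∫ x, H x ∂(ballMeasure n) :=
  integral_radial_mul (by omega) h hi (w := fun r => radialBump (r ^ 2))
    (radialBump.continuous.comp (continuous_pow 2))

theorem integral_deriv_cutoff_mul {H : E n → ℝ} (h : AEHomog 4 H)
    (hi : Integrable H (ballMeasure n)) :
    ∫ x, 2 * deriv radialBump (‖x‖ ^ 2) * H x ∂(ballMeasure n)
      = - ((n + 4 : ℕ) : ℝ) * cutoffMass n * ∫ x, H x ∂(ballMeasure n) := by
  rw [← radialMass_deriv_radialBump]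
  exact integral_radial_mul (by omega) h hi (w := fun r => 2 * deriv radialBump (r ^ 2))
    (continuous_const.mul (continuous_deriv_radialBump.comp (continuous_pow 2)))

theorem integral_norm_sq_mul (hn : 0 < n) {H : E n → ℝ} (h : AEHomog 2 H)
    (hi : Integrable H (ballMeasure n)) :
    ∫ x, ‖x‖ ^ 2 * H x ∂(ballMeasure n) = ((n : ℝ) + 2) / (n + 4) * ∫ x, H x ∂(ballMeasure n) := by
  have := integral_radial_mul (by omega) h hi (w := fun r => r ^ 2) (continuous_pow 2)
  rw [radialMass_pow hn] at this
  rw [this]; push_cast; ring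

end Cutoff

/-! ### Smooth approximation of the positive part -/

section PositivePart

/-- A smooth function vanishing on `(-∞, 0]` and equal to the identity on `[1, ∞)`. -/
def smoothPos (u : ℝ) : ℝ := u * Real.smoothTransition u

theorem smoothPos_contDiff : ContDiff ℝ ∞ smoothPos := contDiff_id.mul Real.smoothTransition.contDiff

theorem smoothPos_of_nonpos {u : ℝ} (hu : u ≤ 0) : smoothPos u = 0 := by
  simp [smoothPos, Real.smoothTransition.zero_of_nonpos hu]

theorem smoothPos_of_one_le {u : ℝ} (hu : 1 ≤ u) : smoothPos u = u := by
  simp [smoothPos, Real.smoothTransition.one_of_one_le hu]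

theorem abs_smoothPos_le (u : ℝ) : |smoothPos u| ≤ |u| := by
  rw [smoothPos, abs_mul, abs_of_nonneg (Real.smoothTransition.nonneg u)]
  exact mul_le_of_le_one_right (abs_nonneg u) (Real.smoothTransition.le_one u)

theorem continuous_deriv_smoothPos : Continuous (deriv smoothPos) :=
  smoothPos_contDiff.continuous_deriv (by simp)

theorem deriv_smoothPos_of_nonpos {u : ℝ} (hu : u ≤ 0) : deriv smoothPos u = 0 := by
  have h1 : ∀ v ∈ Set.Iio (0:ℝ), deriv smoothPos v = 0 := fun v hv => by
    have : smoothPos =ᶠ[𝓝 v] fun _ => 0 := by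
      filter_upwards [Iio_mem_nhds hv] with w hw using smoothPos_of_nonpos (le_of_lt hw)
    rw [this.deriv_eq, deriv_const]
  have h2 : Set.Iic (0:ℝ) ⊆ {v | deriv smoothPos v = 0} := by
    rw [← closure_Iio]
    exact closure_minimal h1 (isClosed_eq continuous_deriv_smoothPos continuous_const)
  exact h2 hu

theorem deriv_smoothPos_of_one_lt {u : ℝ} (hu : 1 < u) : deriv smoothPos u = 1 := by
  have : smoothPos =ᶠ[𝓝 u] fun v => v := by
    filter_upwards [Ioi_mem_nhds hu] with w hw using smoothPos_of_one_le (le_of_lt hw)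
  rw [this.deriv_eq]
  exact deriv_id u

theorem exists_bound_deriv_smoothPos : ∃ C, 1 ≤ C ∧ ∀ u, |deriv smoothPos u| ≤ C := by
  obtain ⟨C, hC⟩ := (isCompact_Icc (a := (0:ℝ)) (b := 1)).exists_bound_of_continuousOn
    continuous_deriv_smoothPos.continuousOn
  refine ⟨max C 1, le_max_right _ _, fun u => ?_⟩
  rcases le_or_gt u 0 with h | h
  · rw [deriv_smoothPos_of_nonpos h]; simp
  rcases le_or_gt u 1 with h1 | h1
  · exact (hC u ⟨h.le, h1⟩).trans (le_max_left _ _)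
  · rw [deriv_smoothPos_of_one_lt h1]; simp

/-- Smooth approximations of the positive part. -/
def posApprox (k : ℕ) (t : ℝ) : ℝ := smoothPos (((k : ℝ) + 1) * t) / ((k : ℝ) + 1)

theorem posApprox_contDiff (k : ℕ) : ContDiff ℝ ∞ (posApprox k) :=
  (smoothPos_contDiff.comp (contDiff_const.mul contDiff_id)).div_const _

theorem hasDerivAt_posApprox (k : ℕ) (t : ℝ) :
    HasDerivAt (posApprox k) (deriv smoothPos (((k : ℝ) + 1) * t)) t := by
  have h1 : HasDerivAt smoothPos (deriv smoothPos (((k : ℝ) + 1) * t)) (((k : ℝ) + 1) * t) :=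
    (smoothPos_contDiff.differentiable (by simp) _).hasDerivAt
  have h2 := (h1.comp t ((hasDerivAt_id t).const_mul ((k : ℝ) + 1))).div_const ((k : ℝ) + 1)
  have : ((k : ℝ) + 1) ≠ 0 := by positivity
  exact h2.congr_deriv (by rw [mul_one, mul_div_assoc, div_self this, mul_one])

theorem abs_posApprox_le (k : ℕ) (t : ℝ) : |posApprox k t| ≤ |t| := by
  have hk : (0:ℝ) < (k : ℝ) + 1 := by positivity
  rw [posApprox, abs_div, abs_of_pos hk, div_le_iff₀ hk]
  refine (abs_smoothPos_le _).trans ?_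
  rw [abs_mul, abs_of_pos hk, mul_comm]

theorem eventually_one_lt {t : ℝ} (ht : 0 < t) : ∀ᶠ k : ℕ in atTop, 1 < ((k : ℝ) + 1) * t := by
  have : Tendsto (fun k : ℕ => ((k : ℝ) + 1) * t) atTop atTop :=
    (tendsto_atTop_add_const_right _ _ tendsto_natCast_atTop_atTop).atTop_mul_const ht
  exact this.eventually_gt_atTop 1

theorem tendsto_posApprox (t : ℝ) : Tendsto (fun k => posApprox k t) atTop (𝓝 (max t 0)) := by
  rcases le_or_gt t 0 with h | h
  · rw [max_eq_right h]
    refine tendsto_const_nhds.congr fun k => ?_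
    rw [posApprox, smoothPos_of_nonpos (mul_nonpos_of_nonneg_of_nonpos (by positivity) h), zero_div]
  · rw [max_eq_left h.le]
    refine tendsto_const_nhds.congr' ?_
    filter_upwards [eventually_one_lt h] with k hk
    have : ((k : ℝ) + 1) ≠ 0 := by positivity
    rw [posApprox, smoothPos_of_one_le hk.le]
    field_simp

theorem tendsto_deriv_posApprox (t : ℝ) :
    Tendsto (fun k : ℕ => deriv smoothPos (((k : ℝ) + 1) * t)) atTop
      (𝓝 (if 0 < t then 1 else 0)) := by
  split_ifs with h
  · refine tendsto_const_nhds.congr' ?_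
    filter_upwards [eventually_one_lt h] with k hk
    rw [deriv_smoothPos_of_one_lt hk]
  · refine tendsto_const_nhds.congr fun k => ?_
    rw [deriv_smoothPos_of_nonpos (mul_nonpos_of_nonneg_of_nonpos (by positivity) (not_lt.1 h))]

end PositivePart

/-! ### The half-space indicator and the equation of the half-plane profile -/

section HalfSpace
variable {n : ℕ}

/-- The indicator function of the half-space `x · ν > 0`. -/
def halfInd (ν x : E n) : ℝ := if 0 < inner ℝ x ν then 1 else 0

/-- The positive part of `x · ν`. -/
def posInner (ν x : E n) : ℝ := max (inner ℝ x ν) 0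

theorem halfInd_nonneg (ν x : E n) : 0 ≤ halfInd ν x := by unfold halfInd; split_ifs <;> norm_num

theorem halfInd_le_one (ν x : E n) : halfInd ν x ≤ 1 := by unfold halfInd; split_ifs <;> norm_num

theorem abs_halfInd_le (ν x : E n) : |halfInd ν x| ≤ 1 := by
  rw [abs_of_nonneg (halfInd_nonneg ν x)]; exact halfInd_le_one ν x

theorem measurable_halfInd (ν : E n) : Measurable (halfInd ν) := by
  unfold halfInd
  exact Measurable.ite (measurableSet_lt measurable_const (by fun_prop)) measurable_const
    measurable_const

theorem posInner_eq (ν x : E n) : posInner ν x = halfInd ν x * inner ℝ x ν := by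
  unfold posInner halfInd
  split_ifs with h
  · rw [max_eq_left h.le, one_mul]
  · rw [max_eq_right (not_lt.1 h), zero_mul]

theorem halfInd_mul_posInner (ν x : E n) : halfInd ν x * posInner ν x = posInner ν x := by
  rw [posInner_eq]; unfold halfInd; split_ifs <;> simp

theorem halfInd_sq (ν x : E n) : halfInd ν x * halfInd ν x = halfInd ν x := by
  unfold halfInd; split_ifs <;> simp

theorem inner_mul_posInner (ν x : E n) : inner ℝ x ν * posInner ν x = posInner ν x ^ 2 := by
  unfold posInner
  rcases le_total (inner ℝ x ν) 0 with h | h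
  · rw [max_eq_right h]; ring
  · rw [max_eq_left h]; ring

theorem posInner_nonneg (ν x : E n) : 0 ≤ posInner ν x := le_max_right _ _

theorem posInner_le {ν : E n} (hν : ‖ν‖ = 1) (x : E n) : posInner ν x ≤ ‖x‖ := by
  refine max_le ?_ (norm_nonneg x)
  simpa [hν] using real_inner_le_norm x ν

theorem continuous_posInner (ν : E n) : Continuous (posInner ν) := by
  unfold posInner; fun_prop

theorem posInner_smul (ν x : E n) {t : ℝ} (ht : 0 < t) : posInner ν (t • x) = t * posInner ν x := by
  unfold posInner
  rw [real_inner_smul_left, mul_max_of_nonneg _ _ ht.le, mul_zero]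

theorem halfInd_smul (ν x : E n) {t : ℝ} (ht : 0 < t) : halfInd ν (t • x) = halfInd ν x := by
  unfold halfInd
  rw [real_inner_smul_left]
  simp [ht]

theorem aehomog_posInner (ν : E n) : AEHomog 1 (posInner ν) :=
  AEHomog.of_forall fun t ht x => by rw [posInner_smul ν x ht]; simp

theorem aehomog_halfInd (ν : E n) : AEHomog 0 (halfInd ν) :=
  AEHomog.of_forall fun t ht x => by rw [halfInd_smul ν x ht]; simp

theorem aehomog_posInner_sq (ν : E n) : AEHomog 2 (fun x => posInner ν x ^ 2) := by
  simpa only [sq] using (aehomog_posInner ν).mul (aehomog_posInner ν)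

theorem aehomog_const {F : Type*} [AddCommGroup F] [Module ℝ F] (b : F) :
    AEHomog 0 (fun _ : E n => b) :=
  AEHomog.of_forall fun t _ x => by simp

theorem memLp_halfInd_mul (ν : E n) {f : E n → ℝ} {p : ℝ≥0∞} (hf : MemLp f p (ballMeasure n)) :
    MemLp (fun x => halfInd ν x * f x) p (ballMeasure n) := by
  refine hf.of_le ((measurable_halfInd ν).aestronglyMeasurable.mul hf.1) (ae_of_all _ fun x => ?_)
  rw [norm_mul]
  exact mul_le_of_le_one_left (norm_nonneg _) (abs_halfInd_le ν x)

/-- The equation `Δ(max(x · ν, 0)² / 2) = 1_{x · ν > 0}`, tested with functions homogeneous of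
degree two. -/
theorem integral_posInner_mul_gradient {f : E n → ℝ} {g : E n → E n} (h : IsHomogeneousPair f g)
    {ν : E n} (hν : ‖ν‖ = 1) :
    ∫ x, posInner ν x * inner ℝ (g x) ν ∂(ballMeasure n)
      = (n + 4) * ∫ x, posInner ν x ^ 2 * f x ∂(ballMeasure n)
        - ∫ x, halfInd ν x * f x ∂(ballMeasure n) := by
  have hn : Continuous fun x : E n => inner ℝ x ν := by fun_prop
  have hpc : ∀ k, ContDiff ℝ ∞ fun x : E n => posApprox k (inner ℝ x ν) := fun k =>
    (posApprox_contDiff k).comp (contDiff_id.inner ℝ contDiff_const)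
  -- The weak gradient is tested in the direction `ν` with a cut off regularization of `max(x·ν,
  -- 0)`; the limit in `k` yields the weak equation weighted by the cutoff.
  have hT : ∀ k, IsTest fun x : E n => cutoff x * posApprox k (inner ℝ x ν) := fun k =>
    isTest_cutoff.mul_right (hpc k)
  have hfd : ∀ k x, fderiv ℝ (fun x : E n => cutoff x * posApprox k (inner ℝ x ν)) x ν
      = 2 * deriv radialBump (‖x‖ ^ 2) * inner ℝ x ν * posApprox k (inner ℝ x ν)
        + cutoff x * deriv smoothPos (((k : ℝ) + 1) * inner ℝ x ν) := by
    intro k x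
    have h1 : HasFDerivAt (fun x : E n => posApprox k (inner ℝ x ν))
        (deriv smoothPos (((k : ℝ) + 1) * inner ℝ x ν) • innerSL ℝ ν) x := by
      have h2 : HasFDerivAt (fun x : E n => inner ℝ x ν) (innerSL ℝ ν) x := by
        have := (innerSL ℝ ν).hasFDerivAt (x := x)
        simpa [real_inner_comm] using this
      exact HasDerivAt.comp_hasFDerivAt (f := fun x : E n => inner ℝ x ν) x
        (hasDerivAt_posApprox k (inner ℝ x ν)) h2
    rw [fderiv_fun_mul (hasFDerivAt_cutoff x).differentiableAt h1.differentiableAt, h1.fderiv,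
      (hasFDerivAt_cutoff x).fderiv]
    simp [hν]; ring
  obtain ⟨C, hC1, hC⟩ := exists_bound_deriv_smoothPos
  obtain ⟨D, hD⟩ := ContDiff.bounded_on_ball (n := n)
    ((continuous_const.mul (continuous_deriv_radialBump.comp (by fun_prop : Continuous fun x : E n => ‖x‖ ^ 2)) :
      Continuous fun x : E n => 2 * deriv radialBump (‖x‖ ^ 2)))
  have hgν : MemLp (fun x => inner ℝ (g x) ν) 2 (ballMeasure n) := h.1.2.1.inner_const ν
  have hfi : Integrable f (ballMeasure n) := h.1.1.integrable (by norm_num)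
  have hgi : Integrable (fun x => inner ℝ (g x) ν) (ballMeasure n) := hgν.integrable (by norm_num)
  have hxν : ∀ x : E n, ‖x‖ ≤ 1 → |inner ℝ x ν| ≤ 1 := fun x hx => by
    have := abs_real_inner_le_norm x ν
    rw [hν, mul_one] at this
    exact this.trans hx
  have lhs : Tendsto (fun k => ∫ x, cutoff x * posApprox k (inner ℝ x ν) * inner ℝ (g x) ν
      ∂(ballMeasure n)) atTop
      (𝓝 (∫ x, cutoff x * posInner ν x * inner ℝ (g x) ν ∂(ballMeasure n))) := by
    refine tendsto_integral_of_dominated_convergence (fun x => ‖inner ℝ (g x) ν‖)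
      (fun k => (hT k).1.continuous.aestronglyMeasurable.mul hgν.1) hgi.norm (fun k => ?_)
      (ae_of_all _ fun x => ((tendsto_posApprox _).const_mul _).mul_const _)
    filter_upwards [ae_norm_le_one n] with x hx
    rw [norm_mul, norm_mul]
    refine mul_le_of_le_one_left (norm_nonneg _) ?_
    rw [Real.norm_of_nonneg (cutoff_nonneg x)]
    exact mul_le_one₀ (cutoff_le_one x) (norm_nonneg _) ((abs_posApprox_le k _).trans (hxν x hx))
  have rhs : Tendsto (fun k => ∫ x, fderiv ℝ (fun x : E n => cutoff x * posApprox k (inner ℝ x ν)) x ν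
      * f x ∂(ballMeasure n)) atTop
      (𝓝 (∫ x, (2 * deriv radialBump (‖x‖ ^ 2) * (posInner ν x ^ 2 * f x)
        + cutoff x * (halfInd ν x * f x)) ∂(ballMeasure n))) := by
    refine tendsto_integral_of_dominated_convergence (fun x => (D + C) * ‖f x‖)
      (fun k => ((hT k).fderiv_apply ν).1.continuous.aestronglyMeasurable.mul h.1.1.1)
      (hfi.norm.const_mul _) (fun k => ?_) (ae_of_all _ fun x => ?_)
    · filter_upwards [ae_norm_le_one n] with x hx
      rw [norm_mul, hfd]
      gcongr
      refine (norm_add_le _ _).trans (add_le_add ?_ ?_)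
      · rw [norm_mul, norm_mul, mul_assoc]
        have := hD x hx
        refine (mul_le_of_le_one_right (norm_nonneg _) ?_).trans this
        exact mul_le_one₀ (hxν x hx) (norm_nonneg _) ((abs_posApprox_le k _).trans (hxν x hx))
      · rw [norm_mul, Real.norm_of_nonneg (cutoff_nonneg x)]
        exact (mul_le_of_le_one_left (norm_nonneg _) (cutoff_le_one x)).trans (hC _)
    · simp only [hfd]
      have h1 := (((tendsto_posApprox (inner ℝ x ν)).const_mul
        (2 * deriv radialBump (‖x‖ ^ 2) * inner ℝ x ν)).add
        ((tendsto_deriv_posApprox (inner ℝ x ν)).const_mul (cutoff x))).mul_const (f x)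
      convert h1 using 2
      have := inner_mul_posInner ν x
      rw [← this]
      unfold posInner halfInd
      ring
  have heq := tendsto_nhds_unique rhs ((lhs.neg).congr fun k => ((h.1.2.2 _ (hT k) ν)).symm)
  have hp2 : MemLp (fun x => posInner ν x ^ 2) 2 (ballMeasure n) :=
    ((continuous_posInner ν).pow 2).memLp_ball 2
  have hp1 : MemLp (fun x => posInner ν x) 2 (ballMeasure n) := (continuous_posInner ν).memLp_ball 2
  have H1 : AEHomog 4 (fun x => posInner ν x ^ 2 * f x) := (aehomog_posInner_sq ν).mul h.2
  have H2 : AEHomog 2 (fun x => halfInd ν x * f x) := by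
    simpa using (aehomog_halfInd ν).mul h.2
  have H3 : AEHomog 2 (fun x => posInner ν x * inner ℝ (g x) ν) :=
    (aehomog_posInner ν).mul (e := 1) ((h.gradient_homog).inner (aehomog_const ν))
  have I1 : Integrable (fun x => posInner ν x ^ 2 * f x) (ballMeasure n) := hp2.mul_integrable h.1.1
  have I2 : Integrable (fun x => halfInd ν x * f x) (ballMeasure n) :=
    (memLp_halfInd_mul ν h.1.1).integrable (by norm_num)
  have I3 : Integrable (fun x => posInner ν x * inner ℝ (g x) ν) (ballMeasure n) :=
    hp1.mul_integrable hgν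
  -- Each integrand is a radial weight times a homogeneous function, so every term becomes a
  -- multiple of the positive number `cutoffMass n`, which then cancels.
  rw [integral_add, integral_deriv_cutoff_mul H1 I1, integral_cutoff_mul H2 I2] at heq
  · simp only [mul_assoc] at heq
    rw [integral_cutoff_mul H3 I3] at heq
    have hA := cutoffMass_pos (n := n)
    apply mul_left_cancel₀ hA.ne'
    push_cast at heq
    linarith
  · exact I1.bdd_mul (c := D)
      (by
        have := continuous_deriv_radialBump
        exact (by fun_prop : Continuous fun x : E n => 2 * deriv radialBump (‖x‖ ^ 2)).aestronglyMeasurable)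
      ((ae_norm_le_one n).mono fun x hx => hD x hx)
  · exact I2.bdd_mul (c := 1) isTest_cutoff.1.continuous.aestronglyMeasurable
      (ae_of_all _ fun x => by rw [Real.norm_of_nonneg (cutoff_nonneg x)]; exact cutoff_le_one x)

end HalfSpace

/-! ### The generators |x|² (x·b/|x|)^j and the spherical operator on them -/

section Generators
variable {n : ℕ}

/-- The function `x · b / |x|`. -/
def angular (b x : E n) : ℝ := inner ℝ x b / ‖x‖

/-- The function `|x|² (x · b / |x|) ^ j`, the homogeneous extension of degree two of the
restriction of `(x · b) ^ j` to the sphere. -/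
def powerFn (j : ℕ) (b x : E n) : ℝ := ‖x‖ ^ 2 * angular b x ^ j

/-- The gradient of `powerFn j b` away from the origin. -/
def powerGrad (j : ℕ) (b x : E n) : E n :=
  (2 * angular b x ^ j) • x + ((j : ℝ) * angular b x ^ (j - 1)) • (‖x‖ • b - angular b x • x)

theorem abs_angular_le (b x : E n) : |angular b x| ≤ ‖b‖ := by
  unfold angular
  rw [abs_div, abs_norm]
  refine div_le_of_le_mul₀ (norm_nonneg _) (norm_nonneg _) ?_
  rw [mul_comm]
  exact abs_real_inner_le_norm x b

theorem angular_smul (b x : E n) {t : ℝ} (ht : 0 < t) : angular b (t • x) = angular b x := by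
  unfold angular
  rw [real_inner_smul_left, norm_smul, Real.norm_of_nonneg ht.le, mul_div_mul_left _ _ ht.ne']

theorem measurable_angular (b : E n) : Measurable (angular b) := by
  unfold angular; fun_prop

theorem abs_angular_pow_le (b x : E n) (j : ℕ) : |angular b x ^ j| ≤ ‖b‖ ^ j := by
  rw [abs_pow]; gcongr; exact abs_angular_le b x

theorem powerFn_smul (j : ℕ) (b x : E n) {t : ℝ} (ht : 0 < t) :
    powerFn j b (t • x) = t ^ 2 * powerFn j b x := by
  unfold powerFn
  rw [angular_smul b x ht, norm_smul, Real.norm_of_nonneg ht.le]; ring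

theorem aehomog_powerFn (j : ℕ) (b : E n) : AEHomog 2 (powerFn j b) :=
  AEHomog.of_forall fun t ht x => by rw [powerFn_smul j b x ht, smul_eq_mul]

theorem abs_powerFn_le (j : ℕ) (b x : E n) : |powerFn j b x| ≤ ‖x‖ ^ 2 * ‖b‖ ^ j := by
  unfold powerFn
  rw [abs_mul, abs_of_nonneg (sq_nonneg ‖x‖)]
  gcongr
  exact abs_angular_pow_le b x j

theorem norm_powerGrad_le (j : ℕ) (b x : E n) :
    ‖powerGrad j b x‖ ≤ (2 * ‖b‖ ^ j + j * ‖b‖ ^ (j - 1) * (2 * ‖b‖)) * ‖x‖ := by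
  unfold powerGrad
  refine (norm_add_le _ _).trans ?_
  rw [add_mul]
  refine add_le_add ?_ ?_
  · rw [norm_smul, norm_mul, Real.norm_of_nonneg zero_le_two]
    gcongr
    exact abs_angular_pow_le b x j
  · rw [norm_smul, norm_mul, Real.norm_of_nonneg (Nat.cast_nonneg j), mul_assoc _ (2 * ‖b‖)]
    have h1 : ‖‖x‖ • b - angular b x • x‖ ≤ 2 * ‖b‖ * ‖x‖ := by
      refine (norm_sub_le _ _).trans ?_
      rw [norm_smul, norm_smul, norm_norm]
      have := mul_le_mul_of_nonneg_right (abs_angular_le b x) (norm_nonneg x)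
      rw [Real.norm_eq_abs]
      linarith
    gcongr
    exact abs_angular_pow_le b x _

theorem hasFDerivAt_norm_of_ne {x : E n} (hx : x ≠ 0) :
    HasFDerivAt (fun x : E n => ‖x‖) (‖x‖⁻¹ • innerSL ℝ x) x := by
  have h0 : ‖x‖ ≠ 0 := norm_ne_zero_iff.2 hx
  have h1 := (hasStrictFDerivAt_norm_sq x).hasFDerivAt.sqrt (by positivity)
  have e : (fun x : E n => √(‖x‖ ^ 2)) = fun x => ‖x‖ := by
    ext y; exact Real.sqrt_sq (norm_nonneg y)
  rw [e] at h1
  refine h1.congr_fderiv ?_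
  ext b
  rw [Real.sqrt_sq (norm_nonneg x)]
  simp
  field_simp

theorem hasFDerivAt_inner_const (b x : E n) :
    HasFDerivAt (fun x : E n => inner ℝ x b) (innerSL ℝ b) x := by
  have := (innerSL ℝ b).hasFDerivAt (x := x)
  simpa [real_inner_comm] using this

theorem hasFDerivAt_angular (b : E n) {x : E n} (hx : x ≠ 0) :
    HasFDerivAt (angular b) (‖x‖⁻¹ • innerSL ℝ b - (angular b x / ‖x‖ ^ 2) • innerSL ℝ x) x := by
  have h0 : ‖x‖ ≠ 0 := norm_ne_zero_iff.2 hx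
  have h2 : HasFDerivAt (fun x : E n => ‖x‖⁻¹) (-(‖x‖ ^ 2)⁻¹ • (‖x‖⁻¹ • innerSL ℝ x)) x :=
    HasDerivAt.comp_hasFDerivAt (f := fun x : E n => ‖x‖) x (hasDerivAt_inv h0)
      (hasFDerivAt_norm_of_ne hx)
  have h1 := (hasFDerivAt_inner_const b x).fun_mul h2
  have h3 : HasFDerivAt (angular b) _ x := h1
  refine h3.congr_fderiv ?_
  ext v
  change inner ℝ x b * (-(‖x‖ ^ 2)⁻¹ * (‖x‖⁻¹ * inner ℝ x v)) + ‖x‖⁻¹ * inner ℝ b v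
    = ‖x‖⁻¹ * inner ℝ b v - inner ℝ x b / ‖x‖ / ‖x‖ ^ 2 * inner ℝ x v
  field_simp
  ring

theorem hasFDerivAt_powerFn (j : ℕ) (b : E n) {x : E n} (hx : x ≠ 0) :
    HasFDerivAt (powerFn j b) (innerSL ℝ (powerGrad j b x)) x := by
  have h0 : ‖x‖ ≠ 0 := norm_ne_zero_iff.2 hx
  have h1 := (hasStrictFDerivAt_norm_sq x).hasFDerivAt.fun_mul ((hasFDerivAt_angular b hx).pow j)
  refine h1.congr_fderiv ?_
  ext v
  simp [powerGrad]
  field_simp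
  ring

theorem contDiffAt_angular (b : E n) {x : E n} (hx : x ≠ 0) : ContDiffAt ℝ ∞ (angular b) x :=
  (contDiffAt_id.inner ℝ contDiffAt_const).div (contDiffAt_norm ℝ hx) (norm_ne_zero_iff.2 hx)

theorem contDiffAt_powerFn (j : ℕ) (b : E n) {x : E n} (hx : x ≠ 0) :
    ContDiffAt ℝ ∞ (powerFn j b) x :=
  (contDiff_norm_sq ℝ).contDiffAt.mul ((contDiffAt_angular b hx).pow j)

/-- A smooth bump around the origin of the real line. -/
def originBump : ContDiffBump (0 : ℝ) := ⟨1, 2, one_pos, by norm_num⟩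

theorem originBump_contDiff : ContDiff ℝ ∞ (originBump : ℝ → ℝ) := originBump.contDiff

theorem exists_bound_mul_deriv_originBump : ∃ C, ∀ u : ℝ, |u * deriv originBump u| ≤ C := by
  have h : HasCompactSupport fun u : ℝ => u * deriv originBump u :=
    (originBump.hasCompactSupport.deriv).mul_left
  exact h.exists_bound_of_continuous
    (continuous_id.mul (originBump_contDiff.continuous_deriv (by simp)))

theorem deriv_originBump_eq_zero {u : ℝ} (hu : 2 < u) : deriv originBump u = 0 := by
  have : (originBump : ℝ → ℝ) =ᶠ[𝓝 u] fun _ => 0 := by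
    filter_upwards [Ioi_mem_nhds hu] with w hw
    apply originBump.zero_of_le_dist
    rw [Real.dist_eq, sub_zero]
    exact (le_of_lt hw).trans (le_abs_self w)
  rw [this.deriv_eq, deriv_const]

/-- Functions smooth away from the origin, bounded by `|x|²` and with gradient bounded by `|x|`,
are limits of smooth functions. -/
theorem isSmoothLimit_of_smooth_away {f : E n → ℝ} {g : E n → E n} (hn : 0 < n) {B : ℝ}
    (hf : ∀ x ≠ 0, ContDiffAt ℝ ∞ f x) (hg : ∀ x ≠ 0, HasFDerivAt f (innerSL ℝ (g x)) x)
    (bf : ∀ x, |f x| ≤ B * ‖x‖ ^ 2) (bg : ∀ x, ‖g x‖ ≤ B * ‖x‖) : IsSmoothLimit f g := by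
  obtain ⟨C, hC⟩ := exists_bound_mul_deriv_originBump
  have hC0 : 0 ≤ C := (abs_nonneg _).trans (hC 0)
  have hB0 : 0 ≤ B := by
    have : Nontrivial (E n) := by
      have : Nonempty (Fin n) := ⟨⟨0, hn⟩⟩
      infer_instance
    obtain ⟨x, hx⟩ := exists_ne (0 : E n)
    have := (norm_nonneg _).trans (bg x)
    exact nonneg_of_mul_nonneg_left this (norm_pos_iff.2 hx)
  -- The possible singularity at the origin is removed by a cut at the scale `|x|² ~ 1/(k+1)`.
  set φ : ℕ → E n → ℝ := fun k x => (1 - originBump (((k : ℝ) + 1) * ‖x‖ ^ 2)) * f x with hφ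
  have hχ : ∀ k : ℕ, ContDiff ℝ ∞ fun x : E n => 1 - originBump (((k : ℝ) + 1) * ‖x‖ ^ 2) :=
    fun k => contDiff_const.sub
      (originBump_contDiff.comp (contDiff_const.mul (contDiff_norm_sq ℝ)))
  have hzero : ∀ k : ℕ, φ k =ᶠ[𝓝 0] fun _ => 0 := by
    intro k
    have ho : IsOpen {x : E n | ((k : ℝ) + 1) * ‖x‖ ^ 2 < 1} :=
      isOpen_lt (by fun_prop) continuous_const
    filter_upwards [ho.mem_nhds (by simp)] with x hx
    have : originBump (((k : ℝ) + 1) * ‖x‖ ^ 2) = 1 := by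
      apply originBump.one_of_mem_closedBall
      rw [Metric.mem_closedBall, Real.dist_eq, sub_zero, abs_of_nonneg (by positivity)]
      exact (le_of_lt hx)
    simp [hφ, this]
  have hsm : ∀ k, ContDiff ℝ ∞ (φ k) := by
    intro k
    rw [contDiff_iff_contDiffAt]
    intro x
    rcases eq_or_ne x 0 with rfl | hx
    · exact contDiffAt_const.congr_of_eventuallyEq (hzero k)
    · exact (hχ k).contDiffAt.mul (hf x hx)
  have hgrad : ∀ k, ∀ x ≠ 0, gradient (φ k) x
      = (1 - originBump (((k : ℝ) + 1) * ‖x‖ ^ 2)) • g x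
        - (2 * (((k : ℝ) + 1) * deriv originBump (((k : ℝ) + 1) * ‖x‖ ^ 2)) * f x) • x := by
    intro k x hx
    have h1 : HasDerivAt (originBump : ℝ → ℝ) (deriv originBump (((k : ℝ) + 1) * ‖x‖ ^ 2))
        (((k : ℝ) + 1) * ‖x‖ ^ 2) := (originBump_contDiff.differentiable (by simp) _).hasDerivAt
    have h2 := HasDerivAt.comp_hasFDerivAt (f := fun x : E n => ((k : ℝ) + 1) * ‖x‖ ^ 2) x h1
      ((hasStrictFDerivAt_norm_sq x).hasFDerivAt.const_mul ((k : ℝ) + 1))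
    have h3 := (h2.const_sub 1).fun_mul (hg x hx)
    apply HasGradientAt.gradient
    unfold HasGradientAt
    refine h3.congr_fderiv ?_
    ext v
    simp
    ring
  have hle : ∀ k : ℕ, ∀ x : E n, |1 - originBump (((k : ℝ) + 1) * ‖x‖ ^ 2)| ≤ 1 := fun k x => by
    have h1 := originBump.nonneg (x := ((k : ℝ) + 1) * ‖x‖ ^ 2)
    have h2 := originBump.le_one (x := ((k : ℝ) + 1) * ‖x‖ ^ 2)
    rw [abs_of_nonneg (by linarith)]; linarith
  have hne : ∀ᵐ x ∂(ballMeasure n), x ≠ 0 := by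
    have : Nontrivial (E n) := by
      have : Nonempty (Fin n) := ⟨⟨0, hn⟩⟩
      infer_instance
    exact ae_restrict_of_ae (compl_mem_ae_iff.2 (measure_singleton 0))
  refine isSmoothLimit_of_bounded (φ := φ) (C := B + 2 * C * B) hsm (fun k x hx => ?_)
    (fun k x hx => ?_) ?_ ?_
  · have h1 : |φ k x| ≤ B * ‖x‖ ^ 2 := by
      rw [hφ]; simp only; rw [abs_mul]
      exact (mul_le_of_le_one_left (abs_nonneg _) (hle k x)).trans (bf x)
    have h2 : B * ‖x‖ ^ 2 ≤ B * 1 := by gcongr; exact pow_le_one₀ (norm_nonneg x) hx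
    nlinarith
  · rcases eq_or_ne x 0 with rfl | hx0
    · have : gradient (φ k) 0 = 0 := by
        unfold gradient
        rw [(hzero k).fderiv_eq]; simp
      rw [this, norm_zero]; positivity
    · rw [hgrad k x hx0]
      have hxp : 0 < ‖x‖ := norm_pos_iff.2 hx0
      refine (norm_sub_le _ _).trans (add_le_add ?_ ?_)
      · rw [norm_smul]
        refine (mul_le_of_le_one_left (norm_nonneg _) (hle k x)).trans ((bg x).trans ?_)
        exact mul_le_of_le_one_right hB0 hx
      · rw [norm_smul, Real.norm_eq_abs, abs_mul, abs_mul, abs_two]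
        set D := |((k : ℝ) + 1) * deriv originBump (((k : ℝ) + 1) * ‖x‖ ^ 2)| with hD
        -- The derivative of the cut blows up, but `u * deriv originBump u` is bounded; one factor
        -- `‖x‖ ^ 2` supplied by the bound on `f` therefore absorbs it, uniformly in `k`.
        have h1 : D * ‖x‖ ^ 2 ≤ C := by
          have := hC (((k : ℝ) + 1) * ‖x‖ ^ 2)
          have e : ((k : ℝ) + 1) * ‖x‖ ^ 2 * deriv originBump (((k : ℝ) + 1) * ‖x‖ ^ 2)
            = ((k : ℝ) + 1) * deriv originBump (((k : ℝ) + 1) * ‖x‖ ^ 2) * ‖x‖ ^ 2 := by ring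
          rwa [e, abs_mul, abs_of_nonneg (sq_nonneg ‖x‖)] at this
        have hD0 : 0 ≤ D := abs_nonneg _
        calc 2 * D * |f x| * ‖x‖ ≤ 2 * D * (B * ‖x‖ ^ 2) * ‖x‖ := by gcongr; exact bf x
          _ = 2 * (D * ‖x‖ ^ 2) * B * ‖x‖ := by ring
          _ ≤ 2 * C * B * 1 := by gcongr
          _ = 2 * C * B := by ring
  · filter_upwards [hne] with x hx
    refine tendsto_const_nhds.congr' ?_
    have hp : 0 < ‖x‖ ^ 2 / 2 := by have := norm_pos_iff.2 hx; positivity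
    filter_upwards [eventually_one_lt hp] with k hk
    have : originBump (((k : ℝ) + 1) * ‖x‖ ^ 2) = 0 := by
      apply originBump.zero_of_le_dist
      rw [Real.dist_eq, sub_zero]
      exact le_trans (by show (2:ℝ) ≤ _; linarith) (le_abs_self _)
    simp [hφ, this]
  · filter_upwards [hne] with x hx
    refine tendsto_const_nhds.congr' ?_
    have hp : 0 < ‖x‖ ^ 2 / 2 := by have := norm_pos_iff.2 hx; positivity
    filter_upwards [eventually_one_lt hp] with k hk
    have : originBump (((k : ℝ) + 1) * ‖x‖ ^ 2) = 0 := by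
      apply originBump.zero_of_le_dist
      rw [Real.dist_eq, sub_zero]
      exact le_trans (by show (2:ℝ) ≤ _; linarith) (le_abs_self _)
    rw [hgrad k x hx, this, deriv_originBump_eq_zero (by linarith)]
    simp

theorem isSmoothLimit_powerFn (hn : 0 < n) (j : ℕ) (b : E n) :
    IsSmoothLimit (powerFn j b) (powerGrad j b) := by
  refine isSmoothLimit_of_smooth_away hn (B := 2 * ‖b‖ ^ j + j * ‖b‖ ^ (j - 1) * (2 * ‖b‖))
    (fun x hx => contDiffAt_powerFn j b hx) (fun x hx => hasFDerivAt_powerFn j b hx)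
    (fun x => (abs_powerFn_le j b x).trans ?_) (fun x => norm_powerGrad_le j b x)
  rw [mul_comm]
  gcongr
  have : 0 ≤ ‖b‖ ^ j := by positivity
  have : 0 ≤ (j : ℝ) * ‖b‖ ^ (j - 1) * (2 * ‖b‖) := by positivity
  linarith

theorem isHomogeneousPair_powerFn (hn : 0 < n) (j : ℕ) (b : E n) :
    IsHomogeneousPair (powerFn j b) (powerGrad j b) :=
  ⟨(isSmoothLimit_powerFn hn j b).hasScalarGradient, aehomog_powerFn j b⟩

/-- The cutoff also vanishes near the origin, so functions singular only there become admissible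
test functions. -/
theorem isTest_cutoff_mul {ψ : E n → ℝ} (hψ : ∀ x ≠ 0, ContDiffAt ℝ ∞ ψ x) :
    IsTest fun x => cutoff x * ψ x := by
  refine ⟨?_, isTest_cutoff.2.1.mul_right, tsupport_mul_subset_left.trans isTest_cutoff.2.2⟩
  rw [contDiff_iff_contDiffAt]
  intro x
  rcases eq_or_ne x 0 with rfl | hx
  · refine contDiffAt_const (c := (0:ℝ)).congr_of_eventuallyEq ?_
    filter_upwards [Metric.ball_mem_nhds (0 : E n) (by norm_num : (0:ℝ) < 1 / 2)] with x hx
    rw [cutoff_eq_zero (le_of_lt (by simpa using hx)), zero_mul]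
  · exact isTest_cutoff.1.contDiffAt.mul (hψ x hx)

theorem memLp_angular_pow_mul (b : E n) (j : ℕ) {f : E n → ℝ} {p : ℝ≥0∞}
    (hf : MemLp f p (ballMeasure n)) :
    MemLp (fun x => angular b x ^ j * f x) p (ballMeasure n) := by
  refine hf.of_le_mul (c := ‖b‖ ^ j)
    (((measurable_angular b).pow_const j).aestronglyMeasurable.mul hf.1) (ae_of_all _ fun x => ?_)
  rw [norm_mul]
  gcongr
  exact abs_angular_pow_le b x j

theorem aehomog_angular_pow (b : E n) (j : ℕ) : AEHomog 0 (fun x => angular b x ^ j) :=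
  AEHomog.of_forall fun t ht x => by rw [angular_smul b x ht]; simp

/-- The eigenvalue of degree `j` on functions homogeneous of degree two. -/
def eigen (n j : ℕ) : ℝ := ((n : ℝ) + 4) / (n + 2) * (j * (j + n - 2) + 4)

/-- The equation satisfied by `powerFn j b`, tested with homogeneous functions. -/
theorem IsHomogeneousPair.integral_inner_powerGrad (hn : 0 < n) {f : E n → ℝ} {g : E n → E n}
    (h : IsHomogeneousPair f g) (j : ℕ) (b : E n) :
    ∫ x, inner ℝ (g x) (powerGrad j b x) ∂(ballMeasure n)
      = eigen n j * ∫ x, f x * powerFn j b x ∂(ballMeasure n)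
        - ((n : ℝ) + 4) / (n + 2) * (j * (j - 1) * ‖b‖ ^ 2) *
          ∫ x, f x * powerFn (j - 2) b x ∂(ballMeasure n) := by
  have hfi : Integrable f (ballMeasure n) := h.1.1.integrable (by norm_num)
  have hK : ∀ i, Integrable (fun x => angular b x ^ i * f x) (ballMeasure n) := fun i =>
    (memLp_angular_pow_mul b i h.1.1).integrable (by norm_num)
  have hKh : ∀ i, AEHomog 2 (fun x => angular b x ^ i * f x) := fun i => by
    simpa using (aehomog_angular_pow b i).mul h.2
  have hconv : ∀ i, ∫ x, angular b x ^ i * f x ∂(ballMeasure n)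
      = ((n : ℝ) + 4) / (n + 2) * ∫ x, f x * powerFn i b x ∂(ballMeasure n) := fun i => by
    have h1 := integral_norm_sq_mul hn (hKh i) (hK i)
    have h2 : ∀ x, f x * powerFn i b x = ‖x‖ ^ 2 * (angular b x ^ i * f x) := fun x => by
      unfold powerFn; ring
    simp only [h2, h1]
    field_simp
  have hgb : MemLp (fun x => inner ℝ (g x) b) 2 (ballMeasure n) := h.1.2.1.inner_const b
  have hjm : ∀ u : ℝ, (j : ℝ) * (u ^ (j - 1) * u) = j * u ^ j := fun u => by
    rcases j with _ | j
    · simp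
    · simp [pow_succ]
  have hnx : ∀ p, MemLp (fun x : E n => ‖x‖) p (ballMeasure n) := fun p => continuous_norm.memLp_ball p
  have hngb : Integrable (fun x => ‖x‖ * (angular b x ^ (j - 1) * inner ℝ (g x) b))
      (ballMeasure n) := (hnx 2).mul_integrable (memLp_angular_pow_mul b _ hgb)
  have hngbH : AEHomog 2 (fun x => ‖x‖ * (angular b x ^ (j - 1) * inner ℝ (g x) b)) := by
    have h1 : AEHomog 1 (fun x : E n => ‖x‖) := AEHomog.of_forall fun t ht x => by
      simp [norm_smul, abs_of_pos ht]
    exact h1.mul (e := 1) (by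
      simpa using (aehomog_angular_pow b (j - 1)).mul
        (h.gradient_homog.inner (aehomog_const b)))
  -- The weak gradient is tested with `‖x‖ * angular b x ^ (j - 1)`, cut off, in the direction `b`.
  -- Carrying the factor `j` makes the truncated exponents harmless: the coefficient `j` vanishes at
  -- `j = 0`, and `j * (j - 1)` vanishes for `j < 2`.
  have main : (j : ℝ) * ∫ x, ‖x‖ * (angular b x ^ (j - 1) * inner ℝ (g x) b) ∂(ballMeasure n)
      = (n + 4) * j * ∫ x, ‖x‖ ^ 2 * (angular b x ^ j * f x) ∂(ballMeasure n)
        - (j * (2 - j) * ∫ x, angular b x ^ j * f x ∂(ballMeasure n)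
          + j * (j - 1) * ‖b‖ ^ 2 * ∫ x, angular b x ^ (j - 2) * f x ∂(ballMeasure n)) := by
    have hT : IsTest fun x : E n => cutoff x * (‖x‖ * angular b x ^ (j - 1)) :=
      isTest_cutoff_mul fun x hx => (contDiffAt_norm ℝ hx).mul ((contDiffAt_angular b hx).pow _)
    have hD : ∀ x : E n, (j : ℝ) * fderiv ℝ (fun x : E n => cutoff x * (‖x‖ * angular b x ^ (j - 1))) x b
        = 2 * deriv radialBump (‖x‖ ^ 2) * (j * (‖x‖ ^ 2 * angular b x ^ j))
          + cutoff x * (j * (2 - j) * angular b x ^ j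
            + j * (j - 1) * ‖b‖ ^ 2 * angular b x ^ (j - 2)) := by
      intro x
      rcases eq_or_ne x 0 with rfl | hx
      · have h0 : (fun x : E n => cutoff x * (‖x‖ * angular b x ^ (j - 1))) =ᶠ[𝓝 0] fun _ => 0 := by
          filter_upwards [Metric.ball_mem_nhds (0 : E n) (by norm_num : (0:ℝ) < 1 / 2)] with x hx
          rw [cutoff_eq_zero (le_of_lt (by simpa using hx)), zero_mul]
        rw [h0.fderiv_eq]
        simp [cutoff_eq_zero (x := (0 : E n)) (by simp)]
      · have hx0 : ‖x‖ ≠ 0 := norm_ne_zero_iff.2 hx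
        have h1 := (hasFDerivAt_cutoff x).fun_mul
          ((hasFDerivAt_norm_of_ne hx).fun_mul ((hasFDerivAt_angular b hx).pow (j - 1)))
        rw [h1.fderiv]
        have hxb : inner ℝ x b = angular b x * ‖x‖ := by unfold angular; field_simp
        simp only [nsmul_eq_mul, add_apply, FunLike.coe_smul,
          Pi.smul_apply, FunLike.coe_sub, Pi.sub_apply, innerSL_apply_apply,
          smul_eq_mul, real_inner_self_eq_norm_sq, hxb]
        rcases j with _ | _ | j
        · simp
        · simp; field_simp; ring
        · push_cast
          field_simp
          ring
    have h1 := h.1.2.2 _ hT b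
    have h2 : ∫ x, cutoff x * (‖x‖ * angular b x ^ (j - 1)) * inner ℝ (g x) b ∂(ballMeasure n)
        = cutoffMass n * ∫ x, ‖x‖ * (angular b x ^ (j - 1) * inner ℝ (g x) b) ∂(ballMeasure n) := by
      rw [← integral_cutoff_mul hngbH hngb]
      refine integral_congr_ae (ae_of_all _ fun x => ?_)
      simp only; ring
    have h3 : (j : ℝ) * ∫ x, fderiv ℝ (fun x : E n => cutoff x * (‖x‖ * angular b x ^ (j - 1))) x b
        * f x ∂(ballMeasure n)
        = ∫ x, (2 * deriv radialBump (‖x‖ ^ 2) * (j * (‖x‖ ^ 2 * (angular b x ^ j * f x)))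
          + cutoff x * (j * (2 - j) * (angular b x ^ j * f x)
            + j * (j - 1) * ‖b‖ ^ 2 * (angular b x ^ (j - 2) * f x))) ∂(ballMeasure n) := by
      rw [← integral_const_mul]
      refine integral_congr_ae (ae_of_all _ fun x => ?_)
      simp only
      rw [← mul_assoc, hD x]; ring
    have I4 : Integrable (fun x => ‖x‖ ^ 2 * (angular b x ^ j * f x)) (ballMeasure n) :=
      ((continuous_norm.pow 2).memLp_ball 2).mul_integrable (memLp_angular_pow_mul b j h.1.1)
    have H4 : AEHomog 4 (fun x => ‖x‖ ^ 2 * (angular b x ^ j * f x)) := by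
      have h1 : AEHomog 2 (fun x : E n => ‖x‖ ^ 2) := AEHomog.of_forall fun t ht x => by
        simp [norm_smul, abs_of_pos ht, mul_pow]
      exact h1.mul (hKh j)
    have I2 : Integrable (fun x => j * (2 - j) * (angular b x ^ j * f x)
            + j * (j - 1) * ‖b‖ ^ 2 * (angular b x ^ (j - 2) * f x)) (ballMeasure n) :=
      ((hK j).const_mul _).add ((hK (j - 2)).const_mul _)
    have H2 : AEHomog 2 (fun x => j * (2 - j) * (angular b x ^ j * f x)
            + j * (j - 1) * ‖b‖ ^ 2 * (angular b x ^ (j - 2) * f x)) :=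
      ((hKh j).const_smul _).add ((hKh (j - 2)).const_smul _)
    have cr : Continuous fun x : E n => 2 * deriv radialBump (‖x‖ ^ 2) := by
      have := continuous_deriv_radialBump
      fun_prop
    obtain ⟨D, hDb⟩ := ContDiff.bounded_on_ball cr
    have H4' : AEHomog 4 (fun x => j * (‖x‖ ^ 2 * (angular b x ^ j * f x))) :=
      H4.const_smul (j : ℝ)
    rw [integral_add, integral_deriv_cutoff_mul H4' (I4.const_mul _),
      integral_cutoff_mul H2 I2, integral_add ((hK j).const_mul _) ((hK (j - 2)).const_mul _),
      integral_const_mul, integral_const_mul] at h3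
    · rw [integral_const_mul] at h3
      rw [h2] at h1
      rw [h1] at h3
      have hA := cutoffMass_pos (n := n)
      apply mul_left_cancel₀ hA.ne'
      push_cast at h3
      linarith
    · exact (I4.const_mul (j : ℝ)).bdd_mul (c := D) cr.aestronglyMeasurable
        ((ae_norm_le_one n).mono fun x hx => hDb x hx)
    · exact I2.bdd_mul (c := 1) isTest_cutoff.1.continuous.aestronglyMeasurable
        (ae_of_all _ fun x => by rw [Real.norm_of_nonneg (cutoff_nonneg x)]; exact cutoff_le_one x)
  -- Euler's identity replaces the radial part of the pairing by `2 * f`; only the component of `g`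
  -- along `b` is left, and `main` computes it.
  have hsplit : ∫ x, inner ℝ (g x) (powerGrad j b x) ∂(ballMeasure n)
      = ∫ x, ((4 - 2 * j) * (angular b x ^ j * f x)
        + j * (‖x‖ * (angular b x ^ (j - 1) * inner ℝ (g x) b))) ∂(ballMeasure n) := by
    refine integral_congr_ae ?_
    filter_upwards [h.euler] with x hx
    simp only [powerGrad, inner_add_right, inner_sub_right, real_inner_smul_right, hx]
    have := hjm (angular b x)
    linear_combination (-2 * f x) * this
  rw [hsplit, integral_add ((hK j).const_mul _) (hngb.const_mul _), integral_const_mul,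
    integral_const_mul, main, integral_norm_sq_mul hn (hKh j) (hK j)]
  rw [hconv j, hconv (j - 2)]
  unfold eigen
  field_simp
  ring

end Generators

/-! ### Completeness of the generators -/

section Density
variable {n : ℕ}

/-- The exponential is expanded in its power series and integrated term by term; on the ball the
series of norms converges like that of `exp ‖t‖`. -/
theorem integral_mul_cexp_eq_zero {f : E n → ℝ} (hf : Integrable f (ballMeasure n))
    (h : ∀ (j : ℕ) (b : E n), ∫ x, f x * inner ℝ x b ^ j ∂(ballMeasure n) = 0) (t : E n) :
    ∫ x, (f x : ℂ) * Complex.exp (inner ℝ x t * Complex.I) ∂(ballMeasure n) = 0 := by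
  set F : ℕ → E n → ℂ := fun j x =>
    (Complex.I ^ j / (Nat.factorial j : ℂ)) * ((f x * inner ℝ x t ^ j : ℝ) : ℂ) with hF
  have hin : ∀ x : E n, ‖x‖ ≤ 1 → |inner ℝ x t| ≤ ‖t‖ := fun x hx => by
    refine (abs_real_inner_le_norm x t).trans ?_
    exact mul_le_of_le_one_left (norm_nonneg t) hx
  have hint : ∀ j, Integrable (fun x => f x * inner ℝ x t ^ j) (ballMeasure n) := fun j => by
    refine hf.mul_bdd (c := ‖t‖ ^ j) (by fun_prop) ?_
    filter_upwards [ae_norm_le_one n] with x hx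
    rw [norm_pow]; gcongr; exact hin x hx
  have hFint : ∀ j, Integrable (F j) (ballMeasure n) := fun j => (hint j).ofReal.const_mul _
  have hbound : ∀ j, ∫ x, ‖F j x‖ ∂(ballMeasure n)
      ≤ ‖t‖ ^ j / (Nat.factorial j : ℝ) * ∫ x, ‖f x‖ ∂(ballMeasure n) := fun j => by
    rw [← integral_const_mul]
    refine integral_mono_ae (hFint j).norm (hf.norm.const_mul _) ?_
    filter_upwards [ae_norm_le_one n] with x hx
    simp only [hF, norm_mul, norm_div, norm_pow, Complex.norm_I, one_pow, Complex.norm_natCast,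
      Complex.norm_real]
    have := hin x hx
    rw [Real.norm_eq_abs (inner ℝ x t)]
    calc 1 / (Nat.factorial j : ℝ) * (‖f x‖ * |inner ℝ x t| ^ j)
        ≤ 1 / (Nat.factorial j : ℝ) * (‖f x‖ * ‖t‖ ^ j) := by gcongr
      _ = _ := by ring
  have hsum : Summable fun j => ∫ x, ‖F j x‖ ∂(ballMeasure n) :=
    Summable.of_nonneg_of_le (fun j => integral_nonneg fun x => norm_nonneg _) hbound
      ((Real.summable_pow_div_factorial ‖t‖).mul_right _)
  have h1 := hasSum_integral_of_summable_integral_norm hFint hsum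
  have h2 : ∀ j, ∫ x, F j x ∂(ballMeasure n) = 0 := fun j => by
    simp only [hF]
    rw [integral_const_mul, integral_complex_ofReal, h j]; simp
  simp only [h2] at h1
  have h3 := h1.unique hasSum_zero
  rw [← h3]
  refine integral_congr_ae (ae_of_all _ fun x => ?_)
  have h4 := (NormedSpace.expSeries_div_hasSum_exp ((inner ℝ x t : ℂ) * Complex.I)).mul_left (f x : ℂ)
  rw [← Complex.exp_eq_exp_ℂ] at h4
  simp only
  rw [← h4.tsum_eq]
  refine tsum_congr fun j => ?_
  simp only [hF]; push_cast; rw [mul_pow]; ring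

/-- The measures with densities the positive and negative parts of `f` have the same characteristic
function, hence coincide, and so do the two parts. -/
theorem ae_eq_zero_of_moments {f : E n → ℝ} (hf : Integrable f (ballMeasure n))
    (h : ∀ (j : ℕ) (b : E n), ∫ x, f x * inner ℝ x b ^ j ∂(ballMeasure n) = 0) :
    f =ᵐ[ballMeasure n] 0 := by
  set μp := (ballMeasure n).withDensity (fun x => ENNReal.ofReal (f x)) with hp
  set μm := (ballMeasure n).withDensity (fun x => ENNReal.ofReal (-f x)) with hm
  have : IsFiniteMeasure μp := isFiniteMeasure_withDensity_ofReal hf.2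
  have : IsFiniteMeasure μm := isFiniteMeasure_withDensity_ofReal hf.neg.2
  have hexp : ∀ t x : E n, ‖Complex.exp (inner ℝ x t * Complex.I)‖ = 1 := fun t x => by
    exact Complex.norm_exp_ofReal_mul_I _
  have hc : ∀ t : E n, Continuous fun x : E n => Complex.exp (inner ℝ x t * Complex.I) := fun t => by
    fun_prop
  have hneg : AEMeasurable (fun x => ENNReal.ofReal (-f x)) (ballMeasure n) :=
    hf.1.aemeasurable.neg.ennreal_ofReal
  have heq : μp = μm := by
    refine Measure.ext_of_charFun ?_
    ext t
    rw [charFun_apply, charFun_apply, hp, hm,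
      integral_withDensity_eq_integral_toReal_smul₀ hf.1.aemeasurable.ennreal_ofReal
        (ae_of_all _ fun _ => ENNReal.ofReal_lt_top),
      integral_withDensity_eq_integral_toReal_smul₀ hneg
        (ae_of_all _ fun _ => ENNReal.ofReal_lt_top), ← sub_eq_zero, ← integral_sub]
    · rw [← integral_mul_cexp_eq_zero hf h t]
      refine integral_congr_ae (ae_of_all _ fun x => ?_)
      simp only [ENNReal.toReal_ofReal', ← sub_smul]
      have : max (f x) 0 - max (-f x) 0 = f x := by
        rcases le_total (f x) 0 with h | h
        · rw [max_eq_right h, max_eq_left (by linarith)]; ring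
        · rw [max_eq_left h, max_eq_right (by linarith)]; ring
      rw [this, Complex.real_smul]
    · have i1 : Integrable (fun x => (ENNReal.ofReal (f x)).toReal) (ballMeasure n) := by
        simpa only [ENNReal.toReal_ofReal'] using hf.pos_part
      exact i1.smul_bdd 1 (hc t).aestronglyMeasurable (ae_of_all _ fun x => (hexp t x).le)
    · have i1 : Integrable (fun x => (ENNReal.ofReal (-f x)).toReal) (ballMeasure n) := by
        simpa only [ENNReal.toReal_ofReal'] using hf.neg_part
      exact i1.smul_bdd 1 (hc t).aestronglyMeasurable (ae_of_all _ fun x => (hexp t x).le)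
  have h2 := (withDensity_eq_iff_of_sigmaFinite hf.1.aemeasurable.ennreal_ofReal
    hneg).1 heq
  filter_upwards [h2] with x hx
  simp only [Pi.zero_apply]
  rcases le_total (f x) 0 with h | h
  · rw [ENNReal.ofReal_of_nonpos h, eq_comm, ENNReal.ofReal_eq_zero] at hx
    linarith
  · rw [ENNReal.ofReal_of_nonpos (by linarith : -f x ≤ 0), ENNReal.ofReal_eq_zero] at hx
    linarith

theorem inner_pow_eq (j : ℕ) (b x : E n) : inner ℝ x b ^ j = ‖x‖ ^ j * angular b x ^ j := by
  rw [← mul_pow]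
  congr 1
  unfold angular
  rcases eq_or_ne x 0 with rfl | hx
  · simp
  · field_simp [norm_ne_zero_iff.2 hx]

/-- Functions homogeneous of degree two and orthogonal to all `powerFn j b` vanish. -/
theorem ae_eq_zero_of_orthogonal_powerFn (hn : 0 < n) {f : E n → ℝ}
    (hf : MemLp f 2 (ballMeasure n)) (hh : AEHomog 2 f)
    (h : ∀ (j : ℕ) (b : E n), ∫ x, f x * powerFn j b x ∂(ballMeasure n) = 0) :
    f =ᵐ[ballMeasure n] 0 := by
  have hfi : Integrable f (ballMeasure n) := hf.integrable (by norm_num)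
  have h1 : Integrable (fun x => ‖x‖ ^ 2 * f x) (ballMeasure n) :=
    ((continuous_norm.pow 2).memLp_ball 2).mul_integrable hf
  -- The extra weight `‖x‖ ^ 2` turns the moment of order `j` into `‖x‖ ^ j` times `f x * powerFn j
  -- b x`; the radial factor comes out and leaves an integral that vanishes by hypothesis.
  have h2 := ae_eq_zero_of_moments h1 fun j b => by
    have h3 : AEHomog 4 (fun x => f x * powerFn j b x) := hh.mul (aehomog_powerFn j b)
    have h4 : Integrable (fun x => f x * powerFn j b x) (ballMeasure n) :=
      hf.mul_integrable (isSmoothLimit_powerFn hn j b).1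
    have h5 := integral_radial_mul (by omega) h3 h4 (w := fun r => r ^ j) (continuous_pow j)
    rw [h j b, mul_zero] at h5
    rw [← h5]
    refine integral_congr_ae (ae_of_all _ fun x => ?_)
    simp only [inner_pow_eq, powerFn]; ring
  have hne : ∀ᵐ x ∂(ballMeasure n), x ≠ 0 := by
    have : Nontrivial (E n) := by
      have : Nonempty (Fin n) := ⟨⟨0, hn⟩⟩
      infer_instance
    exact ae_restrict_of_ae (compl_mem_ae_iff.2 (measure_singleton 0))
  filter_upwards [h2, hne] with x hx hx0
  simpa [hx0] using hx

end Density

/-! ### Spectral gap for symmetric operators triangular along a filtration -/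

section Abstract

/-- A symmetric operator, triangular along a filtration by finite-dimensional subspaces, together
with the associated energy. -/
structure TriangularData (P H X : Type*) [AddCommGroup P] [Module ℝ P] [NormedAddCommGroup H]
    [InnerProductSpace ℝ H] [NormedAddCommGroup X] [InnerProductSpace ℝ X] where
  val : P →ₗ[ℝ] H
  grad : P →ₗ[ℝ] X
  op : P →ₗ[ℝ] P
  filt : ℕ → Submodule ℝ P
  eig : ℕ → ℝ
  energy : ∀ p q, inner ℝ (grad p) (grad q) = inner ℝ (val p) (val (op q))
  filt_mono : Monotone filt
  filt_zero : filt 0 = ⊥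
  filt_top : ∀ p, ∃ k, p ∈ filt k
  finite : ∀ k, FiniteDimensional ℝ ((filt k).map val)
  triangular : ∀ k, ∀ p ∈ filt (k + 1), op p - eig k • p ∈ filt k
  eig_mono : Monotone eig

namespace TriangularData
variable {P H X : Type*} [AddCommGroup P] [Module ℝ P] [NormedAddCommGroup H]
    [InnerProductSpace ℝ H] [NormedAddCommGroup X] [InnerProductSpace ℝ X]
    (T : TriangularData P H X)

theorem op_mem {k : ℕ} {p : P} (hp : p ∈ T.filt k) : T.op p ∈ T.filt k := by
  rcases k with _ | k
  · rw [T.filt_zero, Submodule.mem_bot] at *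
    rw [hp, map_zero]
  · have h1 := T.filt_mono k.le_succ (T.triangular k p hp)
    have := add_mem h1 ((T.filt (k + 1)).smul_mem (T.eig k) hp)
    simpa using this

theorem symm (p q : P) : inner ℝ (T.val (T.op p)) (T.val q) = inner ℝ (T.val p) (T.val (T.op q)) := by
  rw [← T.energy, real_inner_comm, ← T.energy, real_inner_comm]

theorem exists_proj (k : ℕ) (f : H) :
    ∃ p ∈ T.filt k, ∀ q ∈ T.filt k, inner ℝ (f - T.val p) (T.val q) = 0 := by
  have := T.finite k
  obtain ⟨p, hp, hpe⟩ := (Submodule.mem_map).1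
    (((T.filt k).map T.val).starProjection_apply_mem f)
  refine ⟨p, hp, fun q hq => ?_⟩
  have h := Submodule.sub_starProjection_mem_orthogonal (K := (T.filt k).map T.val) f
  rw [hpe]
  exact Submodule.inner_left_of_mem_orthogonal (Submodule.mem_map_of_mem hq) h

/-- Induction on the level. Split `p` into its projection `z` on the lower level and a rest `w`
orthogonal to that level. By triangularity `w` behaves like an eigenvector with eigenvalue `eig k`,
cross terms vanish by symmetry, and `z` is still orthogonal to `filt K`. No eigenbasis is
constructed. -/
theorem eig_le_of_orthogonal (K : ℕ) : ∀ k, K ≤ k → ∀ p ∈ T.filt k,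
    (∀ q ∈ T.filt K, inner ℝ (T.val p) (T.val q) = 0) →
    T.eig K * ‖T.val p‖ ^ 2 ≤ inner ℝ (T.val p) (T.val (T.op p)) := by
  intro k hk
  induction k, hk using Nat.le_induction with
  | base =>
    intro p hp h
    have h1 : T.val p = 0 := by
      rw [← inner_self_eq_zero (𝕜 := ℝ)]; exact h p hp
    simp [h1]
  | succ k hk ih =>
    intro p hp h
    obtain ⟨z, hz, hzo⟩ := T.exists_proj k (T.val p)
    set w := p - z with hw
    have hwv : T.val w = T.val p - T.val z := by rw [hw, map_sub]
    have hw1 : w ∈ T.filt (k + 1) := sub_mem hp (T.filt_mono k.le_succ hz)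
    have ho : ∀ q ∈ T.filt k, inner ℝ (T.val w) (T.val q) = 0 := fun q hq => by
      rw [hwv]; exact hzo q hq
    have hpzw : T.val p = T.val z + T.val w := by rw [hwv]; abel
    have hww : inner ℝ (T.val w) (T.val (T.op w)) = T.eig k * ‖T.val w‖ ^ 2 := by
      have h1 := ho _ (T.triangular k w hw1)
      have e : T.val (T.op w - T.eig k • w) = T.val (T.op w) - T.eig k • T.val w :=
        (map_sub T.val _ _).trans (by rw [map_smul])
      rw [e, inner_sub_right, real_inner_smul_right, real_inner_self_eq_norm_sq] at h1
      linarith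
    have hwz : inner ℝ (T.val w) (T.val (T.op z)) = 0 := ho _ (T.op_mem hz)
    have hzw : inner ℝ (T.val z) (T.val (T.op w)) = 0 := by
      rw [← T.symm, real_inner_comm]; exact hwz
    have hzw0 : inner ℝ (T.val w) (T.val z) = 0 := ho z hz
    have hop : T.op p = T.op z + T.op w := by rw [hw, map_sub]; abel
    have ihz := ih z hz fun q hq => by
      have h1 := h q hq
      rw [hpzw, inner_add_left, ho q (T.filt_mono hk hq), add_zero] at h1
      exact h1
    have e1 : inner ℝ (T.val p) (T.val (T.op p))
        = inner ℝ (T.val z) (T.val (T.op z)) + T.eig k * ‖T.val w‖ ^ 2 := by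
      rw [hop, map_add, hpzw, inner_add_left, inner_add_right, inner_add_right, hww, hwz, hzw]
      ring
    have e2 : ‖T.val p‖ ^ 2 = ‖T.val z‖ ^ 2 + ‖T.val w‖ ^ 2 := by
      rw [hpzw, norm_add_sq_real, real_inner_comm, hzw0]; ring
    have := mul_le_mul_of_nonneg_right (T.eig_mono hk) (sq_nonneg ‖T.val w‖)
    rw [e1, e2, mul_add]
    linarith

/-- The spectral gap inequality. -/
theorem eig_mul_norm_sq_le {K : ℕ} (hK : 0 ≤ T.eig K) {f : H} {G : X}
    (hG : ∀ p, inner ℝ G (T.grad p) = inner ℝ f (T.val (T.op p)))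
    (hdense : ∀ ε > 0, ∃ p, ‖f - T.val p‖ < ε)
    (ho : ∀ p ∈ T.filt K, inner ℝ f (T.val p) = 0) : T.eig K * ‖f‖ ^ 2 ≤ ‖G‖ ^ 2 := by
  refine le_of_forall_pos_le_add fun ε hε => ?_
  -- With this accuracy the discarded part of `f` costs at most `eig K * ε / (eig K + 1) ≤ ε`.
  obtain ⟨p, hp⟩ := hdense (√(ε / (T.eig K + 1))) (by positivity)
  obtain ⟨k₀, hk₀⟩ := T.filt_top p
  set k := max k₀ K
  have hpk : p ∈ T.filt k := T.filt_mono (le_max_left _ _) hk₀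
  obtain ⟨y, hy, hyo⟩ := T.exists_proj k f
  have h1 : ‖f - T.val y‖ ^ 2 ≤ ‖f - T.val p‖ ^ 2 := by
    have e : f - T.val p = (f - T.val y) + T.val (y - p) := by rw [map_sub]; abel
    rw [e, norm_add_sq_real, hyo _ (sub_mem hy hpk)]
    nlinarith [sq_nonneg ‖T.val (y - p)‖]
  have h2 : ‖f‖ ^ 2 = ‖f - T.val y‖ ^ 2 + ‖T.val y‖ ^ 2 := by
    have e : f = (f - T.val y) + T.val y := by abel
    conv_lhs => rw [e]
    rw [norm_add_sq_real, hyo y hy]; ring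
  have h3 : ‖f - T.val p‖ ^ 2 ≤ ε / (T.eig K + 1) := by
    rw [← Real.sq_sqrt (by positivity : 0 ≤ ε / (T.eig K + 1))]
    gcongr
  have h4 : T.eig K * ‖T.val y‖ ^ 2 ≤ inner ℝ (T.val y) (T.val (T.op y)) := by
    refine T.eig_le_of_orthogonal K k (le_max_right _ _) y hy fun q hq => ?_
    have := hyo q (T.filt_mono (le_max_right _ _) hq)
    rw [inner_sub_left, ho q hq] at this
    linarith
  -- Bessel's inequality in the gradient space: the pairing of `G` with `grad y` equals `‖grad y‖ ^
  -- 2`, because `f - val y` is orthogonal to `val (op y)`.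
  have h5 : inner ℝ (T.val y) (T.val (T.op y)) ≤ ‖G‖ ^ 2 := by
    have e1 := hG y
    have e2 := hyo _ (T.op_mem hy)
    rw [inner_sub_left] at e2
    have e3 := T.energy y y
    rw [real_inner_self_eq_norm_sq] at e3
    have e4 := norm_sub_sq_real G (T.grad y)
    nlinarith [sq_nonneg ‖G - T.grad y‖]
  have h6 : T.eig K * (ε / (T.eig K + 1)) ≤ ε := by
    rw [mul_div_assoc', div_le_iff₀ (by positivity)]
    nlinarith
  have h7 : T.eig K * ‖f - T.val y‖ ^ 2 ≤ T.eig K * (ε / (T.eig K + 1)) := by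
    gcongr; exact h1.trans h3
  rw [h2, mul_add]
  linarith

/-- Quantitative truncation, the source of compactness: removing the projection on `filt K` does not
increase the Dirichlet norm, and the gap applies to the remainder. -/
theorem exists_proj_norm_sq_le {K : ℕ} (hK : 0 ≤ T.eig K) {f : H} {G : X}
    (hG : ∀ p, inner ℝ G (T.grad p) = inner ℝ f (T.val (T.op p)))
    (hdense : ∀ ε > 0, ∃ p, ‖f - T.val p‖ < ε) :
    ∃ z ∈ T.filt K, (∀ q ∈ T.filt K, inner ℝ (f - T.val z) (T.val q) = 0) ∧
      T.eig K * ‖f - T.val z‖ ^ 2 ≤ ‖G‖ ^ 2 := by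
  obtain ⟨z, hz, hzo⟩ := T.exists_proj K f
  refine ⟨z, hz, hzo, ?_⟩
  have h1 := T.eig_mul_norm_sq_le hK (f := f - T.val z) (G := G - T.grad z)
    (fun p => by rw [inner_sub_left, inner_sub_left, hG, T.energy])
    (fun ε hε => by
      obtain ⟨p, hp⟩ := hdense ε hε
      exact ⟨p - z, by rw [map_sub, sub_sub_sub_cancel_right]; exact hp⟩) hzo
  refine h1.trans ?_
  have e1 := hG z
  have e2 := hzo _ (T.op_mem hz)
  rw [inner_sub_left] at e2
  have e3 := T.energy z z
  rw [real_inner_self_eq_norm_sq] at e3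
  rw [norm_sub_sq_real]
  nlinarith [sq_nonneg ‖T.grad z‖]

end TriangularData
end Abstract

/-! ### Homogeneity expressed by testing -/

section HomogTest
variable {n : ℕ}

theorem integral_test_comp_inv_smul (φ : E n → ℝ) {f : E n → ℝ} {t : ℝ} (ht : 0 < t) (ht1 : t ≤ 1)
    (hφ : IsTest φ) : ∫ x, φ (t⁻¹ • x) * f x ∂(ballMeasure n)
      = t ^ n * ∫ x, φ x * f (t • x) ∂(ballMeasure n) := by
  have hz := (hφ.comp_inv_smul ht ht1).2
  have := setIntegral_ball_comp_smul (fun x => φ (t⁻¹ • x) * f x) ht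
  simp only [smul_smul, inv_mul_cancel₀ ht.ne', one_smul] at this
  rw [integral_eq_setIntegral_of_test ht1 (fun x hx => by rw [hz x hx, zero_mul])] at this
  rw [this, smul_eq_mul, mul_inv_cancel_left₀ (by positivity)]

/-- Homogeneity, expressed by testing. -/
theorem aehomog_iff_test {d : ℕ} {f : E n → ℝ} (hf : MemLp f 2 (ballMeasure n)) :
    AEHomog d f ↔ ∀ t : ℝ, 0 < t → t ≤ 1 → ∀ φ : E n → ℝ, IsTest φ →
      ∫ x, (φ (t⁻¹ • x) - t ^ (n + d) * φ x) * f x ∂(ballMeasure n) = 0 := by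
  have key : ∀ t : ℝ, 0 < t → t ≤ 1 → ∀ φ : E n → ℝ, IsTest φ →
      ∫ x, (φ (t⁻¹ • x) - t ^ (n + d) * φ x) * f x ∂(ballMeasure n)
        = t ^ n * (∫ x, φ x * f (t • x) ∂(ballMeasure n)
          - ∫ x, φ x * (t ^ d * f x) ∂(ballMeasure n)) := by
    intro t ht ht1 φ hφ
    have e : ∀ x, (φ (t⁻¹ • x) - t ^ (n + d) * φ x) * f x
        = φ (t⁻¹ • x) * f x - t ^ n * (φ x * (t ^ d * f x)) := fun x => by rw [pow_add]; ring
    simp only [e]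
    rw [integral_sub, integral_test_comp_inv_smul φ ht ht1 hφ, integral_const_mul, mul_sub]
    · exact ((hφ.comp_inv_smul ht ht1).1.memLp 2).mul_integrable hf
    · exact ((hφ.memLp 2).mul_integrable (hf.const_mul _)).const_mul _
  constructor
  · intro h t ht ht1 φ hφ
    rw [key t ht ht1 φ hφ, integral_congr_ae (g := fun x => φ x * (t ^ d * f x)), sub_self, mul_zero]
    filter_upwards [h t ht ht1] with x hx
    rw [hx, smul_eq_mul]
  · intro h t ht ht1
    refine ae_eq_of_test ((hf.comp_smul_ball ht ht1).integrable (by norm_num))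
      ((hf.const_mul (t ^ d)).integrable (by norm_num)) fun φ hφ => ?_
    have h1 := h t ht ht1 φ hφ
    rw [key t ht ht1 φ hφ] at h1
    have htn : t ^ n ≠ 0 := by positivity
    have := (mul_eq_zero.1 h1).resolve_left htn
    simp only [smul_eq_mul]
    linarith

/-- Dilations preserve null sets and map the unit ball into itself for `t ≤ 1`, so homogeneity is a
property of the class modulo null sets. -/
theorem AEHomog.congr {F : Type*} [AddCommGroup F] [Module ℝ F] {d : ℕ} {f f' : E n → F}
    (h : AEHomog d f) (he : f =ᵐ[ballMeasure n] f') : AEHomog d f' := by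
  intro t ht ht1
  have h1 : ∀ᵐ x ∂(ballMeasure n), f (t • x) = f' (t • x) := by
    have hv : ∀ᵐ x ∂(volume : Measure (E n)), x ∈ unitBall n → f x = f' x := by
      rwa [Filter.EventuallyEq, ballMeasure, ae_restrict_iff' (measurableSet_unitBall n)] at he
    have hq : Measure.QuasiMeasurePreserving (fun x : E n => t • x) volume volume := by
      refine ⟨measurable_const_smul t, ?_⟩
      rw [Measure.map_addHaar_smul _ ht.ne']
      exact Measure.smul_absolutelyContinuous
    have h2 := hq.ae hv
    rw [ballMeasure, ae_restrict_iff' (measurableSet_unitBall n)]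
    filter_upwards [h2] with x hx hxU
    refine hx ?_
    simp only [unitBall, mem_ball_zero_iff, norm_smul, Real.norm_of_nonneg ht.le] at hxU ⊢
    nlinarith [norm_nonneg x]
  filter_upwards [h t ht ht1, h1, he] with x a b c
  rw [← b, a, c]

end HomogTest

/-! ### Reflection in a hyperplane and odd generators -/

section Reflection
variable {n : ℕ}

/-- The reflection across the hyperplane orthogonal to `ν`. -/
def mirror (ν : E n) : E n ≃ₗᵢ[ℝ] E n := (ℝ ∙ ν)ᗮ.reflection

theorem mirror_apply {ν : E n} (hν : ‖ν‖ = 1) (x : E n) :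
    mirror ν x = x - (2 * inner ℝ x ν) • ν := by
  unfold mirror
  rw [Submodule.reflection_orthogonal_apply, Submodule.reflection_singleton_apply]
  simp [hν, real_inner_comm, two_smul, two_mul, add_smul]

theorem inner_mirror_mirror {ν : E n} (x y : E n) : inner ℝ (mirror ν x) (mirror ν y) = inner ℝ x y :=
  (mirror ν).inner_map_map x y

theorem mirror_mirror (ν x : E n) : mirror ν (mirror ν x) = x :=
  Submodule.reflection_reflection _ x

theorem inner_mirror_left (ν x y : E n) : inner ℝ (mirror ν x) y = inner ℝ x (mirror ν y) := by
  rw [← inner_mirror_mirror (ν := ν) (mirror ν x) y, mirror_mirror]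

theorem norm_mirror (ν x : E n) : ‖mirror ν x‖ = ‖x‖ := (mirror ν).norm_map x

theorem inner_mirror_self {ν : E n} (hν : ‖ν‖ = 1) (x : E n) :
    inner ℝ (mirror ν x) ν = - inner ℝ x ν := by
  rw [mirror_apply hν, inner_sub_left, real_inner_smul_left, real_inner_self_eq_norm_sq, hν]; ring

theorem measurePreserving_isometry (R : E n ≃ₗᵢ[ℝ] E n) :
    MeasurePreserving R (ballMeasure n) (ballMeasure n) := by
  have h := R.measurePreserving.restrict_preimage (measurableSet_unitBall n)
  have e : R ⁻¹' unitBall n = unitBall n := by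
    ext x; simp [unitBall]
  rwa [e] at h

theorem integral_comp_isometry {F : Type*} [NormedAddCommGroup F] [NormedSpace ℝ F]
    (R : E n ≃ₗᵢ[ℝ] E n) (f : E n → F) :
    ∫ x, f (R x) ∂(ballMeasure n) = ∫ x, f x ∂(ballMeasure n) :=
  (measurePreserving_isometry R).integral_comp R.toHomeomorph.measurableEmbedding f

theorem ae_inner_ne_zero {ν : E n} (hν : ‖ν‖ = 1) : ∀ᵐ x ∂(ballMeasure n), inner ℝ x ν ≠ 0 := by
  refine ae_restrict_of_ae ?_
  have hs : (LinearMap.ker (innerSL ℝ ν).toLinearMap : Submodule ℝ (E n)) ≠ ⊤ := by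
    intro h
    have : ν ∈ LinearMap.ker (innerSL ℝ ν).toLinearMap := h ▸ Submodule.mem_top
    simp at this
    rw [this, norm_zero] at hν
    exact zero_ne_one hν
  have := Measure.addHaar_submodule (volume : Measure (E n)) _ hs
  rw [ae_iff]
  convert this using 2
  ext x
  simp [real_inner_comm]

theorem halfInd_add_mirror {ν : E n} (hν : ‖ν‖ = 1) {x : E n} (hx : inner ℝ x ν ≠ 0) :
    halfInd ν x + halfInd ν (mirror ν x) = 1 := by
  unfold halfInd
  rw [inner_mirror_self hν]
  rcases lt_or_gt_of_ne hx with h | h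
  · rw [if_neg (not_lt.2 h.le), if_pos (by linarith), zero_add]
  · rw [if_pos h, if_neg (by linarith), add_zero]

/-- Integrals of even functions over half-balls. -/
theorem integral_halfInd_mul_of_even {ν : E n} (hν : ‖ν‖ = 1) {f : E n → ℝ}
    (hf : Integrable f (ballMeasure n)) (he : ∀ x, f (mirror ν x) = f x) :
    ∫ x, halfInd ν x * f x ∂(ballMeasure n) = 1 / 2 * ∫ x, f x ∂(ballMeasure n) := by
  have hi : Integrable (fun x => halfInd ν x * f x) (ballMeasure n) :=
    memLp_one_iff_integrable.1 (memLp_halfInd_mul ν (memLp_one_iff_integrable.2 hf))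
  have h1 := integral_comp_isometry (mirror ν) (fun x => halfInd ν x * f x)
  have hi' : Integrable (fun x => halfInd ν (mirror ν x) * f (mirror ν x)) (ballMeasure n) :=
    (measurePreserving_isometry (mirror ν)).integrable_comp_of_integrable hi
  have h2 : ∫ x, (halfInd ν x * f x + halfInd ν (mirror ν x) * f (mirror ν x)) ∂(ballMeasure n)
      = ∫ x, f x ∂(ballMeasure n) := by
    refine integral_congr_ae ?_
    filter_upwards [ae_inner_ne_zero hν] with x hx
    rw [he, ← add_mul, halfInd_add_mirror hν hx, one_mul]
  rw [integral_add hi hi', h1] at h2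
  linarith

theorem angular_mirror (ν b x : E n) : angular b (mirror ν x) = angular (mirror ν b) x := by
  unfold angular; rw [norm_mirror, inner_mirror_left]

theorem powerFn_mirror (ν : E n) (j : ℕ) (b x : E n) :
    powerFn j b (mirror ν x) = powerFn j (mirror ν b) x := by
  unfold powerFn; rw [norm_mirror, angular_mirror]

theorem powerGrad_mirror (ν : E n) (j : ℕ) (b x : E n) :
    powerGrad j b (mirror ν x) = mirror ν (powerGrad j (mirror ν b) x) := by
  unfold powerGrad
  rw [norm_mirror, angular_mirror]
  simp only [map_add, map_sub, map_smul, mirror_mirror]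

/-- The part of `powerFn j b` odd under the reflection across `ν`. -/
def oddPower (ν : E n) (j : ℕ) (b x : E n) : ℝ := powerFn j b x - powerFn j (mirror ν b) x

/-- The gradient of `oddPower ν j b`. -/
def oddGrad (ν : E n) (j : ℕ) (b x : E n) : E n := powerGrad j b x - powerGrad j (mirror ν b) x

theorem oddPower_mirror (ν : E n) (j : ℕ) (b x : E n) :
    oddPower ν j b (mirror ν x) = - oddPower ν j b x := by
  unfold oddPower
  rw [powerFn_mirror, powerFn_mirror, mirror_mirror]; ring

theorem oddGrad_mirror (ν : E n) (j : ℕ) (b x : E n) :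
    oddGrad ν j b (mirror ν x) = - mirror ν (oddGrad ν j b x) := by
  unfold oddGrad
  rw [powerGrad_mirror, powerGrad_mirror, mirror_mirror, map_sub]; abel

theorem IsHomogeneousPair.sub {f₁ f₂ : E n → ℝ} {g₁ g₂ : E n → E n} (h₁ : IsHomogeneousPair f₁ g₁)
    (h₂ : IsHomogeneousPair f₂ g₂) :
    IsHomogeneousPair (fun x => f₁ x - f₂ x) (fun x => g₁ x - g₂ x) :=
  ⟨h₁.1.sub h₂.1, h₁.2.sub h₂.2⟩

theorem IsHomogeneousPair.add {f₁ f₂ : E n → ℝ} {g₁ g₂ : E n → E n} (h₁ : IsHomogeneousPair f₁ g₁)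
    (h₂ : IsHomogeneousPair f₂ g₂) :
    IsHomogeneousPair (fun x => f₁ x + f₂ x) (fun x => g₁ x + g₂ x) :=
  ⟨h₁.1.add h₂.1, h₁.2.add h₂.2⟩

theorem IsHomogeneousPair.const_mul {f : E n → ℝ} {g : E n → E n} (a : ℝ)
    (h : IsHomogeneousPair f g) : IsHomogeneousPair (fun x => a * f x) (fun x => a • g x) :=
  ⟨h.1.const_mul a, h.2.const_smul a⟩

theorem isHomogeneousPair_oddPower (hn : 0 < n) (ν : E n) (j : ℕ) (b : E n) :
    IsHomogeneousPair (oddPower ν j b) (oddGrad ν j b) :=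
  (isHomogeneousPair_powerFn hn j b).sub (isHomogeneousPair_powerFn hn j (mirror ν b))

/-- The coefficient coupling the degrees `j` and `j - 2`. -/
def coupling (j : ℕ) (b : E n) : ℝ := ((n : ℝ) + 4) / (n + 2) * (j * (j - 1) * ‖b‖ ^ 2)

theorem coupling_mirror (ν : E n) (j : ℕ) (b : E n) : coupling j (mirror ν b) = coupling j b := by
  unfold coupling; rw [norm_mirror]

theorem IsHomogeneousPair.integral_inner_powerGrad' (hn : 0 < n) {f : E n → ℝ} {g : E n → E n}
    (h : IsHomogeneousPair f g) (j : ℕ) (b : E n) :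
    ∫ x, inner ℝ (g x) (powerGrad j b x) ∂(ballMeasure n)
      = ∫ x, f x * (eigen n j * powerFn j b x - coupling j b * powerFn (j - 2) b x)
        ∂(ballMeasure n) := by
  rw [h.integral_inner_powerGrad hn]
  have e : ∀ x, f x * (eigen n j * powerFn j b x - coupling j b * powerFn (j - 2) b x)
      = eigen n j * (f x * powerFn j b x) - coupling j b * (f x * powerFn (j - 2) b x) := fun x => by
    ring
  simp only [e]
  rw [integral_sub, integral_const_mul, integral_const_mul]
  · rfl
  · exact (h.1.1.mul_integrable (isSmoothLimit_powerFn hn j b).1).const_mul _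
  · exact (h.1.1.mul_integrable (isSmoothLimit_powerFn hn (j - 2) b).1).const_mul _

/-- The coupling depends on `b` only through its norm, which the reflection preserves; the recursion
for `powerFn` therefore passes to the odd parts unchanged. -/
theorem IsHomogeneousPair.integral_inner_oddGrad (hn : 0 < n) {f : E n → ℝ} {g : E n → E n}
    (h : IsHomogeneousPair f g) (ν : E n) (j : ℕ) (b : E n) :
    ∫ x, inner ℝ (g x) (oddGrad ν j b x) ∂(ballMeasure n)
      = ∫ x, f x * (eigen n j * oddPower ν j b x - coupling j b * oddPower ν (j - 2) b x)
        ∂(ballMeasure n) := by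
  unfold oddGrad oddPower
  simp only [inner_sub_right]
  have i1 : ∀ b, Integrable (fun x => f x * (eigen n j * powerFn j b x
      - coupling j b * powerFn (j - 2) b x)) (ballMeasure n) := fun b =>
    h.1.1.mul_integrable (((isSmoothLimit_powerFn hn j b).1.const_mul _).sub
      ((isSmoothLimit_powerFn hn (j - 2) b).1.const_mul _))
  rw [integral_sub, h.integral_inner_powerGrad' hn, h.integral_inner_powerGrad' hn,
    ← integral_sub (i1 _) (i1 _)]
  · refine integral_congr_ae (ae_of_all _ fun x => ?_)
    simp only [coupling_mirror]; ring
  · exact h.1.2.1.inner_integrable (isSmoothLimit_powerFn hn j b).2.1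
  · exact h.1.2.1.inner_integrable (isSmoothLimit_powerFn hn j (mirror ν b)).2.1

end Reflection

/-! ### Formal combinations of generators and the triangular structure -/

section Build
variable {n : ℕ}

/-- Formal combinations of the functions `powerFn j b`. -/
abbrev PowerSpace (n : ℕ) : Type := (ℕ × E n) →₀ ℝ

/-- The action of the spherical operator on `powerFn j b`. -/
def powerOpGen (n : ℕ) (p : ℕ × E n) : PowerSpace n :=
  eigen n p.1 • Finsupp.single p 1 - coupling p.1 p.2 • Finsupp.single (p.1 - 2, p.2) 1

/-- The spherical operator on formal combinations. -/
def powerOp (n : ℕ) : PowerSpace n →ₗ[ℝ] PowerSpace n := Finsupp.linearCombination ℝ (powerOpGen n)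

theorem powerOp_single (p : ℕ × E n) : powerOp n (Finsupp.single p 1) = powerOpGen n p := by
  simp [powerOp]

/-- Formal combinations of degree less than `k`. -/
def powerFilt (n k : ℕ) : Submodule ℝ (PowerSpace n) := Finsupp.supported ℝ ℝ {p | p.1 < k}

theorem single_mem_powerFilt {p : ℕ × E n} {k : ℕ} (h : p.1 < k) (a : ℝ) :
    Finsupp.single p a ∈ powerFilt n k :=
  Finsupp.single_mem_supported ℝ a h

theorem powerFilt_induction {k : ℕ} {C : PowerSpace n → Prop} (h0 : C 0)
    (hadd : ∀ p q, C p → C q → C (p + q)) (hs : ∀ (a : ℝ) p, C p → C (a • p))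
    (h1 : ∀ p : ℕ × E n, p.1 < k → C (Finsupp.single p 1)) {p : PowerSpace n}
    (hp : p ∈ powerFilt n k) : C p := by
  rw [powerFilt, Finsupp.supported_eq_span_single] at hp
  induction hp using Submodule.span_induction with
  | mem x hx => obtain ⟨q, hq, rfl⟩ := hx; exact h1 q hq
  | zero => exact h0
  | add x y _ _ hx hy => exact hadd x y hx hy
  | smul a x _ hx => exact hs a x hx

theorem coupling_eq_zero {j : ℕ} (h : j < 2) (b : E n) : coupling j b = 0 := by
  unfold coupling
  interval_cases j <;> simp

theorem eigen_monotone (hn : 0 < n) : Monotone (eigen n) := by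
  refine monotone_nat_of_le_succ fun j => ?_
  unfold eigen
  have h1 : (1 : ℝ) ≤ n := by exact_mod_cast hn
  refine mul_le_mul_of_nonneg_left ?_ (by positivity)
  push_cast
  nlinarith [(Nat.cast_nonneg j : (0 : ℝ) ≤ j)]

theorem eigen_pos (hn : 0 < n) (j : ℕ) : 0 < eigen n j := by
  refine lt_of_lt_of_le ?_ (eigen_monotone hn (Nat.zero_le j))
  unfold eigen
  rw [Nat.cast_zero, zero_mul, zero_add]
  positivity

theorem tendsto_eigen (hn : 0 < n) : Tendsto (eigen n) atTop atTop := by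
  refine tendsto_atTop_mono (f := fun j : ℕ => (j : ℝ) - 1) (fun j => ?_)
    (tendsto_atTop_add_const_right _ _ tendsto_natCast_atTop_atTop)
  unfold eigen
  have h1 : (1 : ℝ) ≤ n := by exact_mod_cast hn
  have h2 : (1 : ℝ) ≤ ((n : ℝ) + 4) / (n + 2) := by
    rw [le_div_iff₀ (by positivity)]; linarith
  have h3 : (j : ℝ) - 1 ≤ j * (j + n - 2) + 4 := by
    nlinarith [(Nat.cast_nonneg j : (0 : ℝ) ≤ j), sq_nonneg ((j : ℝ) - 1)]
  have h4 : (0 : ℝ) ≤ j * (j + n - 2) + 4 := by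
    nlinarith [(Nat.cast_nonneg j : (0 : ℝ) ≤ j), sq_nonneg ((j : ℝ) - 1)]
  nlinarith

/-- On generators of top degree `k` the eigenvalue term cancels, and the coupling term lowers the
degree by two; it is absent for degrees below two, where `j - 2` is truncated. -/
theorem powerOp_sub_mem {k : ℕ} {p : PowerSpace n} (hp : p ∈ powerFilt n (k + 1)) :
    powerOp n p - eigen n k • p ∈ powerFilt n k := by
  refine powerFilt_induction (C := fun p => powerOp n p - eigen n k • p ∈ powerFilt n k)
    ?_ ?_ ?_ ?_ hp
  · simp
  · intro p q hp hq
    have := add_mem hp hq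
    rwa [map_add, smul_add, add_sub_add_comm]
  · intro a p hp
    have := (powerFilt n k).smul_mem a hp
    rwa [map_smul, smul_comm, ← smul_sub]
  · rintro ⟨j, b⟩ hj
    rw [powerOp_single]
    have e : powerOpGen n (j, b) - eigen n k • Finsupp.single (j, b) 1
        = (eigen n j - eigen n k) • Finsupp.single (j, b) 1
          - coupling j b • Finsupp.single (j - 2, b) 1 := by
      rw [powerOpGen, sub_smul]; abel
    rw [e]
    refine sub_mem ?_ ?_
    · rcases Nat.lt_succ_iff_lt_or_eq.1 hj with h | h
      · exact (powerFilt n k).smul_mem _ (single_mem_powerFilt h 1)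
      · simp only at h
        rw [h, sub_self, zero_smul]; exact zero_mem _
    · rcases lt_or_ge j 2 with h | h
      · rw [coupling_eq_zero h, zero_smul]; exact zero_mem _
      · refine (powerFilt n k).smul_mem _ (single_mem_powerFilt ?_ 1)
        simp only at hj ⊢
        omega

/-- The identity plus the spherical operator is triangular with nonzero diagonal entries `1 + eigen
n j`, hence solvable by recursion on the degree. This serves to show that nothing in the Sobolev
graph norm is orthogonal to all generators. -/
theorem surjective_add_powerOp (hn : 0 < n) (p : PowerSpace n) : ∃ q, q + powerOp n q = p := by
  have key : ∀ (j : ℕ) (b : E n), ∃ q, q + powerOp n q = Finsupp.single (j, b) 1 := by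
    intro j
    induction j using Nat.strong_induction_on with
    | _ j ih =>
      intro b
      obtain ⟨r, hr⟩ : ∃ r, r + powerOp n r = coupling j b • Finsupp.single (j - 2, b) 1 := by
        rcases lt_or_ge j 2 with h | h
        · exact ⟨0, by rw [coupling_eq_zero h]; simp⟩
        · obtain ⟨r, hr⟩ := ih (j - 2) (by omega) b
          exact ⟨coupling j b • r, by rw [map_smul, ← smul_add, hr]⟩
      have h1 : 1 + eigen n j ≠ 0 := by have := eigen_pos hn j; positivity
      refine ⟨(1 + eigen n j)⁻¹ • (Finsupp.single (j, b) 1 + r), ?_⟩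
      rw [map_smul, ← smul_add, map_add, powerOp_single, powerOpGen, add_add_add_comm, hr,
        ← add_sub_assoc, sub_add_cancel]
      have : Finsupp.single (j, b) (1 : ℝ) + eigen n j • Finsupp.single (j, b) 1
          = (1 + eigen n j) • Finsupp.single (j, b) 1 := by rw [add_smul, one_smul]
      simp only [this]
      rw [smul_smul, inv_mul_cancel₀ h1, one_smul]
  induction p using Finsupp.induction_linear with
  | zero => exact ⟨0, by simp⟩
  | add p q hp hq =>
    obtain ⟨a, rfl⟩ := hp
    obtain ⟨b, rfl⟩ := hq
    exact ⟨a + b, by rw [map_add]; abel⟩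
  | single p a =>
    obtain ⟨q, hq⟩ := key p.1 p.2
    exact ⟨a • q, by rw [map_smul, ← smul_add, hq]; simp⟩

variable {H X : Type*} [NormedAddCommGroup H] [InnerProductSpace ℝ H] [NormedAddCommGroup X]
  [InnerProductSpace ℝ X]

/-- The triangular data given by realizations of the generators. -/
def powerTriangular (hn : 0 < n) (v : ℕ × E n → H) (v' : ℕ × E n → X)
    (henergy : ∀ p q, inner ℝ (v' p) (v' q)
      = inner ℝ (v p) (eigen n q.1 • v q - coupling q.1 q.2 • v (q.1 - 2, q.2)))
    (hfin : ∀ k, FiniteDimensional ℝ (Submodule.span ℝ (v '' {p | p.1 < k}))) :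
    TriangularData (PowerSpace n) H X where
  val := Finsupp.linearCombination ℝ v
  grad := Finsupp.linearCombination ℝ v'
  op := powerOp n
  filt := powerFilt n
  eig := eigen n
  energy p q := by
    induction p using Finsupp.induction_linear with
    | zero => simp
    | add p₁ p₂ h₁ h₂ => rw [map_add, map_add, inner_add_left, inner_add_left, h₁, h₂]
    | single a s =>
      induction q using Finsupp.induction_linear with
      | zero => simp
      | add q₁ q₂ h₁ h₂ => rw [map_add, map_add, map_add, inner_add_right, inner_add_right, h₁, h₂]
      | single b t =>
        have e : powerOp n (Finsupp.single b t) = t • powerOpGen n b := by simp [powerOp]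
        rw [e, map_smul, powerOpGen, map_sub, map_smul, map_smul]
        simp only [Finsupp.linearCombination_single, one_smul, real_inner_smul_left,
          real_inner_smul_right, henergy]
  filt_mono := fun i j hij => Finsupp.supported_mono fun p (hp : p.1 < i) => lt_of_lt_of_le hp hij
  filt_zero := by
    rw [powerFilt]
    simp
  filt_top := fun p => ⟨p.support.sup (fun q => q.1) + 1, by
    rw [powerFilt, Finsupp.mem_supported]
    intro q hq
    exact Nat.lt_succ_of_le (Finset.le_sup (f := fun q : ℕ × E n => q.1) hq)⟩
  finite k := by
    have := hfin k
    rwa [Finsupp.span_image_eq_map_linearCombination] at this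
  triangular k p hp := powerOp_sub_mem hp
  eig_mono := eigen_monotone hn

end Build

/-! ### Finite dimension of each degree -/

section FiniteDim
variable {n : ℕ}

/-- The degree two extension of a spherical monomial. -/
def sphMonomial {j : ℕ} (w : Fin j → Fin n) (x : E n) : ℝ :=
  ‖x‖ ^ 2 * ∏ i, (angular (EuclideanSpace.single (w i) 1) x)

theorem memLp_sphMonomial {j : ℕ} (w : Fin j → Fin n) : MemLp (sphMonomial w) 2 (ballMeasure n) := by
  refine MemLp.of_bound (C := 1) ?_ ?_
  · refine Measurable.aestronglyMeasurable ?_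
    unfold sphMonomial
    exact (measurable_norm.pow_const 2).mul
      (Finset.measurable_fun_prod _ fun i _ => measurable_angular _)
  · filter_upwards [ae_norm_le_one n] with x hx
    rw [sphMonomial, norm_mul, norm_prod]
    have h1 : ∏ i, ‖angular (EuclideanSpace.single (w i) 1) x‖ ≤ 1 :=
      Finset.prod_le_one (fun i _ => norm_nonneg _) fun i _ => by
        have := abs_angular_le (EuclideanSpace.single (w i) 1) x
        simpa using this
    have h2 : ‖‖x‖ ^ 2‖ ≤ 1 := by
      rw [norm_pow, norm_norm]; exact pow_le_one₀ (norm_nonneg x) hx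
    exact mul_le_one₀ h2 (Finset.prod_nonneg fun i _ => norm_nonneg _) h1

theorem powerFn_eq_sum (j : ℕ) (b x : E n) :
    powerFn j b x = ∑ w : Fin j → Fin n, (∏ i, b (w i)) * sphMonomial w x := by
  have h : angular b x = ∑ i, b i * angular (EuclideanSpace.single i 1) x := by
    have h1 : ∀ i : Fin n, inner ℝ x (EuclideanSpace.single i 1) = x i := fun i => by
      simp [EuclideanSpace.inner_single_right]
    have h2 : inner ℝ x b = ∑ i, b i * x i := by simp [PiLp.inner_apply]
    simp only [angular, h1]
    rw [h2, Finset.sum_div]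
    exact Finset.sum_congr rfl fun i _ => by ring
  rw [powerFn, h, Fintype.sum_pow, Finset.mul_sum]
  refine Finset.sum_congr rfl fun w _ => ?_
  rw [sphMonomial, Finset.prod_mul_distrib]; ring

theorem coeFn_finsetSum {ι : Type*} (s : Finset ι) (M : ι → Lp ℝ 2 (ballMeasure n)) :
    ∀ᵐ x ∂(ballMeasure n), (∑ i ∈ s, M i : Lp ℝ 2 (ballMeasure n)) x = ∑ i ∈ s, M i x := by
  classical
  induction s using Finset.induction_on with
  | empty =>
    filter_upwards [Lp.coeFn_zero ℝ 2 (ballMeasure n)] with x hx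
    simpa using hx
  | insert a s ha ih =>
    rw [Finset.sum_insert ha]
    filter_upwards [ih, Lp.coeFn_add (M a) (∑ i ∈ s, M i)] with x h1 h2
    rw [h2, Pi.add_apply, h1, Finset.sum_insert ha]

/-- Although `b` ranges over a continuum, expanding `(x·b) ^ j` in coordinates writes each generator
through the finitely many monomials of degree `j`. The weight `θ` covers both the ball (`θ = 1`) and
the half-ball (`θ = halfInd ν`). -/
theorem finiteDimensional_span_powerFn {θ : E n → ℝ}
    (hθ : ∀ f : E n → ℝ, MemLp f 2 (ballMeasure n) → MemLp (fun x => θ x * f x) 2 (ballMeasure n))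
    (hp : ∀ p : ℕ × E n, MemLp (fun x => θ x * powerFn p.1 p.2 x) 2 (ballMeasure n)) (k : ℕ) :
    FiniteDimensional ℝ (Submodule.span ℝ ((fun p : ℕ × E n => (hp p).toLp) '' {p | p.1 < k})) := by
  let M : (Σ j : Fin k, (Fin j → Fin n)) → Lp ℝ 2 (ballMeasure n) :=
    fun w => (hθ _ (memLp_sphMonomial w.2)).toLp
  have h1 : FiniteDimensional ℝ (Submodule.span ℝ (Set.range M)) :=
    FiniteDimensional.span_of_finite ℝ (Set.finite_range M)
  refine Submodule.finiteDimensional_of_le (S₂ := Submodule.span ℝ (Set.range M))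
    (Submodule.span_le.2 ?_)
  rintro _ ⟨⟨j, b⟩, hj, rfl⟩
  have e : (hp (j, b)).toLp = ∑ w : Fin j → Fin n, (∏ i, b (w i)) • M ⟨⟨j, hj⟩, w⟩ := by
    refine Lp.ext ?_
    have h2 : ∀ᵐ x ∂(ballMeasure n), ∀ w : Fin j → Fin n,
        M ⟨⟨j, hj⟩, w⟩ x = θ x * sphMonomial w x :=
      ae_all_iff.2 fun w => (hθ _ (memLp_sphMonomial w)).coeFn_toLp
    have h3 : ∀ᵐ x ∂(ballMeasure n), ∀ w : Fin j → Fin n,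
        ((∏ i, b (w i)) • M ⟨⟨j, hj⟩, w⟩ : Lp ℝ 2 (ballMeasure n)) x
          = (∏ i, b (w i)) • M ⟨⟨j, hj⟩, w⟩ x :=
      ae_all_iff.2 fun w => Lp.coeFn_smul _ _
    have h4 := coeFn_finsetSum Finset.univ
      (fun w : Fin j → Fin n => (∏ i, b (w i)) • M ⟨⟨j, hj⟩, w⟩)
    filter_upwards [(hp (j, b)).coeFn_toLp, h2, h3, h4] with x a1 a2 a3 a4
    rw [a1, a4, powerFn_eq_sum, Finset.mul_sum]
    simp only [a3, a2, smul_eq_mul]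
    exact Finset.sum_congr rfl fun w _ => by ring
  simp only [SetLike.mem_coe]
  rw [e]
  exact Submodule.sum_mem _ fun w _ => Submodule.smul_mem _ _ (Submodule.subset_span ⟨_, rfl⟩)

end FiniteDim

/-! ### Density criteria in Hilbert spaces -/

section AbstractDensity
variable {H P : Type*} [NormedAddCommGroup H] [InnerProductSpace ℝ H] [CompleteSpace H]
  [AddCommGroup P] [Module ℝ P]

/-- A density criterion inside the orthogonal complement of a set of vectors. -/
theorem exists_norm_sub_lt_of_orthogonal (val : P →ₗ[ℝ] H) (S : Set H) {f : H}
    (hf : ∀ s ∈ S, inner ℝ s f = 0) (hv : ∀ p, ∀ s ∈ S, inner ℝ s (val p) = 0)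
    (h0 : ∀ z : H, (∀ s ∈ S, inner ℝ s z = 0) → (∀ p, inner ℝ z (val p) = 0) → z = 0)
    {ε : ℝ} (hε : 0 < ε) : ∃ p, ‖f - val p‖ < ε := by
  set K := (LinearMap.range val).topologicalClosure with hK
  have : CompleteSpace K := (Submodule.isClosed_topologicalClosure _).completeSpace_coe
  have hKS : ∀ y ∈ K, ∀ s ∈ S, inner ℝ s y = 0 := by
    intro y hy s hs
    have hc : IsClosed {y : H | inner ℝ s y = 0} :=
      isClosed_eq (continuous_const.inner continuous_id) continuous_const
    refine closure_minimal (s := (LinearMap.range val : Set H)) ?_ hc hy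
    rintro _ ⟨p, rfl⟩
    exact hv p s hs
  have hz := h0 (f - K.starProjection f)
    (fun s hs => by
      rw [inner_sub_right, hf s hs, hKS _ (K.starProjection_apply_mem f) s hs, sub_zero])
    (fun p => Submodule.inner_left_of_mem_orthogonal
      (Submodule.le_topologicalClosure _ (LinearMap.mem_range_self val p))
      (Submodule.sub_starProjection_mem_orthogonal (K := K) f))
  have hfK : f ∈ K := by
    rw [sub_eq_zero.1 hz]; exact K.starProjection_apply_mem f
  obtain ⟨_, ⟨p, rfl⟩, hp⟩ := Metric.mem_closure_iff.1 (show f ∈ closure _ from hfK) ε hε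
  exact ⟨p, by rwa [← dist_eq_norm]⟩

/-- Projection onto the closed graph of `(val, grad)`. -/
theorem exists_graph_projection {X : Type*} [NormedAddCommGroup X] [InnerProductSpace ℝ X]
    [CompleteSpace X] (val : P →ₗ[ℝ] H) (grad : P →ₗ[ℝ] X) (f : H) (g : X) :
    ∃ a b, (∀ ε > 0, ∃ p, ‖val p - a‖ ^ 2 < ε ∧ ‖grad p - b‖ ^ 2 < ε) ∧
      ∀ p, inner ℝ (f - a) (val p) + inner ℝ (g - b) (grad p) = 0 := by
  let L : P →ₗ[ℝ] WithLp 2 (H × X) :=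
    (WithLp.linearEquiv 2 ℝ (H × X)).symm.toLinearMap ∘ₗ (val.prod grad)
  let K := (LinearMap.range L).topologicalClosure
  have : CompleteSpace K := (Submodule.isClosed_topologicalClosure _).completeSpace_coe
  let F : WithLp 2 (H × X) := WithLp.toLp 2 (f, g)
  have hy : K.starProjection F ∈ K := K.starProjection_apply_mem F
  refine ⟨(K.starProjection F).fst, (K.starProjection F).snd, fun ε hε => ?_, fun p => ?_⟩
  · obtain ⟨_, ⟨p, rfl⟩, hp⟩ := Metric.mem_closure_iff.1
      (show K.starProjection F ∈ closure _ from hy) (√ε) (by positivity)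
    have hp2 : ‖L p - K.starProjection F‖ ^ 2 < ε := by
      rw [← dist_eq_norm, dist_comm, ← Real.sq_sqrt hε.le]
      gcongr
    rw [WithLp.prod_norm_sq_eq_of_L2] at hp2
    have h1 : ‖val p - (K.starProjection F).fst‖ ^ 2 + ‖grad p - (K.starProjection F).snd‖ ^ 2 < ε :=
      hp2
    refine ⟨p, ?_, ?_⟩
    · nlinarith [sq_nonneg ‖grad p - (K.starProjection F).snd‖]
    · nlinarith [sq_nonneg ‖val p - (K.starProjection F).fst‖]
  · have h := Submodule.inner_left_of_mem_orthogonal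
      (Submodule.le_topologicalClosure _ (LinearMap.mem_range_self L p))
      (Submodule.sub_starProjection_mem_orthogonal (K := K) F)
    rw [WithLp.prod_inner_apply] at h
    exact h

end AbstractDensity

/-! ### Spectral decomposition on the ball and smooth approximation -/

section Concrete
variable {n : ℕ}

theorem linearCombination_energy {H X : Type*} [NormedAddCommGroup H] [InnerProductSpace ℝ H]
    [NormedAddCommGroup X] [InnerProductSpace ℝ X] (v : ℕ × E n → H) (v' : ℕ × E n → X)
    {F : H} {G : X} (h : ∀ q : ℕ × E n, inner ℝ G (v' q)
      = inner ℝ F (eigen n q.1 • v q - coupling q.1 q.2 • v (q.1 - 2, q.2))) (p : PowerSpace n) :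
    inner ℝ G (Finsupp.linearCombination ℝ v' p)
      = inner ℝ F (Finsupp.linearCombination ℝ v (powerOp n p)) := by
  induction p using Finsupp.induction_linear with
  | zero => simp
  | add p₁ p₂ h₁ h₂ => rw [map_add, map_add, map_add, inner_add_right, inner_add_right, h₁, h₂]
  | single a s =>
    have e : powerOp n (Finsupp.single a s) = s • powerOpGen n a := by simp [powerOp]
    rw [e, map_smul, powerOpGen, map_sub, map_smul, map_smul]
    simp only [Finsupp.linearCombination_single, one_smul, real_inner_smul_right, h]

theorem inner_linearCombination_eq_zero {H : Type*} [NormedAddCommGroup H] [InnerProductSpace ℝ H]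
    (v : ℕ × E n → H) {F : H} {k : ℕ} (h : ∀ q : ℕ × E n, q.1 < k → inner ℝ F (v q) = 0)
    {p : PowerSpace n} (hp : p ∈ powerFilt n k) :
    inner ℝ F (Finsupp.linearCombination ℝ v p) = 0 := by
  refine powerFilt_induction (C := fun p => inner ℝ F (Finsupp.linearCombination ℝ v p) = 0)
    (by simp) (fun p q hp hq => by rw [map_add, inner_add_right, hp, hq, add_zero])
    (fun a p hp => by rw [map_smul, real_inner_smul_right, hp, mul_zero])
    (fun p hp => by simpa using h p hp) hp

theorem inner_real_eq (a b : ℝ) : inner ℝ a b = a * b := by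
  rw [RCLike.inner_apply, conj_trivial, mul_comm]

/-- The functions `powerFn j b` in `L²`. -/
def fullVal (hn : 0 < n) (p : ℕ × E n) : Lp ℝ 2 (ballMeasure n) :=
  (isSmoothLimit_powerFn hn p.1 p.2).1.toLp

/-- The gradients of `powerFn j b` in `L²`. -/
def fullGrad (hn : 0 < n) (p : ℕ × E n) : Lp (E n) 2 (ballMeasure n) :=
  (isSmoothLimit_powerFn hn p.1 p.2).2.1.toLp

theorem inner_fullGrad (hn : 0 < n) {f : E n → ℝ} {g : E n → E n} (h : IsHomogeneousPair f g)
    (q : ℕ × E n) : inner ℝ (h.1.2.1.toLp g) (fullGrad hn q)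
      = inner ℝ (h.1.1.toLp f)
        (eigen n q.1 • fullVal hn q - coupling q.1 q.2 • fullVal hn (q.1 - 2, q.2)) := by
  have e : eigen n q.1 • fullVal hn q - coupling q.1 q.2 • fullVal hn (q.1 - 2, q.2)
      = ((((isSmoothLimit_powerFn hn q.1 q.2).1.const_smul (eigen n q.1)).sub
        ((isSmoothLimit_powerFn hn (q.1 - 2) q.2).1.const_smul (coupling q.1 q.2))).toLp) := rfl
  rw [e, fullGrad, inner_toLp, inner_toLp, h.integral_inner_powerGrad' hn]
  refine integral_congr_ae (ae_of_all _ fun x => ?_)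
  simp only [inner_real_eq, Pi.sub_apply, Pi.smul_apply, smul_eq_mul]

/-- The spherical harmonics decomposition on the ball. -/
def fullData (hn : 0 < n) :
    TriangularData (PowerSpace n) (Lp ℝ 2 (ballMeasure n)) (Lp (E n) 2 (ballMeasure n)) :=
  powerTriangular hn (fullVal hn) (fullGrad hn)
    (fun p q => inner_fullGrad hn (isHomogeneousPair_powerFn hn p.1 p.2) q)
    (fun k => by
      have h := finiteDimensional_span_powerFn (n := n) (θ := fun _ => 1)
        (fun f hf => by simpa using hf)
        (fun p => by simpa using (isSmoothLimit_powerFn hn p.1 p.2).1) k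
      have e : fullVal hn = fun p : ℕ × E n => (show MemLp (fun x => 1 * powerFn p.1 p.2 x) 2
          (ballMeasure n) by simpa using (isSmoothLimit_powerFn hn p.1 p.2).1).toLp := by
        funext p
        simp [fullVal]
      rw [e]; exact h)

/-- Vectors of `L²` detecting homogeneity of degree two. -/
def homogTests (n : ℕ) : Set (Lp ℝ 2 (ballMeasure n)) :=
  {s | ∃ t : ℝ, 0 < t ∧ t ≤ 1 ∧ ∃ φ, IsTest φ ∧
    s =ᵐ[ballMeasure n] fun x => φ (t⁻¹ • x) - t ^ (n + 2) * φ x}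

/-- Writes homogeneity as orthogonality to a fixed set of vectors: a closed linear condition, suited
to the density criterion and to passing to limits. -/
theorem aehomog_iff_orthogonal (z : Lp ℝ 2 (ballMeasure n)) :
    AEHomog 2 z ↔ ∀ s ∈ homogTests n, inner ℝ s z = 0 := by
  have key : ∀ (s : Lp ℝ 2 (ballMeasure n)) (F : E n → ℝ), s =ᵐ[ballMeasure n] F →
      inner ℝ s z = ∫ x, F x * z x ∂(ballMeasure n) := fun s F h => by
    rw [L2.inner_def]
    refine integral_congr_ae ?_
    filter_upwards [h] with x hx
    rw [inner_real_eq, hx]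
  rw [aehomog_iff_test (Lp.memLp z)]
  constructor
  · rintro h s ⟨t, h0, h1, φ, hφ, hs⟩
    rw [key s _ hs]; exact h t h0 h1 φ hφ
  · intro h t h0 h1 φ hφ
    have hm : MemLp (fun x => φ (t⁻¹ • x) - t ^ (n + 2) * φ x) 2 (ballMeasure n) :=
      ((hφ.comp_inv_smul h0 h1).1.memLp 2).sub ((hφ.memLp 2).const_mul _)
    rw [← key (hm.toLp) _ hm.coeFn_toLp]
    exact h _ ⟨t, h0, h1, φ, hφ, hm.coeFn_toLp⟩

theorem aehomog_toLp {f : E n → ℝ} (hf : MemLp f 2 (ballMeasure n)) (h : AEHomog 2 f) :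
    AEHomog 2 (hf.toLp f) := h.congr hf.coeFn_toLp.symm

theorem inner_linearCombination_right_eq_zero {H : Type*} [NormedAddCommGroup H]
    [InnerProductSpace ℝ H] (v : ℕ × E n → H) {s : H} (h : ∀ q, inner ℝ s (v q) = 0)
    (p : PowerSpace n) : inner ℝ s (Finsupp.linearCombination ℝ v p) = 0 := by
  induction p using Finsupp.induction_linear with
  | zero => simp
  | add p₁ p₂ h₁ h₂ => rw [map_add, inner_add_right, h₁, h₂, add_zero]
  | single a s => simp [real_inner_smul_right, h]

theorem inner_fullVal (hn : 0 < n) (z : Lp ℝ 2 (ballMeasure n)) (p : ℕ × E n) :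
    inner ℝ z (fullVal hn p) = ∫ x, z x * powerFn p.1 p.2 x ∂(ballMeasure n) := by
  rw [L2.inner_def]
  refine integral_congr_ae ?_
  filter_upwards [(isSmoothLimit_powerFn hn p.1 p.2).1.coeFn_toLp] with x hx
  rw [inner_real_eq, fullVal, hx]

theorem fullData_val (hn : 0 < n) :
    (fullData hn).val = Finsupp.linearCombination ℝ (fullVal hn) := rfl

theorem fullData_grad (hn : 0 < n) :
    (fullData hn).grad = Finsupp.linearCombination ℝ (fullGrad hn) := rfl

/-- The generators are themselves homogeneous, and a homogeneous vector orthogonal to all of them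
vanishes. -/
theorem fullData_dense (hn : 0 < n) {f : Lp ℝ 2 (ballMeasure n)} (hf : AEHomog 2 f) {ε : ℝ}
    (hε : 0 < ε) : ∃ p, ‖f - (fullData hn).val p‖ < ε := by
  refine exists_norm_sub_lt_of_orthogonal _ (homogTests n) ((aehomog_iff_orthogonal f).1 hf)
    (fun p s hs => inner_linearCombination_right_eq_zero _ (fun q => ?_) p) (fun z hz hp => ?_) hε
  · exact (aehomog_iff_orthogonal _).1 (aehomog_toLp _ (aehomog_powerFn q.1 q.2)) s hs
  · have h := ae_eq_zero_of_orthogonal_powerFn hn (Lp.memLp z) ((aehomog_iff_orthogonal z).2 hz)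
      fun j b => by
        have := hp (Finsupp.single (j, b) 1)
        rwa [Finsupp.linearCombination_single, one_smul, inner_fullVal] at this
    exact (Lp.eq_zero_iff_ae_eq_zero).2 h

theorem fullData_energy (hn : 0 < n) {f : E n → ℝ} {g : E n → E n} (h : IsHomogeneousPair f g)
    (p : PowerSpace n) : inner ℝ (h.1.2.1.toLp g) ((fullData hn).grad p)
      = inner ℝ (h.1.1.toLp f) ((fullData hn).val ((fullData hn).op p)) :=
  linearCombination_energy _ _ (inner_fullGrad hn h) p

theorem isSmoothLimit_linearCombination (hn : 0 < n) (p : PowerSpace n) :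
    ∃ f g, IsSmoothLimit f g ∧ AEHomog 2 f ∧ (fullData hn).val p =ᵐ[ballMeasure n] f ∧
      (fullData hn).grad p =ᵐ[ballMeasure n] g := by
  rw [fullData_val, fullData_grad]
  induction p using Finsupp.induction_linear with
  | zero =>
    refine ⟨_, _, IsSmoothLimit.zero, AEHomog.of_forall fun t _ x => by simp, ?_, ?_⟩
    · rw [map_zero]; exact Lp.coeFn_zero ℝ 2 (ballMeasure n)
    · rw [map_zero]; exact Lp.coeFn_zero (E n) 2 (ballMeasure n)
  | add p q hp hq =>
    obtain ⟨f, g, h1, h2, h3, h4⟩ := hp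
    obtain ⟨f', g', h1', h2', h3', h4'⟩ := hq
    refine ⟨_, _, h1.add h1', h2.add h2', ?_, ?_⟩
    · rw [map_add]
      filter_upwards [Lp.coeFn_add (Finsupp.linearCombination ℝ (fullVal hn) p) (Finsupp.linearCombination ℝ (fullVal hn) q), h3, h3'] with x a b c
      rw [a, Pi.add_apply, b, c]
    · rw [map_add]
      filter_upwards [Lp.coeFn_add (Finsupp.linearCombination ℝ (fullGrad hn) p) (Finsupp.linearCombination ℝ (fullGrad hn) q), h4, h4'] with x a b c
      rw [a, Pi.add_apply, b, c]
  | single q a =>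
    refine ⟨_, _, (isSmoothLimit_powerFn hn q.1 q.2).const_mul a,
      (aehomog_powerFn q.1 q.2).const_smul a, ?_, ?_⟩
    · rw [Finsupp.linearCombination_single]
      filter_upwards [Lp.coeFn_smul a (fullVal hn q),
        (isSmoothLimit_powerFn hn q.1 q.2).1.coeFn_toLp] with x h1 h2
      rw [h1, Pi.smul_apply, fullVal, h2, smul_eq_mul]
    · rw [Finsupp.linearCombination_single]
      filter_upwards [Lp.coeFn_smul a (fullGrad hn q),
        (isSmoothLimit_powerFn hn q.1 q.2).2.1.coeFn_toLp] with x h1 h2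
      rw [h1, Pi.smul_apply, fullGrad, h2]

theorem IsSmoothLimit.congr {f f' : E n → ℝ} {g g' : E n → E n} (h : IsSmoothLimit f g)
    (hf : f =ᵐ[ballMeasure n] f') (hg : g =ᵐ[ballMeasure n] g') : IsSmoothLimit f' g' := by
  refine ⟨h.1.ae_eq hf, h.2.1.ae_eq hg, fun ε hε => ?_⟩
  obtain ⟨φ, c, h1, h2⟩ := h.2.2 ε hε
  refine ⟨φ, c, ?_, ?_⟩
  · rwa [integral_congr_ae (g := fun x => (φ x - f x) ^ 2)
      (hf.mono fun x hx => by simp only [hx])]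
  · rwa [integral_congr_ae (g := fun x => ‖gradient φ x - g x‖ ^ 2)
      (hg.mono fun x hx => by simp only [hx])]

theorem norm_sub_sq_eq_integral {F : Type*} [NormedAddCommGroup F] [InnerProductSpace ℝ F]
    {a b : Lp F 2 (ballMeasure n)} {u v : E n → F} (ha : a =ᵐ[ballMeasure n] u)
    (hb : b =ᵐ[ballMeasure n] v) : ‖a - b‖ ^ 2 = ∫ x, ‖u x - v x‖ ^ 2 ∂(ballMeasure n) := by
  rw [← real_inner_self_eq_norm_sq, L2.inner_def]
  refine integral_congr_ae ?_
  filter_upwards [Lp.coeFn_sub a b, ha, hb] with x h1 h2 h3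
  rw [real_inner_self_eq_norm_sq, h1, Pi.sub_apply, h2, h3]

theorem isClosed_aehomog : IsClosed {z : Lp ℝ 2 (ballMeasure n) | AEHomog 2 z} := by
  have e : {z : Lp ℝ 2 (ballMeasure n) | AEHomog 2 z}
      = ⋂ s ∈ homogTests n, {z | inner ℝ s z = 0} := by
    ext z
    simp only [Set.mem_iInter]
    exact aehomog_iff_orthogonal z
  rw [e]
  exact isClosed_biInter fun s _ => isClosed_eq (continuous_const.inner continuous_id) continuous_const

/-- Homogeneous Sobolev functions are limits of functions smooth up to the boundary. -/
theorem IsHomogeneousPair.isSmoothLimit (hn : 0 < n) {f : E n → ℝ} {g : E n → E n}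
    (h : IsHomogeneousPair f g) : IsSmoothLimit f g := by
  -- Project `(f, g)` onto the closure of the pairs (generator, its gradient) in `L² × L²`. The
  -- projection is a smooth limit, so it is enough that the residual vanish.
  obtain ⟨a, b, hab, horth⟩ := exists_graph_projection (fullData hn).val (fullData hn).grad
    (h.1.1.toLp f) (h.1.2.1.toLp g)
  have hlim : IsSmoothLimit a b := by
    refine IsSmoothLimit.of_limit (Lp.memLp _) (Lp.memLp _) fun ε hε => ?_
    obtain ⟨p, hp1, hp2⟩ := hab ε hε
    obtain ⟨u, v, h1, _, h3, h4⟩ := isSmoothLimit_linearCombination hn p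
    refine ⟨u, v, h1, ?_, ?_⟩
    · have := norm_sub_sq_eq_integral h3 (ae_eq_refl (a : E n → ℝ))
      simp only [Real.norm_eq_abs, sq_abs] at this
      rwa [← this]
    · rwa [← norm_sub_sq_eq_integral h4 (ae_eq_refl (b : E n → E n))]
  have hhom : AEHomog 2 a := by
    have ha : a ∈ closure {z : Lp ℝ 2 (ballMeasure n) | AEHomog 2 z} := by
      refine Metric.mem_closure_iff.2 fun ε hε => ?_
      obtain ⟨p, hp1, -⟩ := hab (ε ^ 2) (by positivity)
      obtain ⟨u, v, _, h2, h3, _⟩ := isSmoothLimit_linearCombination hn p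
      refine ⟨(fullData hn).val p, h2.congr h3.symm, ?_⟩
      rw [dist_comm, dist_eq_norm]
      exact lt_of_pow_lt_pow_left₀ 2 hε.le hp1
    rwa [isClosed_aehomog.closure_eq] at ha
  have hdiff := h.sub ⟨hlim.hasScalarGradient, hhom⟩
  have ef : hdiff.1.1.toLp _ = h.1.1.toLp f - a := by
    refine Lp.ext ?_
    filter_upwards [hdiff.1.1.coeFn_toLp, h.1.1.coeFn_toLp,
      Lp.coeFn_sub (h.1.1.toLp f) a] with x h1 h2 h3
    rw [h1, h3, Pi.sub_apply, h2]
  have eg : hdiff.1.2.1.toLp _ = h.1.2.1.toLp g - b := by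
    refine Lp.ext ?_
    filter_upwards [hdiff.1.2.1.coeFn_toLp, h.1.2.1.coeFn_toLp,
      Lp.coeFn_sub (h.1.2.1.toLp g) b] with x h1 h2 h3
    rw [h1, h3, Pi.sub_apply, h2]
  -- Orthogonality of the residual in the graph norm says that it is orthogonal in `L²` to `q + op
  -- q` for all `q`, and every `p` has this form.
  have hz : ∀ p, inner ℝ (hdiff.1.1.toLp _) ((fullData hn).val p) = 0 := fun p => by
    obtain ⟨q, rfl⟩ := surjective_add_powerOp hn p
    have h1 := horth q
    have h2 := fullData_energy hn hdiff q
    rw [eg] at h2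
    rw [h2, ← ef, ← inner_add_right, ← map_add] at h1
    exact h1
  have hzero : (fun x => f x - a x) =ᵐ[ballMeasure n] 0 := by
    refine ae_eq_zero_of_orthogonal_powerFn hn hdiff.1.1 hdiff.2 fun j b => ?_
    have := hz (Finsupp.single (j, b) 1)
    rw [fullData_val, Finsupp.linearCombination_single, one_smul, inner_fullVal] at this
    rw [← this]
    refine integral_congr_ae ?_
    filter_upwards [hdiff.1.1.coeFn_toLp] with x hx
    rw [hx]
  -- Once the function part is zero, uniqueness of weak gradients kills the gradient part.
  have hg0 : (fun x => g x - b x) =ᵐ[ballMeasure n] fun _ => 0 :=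
    (hdiff.1.congr hzero ae_eq_rfl).unique HasScalarGradient.zero
  exact hlim.congr (hzero.mono fun x hx => (sub_eq_zero.1 hx).symm)
    (hg0.mono fun x hx => (sub_eq_zero.1 hx).symm)

end Concrete

/-! ### Dirichlet spectrum of the half-ball -/

section HalfBall
variable {n : ℕ}

theorem memLp_halfInd_smul (ν : E n) {g : E n → E n} (hg : MemLp g 2 (ballMeasure n)) :
    MemLp (fun x => halfInd ν x • g x) 2 (ballMeasure n) := by
  refine MemLp.of_le hg ((measurable_halfInd ν).aestronglyMeasurable.smul hg.1)
    (ae_of_all _ fun x => ?_)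
  rw [norm_smul]
  exact mul_le_of_le_one_left (norm_nonneg _) (abs_halfInd_le ν x)

theorem memLp_oddPower (hn : 0 < n) (ν : E n) (p : ℕ × E n) :
    MemLp (oddPower ν p.1 p.2) 2 (ballMeasure n) := (isHomogeneousPair_oddPower hn ν p.1 p.2).1.1

theorem memLp_oddGrad (hn : 0 < n) (ν : E n) (p : ℕ × E n) :
    MemLp (oddGrad ν p.1 p.2) 2 (ballMeasure n) := (isHomogeneousPair_oddPower hn ν p.1 p.2).1.2.1

/-- Restrictions of odd functions to the half-ball, in `L²`. -/
def oddVal (hn : 0 < n) (ν : E n) (p : ℕ × E n) : Lp ℝ 2 (ballMeasure n) :=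
  (memLp_halfInd_mul ν (memLp_oddPower hn ν p)).toLp

/-- Restrictions of gradients of odd functions to the half-ball, in `L²`. -/
def oddGradVal (hn : 0 < n) (ν : E n) (p : ℕ × E n) : Lp (E n) 2 (ballMeasure n) :=
  (memLp_halfInd_smul ν (memLp_oddGrad hn ν p)).toLp

theorem inner_oddVal (hn : 0 < n) (ν : E n) {z : Lp ℝ 2 (ballMeasure n)} {f : E n → ℝ}
    (hz : z =ᵐ[ballMeasure n] f) (p : ℕ × E n) :
    inner ℝ z (oddVal hn ν p) = ∫ x, halfInd ν x * (f x * oddPower ν p.1 p.2 x) ∂(ballMeasure n) := by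
  rw [L2.inner_def]
  refine integral_congr_ae ?_
  filter_upwards [(memLp_halfInd_mul ν (memLp_oddPower hn ν p)).coeFn_toLp, hz] with x hx hx'
  rw [inner_real_eq, oddVal, hx, hx']; ring

theorem inner_oddGradVal (hn : 0 < n) (ν : E n) {z : Lp (E n) 2 (ballMeasure n)} {g : E n → E n}
    (hz : z =ᵐ[ballMeasure n] g) (p : ℕ × E n) :
    inner ℝ z (oddGradVal hn ν p)
      = ∫ x, halfInd ν x * inner ℝ (g x) (oddGrad ν p.1 p.2 x) ∂(ballMeasure n) := by
  rw [L2.inner_def]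
  refine integral_congr_ae ?_
  filter_upwards [(memLp_halfInd_smul ν (memLp_oddGrad hn ν p)).coeFn_toLp, hz] with x hx hx'
  rw [oddGradVal, hx, hx', real_inner_smul_right]

theorem inner_oddVal_comb (hn : 0 < n) (ν : E n) {z : Lp ℝ 2 (ballMeasure n)} {f : E n → ℝ}
    (hf : MemLp f 2 (ballMeasure n)) (hz : z =ᵐ[ballMeasure n] f) (q : ℕ × E n) :
    inner ℝ z (eigen n q.1 • oddVal hn ν q - coupling q.1 q.2 • oddVal hn ν (q.1 - 2, q.2))
      = ∫ x, halfInd ν x * (f x * (eigen n q.1 * oddPower ν q.1 q.2 x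
        - coupling q.1 q.2 * oddPower ν (q.1 - 2) q.2 x)) ∂(ballMeasure n) := by
  rw [inner_sub_right, real_inner_smul_right, real_inner_smul_right, inner_oddVal hn ν hz,
    inner_oddVal hn ν hz, ← integral_const_mul, ← integral_const_mul, ← integral_sub]
  · refine integral_congr_ae (ae_of_all _ fun x => ?_)
    simp only; ring
  · exact (memLp_one_iff_integrable.1 (memLp_halfInd_mul ν (memLp_one_iff_integrable.2
      (hf.mul_integrable (memLp_oddPower hn ν q))))).const_mul _
  · exact (memLp_one_iff_integrable.1 (memLp_halfInd_mul ν (memLp_one_iff_integrable.2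
      (hf.mul_integrable (memLp_oddPower hn ν (q.1 - 2, q.2)))))).const_mul _

/-- Products of two odd functions, and of their gradients, are even under the reflection, so
integrals over the half-ball are half of those over the ball, where the identity is known. -/
theorem oddVal_energy (hn : 0 < n) {ν : E n} (hν : ‖ν‖ = 1) (p q : ℕ × E n) :
    inner ℝ (oddGradVal hn ν p) (oddGradVal hn ν q) = inner ℝ (oddVal hn ν p)
      (eigen n q.1 • oddVal hn ν q - coupling q.1 q.2 • oddVal hn ν (q.1 - 2, q.2)) := by
  have hp := isHomogeneousPair_oddPower hn ν p.1 p.2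
  have hq := isHomogeneousPair_oddPower hn ν q.1 q.2
  rw [inner_oddVal_comb hn ν (z := oddVal hn ν p) (memLp_halfInd_mul ν (memLp_oddPower hn ν p))
      (memLp_halfInd_mul ν (memLp_oddPower hn ν p)).coeFn_toLp,
    inner_oddGradVal hn ν (z := oddGradVal hn ν p)
      (memLp_halfInd_smul ν (memLp_oddGrad hn ν p)).coeFn_toLp]
  have h1 := hp.integral_inner_oddGrad hn ν q.1 q.2
  have hodd : MemLp (fun x => eigen n q.1 * oddPower ν q.1 q.2 x
        - coupling q.1 q.2 * oddPower ν (q.1 - 2) q.2 x) 2 (ballMeasure n) :=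
    ((memLp_oddPower hn ν q).const_mul _).sub ((memLp_oddPower hn ν (q.1 - 2, q.2)).const_mul _)
  have e1 := integral_halfInd_mul_of_even hν (hp.1.2.1.inner_integrable hq.1.2.1) fun x => by
    rw [oddGrad_mirror, oddGrad_mirror, inner_neg_neg, inner_mirror_mirror]
  have e2 := integral_halfInd_mul_of_even hν (hp.1.1.mul_integrable hodd) fun x => by
    rw [oddPower_mirror, oddPower_mirror, oddPower_mirror]; ring
  have r1 : ∀ x, halfInd ν x * inner ℝ (halfInd ν x • oddGrad ν p.1 p.2 x) (oddGrad ν q.1 q.2 x)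
      = halfInd ν x * inner ℝ (oddGrad ν p.1 p.2 x) (oddGrad ν q.1 q.2 x) := fun x => by
    rw [real_inner_smul_left, ← mul_assoc, halfInd_sq]
  have r2 : ∀ x, halfInd ν x * (halfInd ν x * oddPower ν p.1 p.2 x * (eigen n q.1 * oddPower ν q.1 q.2 x
        - coupling q.1 q.2 * oddPower ν (q.1 - 2) q.2 x))
      = halfInd ν x * (oddPower ν p.1 p.2 x * (eigen n q.1 * oddPower ν q.1 q.2 x
        - coupling q.1 q.2 * oddPower ν (q.1 - 2) q.2 x)) := fun x => by
    rw [← mul_assoc, ← mul_assoc, halfInd_sq, mul_assoc]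
  simp only [r1, r2]
  rw [e1, e2, h1]

/-- The Dirichlet spectral decomposition on the half-ball. -/
def oddData (hn : 0 < n) {ν : E n} (hν : ‖ν‖ = 1) :
    TriangularData (PowerSpace n) (Lp ℝ 2 (ballMeasure n)) (Lp (E n) 2 (ballMeasure n)) :=
  powerTriangular hn (oddVal hn ν) (oddGradVal hn ν) (oddVal_energy hn hν) fun k => by
    have hm : ∀ p : ℕ × E n, MemLp (fun x => halfInd ν x * powerFn p.1 p.2 x) 2 (ballMeasure n) :=
      fun p => memLp_halfInd_mul ν (isSmoothLimit_powerFn hn p.1 p.2).1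
    have h := finiteDimensional_span_powerFn (n := n) (θ := halfInd ν)
      (fun f hf => memLp_halfInd_mul ν hf) hm k
    refine Submodule.finiteDimensional_of_le (Submodule.span_le.2 ?_) (S₂ := Submodule.span ℝ
      ((fun p : ℕ × E n => (hm p).toLp) '' {p | p.1 < k}))
    rintro _ ⟨p, hp, rfl⟩
    have e : oddVal hn ν p = (hm p).toLp - (hm (p.1, mirror ν p.2)).toLp := by
      rw [← MemLp.toLp_sub, oddVal]
      refine MemLp.toLp_congr _ _ (ae_of_all _ fun x => ?_)
      simp only [oddPower, Pi.sub_apply]; ring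
    rw [e]
    exact sub_mem (Submodule.subset_span ⟨p, hp, rfl⟩)
      (Submodule.subset_span ⟨(p.1, mirror ν p.2), hp, rfl⟩)

/-- Vectors of `L²` detecting the vanishing outside the half-ball. -/
def halfTests (ν : E n) : Set (Lp ℝ 2 (ballMeasure n)) :=
  {s | ∃ φ, IsTest φ ∧ s =ᵐ[ballMeasure n] fun x => (1 - halfInd ν x) * φ x}

theorem memLp_one_sub_halfInd_mul (ν : E n) {f : E n → ℝ} {p : ℝ≥0∞}
    (hf : MemLp f p (ballMeasure n)) : MemLp (fun x => (1 - halfInd ν x) * f x) p (ballMeasure n) := by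
  have := hf.sub (memLp_halfInd_mul ν hf)
  refine this.ae_eq (ae_of_all _ fun x => ?_)
  simp only [Pi.sub_apply]; ring

theorem vanishing_iff_orthogonal (ν : E n) (z : Lp ℝ 2 (ballMeasure n)) :
    (∀ᵐ x ∂(ballMeasure n), halfInd ν x * z x = z x) ↔ ∀ s ∈ halfTests ν, inner ℝ s z = 0 := by
  have key : ∀ (s : Lp ℝ 2 (ballMeasure n)) (F : E n → ℝ), s =ᵐ[ballMeasure n] F →
      inner ℝ s z = ∫ x, F x * z x ∂(ballMeasure n) := fun s F h => by
    rw [L2.inner_def]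
    refine integral_congr_ae ?_
    filter_upwards [h] with x hx
    rw [inner_real_eq, hx]
  constructor
  · rintro h s ⟨φ, hφ, hs⟩
    rw [key s _ hs, ← integral_zero (E n) ℝ]
    refine integral_congr_ae ?_
    filter_upwards [h] with x hx
    linear_combination φ x * (- hx)
  · intro h
    have hz := Lp.memLp z
    refine ae_eq_of_test ((memLp_halfInd_mul ν hz).integrable (by norm_num))
      (hz.integrable (by norm_num)) fun φ hφ => ?_
    have hm := memLp_one_sub_halfInd_mul ν (hφ.memLp 2)
    have h1 := h _ ⟨φ, hφ, hm.coeFn_toLp⟩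
    rw [key _ _ hm.coeFn_toLp] at h1
    have h2 : ∫ x, (φ x * z x - φ x * (halfInd ν x * z x)) ∂(ballMeasure n) = 0 := by
      rw [← h1]; exact integral_congr_ae (ae_of_all _ fun x => by ring)
    rw [integral_sub ((hφ.memLp 2).mul_integrable hz)
      ((hφ.memLp 2).mul_integrable (memLp_halfInd_mul ν hz))] at h2
    simp only [smul_eq_mul]
    linarith

theorem AEHomog.comp_isometry {d : ℕ} {f : E n → ℝ} (h : AEHomog d f) (R : E n ≃ₗᵢ[ℝ] E n) :
    AEHomog d (fun x => f (R x)) := by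
  intro t h0 h1
  filter_upwards [(measurePreserving_isometry R).quasiMeasurePreserving.ae (h t h0 h1)] with x hx
  rw [map_smul]; exact hx

/-- If `z` lives on the half-ball and is orthogonal to the odd generators there, its
antisymmetrization is orthogonal to all generators, hence zero. So `z` agrees with its mirror image,
which lives on the other side, and `z` vanishes. -/
theorem oddData_dense (hn : 0 < n) {ν : E n} (hν : ‖ν‖ = 1) {f : Lp ℝ 2 (ballMeasure n)}
    (hf : AEHomog 2 f) (hf' : ∀ᵐ x ∂(ballMeasure n), halfInd ν x * f x = f x) {ε : ℝ} (hε : 0 < ε) :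
    ∃ p, ‖f - (oddData hn hν).val p‖ < ε := by
  have hhom : ∀ q : ℕ × E n, AEHomog 2 (oddVal hn ν q) := fun q =>
    aehomog_toLp _ (by
      have := (aehomog_halfInd ν).mul (isHomogeneousPair_oddPower hn ν q.1 q.2).2
      simpa using this)
  have hvan : ∀ q : ℕ × E n, ∀ᵐ x ∂(ballMeasure n), halfInd ν x * oddVal hn ν q x = oddVal hn ν q x :=
    fun q => by
      filter_upwards [(memLp_halfInd_mul ν (memLp_oddPower hn ν q)).coeFn_toLp] with x hx
      rw [oddVal, hx, ← mul_assoc, halfInd_sq]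
  refine exists_norm_sub_lt_of_orthogonal _ (homogTests n ∪ halfTests ν) ?_ ?_ ?_ hε
  · rintro s (hs | hs)
    · exact (aehomog_iff_orthogonal f).1 hf s hs
    · exact (vanishing_iff_orthogonal ν f).1 hf' s hs
  · rintro p s (hs | hs)
    · exact inner_linearCombination_right_eq_zero _
        (fun q => (aehomog_iff_orthogonal _).1 (hhom q) s hs) p
    · exact inner_linearCombination_right_eq_zero _
        (fun q => (vanishing_iff_orthogonal ν _).1 (hvan q) s hs) p
  · intro z hz hp
    have z1 : AEHomog 2 z := (aehomog_iff_orthogonal z).2 fun s hs => hz s (Or.inl hs)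
    have z2 := (vanishing_iff_orthogonal ν z).2 fun s hs => hz s (Or.inr hs)
    have hmp := measurePreserving_isometry (n := n) (mirror ν)
    have mR : MemLp (fun x => z (mirror ν x)) 2 (ballMeasure n) :=
      (Lp.memLp z).comp_measurePreserving hmp
    have h := ae_eq_zero_of_orthogonal_powerFn hn ((Lp.memLp z).sub mR)
      (z1.sub (z1.comp_isometry (mirror ν))) fun j b => by
        have h1 := hp (Finsupp.single (j, b) 1)
        change inner ℝ z (Finsupp.linearCombination ℝ (oddVal hn ν) _) = 0 at h1
        rw [Finsupp.linearCombination_single, one_smul, inner_oddVal hn ν (ae_eq_refl _)] at h1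
        have i1 := (Lp.memLp z).mul_integrable (isSmoothLimit_powerFn hn j b).1
        have i2 := (Lp.memLp z).mul_integrable (isSmoothLimit_powerFn hn j (mirror ν b)).1
        have i3 := mR.mul_integrable (isSmoothLimit_powerFn hn j b).1
        have h2 : ∫ x, z (mirror ν x) * powerFn j b x ∂(ballMeasure n)
            = ∫ x, z x * powerFn j (mirror ν b) x ∂(ballMeasure n) := by
          rw [← integral_comp_isometry (mirror ν)]
          refine integral_congr_ae (ae_of_all _ fun x => ?_)
          simp only [mirror_mirror, powerFn_mirror]
        simp only [Pi.sub_apply, sub_mul]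
        rw [integral_sub i1 i3, h2, ← integral_sub i1 i2, ← h1]
        refine integral_congr_ae ?_
        filter_upwards [z2] with x hx
        simp only [oddPower]
        rw [← mul_assoc, hx, mul_sub]
    refine (Lp.eq_zero_iff_ae_eq_zero).2 ?_
    filter_upwards [h, z2, hmp.quasiMeasurePreserving.ae z2, ae_inner_ne_zero hν] with x a b c d
    have hs := halfInd_add_mirror hν d
    simp only [Pi.sub_apply, Pi.zero_apply] at a ⊢
    rcases lt_or_gt_of_ne d with h | h
    · have : halfInd ν x = 0 := by unfold halfInd; rw [if_neg (not_lt.2 h.le)]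
      rw [← b, this, zero_mul]
    · have : halfInd ν x = 1 := by unfold halfInd; rw [if_pos h]
      have h0 : halfInd ν (mirror ν x) = 0 := by linarith
      rw [h0, zero_mul] at c
      linarith

/-- The weak gradient vanishes where the function does. -/
theorem HasScalarGradient.halfInd_smul_eq {f : E n → ℝ} {g : E n → E n} (h : HasScalarGradient f g)
    {ν : E n} (hν : ‖ν‖ = 1) (hf : ∀ᵐ x ∂(ballMeasure n), halfInd ν x * f x = f x) :
    ∀ᵐ x ∂(ballMeasure n), halfInd ν x • g x = g x := by
  have hsm : ContDiff ℝ ∞ (fun x : E n => smoothPos (-(inner ℝ x ν))) :=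
    smoothPos_contDiff.comp (contDiff_id.inner ℝ contDiff_const).neg
  have hd : ∀ x b, fderiv ℝ (fun x : E n => smoothPos (-(inner ℝ x ν))) x b
      = - deriv smoothPos (-(inner ℝ x ν)) * inner ℝ ν b := fun x b => by
    have h1 := HasDerivAt.comp_hasFDerivAt (f := fun x : E n => -(inner ℝ x ν)) x
      (smoothPos_contDiff.differentiable (by simp) _).hasDerivAt (hasFDerivAt_inner_const ν x).neg
    have h2 : HasFDerivAt (fun x : E n => smoothPos (-(inner ℝ x ν))) _ x := h1
    rw [h2.fderiv]
    simp
  -- Test functions carrying the smooth weight `smoothPos (-(x·ν))` live where `f` vanishes; the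
  -- weighted gradient is therefore zero, and the weight is positive for `x·ν < 0`.
  have key : ∀ i : Fin n, (fun x => smoothPos (-(inner ℝ x ν)) * g x i) =ᵐ[ballMeasure n] fun _ => 0 := by
    intro i
    have hmem : MemLp (fun x => g x i) 2 (ballMeasure n) := by
      have := h.2.1.inner_const (𝕜 := ℝ) (EuclideanSpace.single i 1)
      simpa [EuclideanSpace.inner_single_right] using this
    have hint : Integrable (fun x => smoothPos (-(inner ℝ x ν)) * g x i) (ballMeasure n) :=
      (hsm.continuous.memLp_ball 2).mul_integrable hmem
    refine ae_eq_of_test hint (integrable_zero _ _ _) fun φ hφ => ?_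
    have hT := hφ.mul_right hsm
    have h1 := h.smul_test hT i
    simp only [smul_eq_mul, mul_zero, integral_zero, ← mul_assoc]
    rw [← neg_eq_zero, ← h1, ← integral_zero (E n) ℝ]
    refine integral_congr_ae ?_
    filter_upwards [hf] with x hx
    rw [fderiv_fun_mul (hφ.1.differentiable (by simp) x) (hsm.differentiable (by simp) x)]
    simp only [add_apply, FunLike.coe_smul, Pi.smul_apply, smul_eq_mul, hd]
    by_cases hp : 0 < inner ℝ x ν
    · rw [smoothPos_of_nonpos (by linarith), deriv_smoothPos_of_nonpos (by linarith)]; ring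
    · have : f x = 0 := by
        rw [← hx]; unfold halfInd; rw [if_neg hp, zero_mul]
      rw [this, mul_zero]
  filter_upwards [ae_all_iff.2 key, ae_inner_ne_zero hν] with x hx hne
  rcases lt_or_gt_of_ne hne with h | h
  · have hs : smoothPos (-(inner ℝ x ν)) ≠ 0 := by
      unfold smoothPos
      exact mul_ne_zero (by linarith) (Real.smoothTransition.pos_of_pos (by linarith)).ne'
    have : g x = 0 := by
      ext i
      exact (mul_eq_zero.1 (hx i)).resolve_left hs
    rw [this, smul_zero]
  · unfold halfInd; rw [if_pos h, one_smul]

/-- Since `f` and its gradient vanish on the other side, the identity on the whole ball for the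
pairing with an odd generator is the identity on the half-ball required by the abstract gap for
`oddData`. -/
theorem dirichlet_gap (hn : 0 < n) {ν : E n} (hν : ‖ν‖ = 1) {f : E n → ℝ} {g : E n → E n}
    (h : IsHomogeneousPair f g) (hf : ∀ᵐ x ∂(ballMeasure n), halfInd ν x * f x = f x) (K : ℕ)
    (ho : ∀ j < K, ∀ b, ∫ x, f x * oddPower ν j b x ∂(ballMeasure n) = 0) :
    eigen n K * ∫ x, f x ^ 2 ∂(ballMeasure n) ≤ ∫ x, ‖g x‖ ^ 2 ∂(ballMeasure n) := by
  have hg := h.1.halfInd_smul_eq hν hf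
  have hgap := (oddData hn hν).eig_mul_norm_sq_le (K := K) (eigen_pos hn K).le
    (f := h.1.1.toLp f) (G := h.1.2.1.toLp g) ?_ ?_ ?_
  · have e : (oddData hn hν).eig = eigen n := rfl
    rw [e, norm_toLp_sq, norm_toLp_sq] at hgap
    simpa only [Real.norm_eq_abs, sq_abs] using hgap
  · refine linearCombination_energy _ _ fun q => ?_
    rw [inner_oddVal_comb hn ν h.1.1 h.1.1.coeFn_toLp, inner_oddGradVal hn ν h.1.2.1.coeFn_toLp]
    have h1 := h.integral_inner_oddGrad hn ν q.1 q.2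
    refine Eq.trans (integral_congr_ae ?_) (h1.trans (integral_congr_ae ?_))
    · filter_upwards [hg] with x hx
      rw [← real_inner_smul_left, hx]
    · filter_upwards [hf] with x hx
      rw [← mul_assoc (halfInd ν x), hx]
  · intro ε hε
    refine oddData_dense hn hν (aehomog_toLp _ h.2) ?_ hε
    filter_upwards [h.1.1.coeFn_toLp, hf] with x h1 h2
    rw [h1, h2]
  · intro p hp
    refine inner_linearCombination_eq_zero _ (fun q hq => ?_) hp
    rw [inner_oddVal hn ν h.1.1.coeFn_toLp, ← ho q.1 hq q.2]
    refine integral_congr_ae ?_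
    filter_upwards [hf] with x hx
    rw [← mul_assoc, hx]

theorem oddPower_zero (ν b x : E n) : oddPower ν 0 b x = 0 := by
  simp [oddPower, powerFn]

/-- Up to a factor there is a single Dirichlet mode of degree one. -/
theorem oddPower_one {ν : E n} (hν : ‖ν‖ = 1) (b x : E n) :
    oddPower ν 1 b x = 2 * inner ℝ b ν * (‖x‖ * inner ℝ x ν) := by
  have : ∀ b, powerFn 1 b x = ‖x‖ * inner ℝ x b := fun b => by
    unfold powerFn angular
    rcases eq_or_ne x 0 with rfl | hx
    · simp
    · field_simp [norm_ne_zero_iff.2 hx]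
  rw [oddPower, this, this, mirror_apply hν, inner_sub_right, real_inner_smul_right]
  ring

/-- The modes of degree two are the products of `x·ν` with a tangential coordinate: the
infinitesimal rotations of the half-plane profile. -/
theorem oddPower_two {ν : E n} (hν : ‖ν‖ = 1) (b x : E n) :
    oddPower ν 2 b x = 4 * inner ℝ b ν * (inner ℝ x ν * inner ℝ x (b - inner ℝ b ν • ν)) := by
  have : ∀ b, powerFn 2 b x = inner ℝ x b ^ 2 := fun b => by
    unfold powerFn angular
    rcases eq_or_ne x 0 with rfl | hx
    · simp
    · field_simp [norm_ne_zero_iff.2 hx]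
  rw [oddPower, this, this, mirror_apply hν, inner_sub_right, inner_sub_right,
    real_inner_smul_right, real_inner_smul_right]
  ring

/-- Degree two is borderline: its eigenvalue equals the coefficient of the zero order term in
`quad`. -/
theorem eigen_two : eigen n 2 = 2 * ((n : ℝ) + 4) := by
  unfold eigen; push_cast; field_simp; ring

theorem dirichlet_gap_two (hn : 0 < n) {ν : E n} (hν : ‖ν‖ = 1) {f : E n → ℝ} {g : E n → E n}
    (h : IsHomogeneousPair f g) (hf : ∀ᵐ x ∂(ballMeasure n), halfInd ν x * f x = f x)
    (h1 : ∫ x, f x * (‖x‖ * inner ℝ x ν) ∂(ballMeasure n) = 0) :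
    2 * ((n : ℝ) + 4) * ∫ x, f x ^ 2 ∂(ballMeasure n) ≤ ∫ x, ‖g x‖ ^ 2 ∂(ballMeasure n) := by
  rw [← eigen_two]
  refine dirichlet_gap hn hν h hf 2 fun j hj b => ?_
  interval_cases j
  · simp [oddPower_zero]
  · simp only [oddPower_one hν]
    simp only [mul_left_comm _ (2 * inner ℝ b ν)]
    rw [integral_const_mul, h1, mul_zero]

theorem dirichlet_gap_three (hn : 0 < n) {ν : E n} (hν : ‖ν‖ = 1) {f : E n → ℝ} {g : E n → E n}
    (h : IsHomogeneousPair f g) (hf : ∀ᵐ x ∂(ballMeasure n), halfInd ν x * f x = f x)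
    (h1 : ∫ x, f x * (‖x‖ * inner ℝ x ν) ∂(ballMeasure n) = 0)
    (h2 : ∀ b, ∫ x, f x * (inner ℝ x ν * inner ℝ x (b - inner ℝ b ν • ν)) ∂(ballMeasure n) = 0) :
    eigen n 3 * ∫ x, f x ^ 2 ∂(ballMeasure n) ≤ ∫ x, ‖g x‖ ^ 2 ∂(ballMeasure n) := by
  refine dirichlet_gap hn hν h hf 3 fun j hj b => ?_
  interval_cases j
  · simp [oddPower_zero]
  · simp only [oddPower_one hν]
    simp only [mul_left_comm _ (2 * inner ℝ b ν)]
    rw [integral_const_mul, h1, mul_zero]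
  · simp only [oddPower_two hν]
    simp only [mul_left_comm _ (4 * inner ℝ b ν)]
    rw [integral_const_mul, h2, mul_zero]

end HalfBall

/-! ### Weak and strong limits along ultrafilters -/

section Weak
variable {X : Type*} [NormedAddCommGroup X] [InnerProductSpace ℝ X]

theorem norm_le_of_weak_limit {ι : Type*} {l : Filter ι} [l.NeBot] {G : ι → X} {y : X}
    (h : Tendsto (fun k => inner ℝ (G k) y) l (𝓝 (inner ℝ y y))) {c : ℝ} (hc : 0 ≤ c)
    (hG : ∀ᶠ k in l, ‖G k‖ ≤ c) : ‖y‖ ≤ c := by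
  have h1 : inner ℝ y y ≤ c * ‖y‖ := le_of_tendsto h (hG.mono fun k hk =>
    (real_inner_le_norm _ _).trans (by gcongr))
  rw [real_inner_self_eq_norm_sq] at h1
  rcases (norm_nonneg y).eq_or_lt with h0 | h0
  · rw [← h0]; exact hc
  · nlinarith

variable [CompleteSpace X]

/-- Bounded families have weak limits along ultrafilters. -/
theorem exists_weak_limit {ι : Type*} (U : Ultrafilter ι) {G : ι → X} {r : ℝ} (h : ∀ k, ‖G k‖ ≤ r) :
    ∃ y : X, ∀ z, Tendsto (fun k => inner ℝ (G k) z) U (𝓝 (inner ℝ y z)) := by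
  let T : ι → WeakDual ℝ X := fun k => StrongDual.toWeakDual (InnerProductSpace.toDual ℝ X (G k))
  have hc := WeakDual.isCompact_closedBall (𝕜 := ℝ) (E := X) 0 r
  obtain ⟨ξ, -, hξ⟩ := hc.ultrafilter_le_nhds (U.map T) (by
    rw [le_principal_iff]
    refine Filter.mem_map.2 (Filter.mem_of_superset Filter.univ_mem fun k _ => ?_)
    simp only [Set.mem_preimage, Metric.mem_closedBall, dist_zero_right]
    exact ((InnerProductSpace.toDual ℝ X).norm_map (G k)).trans_le (h k))
  refine ⟨(InnerProductSpace.toDual ℝ X).symm (WeakDual.toStrongDual ξ), fun z => ?_⟩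
  have h1 : Tendsto T U (𝓝 ξ) := hξ
  have h2 := ((WeakDual.eval_continuous z).tendsto ξ).comp h1
  rw [InnerProductSpace.toDual_symm_apply]
  exact h2

/-- Approximation by finite-dimensional bounded families gives strong limits along ultrafilters. -/
theorem exists_strong_limit {ι : Type*} (U : Ultrafilter ι) {F : ι → X}
    (h : ∀ ε > 0, ∃ S : Submodule ℝ X, FiniteDimensional ℝ S ∧ ∃ r : ℝ, ∀ k, ∃ y ∈ S, ‖y‖ ≤ r ∧
      ‖F k - y‖ ≤ ε) : ∃ x, Tendsto F U (𝓝 x) := by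
  have hC : Cauchy ((U : Filter ι).map F) := by
    rw [Metric.cauchy_iff]
    refine ⟨inferInstance, fun ε hε => ?_⟩
    obtain ⟨S, hS, r, hr⟩ := h (ε / 5) (by positivity)
    choose y hyS hyr hy using hr
    have : ProperSpace S := FiniteDimensional.proper ℝ S
    let Y : ι → S := fun k => ⟨y k, hyS k⟩
    -- Closed balls of the finite-dimensional `S` are compact, so the approximants converge along
    -- the ultrafilter, and `F` is eventually within `2ε/5` of their limit.
    obtain ⟨z, -, hz⟩ := (isCompact_closedBall (0 : S) r).ultrafilter_le_nhds (U.map Y) (by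
      rw [le_principal_iff]
      refine Filter.mem_map.2 (Filter.mem_of_superset Filter.univ_mem fun k _ => ?_)
      simp only [Set.mem_preimage, Metric.mem_closedBall, dist_zero_right]
      exact hyr k)
    have hT : Tendsto Y U (𝓝 z) := hz
    have hev : ∀ᶠ k in (U : Filter ι), dist (F k) (z : X) < 2 * ε / 5 := by
      filter_upwards [hT.eventually (Metric.ball_mem_nhds z (show 0 < ε / 5 by positivity))] with k hk
      have h1 : dist (y k) (z : X) < ε / 5 := hk
      have h2 : dist (F k) (y k) ≤ ε / 5 := by rw [dist_eq_norm]; exact hy k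
      linarith [dist_triangle (F k) (y k) (z : X)]
    refine ⟨{x | dist x (z : X) < 2 * ε / 5}, hev, fun a ha b hb => ?_⟩
    have ha' : dist a (z : X) < 2 * ε / 5 := ha
    have hb' : dist b (z : X) < 2 * ε / 5 := hb
    linarith [dist_triangle_right a b (z : X)]
  obtain ⟨x, hx⟩ := CompleteSpace.complete hC
  exact ⟨x, hx⟩

end Weak

/-! ### Compactness of bounded homogeneous Sobolev functions -/

section Rellich
variable {n : ℕ}

theorem tendsto_toLp_iff {ι : Type*} {l : Filter ι} {F : ι → E n → ℝ} {f : E n → ℝ}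
    (hF : ∀ k, MemLp (F k) 2 (ballMeasure n)) (hf : MemLp f 2 (ballMeasure n)) :
    Tendsto (fun k => (hF k).toLp (F k)) l (𝓝 (hf.toLp f))
      ↔ Tendsto (fun k => ∫ x, (F k x - f x) ^ 2 ∂(ballMeasure n)) l (𝓝 0) := by
  have e : ∀ k, ∫ x, (F k x - f x) ^ 2 ∂(ballMeasure n) = ‖(hF k).toLp (F k) - hf.toLp f‖ ^ 2 :=
    fun k => by
      rw [norm_sub_sq_eq_integral (hF k).coeFn_toLp hf.coeFn_toLp]
      simp only [Real.norm_eq_abs, sq_abs]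
  simp only [e]
  rw [tendsto_iff_norm_sub_tendsto_zero]
  constructor
  · intro h
    simpa using h.pow 2
  · intro h
    have := h.sqrt
    simpa [Real.sqrt_sq] using this

/-- Products of strongly converging families. -/
theorem tendsto_integral_mul_of_sq_sq {ι : Type*} {l : Filter ι} {F G : ι → E n → ℝ}
    {f g : E n → ℝ} (hF : ∀ k, MemLp (F k) 2 (ballMeasure n)) (hf : MemLp f 2 (ballMeasure n))
    (hG : ∀ k, MemLp (G k) 2 (ballMeasure n)) (hg : MemLp g 2 (ballMeasure n))
    (h1 : Tendsto (fun k => ∫ x, (F k x - f x) ^ 2 ∂(ballMeasure n)) l (𝓝 0))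
    (h2 : Tendsto (fun k => ∫ x, (G k x - g x) ^ 2 ∂(ballMeasure n)) l (𝓝 0)) :
    Tendsto (fun k => ∫ x, F k x * G k x ∂(ballMeasure n)) l
      (𝓝 (∫ x, f x * g x ∂(ballMeasure n))) := by
  have h := ((tendsto_toLp_iff hF hf).2 h1).inner ((tendsto_toLp_iff hG hg).2 h2) (𝕜 := ℝ)
  simpa only [inner_toLp, inner_real_eq] using h

/-- Compactness of bounded families of homogeneous Sobolev functions. -/
theorem exists_ultralimit (hn : 0 < n) {f : ℕ → E n → ℝ} {g : ℕ → E n → E n}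
    (h : ∀ k, IsHomogeneousPair (f k) (g k)) {C : ℝ}
    (hf : ∀ k, ∫ x, f k x ^ 2 ∂(ballMeasure n) ≤ C)
    (hg : ∀ k, ∫ x, ‖g k x‖ ^ 2 ∂(ballMeasure n) ≤ C) :
    ∃ f₀ g₀, IsHomogeneousPair f₀ g₀ ∧
      Tendsto (fun k => ∫ x, (f k x - f₀ x) ^ 2 ∂(ballMeasure n)) (hyperfilter ℕ) (𝓝 0) ∧
      ∀ c, (∀ᶠ k in (hyperfilter ℕ : Filter ℕ), ∫ x, ‖g k x‖ ^ 2 ∂(ballMeasure n) ≤ c) →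
        ∫ x, ‖g₀ x‖ ^ 2 ∂(ballMeasure n) ≤ c := by
  let F : ℕ → Lp ℝ 2 (ballMeasure n) := fun k => (h k).1.1.toLp (f k)
  let G : ℕ → Lp (E n) 2 (ballMeasure n) := fun k => (h k).1.2.1.toLp (g k)
  have hC : 0 ≤ C := (integral_nonneg fun x => sq_nonneg _).trans (hf 0)
  have hFn : ∀ k, ‖F k‖ ≤ √C := fun k => by
    refine Real.le_sqrt_of_sq_le ?_
    rw [norm_toLp_sq]
    simpa only [Real.norm_eq_abs, sq_abs] using hf k
  have hGsq : ∀ k, ‖G k‖ ^ 2 = ∫ x, ‖g k x‖ ^ 2 ∂(ballMeasure n) := fun k => norm_toLp_sq _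
  have hGn : ∀ k, ‖G k‖ ≤ √C := fun k => by
    refine Real.le_sqrt_of_sq_le ?_
    rw [hGsq]; exact hg k
  obtain ⟨y, hy⟩ := exists_weak_limit (hyperfilter ℕ) hGn
  -- Strong `L²` convergence: projecting onto degrees below `K` costs at most `√(C / eigen n K)`,
  -- uniformly in `k`, and the eigenvalues tend to infinity.
  obtain ⟨z, hz⟩ := exists_strong_limit (hyperfilter ℕ) (F := F) (by
    intro ε hε
    obtain ⟨K, hK⟩ := ((tendsto_eigen hn).eventually_ge_atTop (C / ε ^ 2)).exists
    refine ⟨(powerFilt n K).map (fullData hn).val, (fullData hn).finite K, √C, fun k => ?_⟩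
    obtain ⟨p, hp, hpo, hpe⟩ := (fullData hn).exists_proj_norm_sq_le (K := K) (eigen_pos hn K).le
      (fullData_energy hn (h k)) (fun ε hε => fullData_dense hn (aehomog_toLp _ (h k).2) hε)
    refine ⟨(fullData hn).val p, Submodule.mem_map_of_mem hp, ?_, ?_⟩
    · have h1 := hpo p hp
      rw [inner_sub_left, real_inner_self_eq_norm_sq, sub_eq_zero] at h1
      have h2 := real_inner_le_norm (F k) ((fullData hn).val p)
      rcases (norm_nonneg ((fullData hn).val p)).eq_or_lt with h0 | h0
      · rw [← h0]; positivity
      · have h3 : ‖(fullData hn).val p‖ ^ 2 ≤ ‖F k‖ * ‖(fullData hn).val p‖ := h1 ▸ h2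
        refine le_trans ?_ (hFn k)
        nlinarith
    · have e : (fullData hn).eig K = eigen n K := rfl
      rw [e] at hpe
      have h1 : eigen n K * ‖F k - (fullData hn).val p‖ ^ 2 ≤ C :=
        hpe.trans ((hGsq k).le.trans (hg k))
      have h2 : C ≤ eigen n K * ε ^ 2 := by
        rwa [div_le_iff₀ (by positivity)] at hK
      have h3 := le_of_mul_le_mul_left (h1.trans h2) (eigen_pos hn K)
      exact (pow_le_pow_iff_left₀ (norm_nonneg _) hε.le two_ne_zero).1 h3)
  have hL2 : Tendsto (fun k => ∫ x, (f k x - z x) ^ 2 ∂(ballMeasure n)) (hyperfilter ℕ) (𝓝 0) := by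
    refine (tendsto_toLp_iff (fun k => (h k).1.1) (Lp.memLp z)).1 ?_
    rw [Lp.toLp_coeFn]; exact hz
  refine ⟨z, y, ⟨hasScalarGradient_of_tendsto (fun k => (h k).1) (Lp.memLp z) (Lp.memLp y)
    (fun φ hφ => tendsto_integral_mul_of_sq (fun k => (h k).1.1) (Lp.memLp z) (hφ.memLp 2) hL2)
    (fun φ hφ b => ?_), ?_⟩, hL2, fun c hc => ?_⟩
  · have hm : MemLp (fun x => φ x • b) 2 (ballMeasure n) :=
      (hφ.1.continuous.smul continuous_const).memLp_ball 2
    have h1 := hy (hm.toLp)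
    have e : ∀ (w : Lp (E n) 2 (ballMeasure n)) (v : E n → E n), w =ᵐ[ballMeasure n] v →
        inner ℝ w hm.toLp = ∫ x, φ x * inner ℝ (v x) b ∂(ballMeasure n) := fun w v hw => by
      rw [L2.inner_def]
      refine integral_congr_ae ?_
      filter_upwards [hw, hm.coeFn_toLp] with x h1 h2
      rw [h1, h2, real_inner_smul_right]
    simp only [e _ _ (ae_eq_refl (y : E n → E n)), e _ _ (h _).1.2.1.coeFn_toLp, G] at h1
    exact h1
  · exact isClosed_aehomog.mem_of_tendsto hz (Eventually.of_forall fun k => aehomog_toLp _ (h k).2)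
  · obtain ⟨k, hk⟩ := hc.exists
    have hc0 : 0 ≤ c := (integral_nonneg fun x => sq_nonneg _).trans hk
    have h1 := norm_le_of_weak_limit (hy y) (Real.sqrt_nonneg c) (hc.mono fun k hk => by
      refine Real.le_sqrt_of_sq_le ?_
      rw [hGsq]; exact hk)
    have h2 : ‖y‖ ^ 2 ≤ c := by
      rw [← Real.sq_sqrt hc0]; gcongr
    rwa [← Lp.toLp_coeFn y (Lp.memLp y), norm_toLp_sq] at h2

end Rellich

/-! ### The quadratic form of the energy and the half-plane profile -/

section Quad
variable {n : ℕ}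

/-- The quadratic form `∫ |∇f|² - 2 (n + 4) ∫ f²`. -/
def quad (f : E n → ℝ) (g : E n → E n) : ℝ :=
  ∫ x, ‖g x‖ ^ 2 ∂(ballMeasure n) - 2 * ((n : ℝ) + 4) * ∫ x, f x ^ 2 ∂(ballMeasure n)

theorem integral_norm_add_sq {F : Type*} [NormedAddCommGroup F] [InnerProductSpace ℝ F]
    {g₁ g₂ : E n → F} (h₁ : MemLp g₁ 2 (ballMeasure n)) (h₂ : MemLp g₂ 2 (ballMeasure n)) :
    ∫ x, ‖g₁ x + g₂ x‖ ^ 2 ∂(ballMeasure n) = ∫ x, ‖g₁ x‖ ^ 2 ∂(ballMeasure n)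
      + 2 * ∫ x, inner ℝ (g₁ x) (g₂ x) ∂(ballMeasure n) + ∫ x, ‖g₂ x‖ ^ 2 ∂(ballMeasure n) := by
  have i1 := h₁.integrable_norm_sq
  have i2 := h₂.integrable_norm_sq
  have i3 := (h₁.inner_integrable h₂).const_mul 2
  simp only [norm_add_sq_real]
  have i4 : Integrable (fun x => ‖g₁ x‖ ^ 2 + 2 * inner ℝ (g₁ x) (g₂ x)) (ballMeasure n) := i1.add i3
  rw [integral_add i4 i2, integral_add i1 i3, integral_const_mul]

theorem integral_add_sq {f₁ f₂ : E n → ℝ} (h₁ : MemLp f₁ 2 (ballMeasure n))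
    (h₂ : MemLp f₂ 2 (ballMeasure n)) :
    ∫ x, (f₁ x + f₂ x) ^ 2 ∂(ballMeasure n) = ∫ x, f₁ x ^ 2 ∂(ballMeasure n)
      + 2 * ∫ x, f₁ x * f₂ x ∂(ballMeasure n) + ∫ x, f₂ x ^ 2 ∂(ballMeasure n) := by
  have := integral_norm_add_sq h₁ h₂
  simpa only [Real.norm_eq_abs, sq_abs, inner_real_eq] using this

theorem quad_add {f₁ f₂ : E n → ℝ} {g₁ g₂ : E n → E n} (h₁ : HasScalarGradient f₁ g₁)
    (h₂ : HasScalarGradient f₂ g₂) :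
    quad (fun x => f₁ x + f₂ x) (fun x => g₁ x + g₂ x) = quad f₁ g₁ + quad f₂ g₂
      + 2 * (∫ x, inner ℝ (g₁ x) (g₂ x) ∂(ballMeasure n)
        - 2 * ((n : ℝ) + 4) * ∫ x, f₁ x * f₂ x ∂(ballMeasure n)) := by
  unfold quad
  rw [integral_norm_add_sq h₁.2.1 h₂.2.1, integral_add_sq h₁.1 h₂.1]
  ring

theorem quad_const_mul (a : ℝ) (f : E n → ℝ) (g : E n → E n) :
    quad (fun x => a * f x) (fun x => a • g x) = a ^ 2 * quad f g := by
  unfold quad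
  simp only [norm_smul, mul_pow, Real.norm_eq_abs, sq_abs]
  rw [integral_const_mul, integral_const_mul]
  ring

theorem posInner_sq_smul_isSmoothLimit (ν : E n) :
    IsSmoothLimit (fun x => posInner ν x ^ 2 / 2) (fun x => posInner ν x • ν) := by
  obtain ⟨C, hC1, hC⟩ := exists_bound_deriv_smoothPos
  set d : ℕ → E n → ℝ := fun k x => deriv smoothPos (((k : ℝ) + 1) * inner ℝ x ν) with hd
  have hF : ∀ k x, HasGradientAt (fun x : E n => posApprox k (inner ℝ x ν) ^ 2 / 2)
      ((posApprox k (inner ℝ x ν) * d k x) • ν) x := fun k x => by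
    have h1 := HasDerivAt.comp_hasFDerivAt (f := fun x : E n => inner ℝ x ν) x
      (((hasDerivAt_posApprox k (inner ℝ x ν)).pow 2).div_const 2) (hasFDerivAt_inner_const ν x)
    have h2 : HasFDerivAt (fun x : E n => posApprox k (inner ℝ x ν) ^ 2 / 2) _ x := h1
    refine h2.congr_fderiv ?_
    ext y
    simp only [hd, FunLike.coe_smul, Pi.smul_apply, smul_eq_mul, InnerProductSpace.toDual_apply_apply,
      real_inner_smul_left, innerSL_apply_apply, Nat.cast_ofNat, Nat.add_one_sub_one, pow_one]
    ring
  have hin : ∀ x : E n, ‖x‖ ≤ 1 → ∀ k, |posApprox k (inner ℝ x ν)| ≤ ‖ν‖ := fun x hx k =>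
    (abs_posApprox_le k _).trans ((abs_real_inner_le_norm x ν).trans
      (mul_le_of_le_one_left (norm_nonneg _) hx))
  refine isSmoothLimit_of_bounded (φ := fun k x => posApprox k (inner ℝ x ν) ^ 2 / 2)
    (C := ‖ν‖ ^ 2 * C) (fun k => ?_) (fun k x hx => ?_) (fun k x hx => ?_)
    (ae_of_all _ fun x => ?_) (ae_of_all _ fun x => ?_)
  · exact (((posApprox_contDiff k).comp (contDiff_id.inner ℝ contDiff_const)).pow 2).div_const 2
  · have h1 := hin x hx k
    rw [abs_of_nonneg (by positivity), ← sq_abs]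
    have h2 : |posApprox k (inner ℝ x ν)| ^ 2 ≤ ‖ν‖ ^ 2 := by gcongr
    nlinarith [sq_nonneg ‖ν‖]
  · rw [(hF k x).gradient, norm_smul, norm_mul]
    have h1 := hin x hx k
    have h2 : ‖d k x‖ ≤ C := hC _
    rw [Real.norm_eq_abs (posApprox k _)]
    calc |posApprox k (inner ℝ x ν)| * ‖d k x‖ * ‖ν‖ ≤ ‖ν‖ * C * ‖ν‖ := by gcongr
      _ = _ := by ring
  · exact ((tendsto_posApprox _).pow 2).div_const 2
  · simp only [(hF _ x).gradient]
    have h1 := (tendsto_posApprox (inner ℝ x ν)).mul (tendsto_deriv_posApprox (inner ℝ x ν))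
    have h2 : max (inner ℝ x ν) 0 * (if 0 < inner ℝ x ν then 1 else 0) = posInner ν x := by
      rw [posInner, mul_ite, mul_one, mul_zero]
      split_ifs with h
      · rfl
      · exact (max_eq_right (not_lt.1 h)).symm
    rw [h2] at h1
    exact h1.smul_const ν

theorem isHomogeneousPair_posInner_sq (ν : E n) :
    IsHomogeneousPair (fun x => posInner ν x ^ 2 / 2) (fun x => posInner ν x • ν) := by
  refine ⟨(posInner_sq_smul_isSmoothLimit ν).hasScalarGradient, ?_⟩
  have := (aehomog_posInner_sq ν).const_smul (1 / 2)
  refine this.congr (ae_of_all _ fun x => ?_)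
  simp only [smul_eq_mul]; ring

/-- The pairing with the half-plane solution in the direction `ν`. -/
theorem quad_pairing {f : E n → ℝ} {g : E n → E n} (h : IsHomogeneousPair f g)
    {ν : E n} (hν : ‖ν‖ = 1) :
    ∫ x, inner ℝ (g x) (posInner ν x • ν) ∂(ballMeasure n)
        - 2 * ((n : ℝ) + 4) * ∫ x, f x * (posInner ν x ^ 2 / 2) ∂(ballMeasure n)
      = - ∫ x, halfInd ν x * f x ∂(ballMeasure n) := by
  have h1 := integral_posInner_mul_gradient h hν
  simp only [real_inner_smul_right]
  rw [h1]
  have e : ∀ x, f x * (posInner ν x ^ 2 / 2) = (1 / 2) * (posInner ν x ^ 2 * f x) := fun x => by ring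
  simp only [e]
  rw [integral_const_mul]
  ring

/-- The integral of the half-plane solution in the direction `ν`. -/
def halfMass (ν : E n) : ℝ := ∫ x, posInner ν x ^ 2 / 2 ∂(ballMeasure n)

theorem halfInd_mul_posInner_sq (ν x : E n) : halfInd ν x * posInner ν x ^ 2 = posInner ν x ^ 2 := by
  rw [pow_two, ← mul_assoc, halfInd_mul_posInner]

/-- The pairing of the profile with itself: it already vanishes outside the half-space. -/
theorem quad_posInner_sq {ν : E n} (hν : ‖ν‖ = 1) :
    quad (fun x => posInner ν x ^ 2 / 2) (fun x => posInner ν x • ν) = - halfMass ν := by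
  have h := quad_pairing (isHomogeneousPair_posInner_sq ν) hν
  unfold quad halfMass
  simp only [real_inner_self_eq_norm_sq, ← pow_two] at h
  rw [h]
  congr 1
  refine integral_congr_ae (ae_of_all _ fun x => ?_)
  simp only
  rw [← mul_div_assoc, halfInd_mul_posInner_sq]

theorem integral_pos_of_posInner {ν : E n} (hν : ‖ν‖ = 1) {F : E n → ℝ} (hF : Continuous F)
    (h0 : ∀ x, 0 ≤ F x) (h1 : 0 < F ((1 / 2 : ℝ) • ν)) : 0 < ∫ x, F x ∂(ballMeasure n) := by
  have hint : Integrable F (ballMeasure n) := (hF.memLp_ball 1).integrable le_rfl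
  rw [integral_pos_iff_support_of_nonneg h0 hint]
  have hsub : F ⁻¹' Set.Ioi 0 ∩ unitBall n ⊆ Function.support F := fun x hx => ne_of_gt hx.1
  have hopen : IsOpen (F ⁻¹' Set.Ioi 0 ∩ unitBall n) :=
    (isOpen_Ioi.preimage hF).inter Metric.isOpen_ball
  have hne : (F ⁻¹' Set.Ioi 0 ∩ unitBall n).Nonempty := by
    refine ⟨(1 / 2 : ℝ) • ν, h1, ?_⟩
    simp only [unitBall, mem_ball_zero_iff, norm_smul, hν]
    norm_num
  have hpos := hopen.measure_pos volume hne
  rw [ballMeasure, Measure.restrict_apply' (measurableSet_unitBall n)]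
  refine hpos.trans_le (measure_mono fun x hx => ⟨hsub hx, hx.2⟩)

theorem posInner_half {ν : E n} (hν : ‖ν‖ = 1) : posInner ν ((1 / 2 : ℝ) • ν) = 1 / 2 := by
  rw [posInner, real_inner_smul_left, real_inner_self_eq_norm_sq, hν]; norm_num

theorem halfMass_pos {ν : E n} (hν : ‖ν‖ = 1) : 0 < halfMass ν := by
  refine integral_pos_of_posInner hν (((continuous_posInner ν).pow 2).div_const 2)
    (fun x => by positivity) ?_
  rw [posInner_half hν]; norm_num

/-- Functions vanishing outside a half-ball with zero mean have nonnegative energy, and positive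
energy unless they are orthogonal to the first Dirichlet mode. -/
theorem exists_sq_mul_halfMass_le_quad (hn : 0 < n) {ν : E n} (hν : ‖ν‖ = 1) {f : E n → ℝ}
    {g : E n → E n} (h : IsHomogeneousPair f g)
    (hf : ∀ᵐ x ∂(ballMeasure n), halfInd ν x * f x = f x)
    (h0 : ∫ x, halfInd ν x * f x ∂(ballMeasure n) = 0) :
    ∃ β : ℝ, β ^ 2 * halfMass ν ≤ quad f g ∧
      (β = 0 → ∫ x, f x * (‖x‖ * inner ℝ x ν) ∂(ballMeasure n) = 0) := by
  set s : E n → ℝ := fun x => posInner ν x ^ 2 / 2 with hs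
  have hsP := isHomogeneousPair_posInner_sq ν
  -- The degree one component of the profile `s` is nonzero, so a multiple of `s` can cancel that of
  -- `f`.
  set m := ∫ x, s x * (‖x‖ * inner ℝ x ν) ∂(ballMeasure n) with hm
  have hmpos : 0 < m := by
    have e : ∀ x, s x * (‖x‖ * inner ℝ x ν) = ‖x‖ * posInner ν x ^ 3 / 2 := fun x => by
      simp only [hs]
      have := inner_mul_posInner ν x
      linear_combination ‖x‖ * posInner ν x / 2 * this
    rw [hm]
    simp only [e]
    refine integral_pos_of_posInner hν
      ((continuous_norm.mul ((continuous_posInner ν).pow 3)).div_const 2) (fun x => ?_) ?_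
    · have := posInner_nonneg ν x
      positivity
    · rw [posInner_half hν, norm_smul, hν]; norm_num
  have hc : MemLp (fun x : E n => ‖x‖ * inner ℝ x ν) 2 (ballMeasure n) :=
    (Continuous.memLp_ball (by fun_prop) 2)
  -- With this multiple `f + β s` is orthogonal to the first Dirichlet mode, hence has nonnegative
  -- energy. The zero mean removes the cross term, and `s` contributes `-β² * halfMass ν`.
  set β := - (∫ x, f x * (‖x‖ * inner ℝ x ν) ∂(ballMeasure n)) / m with hβ
  have hy := h.add (hsP.const_mul β)
  have hyo : ∫ x, (f x + β * s x) * (‖x‖ * inner ℝ x ν) ∂(ballMeasure n) = 0 := by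
    simp only [add_mul, mul_assoc β]
    rw [integral_add (h.1.1.mul_integrable hc) ((hsP.1.1.mul_integrable hc).const_mul β),
      integral_const_mul, ← hm, hβ]
    field_simp
    ring
  have hgap := dirichlet_gap_two hn hν hy (by
    filter_upwards [hf] with x hx
    rw [mul_add, hx, mul_left_comm, ← mul_div_assoc, halfInd_mul_posInner_sq]) hyo
  have hq : 0 ≤ quad (fun x => f x + β * s x) (fun x => g x + β • (posInner ν x • ν)) :=
    sub_nonneg.2 hgap
  rw [quad_add h.1 (hsP.const_mul β).1, quad_const_mul, quad_posInner_sq hν] at hq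
  have hp := quad_pairing h hν
  rw [h0, neg_zero] at hp
  have e1 : ∫ x, inner ℝ (g x) (β • (posInner ν x • ν)) ∂(ballMeasure n)
      = β * ∫ x, inner ℝ (g x) (posInner ν x • ν) ∂(ballMeasure n) := by
    rw [← integral_const_mul]
    exact integral_congr_ae (ae_of_all _ fun x => real_inner_smul_right _ _ _)
  have e2 : ∫ x, f x * (β * s x) ∂(ballMeasure n) = β * ∫ x, f x * s x ∂(ballMeasure n) := by
    rw [← integral_const_mul]
    exact integral_congr_ae (ae_of_all _ fun x => by ring)
  rw [e1, e2] at hq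
  refine ⟨β, ?_, fun hb => ?_⟩
  · have e3 : 2 * (β * ∫ x, inner ℝ (g x) (posInner ν x • ν) ∂(ballMeasure n)
        - 2 * ((n : ℝ) + 4) * (β * ∫ x, f x * s x ∂(ballMeasure n))) = 0 := by
      linear_combination 2 * β * hp
    linarith
  · rw [hβ, div_eq_zero_iff] at hb
    linarith [hb.resolve_right hmpos.ne']

end Quad

/-! ### Uniform coercivity of the quadratic form -/

section Coercivity
variable {n : ℕ}

/-- The integrand measuring the tangential moments on the half-ball. -/
def shear (ν b x : E n) : ℝ := posInner ν x * (inner ℝ x b - inner ℝ x ν * inner ℝ ν b)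

/-- The size of the tangential moments on the half-ball. -/
def tangential (ν : E n) (f : E n → ℝ) : ℝ :=
  ∑ i : Fin n, (∫ x, f x * shear ν (EuclideanSpace.single i 1) x ∂(ballMeasure n)) ^ 2

theorem tangential_nonneg (ν : E n) (f : E n → ℝ) : 0 ≤ tangential ν f :=
  Finset.sum_nonneg fun _ _ => sq_nonneg _

theorem continuous_shear (ν b : E n) : Continuous (shear ν b) := by
  unfold shear posInner; fun_prop

theorem abs_shear_le {ν : E n} (hν : ‖ν‖ = 1) (b : E n) {x : E n} (hx : ‖x‖ ≤ 1) :
    |shear ν b x| ≤ 2 * ‖b‖ := by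
  have h1 := posInner_nonneg ν x
  have h2 := (posInner_le hν x).trans hx
  have h3 : |inner ℝ x b| ≤ ‖b‖ :=
    (abs_real_inner_le_norm x b).trans (mul_le_of_le_one_left (norm_nonneg _) hx)
  have h4 : |inner ℝ x ν| ≤ 1 := by
    have := abs_real_inner_le_norm x ν
    rw [hν, mul_one] at this
    exact this.trans hx
  have h5 : |inner ℝ ν b| ≤ ‖b‖ := by
    have := abs_real_inner_le_norm ν b
    rwa [hν, one_mul] at this
  have h6 : |inner ℝ x b - inner ℝ x ν * inner ℝ ν b| ≤ 2 * ‖b‖ := by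
    refine (abs_sub _ _).trans ?_
    rw [abs_mul]
    nlinarith [abs_nonneg (inner ℝ x ν), abs_nonneg (inner ℝ ν b), norm_nonneg b]
  rw [shear, abs_mul, abs_of_nonneg h1]
  nlinarith [abs_nonneg (inner ℝ x b - inner ℝ x ν * inner ℝ ν b), norm_nonneg b]

/-- Dominated convergence in the direction; it gives strong convergence of half-space indicators and
shears when the direction varies on the sphere. -/
theorem tendsto_integral_sq_sub_nhdsWithin {Φ : E n → E n → ℝ} {ν : E n} {C : ℝ}
    (hm : ∀ ν', AEStronglyMeasurable (Φ ν') (ballMeasure n))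
    (hb : ∀ ν' ∈ Metric.sphere (0 : E n) 1, ∀ x, ‖x‖ ≤ 1 → |Φ ν' x| ≤ C)
    (hν : ν ∈ Metric.sphere (0 : E n) 1)
    (hc : ∀ᵐ x ∂(ballMeasure n), ContinuousAt (fun ν' => Φ ν' x) ν) :
    Tendsto (fun ν' => ∫ x, (Φ ν' x - Φ ν x) ^ 2 ∂(ballMeasure n))
      (𝓝[Metric.sphere (0 : E n) 1] ν) (𝓝 0) := by
  have h := tendsto_integral_filter_of_dominated_convergence (μ := ballMeasure n)
    (l := 𝓝[Metric.sphere (0 : E n) 1] ν) (F := fun ν' x => (Φ ν' x - Φ ν x) ^ 2)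
    (f := fun _ => 0) (fun _ => (C + C) ^ 2)
    (Eventually.of_forall fun ν' => ((hm ν').sub (hm ν)).pow 2) ?_ (integrable_const _) ?_
  · simpa using h
  · filter_upwards [self_mem_nhdsWithin] with ν' hν'
    filter_upwards [ae_norm_le_one n] with x hx
    rw [norm_pow]
    have := (norm_sub_le (Φ ν' x) (Φ ν x)).trans (add_le_add (hb ν' hν' x hx) (hb ν hν x hx))
    gcongr
  · filter_upwards [hc] with x hx
    have h1 : Tendsto (fun ν' => Φ ν' x) (𝓝[Metric.sphere (0 : E n) 1] ν) (𝓝 (Φ ν x)) :=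
      hx.tendsto.mono_left nhdsWithin_le_nhds
    have h2 := (h1.sub_const (Φ ν x)).pow 2
    simpa using h2

theorem continuousAt_halfInd {ν x : E n} (h : inner ℝ x ν ≠ 0) :
    ContinuousAt (fun ν' => halfInd ν' x) ν := by
  have hc : ContinuousAt (fun ν' : E n => inner ℝ x ν') ν := by fun_prop
  rcases lt_or_gt_of_ne h with h | h
  · refine (continuousAt_const (y := (0 : ℝ))).congr ?_
    filter_upwards [hc.eventually_lt continuousAt_const h] with y hy
    rw [halfInd, if_neg (not_lt.2 hy.le)]
  · refine (continuousAt_const (y := (1 : ℝ))).congr ?_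
    filter_upwards [continuousAt_const.eventually_lt hc h] with y hy
    rw [halfInd, if_pos hy]

/-- `shear` is linear in `b`, so the coordinate directions determine all tangential moments. -/
theorem tangential_eq_zero {ν : E n} {f : E n → ℝ} (hf : MemLp f 2 (ballMeasure n))
    (h : tangential ν f = 0) (b : E n) : ∫ x, f x * shear ν b x ∂(ballMeasure n) = 0 := by
  have h1 := (Finset.sum_eq_zero_iff_of_nonneg fun i _ => sq_nonneg _).1 h
  have e : ∀ x, f x * shear ν b x
      = ∑ i, b i * (f x * shear ν (EuclideanSpace.single i 1) x) := fun x => by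
    have hb : b = ∑ i, b i • EuclideanSpace.single i (1 : ℝ) := by
      have := (EuclideanSpace.basisFun (Fin n) ℝ).sum_repr b
      simpa using this.symm
    conv_lhs => rw [hb]
    simp only [shear, inner_sum, real_inner_smul_right, Finset.mul_sum, ← Finset.sum_sub_distrib]
    exact Finset.sum_congr rfl fun i _ => by ring
  simp only [e]
  rw [integral_finsetSum _ fun i _ =>
    (hf.mul_integrable ((continuous_shear ν _).memLp_ball 2)).const_mul _]
  refine Finset.sum_eq_zero fun i hi => ?_
  rw [integral_const_mul, pow_eq_zero_iff two_ne_zero |>.1 (h1 i hi), mul_zero]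

/-- Argument by contradiction and compactness, for functions of unit norm. One integer `k` is both
the penalty weight and the inverse of the coercivity constant, so a failure for all `k` yields a
sequence whose limit `f₀` has norm one, vanishes off a half-ball, has zero mean there and `quad` at
most `-ε` times its tangential moments. The spectral analysis of the half-ball excludes such a
limit. -/
theorem coercivity_normalized (hn : 0 < n) {ε : ℝ} (hε : 0 < ε) :
    ∃ k : ℕ, ∀ ν : E n, ‖ν‖ = 1 → ∀ f g, IsHomogeneousPair f g →
      ∫ x, halfInd ν x * f x ∂(ballMeasure n) = 0 → ∫ x, f x ^ 2 ∂(ballMeasure n) = 1 →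
      1 / ((k : ℝ) + 1) ≤ quad f g
        + ((k : ℝ) + 1) * ∫ x, (1 - halfInd ν x) * f x ^ 2 ∂(ballMeasure n) + ε * tangential ν f := by
  by_contra! hcon
  choose ν hν f g h h0 h1 hlt using hcon
  set U : Filter ℕ := (hyperfilter ℕ : Filter ℕ) with hU
  have hUtop : U ≤ atTop := Nat.hyperfilter_le_atTop
  have hinv : Tendsto (fun k : ℕ => 1 / ((k : ℝ) + 1)) U (𝓝 0) :=
    tendsto_one_div_add_atTop_nhds_zero_nat.mono_left hUtop
  have hP0 : ∀ k, 0 ≤ ∫ x, (1 - halfInd (ν k) x) * f k x ^ 2 ∂(ballMeasure n) := fun k =>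
    integral_nonneg fun x => mul_nonneg (by have := halfInd_le_one (ν k) x; linarith) (sq_nonneg _)
  have hW0 : ∀ k, 0 ≤ ε * tangential (ν k) (f k) := fun k =>
    mul_nonneg hε.le (tangential_nonneg _ _)
  have hinv1 : ∀ k : ℕ, 1 / ((k : ℝ) + 1) ≤ 1 := fun k => by
    rw [div_le_one (by positivity)]
    linarith [(Nat.cast_nonneg k : (0 : ℝ) ≤ k)]
  set C : ℝ := 2 * ((n : ℝ) + 4) + 1 with hC
  have hkP0 : ∀ k : ℕ, 0 ≤ ((k : ℝ) + 1) * ∫ x, (1 - halfInd (ν k) x) * f k x ^ 2 ∂(ballMeasure n) :=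
    fun k => mul_nonneg (by positivity) (hP0 k)
  have hgb : ∀ k, ∫ x, ‖g k x‖ ^ 2 ∂(ballMeasure n)
      ≤ 2 * ((n : ℝ) + 4) + 1 / ((k : ℝ) + 1) - ε * tangential (ν k) (f k) := fun k => by
    have := hlt k
    have := hkP0 k
    rw [quad, h1 k] at *
    linarith
  -- `quad` is at least `-2 (n + 4)` on normalized functions, so the growing penalty forces the mass
  -- on the wrong side to zero.
  have hPb : ∀ k : ℕ, ∫ x, (1 - halfInd (ν k) x) * f k x ^ 2 ∂(ballMeasure n)
      ≤ C * (1 / ((k : ℝ) + 1)) := fun k => by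
    have a1 := hlt k
    have a2 := hW0 k
    have a3 := hinv1 k
    have a4 : 0 ≤ ∫ x, ‖g k x‖ ^ 2 ∂(ballMeasure n) := integral_nonneg fun x => sq_nonneg _
    rw [quad, h1 k] at a1
    rw [mul_one_div, le_div_iff₀ (by positivity)]
    linarith
  obtain ⟨f₀, g₀, hp, hlim, hweak⟩ := exists_ultralimit hn h (C := C)
    (fun k => by rw [h1 k, hC]; have : (0:ℝ) ≤ n := Nat.cast_nonneg n; linarith)
    (fun k => by linarith [hgb k, hinv1 k, hW0 k])
  obtain ⟨ν₀, hν₀, hνlim⟩ := (isCompact_sphere (0 : E n) 1).ultrafilter_le_nhds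
    ((hyperfilter ℕ).map ν) (by
      rw [le_principal_iff]
      refine Filter.mem_map.2 (Filter.mem_of_superset Filter.univ_mem fun k _ => ?_)
      simp [hν k])
  have hν₀' : ‖ν₀‖ = 1 := by simpa using hν₀
  have hνt : Tendsto ν U (𝓝[Metric.sphere (0 : E n) 1] ν₀) :=
    tendsto_nhdsWithin_iff.2 ⟨hνlim, Eventually.of_forall fun k => by simp [hν k]⟩
  have hnorm : ∀ {ν' : E n}, ν' ∈ Metric.sphere (0 : E n) 1 → ‖ν'‖ = 1 := fun h => by simpa using h
  have mh : ∀ ν' : E n, MemLp (halfInd ν') 2 (ballMeasure n) := fun ν' => by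
    have := memLp_halfInd_mul ν' (memLp_const (1 : ℝ) (μ := ballMeasure n) (p := 2))
    simpa using this
  have lh := (tendsto_integral_sq_sub_nhdsWithin (Φ := halfInd) (C := 1) (fun ν' => (mh ν').1)
    (fun ν' _ x _ => abs_halfInd_le ν' x) hν₀
    ((ae_inner_ne_zero hν₀').mono fun x hx => continuousAt_halfInd hx)).comp hνt
  have z0 : ∫ x, halfInd ν₀ x * f₀ x ∂(ballMeasure n) = 0 := by
    have := tendsto_integral_mul_of_sq_sq (fun k => mh (ν k)) (mh ν₀) (fun k => (h k).1.1) hp.1.1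
      lh hlim
    simp only [h0] at this
    exact tendsto_nhds_unique this tendsto_const_nhds
  have z1 : ∫ x, f₀ x ^ 2 ∂(ballMeasure n) = 1 := by
    have := tendsto_integral_mul_of_sq_sq (fun k => (h k).1.1) hp.1.1 (fun k => (h k).1.1) hp.1.1
      hlim hlim
    simp only [← pow_two, h1] at this
    exact tendsto_nhds_unique this tendsto_const_nhds
  have z2 : ∀ᵐ x ∂(ballMeasure n), halfInd ν₀ x * f₀ x = f₀ x := by
    refine ae_eq_of_test ((memLp_halfInd_mul ν₀ hp.1.1).integrable (by norm_num))
      (hp.1.1.integrable (by norm_num)) fun φ hφ => ?_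
    obtain ⟨B, hB⟩ := hφ.bounded
    have mφ : ∀ ν' : E n, MemLp (fun x => (1 - halfInd ν' x) * φ x) 2 (ballMeasure n) := fun ν' =>
      memLp_one_sub_halfInd_mul ν' (hφ.memLp 2)
    have l1 := (tendsto_integral_sq_sub_nhdsWithin (C := B)
      (Φ := fun ν' x => (1 - halfInd ν' x) * φ x) (fun ν' => (mφ ν').1)
      (fun ν' _ x _ => by
        rw [abs_mul]
        have a1 : |1 - halfInd ν' x| ≤ 1 := by
          rw [abs_le]; constructor <;> linarith [halfInd_nonneg ν' x, halfInd_le_one ν' x]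
        have a2 := hB x
        rw [Real.norm_eq_abs] at a2
        nlinarith [abs_nonneg (φ x), abs_nonneg (1 - halfInd ν' x)]) hν₀
      ((ae_inner_ne_zero hν₀').mono fun x hx =>
        (continuousAt_const.sub (continuousAt_halfInd hx)).mul continuousAt_const)).comp hνt
    have l2 := tendsto_integral_mul_of_sq_sq (fun k => mφ (ν k)) (mφ ν₀) (fun k => (h k).1.1) hp.1.1
      l1 hlim
    have l3 : Tendsto (fun k => (∫ x, (1 - halfInd (ν k) x) * φ x * f k x ∂(ballMeasure n)) ^ 2) U
        (𝓝 0) := by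
      have l4 := (hinv.const_mul C).const_mul (∫ x, φ x ^ 2 ∂(ballMeasure n))
      rw [mul_zero, mul_zero] at l4
      refine squeeze_zero (fun k => sq_nonneg _) (fun k => ?_) l4
      have a1 := sq_integral_mul_le (hφ.memLp 2) (memLp_one_sub_halfInd_mul (ν k) (h k).1.1)
      have a2 : ∀ x, ((1 - halfInd (ν k) x) * f k x) ^ 2 = (1 - halfInd (ν k) x) * f k x ^ 2 :=
        fun x => by linear_combination f k x ^ 2 * halfInd_sq (ν k) x
      simp only [a2] at a1
      have a3 : ∀ x, (1 - halfInd (ν k) x) * φ x * f k x = φ x * ((1 - halfInd (ν k) x) * f k x) :=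
        fun x => by ring
      simp only [a3]
      exact a1.trans (mul_le_mul_of_nonneg_left (hPb k) (integral_nonneg fun x => sq_nonneg _))
    have l5 := tendsto_nhds_unique (l2.pow 2) l3
    rw [pow_eq_zero_iff two_ne_zero] at l5
    have l6 : ∫ x, (φ x * f₀ x - φ x * (halfInd ν₀ x * f₀ x)) ∂(ballMeasure n) = 0 := by
      rw [← l5]; exact integral_congr_ae (ae_of_all _ fun x => by ring)
    rw [integral_sub ((hφ.memLp 2).mul_integrable hp.1.1)
      ((hφ.memLp 2).mul_integrable (memLp_halfInd_mul ν₀ hp.1.1))] at l6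
    simp only [smul_eq_mul]
    linarith
  have lW : Tendsto (fun k => tangential (ν k) (f k)) U (𝓝 (tangential ν₀ f₀)) := by
    unfold tangential
    refine tendsto_finsetSum _ fun i _ => ?_
    have ms : ∀ ν' : E n, MemLp (shear ν' (EuclideanSpace.single i 1)) 2 (ballMeasure n) := fun ν' =>
      (continuous_shear ν' _).memLp_ball 2
    have l1 := (tendsto_integral_sq_sub_nhdsWithin
      (Φ := fun ν' => shear ν' (EuclideanSpace.single i 1)) (fun ν' => (ms ν').1)
      (fun ν' hν' x hx => abs_shear_le (hnorm hν') _ hx) hν₀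
      (ae_of_all _ fun x => by unfold shear posInner; fun_prop)).comp hνt
    exact (tendsto_integral_mul_of_sq_sq (fun k => (h k).1.1) hp.1.1 (fun k => ms (ν k)) (ms ν₀)
      hlim l1).pow 2
  -- Weak lower semicontinuity of the Dirichlet integral, combined with the convergence of the
  -- tangential moments.
  have hfin : ∫ x, ‖g₀ x‖ ^ 2 ∂(ballMeasure n) ≤ 2 * ((n : ℝ) + 4) - ε * tangential ν₀ f₀ := by
    refine le_of_forall_pos_le_add fun η hη => hweak _ ?_
    have l1 := ((hinv.const_add (2 * ((n : ℝ) + 4))).sub (lW.const_mul ε)).eventually_lt_const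
      (show 2 * ((n : ℝ) + 4) + 0 - ε * tangential ν₀ f₀
        < 2 * ((n : ℝ) + 4) - ε * tangential ν₀ f₀ + η by linarith)
    exact l1.mono fun k hk => (hgb k).trans hk.le
  have hq : quad f₀ g₀ ≤ - (ε * tangential ν₀ f₀) := by
    rw [quad, z1]; linarith
  -- A nonnegative lower bound for `quad` meets a nonpositive upper bound: both `β` and the
  -- tangential moments vanish, so the limit has no component of degree one or two.
  obtain ⟨β, hβ, hβ0⟩ := exists_sq_mul_halfMass_le_quad hn hν₀' hp z2 z0
  have hI := halfMass_pos hν₀'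
  have hT := tangential_nonneg ν₀ f₀
  have hbz : β = 0 := by
    have : β ^ 2 * halfMass ν₀ ≤ 0 := hβ.trans (hq.trans (by nlinarith))
    have h2 : β ^ 2 ≤ 0 := by nlinarith
    exact pow_eq_zero_iff two_ne_zero |>.1 (le_antisymm h2 (sq_nonneg _))
  have hTz : tangential ν₀ f₀ = 0 := by
    rw [hbz] at hβ
    nlinarith
  have hgap := dirichlet_gap_three hn hν₀' hp z2 (hβ0 hbz) fun b => by
    rw [← tangential_eq_zero hp.1.1 hTz b]
    refine integral_congr_ae ?_
    filter_upwards [z2] with x hx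
    rw [shear, posInner_eq, ← mul_assoc, ← mul_assoc (f₀ x) (_ * _), ← mul_assoc (f₀ x),
      mul_comm (f₀ x) (halfInd ν₀ x), hx, inner_sub_right, real_inner_smul_right,
      real_inner_comm b ν₀]
    ring
  rw [z1, mul_one] at hgap
  -- The strict gap: the limit has norm one, so its Dirichlet integral is at least `eigen n 3`,
  -- against the upper bound `2 (n + 4)`.
  have h3 : 2 * ((n : ℝ) + 4) < eigen n 3 := by
    unfold eigen
    rw [div_mul_eq_mul_div, lt_div_iff₀ (by positivity)]
    push_cast
    have : (0 : ℝ) ≤ n := Nat.cast_nonneg n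
    nlinarith
  rw [hTz] at hfin
  linarith

/-- Coercivity of `quad` on functions with zero mean on a half-ball, up to the mass on the other
half-ball and to tangential moments, uniformly in the direction. -/
theorem coercivity (hn : 0 < n) {ε : ℝ} (hε : 0 < ε) :
    ∃ K > 0, ∃ c₀ > 0, ∀ ν : E n, ‖ν‖ = 1 → ∀ f g, IsHomogeneousPair f g →
      ∫ x, halfInd ν x * f x ∂(ballMeasure n) = 0 →
      c₀ * ∫ x, f x ^ 2 ∂(ballMeasure n) ≤ quad f g
        + K * ∫ x, (1 - halfInd ν x) * f x ^ 2 ∂(ballMeasure n) + ε * tangential ν f := by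
  obtain ⟨k, hk⟩ := coercivity_normalized hn hε
  refine ⟨(k : ℝ) + 1, by positivity, 1 / ((k : ℝ) + 1), by positivity, fun ν hν f g h h0 => ?_⟩
  have hN : 0 ≤ ∫ x, f x ^ 2 ∂(ballMeasure n) := integral_nonneg fun x => sq_nonneg _
  have hP : 0 ≤ ∫ x, (1 - halfInd ν x) * f x ^ 2 ∂(ballMeasure n) :=
    integral_nonneg fun x => mul_nonneg (by have := halfInd_le_one ν x; linarith) (sq_nonneg _)
  rcases hN.eq_or_lt with hz | hpos
  · have h1 : 0 ≤ ∫ x, ‖g x‖ ^ 2 ∂(ballMeasure n) := integral_nonneg fun x => sq_nonneg _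
    have h2 := tangential_nonneg ν f
    have h3 : 0 ≤ ε * tangential ν f := mul_nonneg hε.le h2
    have h4 : 0 ≤ ((k : ℝ) + 1) * ∫ x, (1 - halfInd ν x) * f x ^ 2 ∂(ballMeasure n) :=
      mul_nonneg (by positivity) hP
    rw [quad, ← hz]
    linarith
  · obtain ⟨N, hNdef⟩ : ∃ N, N = ∫ x, f x ^ 2 ∂(ballMeasure n) := ⟨_, rfl⟩
    rw [← hNdef] at hN hpos ⊢
    -- All the terms are quadratic in `f`, so scaling to unit norm reduces to the normalized
    -- statement.
    set a : ℝ := (√N)⁻¹ with ha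
    have ha2 : a ^ 2 = N⁻¹ := by rw [ha, inv_pow, Real.sq_sqrt hN]
    have h1 := hk ν hν _ _ (h.const_mul a) (by
        simp only [mul_left_comm _ a]
        rw [integral_const_mul, h0, mul_zero]) (by
        simp only [mul_pow]
        rw [integral_const_mul, ha2, ← hNdef, inv_mul_cancel₀ hpos.ne'])
    rw [quad_const_mul] at h1
    have e1 : tangential ν (fun x => a * f x) = a ^ 2 * tangential ν f := by
      unfold tangential
      rw [Finset.mul_sum]
      refine Finset.sum_congr rfl fun i _ => ?_
      simp only [mul_assoc a]
      rw [integral_const_mul, mul_pow]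
    have e2 : ∫ x, (1 - halfInd ν x) * (a * f x) ^ 2 ∂(ballMeasure n)
        = a ^ 2 * ∫ x, (1 - halfInd ν x) * f x ^ 2 ∂(ballMeasure n) := by
      rw [← integral_const_mul]
      exact integral_congr_ae (ae_of_all _ fun x => by ring)
    rw [e1, e2, ha2] at h1
    have h2 := mul_le_mul_of_nonneg_right h1 hN
    have e3 : (N⁻¹ * quad f g + ((k : ℝ) + 1) * (N⁻¹ * ∫ x, (1 - halfInd ν x) * f x ^ 2 ∂(ballMeasure n))
        + ε * (N⁻¹ * tangential ν f)) * N
        = quad f g + ((k : ℝ) + 1) * (∫ x, (1 - halfInd ν x) * f x ^ 2 ∂(ballMeasure n))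
        + ε * tangential ν f := by
      field_simp
    linarith

end Coercivity

/-! ### Integration over the sphere -/

section Polar
variable {n : ℕ}

/-- The divergence theorem for the radial field `H(x) x` on the unit ball. -/
theorem integral_sphere_eq (hn : 0 < n) {H : E n → ℝ} (hH : ContDiff ℝ ∞ H) :
    ∫ θ, H θ ∂(sphereMeasure n)
      = ∫ x, ((n : ℝ) * H x + fderiv ℝ H x x) ∂(ballMeasure n) := by
  have : Nonempty (Fin n) := ⟨⟨0, hn⟩⟩
  have : Nontrivial (E n) := inferInstance
  set F : E n → ℝ := fun x => (n : ℝ) * H x + fderiv ℝ H x x with hF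
  have hFc : Continuous F :=
    (continuous_const.mul hH.continuous).add
      ((hH.continuous_fderiv (by simp)).clm_apply continuous_id)
  set B : E n → ℝ := (unitBall n).indicator F with hB
  have hBi : Integrable B volume :=
    (integrable_indicator_iff (measurableSet_unitBall n)).2
      ((hFc.memLp_ball 1).integrable le_rfl)
  have hdim : Module.finrank ℝ (E n) = n := finrank_euclideanSpace_fin
  have hmp := (volume : Measure (E n)).measurePreserving_homeomorphUnitSphereProd
  have hemb := (homeomorphUnitSphereProd (E n)).measurableEmbedding
  set P : Metric.sphere (0 : E n) 1 × Set.Ioi (0 : ℝ) → ℝ := fun p => B (p.2.1 • p.1.1) with hP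
  have hcomp : ∀ x : ({0}ᶜ : Set (E n)), P (homeomorphUnitSphereProd (E n) x) = B x := fun x => by
    have hx : ‖(x : E n)‖ ≠ 0 := norm_ne_zero_iff.2 x.2
    simp only [hP, homeomorphUnitSphereProd_apply_snd_coe, homeomorphUnitSphereProd_apply_fst_coe]
    rw [smul_smul, mul_inv_cancel₀ hx, one_smul]
  have hPi : Integrable P
      ((volume : Measure (E n)).toSphere.prod (Measure.volumeIoiPow (Module.finrank ℝ (E n) - 1))) := by
    rw [← hmp.integrable_comp_emb hemb]
    have h1 : Integrable (fun x : ({0}ᶜ : Set (E n)) => B x)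
        (Measure.comap Subtype.val (volume : Measure (E n))) := by
      have h2 : IntegrableOn B ({0}ᶜ : Set (E n)) volume := hBi.integrableOn
      rwa [integrableOn_iff_comap_subtypeVal (measurableSet_singleton _).compl] at h2
    exact h1.congr (ae_of_all _ fun x => (hcomp x).symm)
  have h1 : ∫ x, F x ∂(ballMeasure n) = ∫ p, P p
      ∂((volume : Measure (E n)).toSphere.prod (Measure.volumeIoiPow (Module.finrank ℝ (E n) - 1))) := by
    rw [← hmp.integral_comp hemb]
    simp only [hcomp]
    rw [integral_subtype_comap (measurableSet_singleton _).compl B, restrict_compl_singleton, hB,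
      integral_indicator (measurableSet_unitBall n)]
    rfl
  rw [h1, integral_prod _ hPi]
  refine integral_congr_ae (ae_of_all _ fun θ => ?_)
  have hθ : ‖(θ : E n)‖ = 1 := by simp
  -- On each ray the integrand, multiplied by the polar weight `r ^ (n - 1)`, is an exact
  -- derivative; integrating from `0` to `1` leaves the value on the sphere.
  have hrad : ∀ r : ℝ, HasDerivAt (fun r : ℝ => r ^ n * H (r • (θ : E n)))
      (r ^ (n - 1) * F (r • (θ : E n))) r := fun r => by
    have d1 : HasDerivAt (fun r : ℝ => r • (θ : E n)) (θ : E n) r := by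
      simpa using (hasDerivAt_id r).smul_const (θ : E n)
    have d2 := (hH.differentiable (by simp) (r • (θ : E n))).hasFDerivAt.comp_hasDerivAt r d1
    have d3 := (hasDerivAt_pow n r).mul d2
    refine d3.congr_deriv ?_
    simp only [hF, map_smul, smul_eq_mul, Function.comp_apply]
    have hr : r ^ n = r ^ (n - 1) * r := by rw [← pow_succ, Nat.sub_add_cancel hn]
    rw [hr]; ring
  have h2 : ∫ r in (0 : ℝ)..1, r ^ (n - 1) * F (r • (θ : E n)) = H θ := by
    rw [intervalIntegral.integral_eq_sub_of_hasDerivAt (fun r _ => hrad r)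
      ((Continuous.intervalIntegrable (by fun_prop) _ _))]
    simp [hn.ne']
  have h3 : ∫ r, P (θ, r) ∂(Measure.volumeIoiPow (Module.finrank ℝ (E n) - 1))
      = ∫ r in Set.Ioi (0 : ℝ), r ^ (n - 1) * B (r • (θ : E n)) := by
    rw [hdim]
    simp only [Measure.volumeIoiPow, ENNReal.ofReal]
    rw [integral_withDensity_eq_integral_smul]
    · rw [integral_subtype_comap measurableSet_Ioi
        fun a : ℝ => Real.toNNReal (a ^ (n - 1)) • B (a • (θ : E n))]
      refine setIntegral_congr_fun measurableSet_Ioi fun r hr => ?_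
      rw [NNReal.smul_def, Real.coe_toNNReal _ (pow_nonneg (le_of_lt hr) _), smul_eq_mul]
    · exact (measurable_subtype_coe.pow_const _).real_toNNReal
  have h4 : ∫ r in Set.Ioi (0 : ℝ), r ^ (n - 1) * B (r • (θ : E n))
      = ∫ r in (0 : ℝ)..1, r ^ (n - 1) * F (r • (θ : E n)) := by
    rw [intervalIntegral.integral_of_le zero_le_one, integral_Ioc_eq_integral_Ioo]
    have e : Set.EqOn (fun r : ℝ => r ^ (n - 1) * B (r • (θ : E n)))
        ((Set.Iio (1 : ℝ)).indicator fun r => r ^ (n - 1) * F (r • (θ : E n))) (Set.Ioi 0) := by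
      intro r hr
      have hn' : ‖r • (θ : E n)‖ = r := by
        rw [norm_smul, hθ, mul_one, Real.norm_of_nonneg (le_of_lt hr)]
      by_cases h : r < 1 <;> beta_reduce
      · rw [Set.indicator_of_mem (show r ∈ Set.Iio 1 from h), hB, Set.indicator_of_mem]
        simpa [unitBall, hn'] using h
      · rw [Set.indicator_of_notMem (show r ∉ Set.Iio 1 from h), hB, Set.indicator_of_notMem, mul_zero]
        simpa [unitBall, hn'] using h
    rw [setIntegral_congr_fun measurableSet_Ioi e, setIntegral_indicator measurableSet_Iio]
    rfl
  exact (h3.trans (h4.trans h2)).symm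

end Polar

/-! ### Vector weak gradients through components -/

section Vector
variable {n m : ℕ}

/-- The gradient of the `i`-th component. -/
def gradComp (G : E n → Grad n m) (i : Fin m) (x : E n) : E n := WithLp.toLp 2 fun j => G x j i

/-- The vector gradient with the given components. -/
def gradOfComp (g : Fin m → E n → E n) (x : E n) : Grad n m :=
  WithLp.toLp 2 fun j => WithLp.toLp 2 fun i => g i x j

theorem gradComp_gradOfComp (g : Fin m → E n → E n) (i : Fin m) : gradComp (gradOfComp g) i = g i := rfl

theorem norm_sq_eq_sum_gradComp (G : E n → Grad n m) (x : E n) :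
    ‖G x‖ ^ 2 = ∑ i, ‖gradComp G i x‖ ^ 2 := by
  rw [PiLp.norm_sq_eq_of_L2]
  simp only [EuclideanSpace.norm_sq_eq, gradComp]
  rw [Finset.sum_comm]

theorem memLp_grad_iff {G : E n → Grad n m} :
    MemLp G 2 (ballMeasure n) ↔ ∀ i, MemLp (gradComp G i) 2 (ballMeasure n) := by
  simp only [memLp_piLp_iff, gradComp]
  exact ⟨fun h i j => h j i, fun h j i => h i j⟩

theorem hasWeakGradient_iff {u : E n → E m} {G : E n → Grad n m} :
    HasWeakGradient u G ↔ ∀ i, HasScalarGradient (fun x => u x i) (gradComp G i) := by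
  have key : MemLp u 2 (ballMeasure n) → MemLp G 2 (ballMeasure n) → ∀ φ : E n → ℝ, IsTest φ →
      ∀ (j : Fin n) (i : Fin m),
      (∫ x, (fderiv ℝ φ x (EuclideanSpace.single j 1)) • u x ∂(ballMeasure n)) i
        = ∫ x, fderiv ℝ φ x (EuclideanSpace.single j 1) * u x i ∂(ballMeasure n) ∧
      (- ∫ x, φ x • G x j ∂(ballMeasure n)) i = - ∫ x, φ x * gradComp G i x j ∂(ballMeasure n) := by
    intro hu hG φ hφ j i
    have hu' : ∀ i, MemLp (fun x => u x i) 2 (ballMeasure n) := memLp_piLp_iff.1 hu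
    have hG' := memLp_grad_iff.1 hG
    constructor
    · rw [eval_integral_piLp fun i => ?_]
      · simp
      · simpa using ((hφ.fderiv_apply (EuclideanSpace.single j 1)).memLp 2).mul_integrable (hu' i)
    · have : (∫ x, φ x • G x j ∂(ballMeasure n)) i = ∫ x, φ x * gradComp G i x j ∂(ballMeasure n) := by
        rw [eval_integral_piLp fun i => ?_]
        · simp [gradComp]
        · simpa [gradComp] using (hφ.memLp 2).mul_integrable (memLp_piLp_iff.1 (hG' i) j)
      rw [PiLp.neg_apply, this]
  constructor
  · intro h i
    refine hasScalarGradient_of_single (memLp_piLp_iff.1 h.1 i) (memLp_grad_iff.1 h.2.1 i)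
      fun φ hφ j => ?_
    have h1 := congrArg (fun v : E m => v i) (h.2.2 φ hφ.1 hφ.2.1 hφ.2.2 j)
    simp only [(key h.1 h.2.1 φ hφ j i).1, (key h.1 h.2.1 φ hφ j i).2] at h1
    exact h1
  · intro h
    have hu : MemLp u 2 (ballMeasure n) := memLp_piLp_iff.2 fun i => (h i).1
    have hG : MemLp G 2 (ballMeasure n) := memLp_grad_iff.2 fun i => (h i).2.1
    refine ⟨hu, hG, fun φ h1 h2 h3 j => ?_⟩
    ext i
    have hφ : IsTest φ := ⟨h1, h2, h3⟩
    rw [(key hu hG φ hφ j i).1, (key hu hG φ hφ j i).2]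
    exact (h i).smul_test hφ j

theorem MemW12.hasWeakGradient {u : E n → E m} (h : MemW12 u) : HasWeakGradient u (weakGradient u) := by
  unfold weakGradient
  rw [dif_pos h]
  exact h.choose_spec

theorem HasWeakGradient.memW12 {u : E n → E m} {G : E n → Grad n m} (h : HasWeakGradient u G) :
    MemW12 u := ⟨G, h⟩

theorem HasWeakGradient.unique {u : E n → E m} {G G' : E n → Grad n m} (h : HasWeakGradient u G)
    (h' : HasWeakGradient u G') : G =ᵐ[ballMeasure n] G' := by
  have : ∀ i, gradComp G i =ᵐ[ballMeasure n] gradComp G' i := fun i =>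
    (hasWeakGradient_iff.1 h i).unique (hasWeakGradient_iff.1 h' i)
  filter_upwards [ae_all_iff.2 this] with x hx
  ext j i
  exact congrArg (fun v : E n => v j) (hx i)

theorem HasWeakGradient.weakGradient_ae {u : E n → E m} {G : E n → Grad n m}
    (h : HasWeakGradient u G) : weakGradient u =ᵐ[ballMeasure n] G :=
  h.memW12.hasWeakGradient.unique h

theorem HasWeakGradient.sub {u u' : E n → E m} {G G' : E n → Grad n m} (h : HasWeakGradient u G)
    (h' : HasWeakGradient u' G') : HasWeakGradient (u - u') (G - G') :=
  hasWeakGradient_iff.2 fun i => (hasWeakGradient_iff.1 h i).sub (hasWeakGradient_iff.1 h' i)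

theorem HasWeakGradient.add {u u' : E n → E m} {G G' : E n → Grad n m} (h : HasWeakGradient u G)
    (h' : HasWeakGradient u' G') : HasWeakGradient (u + u') (G + G') :=
  hasWeakGradient_iff.2 fun i => (hasWeakGradient_iff.1 h i).add (hasWeakGradient_iff.1 h' i)

theorem HasWeakGradient.const_smul {u : E n → E m} {G : E n → Grad n m} (a : ℝ)
    (h : HasWeakGradient u G) : HasWeakGradient (a • u) (a • G) :=
  hasWeakGradient_iff.2 fun i => (hasWeakGradient_iff.1 h i).const_mul a

/-- The gradient of a smooth vector function. -/
def smoothGrad (φ : E n → E m) : E n → Grad n m := gradOfComp fun i => gradient fun x => φ x i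

theorem ContDiff.component {φ : E n → E m} (h : ContDiff ℝ ∞ φ) (i : Fin m) :
    ContDiff ℝ ∞ fun x => φ x i := (contDiff_piLp_apply 2).comp h

theorem hasWeakGradient_of_contDiff {φ : E n → E m} (h : ContDiff ℝ ∞ φ) :
    HasWeakGradient φ (smoothGrad φ) :=
  hasWeakGradient_iff.2 fun i => hasScalarGradient_of_contDiff (ContDiff.component h i)

theorem eLpNorm_two_sq {α F : Type*} [MeasurableSpace α] {μ : Measure α} [NormedAddCommGroup F]
    {f : α → F} (hf : MemLp f 2 μ) : eLpNorm f 2 μ ^ 2 = ENNReal.ofReal (∫ x, ‖f x‖ ^ 2 ∂μ) := by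
  rw [hf.eLpNorm_eq_integral_rpow_norm two_ne_zero ENNReal.ofNat_ne_top,
    ← ENNReal.ofReal_pow (by positivity)]
  congr 1
  have h0 : 0 ≤ ∫ x, ‖f x‖ ^ (2 : ℝ) ∂μ := integral_nonneg fun x => by positivity
  simp only [ENNReal.toReal_ofNat]
  rw [← Real.rpow_natCast, ← Real.rpow_mul h0]
  simp

/-- The square of the Sobolev norm. -/
theorem w12Norm_eq {u : E n → E m} {G : E n → Grad n m} (h : HasWeakGradient u G) :
    w12Norm u = ENNReal.ofReal (√(∫ x, ‖u x‖ ^ 2 ∂(ballMeasure n)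
      + ∫ x, ‖G x‖ ^ 2 ∂(ballMeasure n))) := by
  have h1 : 0 ≤ ∫ x, ‖u x‖ ^ 2 ∂(ballMeasure n) := integral_nonneg fun x => sq_nonneg _
  have h2 : 0 ≤ ∫ x, ‖G x‖ ^ 2 ∂(ballMeasure n) := integral_nonneg fun x => sq_nonneg _
  rw [w12Norm, eLpNorm_congr_ae h.weakGradient_ae, eLpNorm_two_sq h.1, eLpNorm_two_sq h.2.1,
    ← ENNReal.ofReal_add h1 h2, Real.sqrt_eq_rpow,
    ENNReal.ofReal_rpow_of_nonneg (by positivity) (by norm_num)]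

theorem tendsto_w12Norm_iff {ι : Type*} {l : Filter ι} {u : ι → E n → E m} {G : ι → E n → Grad n m}
    (h : ∀ k, HasWeakGradient (u k) (G k)) :
    Tendsto (fun k => w12Norm (u k)) l (𝓝 0)
      ↔ Tendsto (fun k => ∫ x, ‖u k x‖ ^ 2 ∂(ballMeasure n)
        + ∫ x, ‖G k x‖ ^ 2 ∂(ballMeasure n)) l (𝓝 0) := by
  simp only [fun k => w12Norm_eq (h k)]
  have h0 : ∀ k, 0 ≤ ∫ x, ‖u k x‖ ^ 2 ∂(ballMeasure n) + ∫ x, ‖G k x‖ ^ 2 ∂(ballMeasure n) :=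
    fun k => add_nonneg (integral_nonneg fun x => sq_nonneg _) (integral_nonneg fun x => sq_nonneg _)
  constructor
  · intro h
    have h1 := (ENNReal.tendsto_toReal ENNReal.zero_ne_top).comp h
    simp only [Function.comp_def, ENNReal.toReal_ofReal (Real.sqrt_nonneg _), ENNReal.toReal_zero] at h1
    have h2 := h1.pow 2
    simpa [Real.sq_sqrt (h0 _)] using h2
  · intro h
    have h1 := ENNReal.tendsto_ofReal h.sqrt
    simpa using h1

end Vector

/-! ### Traces and the boundary integral as a volume integral -/

section TraceIdentity
variable {n m : ℕ}

/-- The integral of `|u|²` over the sphere, expressed on the ball. -/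
def boundaryForm (u : E n → E m) (G : E n → Grad n m) : ℝ :=
  ∑ i, ((n : ℝ) * ∫ x, u x i * u x i ∂(ballMeasure n)
    + 2 * ∫ x, u x i * inner ℝ (gradComp G i x) x ∂(ballMeasure n))

theorem memLp_inner_self {g : E n → E n} (hg : MemLp g 2 (ballMeasure n)) :
    MemLp (fun x => inner ℝ (g x) x) 2 (ballMeasure n) := by
  refine MemLp.of_le hg (hg.1.inner continuous_id.aestronglyMeasurable) ?_
  filter_upwards [ae_norm_le_one n] with x hx
  exact (norm_inner_le_norm _ _).trans (mul_le_of_le_one_right (norm_nonneg _) hx)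

theorem integral_sphere_norm_sq (hn : 0 < n) {φ : E n → E m} (h : ContDiff ℝ ∞ φ) :
    ∫ θ, ‖φ θ‖ ^ 2 ∂(sphereMeasure n) = boundaryForm φ (smoothGrad φ) := by
  have hfin : IsFiniteMeasure (sphereMeasure n) := by unfold sphereMeasure; infer_instance
  have hc : ∀ i, ContDiff ℝ ∞ fun x => φ x i := fun i => ContDiff.component h i
  have e : ∀ θ : Metric.sphere (0 : E n) 1, ‖φ θ‖ ^ 2 = ∑ i, (φ θ i) ^ 2 := fun θ => by
    simp [EuclideanSpace.norm_sq_eq]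
  simp only [e]
  rw [integral_finsetSum]
  · refine Finset.sum_congr rfl fun i _ => ?_
    have h1 := integral_sphere_eq hn ((hc i).pow 2)
    rw [h1]
    have hg : MemLp (gradComp (smoothGrad φ) i) 2 (ballMeasure n) :=
      (continuous_gradient (hc i)).memLp_ball 2
    have hf : MemLp (fun x => φ x i) 2 (ballMeasure n) := (hc i).continuous.memLp_ball 2
    have h2 : ∀ x, fderiv ℝ (fun x => φ x i ^ 2) x x
        = 2 * (φ x i * inner ℝ (gradComp (smoothGrad φ) i x) x) := fun x => by
      have hd := ((hc i).differentiable (by simp) x).hasFDerivAt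
      have h3 : fderiv ℝ (fun x => φ x i) x x = inner ℝ (gradient (fun x => φ x i) x) x := by
        rw [gradient, InnerProductSpace.toDual_symm_apply]
      rw [(hd.pow 2).fderiv]
      simp only [FunLike.coe_smul, Pi.smul_apply, h3, smul_eq_mul, smoothGrad, gradComp_gradOfComp]
      ring
    simp only [h2]
    simp only [pow_two]
    rw [integral_add ((hf.mul_integrable hf).const_mul _)
      ((hf.mul_integrable (memLp_inner_self hg)).const_mul _), integral_const_mul, integral_const_mul]
  · intro i _
    have hb : Continuous fun θ : Metric.sphere (0 : E n) 1 => φ θ i ^ 2 :=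
      ((hc i).continuous.comp continuous_subtype_val).pow 2
    obtain ⟨C, hC⟩ := (isCompact_univ (X := Metric.sphere (0 : E n) 1)).exists_bound_of_continuousOn
      hb.continuousOn
    exact Integrable.of_bound hb.aestronglyMeasurable C (ae_of_all _ fun θ => hC θ (Set.mem_univ _))

theorem integral_norm_sq_eq_sum {u : E n → E m} (hu : MemLp u 2 (ballMeasure n)) :
    ∫ x, ‖u x‖ ^ 2 ∂(ballMeasure n) = ∑ i, ∫ x, u x i ^ 2 ∂(ballMeasure n) := by
  have e : ∀ x, ‖u x‖ ^ 2 = ∑ i, (u x i) ^ 2 := fun x => by simp [EuclideanSpace.norm_sq_eq]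
  simp only [e]
  exact integral_finsetSum _ fun i _ => (memLp_piLp_iff.1 hu i).integrable_sq'

theorem integral_grad_norm_sq_eq_sum {G : E n → Grad n m} (hG : MemLp G 2 (ballMeasure n)) :
    ∫ x, ‖G x‖ ^ 2 ∂(ballMeasure n) = ∑ i, ∫ x, ‖gradComp G i x‖ ^ 2 ∂(ballMeasure n) := by
  simp only [norm_sq_eq_sum_gradComp]
  exact integral_finsetSum _ fun i _ => (memLp_grad_iff.1 hG i).integrable_norm_sq

/-- A trace inequality: for smooth functions the left side is the squared norm on the sphere, so
this makes restrictions of Sobolev-convergent sequences Cauchy there. -/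
theorem boundaryForm_le {u : E n → E m} {G : E n → Grad n m} (h : HasWeakGradient u G) :
    boundaryForm u G ≤ ((n : ℝ) + 1) * (∫ x, ‖u x‖ ^ 2 ∂(ballMeasure n)
      + ∫ x, ‖G x‖ ^ 2 ∂(ballMeasure n)) := by
  rw [integral_norm_sq_eq_sum h.1, integral_grad_norm_sq_eq_sum h.2.1, boundaryForm,
    ← Finset.sum_add_distrib, Finset.mul_sum]
  refine Finset.sum_le_sum fun i _ => ?_
  have hi := hasWeakGradient_iff.1 h i
  have h1 : 2 * ∫ x, u x i * inner ℝ (gradComp G i x) x ∂(ballMeasure n)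
      ≤ ∫ x, u x i ^ 2 ∂(ballMeasure n) + ∫ x, ‖gradComp G i x‖ ^ 2 ∂(ballMeasure n) := by
    rw [← integral_const_mul, ← integral_add hi.1.integrable_sq' hi.2.1.integrable_norm_sq]
    refine integral_mono_ae ((hi.1.mul_integrable (memLp_inner_self hi.2.1)).const_mul 2)
      (hi.1.integrable_sq'.add hi.2.1.integrable_norm_sq) ?_
    filter_upwards [ae_norm_le_one n] with x hx
    have h2 : |inner ℝ (gradComp G i x) x| ≤ ‖gradComp G i x‖ :=
      (abs_real_inner_le_norm _ _).trans (mul_le_of_le_one_right (norm_nonneg _) hx)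
    have h3 : inner ℝ (gradComp G i x) x ^ 2 ≤ ‖gradComp G i x‖ ^ 2 := by
      rw [← sq_abs]; gcongr
    nlinarith [sq_nonneg (u x i - inner ℝ (gradComp G i x) x)]
  have h4 : 0 ≤ ∫ x, ‖gradComp G i x‖ ^ 2 ∂(ballMeasure n) := integral_nonneg fun x => sq_nonneg _
  have h5 : 0 ≤ (n : ℝ) * ∫ x, ‖gradComp G i x‖ ^ 2 ∂(ballMeasure n) := by positivity
  simp only [← pow_two]
  linarith

theorem tendsto_boundaryForm {ι : Type*} {l : Filter ι} {U : ι → E n → E m} {V : ι → E n → Grad n m}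
    {u : E n → E m} {G : E n → Grad n m} (hU : ∀ k, HasWeakGradient (U k) (V k))
    (hu : HasWeakGradient u G)
    (hlim : Tendsto (fun k => ∫ x, ‖(u - U k) x‖ ^ 2 ∂(ballMeasure n)
      + ∫ x, ‖(G - V k) x‖ ^ 2 ∂(ballMeasure n)) l (𝓝 0)) :
    Tendsto (fun k => boundaryForm (U k) (V k)) l (𝓝 (boundaryForm u G)) := by
  unfold boundaryForm
  refine tendsto_finsetSum _ fun i _ => ?_
  have hi := hasWeakGradient_iff.1 hu i
  have hk := fun k => hasWeakGradient_iff.1 (hU k) i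
  have nn : ∀ {β : Type} (S : Finset β) (f : β → ℝ) (i : β), (∀ i, 0 ≤ f i) → i ∈ S →
      f i ≤ ∑ i ∈ S, f i := fun S f i h hi => Finset.single_le_sum (fun i _ => h i) hi
  have l1 : Tendsto (fun k => ∫ x, (U k x i - u x i) ^ 2 ∂(ballMeasure n)) l (𝓝 0) := by
    refine squeeze_zero (fun k => integral_nonneg fun x => sq_nonneg _) (fun k => ?_) hlim
    rw [integral_norm_sq_eq_sum (hu.sub (hU k)).1]
    have h1 := nn Finset.univ (fun i => ∫ x, (u - U k) x i ^ 2 ∂(ballMeasure n)) i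
      (fun i => integral_nonneg fun x => sq_nonneg _) (Finset.mem_univ i)
    have h2 : 0 ≤ ∫ x, ‖(G - V k) x‖ ^ 2 ∂(ballMeasure n) := integral_nonneg fun x => sq_nonneg _
    have h3 : ∫ x, (U k x i - u x i) ^ 2 ∂(ballMeasure n)
        = ∫ x, (u - U k) x i ^ 2 ∂(ballMeasure n) :=
      integral_congr_ae (ae_of_all _ fun x => by
        simp only [Pi.sub_apply, PiLp.sub_apply]; ring)
    linarith
  have l2 : Tendsto (fun k => ∫ x, (inner ℝ (gradComp (V k) i x) x - inner ℝ (gradComp G i x) x) ^ 2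
      ∂(ballMeasure n)) l (𝓝 0) := by
    refine squeeze_zero (fun k => integral_nonneg fun x => sq_nonneg _) (fun k => ?_) hlim
    rw [integral_grad_norm_sq_eq_sum (hu.sub (hU k)).2.1]
    have h1 := nn Finset.univ (fun i => ∫ x, ‖gradComp (G - V k) i x‖ ^ 2 ∂(ballMeasure n)) i
      (fun i => integral_nonneg fun x => sq_nonneg _) (Finset.mem_univ i)
    have h2 : 0 ≤ ∫ x, ‖(u - U k) x‖ ^ 2 ∂(ballMeasure n) := integral_nonneg fun x => sq_nonneg _
    have hd := (hasWeakGradient_iff.1 (hu.sub (hU k)) i).2.1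
    have h3 : ∫ x, (inner ℝ (gradComp (V k) i x) x - inner ℝ (gradComp G i x) x) ^ 2 ∂(ballMeasure n)
        ≤ ∫ x, ‖gradComp (G - V k) i x‖ ^ 2 ∂(ballMeasure n) := by
      refine integral_mono_ae ?_ hd.integrable_norm_sq ?_
      · exact ((memLp_inner_self (hk k).2.1).sub (memLp_inner_self hi.2.1)).integrable_sq'
      · filter_upwards [ae_norm_le_one n] with x hx
        have e : inner ℝ (gradComp (V k) i x) x - inner ℝ (gradComp G i x) x
            = - inner ℝ (gradComp (G - V k) i x) x := by
          rw [← inner_sub_left, ← inner_neg_left]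
          congr 1
          ext j
          simp [gradComp]
        rw [e, neg_sq, ← sq_abs]
        have := (abs_real_inner_le_norm (gradComp (G - V k) i x) x).trans
          (mul_le_of_le_one_right (norm_nonneg _) hx)
        gcongr
    linarith
  exact ((tendsto_integral_mul_of_sq_sq (fun k => (hk k).1) hi.1 (fun k => (hk k).1) hi.1 l1 l1).const_mul
    _).add ((tendsto_integral_mul_of_sq_sq (fun k => (hk k).1) hi.1
      (fun k => memLp_inner_self (hk k).2.1) (memLp_inner_self hi.2.1) l1 l2).const_mul 2)

theorem memLp_sphere {φ : E n → E m} (h : Continuous φ) :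
    MemLp (fun θ : Metric.sphere (0 : E n) 1 => φ θ) 2 (sphereMeasure n) := by
  have hfin : IsFiniteMeasure (sphereMeasure n) := by unfold sphereMeasure; infer_instance
  have hb : Continuous fun θ : Metric.sphere (0 : E n) 1 => φ θ := h.comp continuous_subtype_val
  obtain ⟨C, hC⟩ := (isCompact_univ (X := Metric.sphere (0 : E n) 1)).exists_bound_of_continuousOn
    hb.continuousOn
  exact MemLp.of_bound hb.aestronglyMeasurable C (ae_of_all _ fun θ => hC θ (Set.mem_univ _))

/-- Holds for smooth functions and passes to the limit on both sides. The value does not depend on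
the trace selected in the definition of `trace`. -/
theorem IsTrace.integral_norm_sq (hn : 0 < n) {u : E n → E m} {g : Metric.sphere (0 : E n) 1 → E m}
    (h : IsTrace u g) {G : E n → Grad n m} (hu : HasWeakGradient u G) :
    ∫ θ, ‖g θ‖ ^ 2 ∂(sphereMeasure n) = boundaryForm u G := by
  obtain ⟨-, hg, φ, hφ, hlim, htr⟩ := h
  have h1 := (tendsto_w12Norm_iff fun k => hu.sub (hasWeakGradient_of_contDiff (hφ k))).1 hlim
  have h2 := tendsto_boundaryForm (fun k => hasWeakGradient_of_contDiff (hφ k)) hu h1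
  have h3 : Tendsto (fun k => (memLp_sphere (hφ k).continuous).toLp) atTop (𝓝 (hg.toLp g)) :=
    (Lp.tendsto_Lp_iff_tendsto_eLpNorm'' _ _ _ _).2 htr
  have h4 := h3.norm.pow 2
  simp only [norm_toLp_sq, integral_sphere_norm_sq hn (hφ _)] at h4
  exact tendsto_nhds_unique h4 h2

theorem exists_smooth_seq {u : E n → E m} {G : E n → Grad n m}
    (h : ∀ i, IsSmoothLimit (fun x => u x i) (gradComp G i)) :
    ∃ φ : ℕ → E n → E m, (∀ k, ContDiff ℝ ∞ (φ k)) ∧ ∀ k : ℕ,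
      ∫ x, ‖(u - φ k) x‖ ^ 2 ∂(ballMeasure n) + ∫ x, ‖(G - smoothGrad (φ k)) x‖ ^ 2 ∂(ballMeasure n)
        ≤ 1 / ((k : ℝ) + 1) := by
  have hu : HasWeakGradient u G := hasWeakGradient_iff.2 fun i => (h i).hasScalarGradient
  have key : ∀ k : ℕ, ∃ φ : E n → E m, ContDiff ℝ ∞ φ ∧
      ∫ x, ‖(u - φ) x‖ ^ 2 ∂(ballMeasure n) + ∫ x, ‖(G - smoothGrad φ) x‖ ^ 2 ∂(ballMeasure n)
        ≤ 1 / ((k : ℝ) + 1) := by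
    intro k
    -- Each of the `m` components contributes at most `2 * ε`; using `m + 1` avoids a division by
    -- zero.
    set ε : ℝ := 1 / ((k : ℝ) + 1) / (2 * ((m : ℝ) + 1)) with hε
    choose φ hc h1 h2 using fun i => (h i).2.2 ε (by positivity)
    have hcφ : ContDiff ℝ ∞ (fun x => (WithLp.toLp 2 fun i => φ i x : E m)) :=
      (contDiff_piLp 2).2 hc
    refine ⟨_, hcφ, ?_⟩
    have hd := hu.sub (hasWeakGradient_of_contDiff hcφ)
    rw [integral_norm_sq_eq_sum hd.1, integral_grad_norm_sq_eq_sum hd.2.1, ← Finset.sum_add_distrib]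
    have h3 : ∀ i, ∫ x, (u - fun x => (WithLp.toLp 2 fun i => φ i x : E m)) x i ^ 2 ∂(ballMeasure n)
        + ∫ x, ‖gradComp (G - smoothGrad fun x => (WithLp.toLp 2 fun i => φ i x : E m)) i x‖ ^ 2
          ∂(ballMeasure n) ≤ 2 * ε := fun i => by
      have e1 : ∀ x, (u - fun x => (WithLp.toLp 2 fun i => φ i x : E m)) x i ^ 2
          = (φ i x - u x i) ^ 2 := fun x => by
        simp only [Pi.sub_apply, PiLp.sub_apply]; ring
      have e2 : ∀ x, ‖gradComp (G - smoothGrad fun x => (WithLp.toLp 2 fun i => φ i x : E m)) i x‖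
          = ‖gradient (φ i) x - gradComp G i x‖ := fun x => by
        rw [norm_sub_rev]; rfl
      simp only [e1, e2]
      linarith [h1 i, h2 i]
    refine (Finset.sum_le_sum fun i _ => h3 i).trans ?_
    simp only [Finset.sum_const, Finset.card_univ, Fintype.card_fin, nsmul_eq_mul]
    have h4 : (m : ℝ) * (2 * ε) ≤ (2 * ((m : ℝ) + 1)) * ε := by
      have : 0 < ε := by positivity
      nlinarith
    refine h4.trans_eq ?_
    rw [hε]; field_simp
  choose φ h1 h2 using key
  exact ⟨φ, h1, h2⟩

/-- Guarantees that `trace` is not its default value `0`, so that `balancedEnergy` has its intended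
meaning. Restrictions of smooth approximants are Cauchy on the sphere by `boundaryForm_le`. -/
theorem exists_isTrace (hn : 0 < n) {u : E n → E m} {G : E n → Grad n m}
    (h : ∀ i, IsSmoothLimit (fun x => u x i) (gradComp G i)) : ∃ g, IsTrace u g := by
  have hu : HasWeakGradient u G := hasWeakGradient_iff.2 fun i => (h i).hasScalarGradient
  obtain ⟨φ, hc, hφ⟩ := exists_smooth_seq h
  have hw := fun k => hasWeakGradient_of_contDiff (hc k)
  have lim := tendsto_one_div_add_atTop_nhds_zero_nat (𝕜 := ℝ)
  have hb0 : ∀ k, 0 ≤ ∫ x, ‖(u - φ k) x‖ ^ 2 ∂(ballMeasure n)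
      + ∫ x, ‖(G - smoothGrad (φ k)) x‖ ^ 2 ∂(ballMeasure n) := fun k =>
    add_nonneg (integral_nonneg fun x => sq_nonneg _) (integral_nonneg fun x => sq_nonneg _)
  let Φ : ℕ → Lp (E m) 2 (sphereMeasure n) := fun k => (memLp_sphere (hc k).continuous).toLp
  have hdist : ∀ k l N : ℕ, N ≤ k → N ≤ l →
      dist (Φ k) (Φ l) ≤ √(((n : ℝ) + 1) * (4 * (1 / ((N : ℝ) + 1)))) := by
    intro k l N hk hl
    rw [dist_eq_norm]
    refine Real.le_sqrt_of_sq_le ?_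
    have e : Φ k - Φ l = (memLp_sphere ((hc k).sub (hc l)).continuous).toLp := rfl
    rw [e, norm_toLp_sq, integral_sphere_norm_sq hn ((hc k).sub (hc l))]
    refine (boundaryForm_le (hasWeakGradient_of_contDiff ((hc k).sub (hc l)))).trans ?_
    have hg := (hasWeakGradient_of_contDiff ((hc k).sub (hc l))).unique ((hw k).sub (hw l))
    have i1 := integral_add_sq_le (hu.sub (hw l)).1 ((hu.sub (hw k)).1.neg)
    have i2 := integral_add_sq_le (hu.sub (hw l)).2.1 ((hu.sub (hw k)).2.1.neg)
    have e1 : ∫ x, ‖φ k x - φ l x‖ ^ 2 ∂(ballMeasure n)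
        = ∫ x, ‖(u - φ l) x + (-(u - φ k)) x‖ ^ 2 ∂(ballMeasure n) :=
      integral_congr_ae (ae_of_all _ fun x => by
        simp only [Pi.sub_apply, Pi.neg_apply]; congr 2; abel)
    have e2 : ∫ x, ‖smoothGrad (fun x => φ k x - φ l x) x‖ ^ 2 ∂(ballMeasure n)
        = ∫ x, ‖(G - smoothGrad (φ l)) x + (-(G - smoothGrad (φ k))) x‖ ^ 2 ∂(ballMeasure n) := by
      refine integral_congr_ae ?_
      filter_upwards [hg] with x hx
      rw [hx]
      simp only [Pi.sub_apply, Pi.neg_apply]; congr 2; abel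
    rw [e1, e2]
    simp only [Pi.neg_apply, norm_neg] at i1 i2 ⊢
    have b1 : 1 / ((k : ℝ) + 1) ≤ 1 / ((N : ℝ) + 1) := by
      have : (N : ℝ) ≤ k := by exact_mod_cast hk
      gcongr
    have b2 : 1 / ((l : ℝ) + 1) ≤ 1 / ((N : ℝ) + 1) := by
      have : (N : ℝ) ≤ l := by exact_mod_cast hl
      gcongr
    refine mul_le_mul_of_nonneg_left ?_ (by positivity)
    linarith [hφ k, hφ l]
  have hlim0 : Tendsto (fun N : ℕ => √(((n : ℝ) + 1) * (4 * (1 / ((N : ℝ) + 1))))) atTop (𝓝 0) := by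
    have := ((lim.const_mul 4).const_mul ((n : ℝ) + 1)).sqrt
    simpa using this
  obtain ⟨g, hg⟩ := cauchySeq_tendsto_of_complete (cauchySeq_of_le_tendsto_0 _ hdist hlim0)
  refine ⟨g, hu.memW12, Lp.memLp g, φ, hc, ?_, ?_⟩
  · exact (tendsto_w12Norm_iff fun k => hu.sub (hw k)).2 (squeeze_zero hb0 hφ lim)
  · refine (Lp.tendsto_Lp_iff_tendsto_eLpNorm'' _ (fun k => memLp_sphere (hc k).continuous) _
      (Lp.memLp g)).1 ?_
    rw [Lp.toLp_coeFn]; exact hg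

theorem isTrace_trace {u : E n → E m} (h : ∃ g, IsTrace u g) : IsTrace u (trace u) := by
  unfold trace
  rw [dif_pos h]
  exact h.choose_spec

/-- The balanced energy in terms of integrals over the ball. -/
theorem balancedEnergy_eq (hn : 0 < n) {u : E n → E m} {G : E n → Grad n m}
    (hu : HasWeakGradient u G) (h : ∃ g, IsTrace u g) :
    balancedEnergy u = ∫ x, ‖G x‖ ^ 2 ∂(ballMeasure n) + 2 * ∫ x, ‖u x‖ ∂(ballMeasure n)
      - 2 * boundaryForm u G := by
  unfold balancedEnergy
  rw [(isTrace_trace h).integral_norm_sq hn hu, integral_add hu.memW12.hasWeakGradient.2.1.integrable_norm_sq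
    ((hu.1.integrable (by norm_num)).norm.const_mul 2), integral_const_mul]
  congr 2
  exact integral_congr_ae (hu.weakGradient_ae.mono fun x hx => by simp only [hx])

end TraceIdentity

/-! ### Perturbation by cut off maps -/

section Competitor
variable {n m : ℕ}

/-- The gradient of the cutoff. -/
def cutoffGrad (x : E n) : E n := (2 * deriv radialBump (‖x‖ ^ 2)) • x

theorem continuous_cutoffGrad : Continuous (cutoffGrad : E n → E n) :=
  (continuous_const.mul (continuous_deriv_radialBump.comp (continuous_norm.pow 2))).smul continuous_id

theorem inner_cutoffGrad (x b : E n) : inner ℝ (cutoffGrad x) b = fderiv ℝ cutoff x b := by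
  rw [fderiv_cutoff, cutoffGrad, real_inner_smul_left]

theorem exists_bound_cutoffGrad (n : ℕ) :
    ∃ C, 0 ≤ C ∧ ∀ x : E n, ‖x‖ ≤ 1 → ‖cutoffGrad x‖ ≤ C := by
  obtain ⟨C, hC⟩ := ContDiff.bounded_on_ball (continuous_cutoffGrad (n := n))
  exact ⟨C, (norm_nonneg _).trans (hC 0 (by simp)), hC⟩

theorem memLp_cutoff_smul {F : Type*} [NormedAddCommGroup F] [NormedSpace ℝ F] {g : E n → F}
    (hg : MemLp g 2 (ballMeasure n)) : MemLp (fun x => cutoff x • g x) 2 (ballMeasure n) := by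
  refine MemLp.of_le hg (isTest_cutoff.1.continuous.aestronglyMeasurable.smul hg.1)
    (ae_of_all _ fun x => ?_)
  rw [norm_smul, Real.norm_of_nonneg (cutoff_nonneg x)]
  exact mul_le_of_le_one_left (norm_nonneg _) (cutoff_le_one x)

theorem memLp_smul_cutoffGrad {f : E n → ℝ} (hf : MemLp f 2 (ballMeasure n)) :
    MemLp (fun x => f x • cutoffGrad x) 2 (ballMeasure n) := by
  obtain ⟨C, -, hC⟩ := exists_bound_cutoffGrad n
  refine MemLp.of_le_mul (c := C) hf (hf.1.smul continuous_cutoffGrad.aestronglyMeasurable) ?_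
  filter_upwards [ae_norm_le_one n] with x hx
  rw [norm_smul, mul_comm]
  exact mul_le_mul_of_nonneg_right (hC x hx) (norm_nonneg _)

theorem HasScalarGradient.cutoff_mul {f : E n → ℝ} {g : E n → E n} (h : HasScalarGradient f g) :
    HasScalarGradient (fun x => cutoff x * f x) (fun x => cutoff x • g x + f x • cutoffGrad x) := by
  have m1 := memLp_cutoff_smul h.2.1
  have m2 := memLp_smul_cutoffGrad h.1
  refine ⟨memLp_cutoff_smul h.1, m1.add m2, fun φ hφ b => ?_⟩
  have h1 := h.2.2 _ (hφ.mul_right isTest_cutoff.1) b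
  have i1 : Integrable (fun x => φ x * inner ℝ (cutoff x • g x) b) (ballMeasure n) :=
    (hφ.memLp 2).mul_integrable (m1.inner_const b)
  have i2 : Integrable (fun x => φ x * inner ℝ (f x • cutoffGrad x) b) (ballMeasure n) :=
    (hφ.memLp 2).mul_integrable (m2.inner_const b)
  have i3 : Integrable (fun x => fderiv ℝ φ x b * (cutoff x * f x)) (ballMeasure n) :=
    ((hφ.fderiv_apply b).memLp 2).mul_integrable (memLp_cutoff_smul h.1)
  have e1 : ∀ x, fderiv ℝ (fun x => φ x * cutoff x) x b * f x
      = fderiv ℝ φ x b * (cutoff x * f x) + φ x * inner ℝ (f x • cutoffGrad x) b := fun x => by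
    rw [fderiv_fun_mul (hφ.1.differentiable (by simp) x) (isTest_cutoff.1.differentiable (by simp) x),
      real_inner_smul_left, inner_cutoffGrad]
    simp only [add_apply, FunLike.coe_smul, Pi.smul_apply, smul_eq_mul]
    ring
  simp only [e1] at h1
  rw [integral_add i3 i2] at h1
  simp only [inner_add_left, mul_add]
  rw [integral_add i1 i2]
  have e2 : ∫ x, φ x * cutoff x * inner ℝ (g x) b ∂(ballMeasure n)
      = ∫ x, φ x * inner ℝ (cutoff x • g x) b ∂(ballMeasure n) :=
    integral_congr_ae (ae_of_all _ fun x => by beta_reduce; rw [real_inner_smul_left]; ring)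
  linarith

/-- The gradient of `cutoff • w`. -/
def cutGrad (w : E n → E m) (G : E n → Grad n m) : E n → Grad n m :=
  gradOfComp fun i x => cutoff x • gradComp G i x + w x i • cutoffGrad x

theorem HasWeakGradient.cutoff_smul {w : E n → E m} {G : E n → Grad n m} (h : HasWeakGradient w G) :
    HasWeakGradient (fun x => cutoff x • w x) (cutGrad w G) :=
  hasWeakGradient_iff.2 fun i => (hasWeakGradient_iff.1 h i).cutoff_mul

/-- The estimate is made component by component, so its constant depends on `n` only. -/
theorem exists_bound_cutGrad (n : ℕ) : ∃ C, 0 < C ∧ ∀ (m : ℕ) (w : E n → E m) (G : E n → Grad n m),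
    HasWeakGradient w G → ∫ x, ‖cutGrad w G x‖ ^ 2 ∂(ballMeasure n)
      ≤ C * (∫ x, ‖w x‖ ^ 2 ∂(ballMeasure n) + ∫ x, ‖G x‖ ^ 2 ∂(ballMeasure n)) := by
  obtain ⟨C, hC0, hC⟩ := exists_bound_cutoffGrad n
  refine ⟨2 * C ^ 2 + 2, by positivity, fun m w G h => ?_⟩
  rw [integral_grad_norm_sq_eq_sum h.cutoff_smul.2.1, integral_norm_sq_eq_sum h.1,
    integral_grad_norm_sq_eq_sum h.2.1, ← Finset.sum_add_distrib, Finset.mul_sum]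
  refine Finset.sum_le_sum fun i _ => ?_
  have hi := hasWeakGradient_iff.1 h i
  rw [← integral_add hi.1.integrable_sq' hi.2.1.integrable_norm_sq, ← integral_const_mul]
  refine integral_mono_ae hi.cutoff_mul.2.1.integrable_norm_sq
    ((hi.1.integrable_sq'.add hi.2.1.integrable_norm_sq).const_mul _) ?_
  filter_upwards [ae_norm_le_one n] with x hx
  simp only [cutGrad, gradComp_gradOfComp]
  have h1 : ‖cutoff x • gradComp G i x + w x i • cutoffGrad x‖ ≤ ‖gradComp G i x‖ + |w x i| * C := by
    refine (norm_add_le _ _).trans (add_le_add ?_ ?_)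
    · rw [norm_smul, Real.norm_of_nonneg (cutoff_nonneg x)]
      exact mul_le_of_le_one_left (norm_nonneg _) (cutoff_le_one x)
    · rw [norm_smul, Real.norm_eq_abs]
      exact mul_le_mul_of_nonneg_left (hC x hx) (abs_nonneg _)
  have h2 : ‖cutoff x • gradComp G i x + w x i • cutoffGrad x‖ ^ 2
      ≤ (‖gradComp G i x‖ + |w x i| * C) ^ 2 := by gcongr
  have h3 : |w x i| ^ 2 = w x i ^ 2 := sq_abs _
  nlinarith [sq_nonneg (‖gradComp G i x‖ - |w x i| * C), sq_nonneg (w x i), sq_nonneg ‖gradComp G i x‖,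
    sq_nonneg C, mul_nonneg (sq_nonneg C) (sq_nonneg ‖gradComp G i x‖)]

theorem integral_cutoff_smul_sq_le {w : E n → E m} (hw : MemLp w 2 (ballMeasure n)) :
    ∫ x, ‖cutoff x • w x‖ ^ 2 ∂(ballMeasure n) ≤ ∫ x, ‖w x‖ ^ 2 ∂(ballMeasure n) := by
  refine integral_mono (memLp_cutoff_smul hw).integrable_norm_sq hw.integrable_norm_sq fun x => ?_
  simp only
  rw [norm_smul, Real.norm_of_nonneg (cutoff_nonneg x)]
  have := mul_le_of_le_one_left (norm_nonneg (w x)) (cutoff_le_one x)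
  have h0 := mul_nonneg (cutoff_nonneg x) (norm_nonneg (w x))
  gcongr

theorem tendsto_w12Norm_cutoff {w : E n → E m} {G : E n → Grad n m} (hw : HasWeakGradient w G)
    {φ : ℕ → E n → E m} (hc : ∀ k, ContDiff ℝ ∞ (φ k))
    (hlim : Tendsto (fun k => w12Norm (w - φ k)) atTop (𝓝 0)) :
    Tendsto (fun k => w12Norm ((fun x => cutoff x • w x) - fun x => cutoff x • φ k x)) atTop (𝓝 0) := by
  have hd := fun k => hw.sub (hasWeakGradient_of_contDiff (hc k))
  have e : ∀ k, ((fun x => cutoff x • w x) - fun x => cutoff x • φ k x)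
      = fun x => cutoff x • (w - φ k) x := fun k => by
    funext x; simp [smul_sub]
  simp only [e]
  obtain ⟨C, hC0, hC⟩ := exists_bound_cutGrad n
  have h1 := (tendsto_w12Norm_iff hd).1 hlim
  refine (tendsto_w12Norm_iff fun k => (hd k).cutoff_smul).2 ?_
  have h2 := h1.const_mul (1 + C)
  rw [mul_zero] at h2
  refine squeeze_zero (fun k => add_nonneg (integral_nonneg fun x => sq_nonneg _)
    (integral_nonneg fun x => sq_nonneg _)) (fun k => ?_) h2
  have a1 := integral_cutoff_smul_sq_le (hd k).1
  have a2 := hC m _ _ (hd k)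
  have a3 : 0 ≤ ∫ x, ‖(G - smoothGrad (φ k)) x‖ ^ 2 ∂(ballMeasure n) :=
    integral_nonneg fun x => sq_nonneg _
  linarith

theorem exists_smooth_approx {w : E n → E m} {G : E n → Grad n m}
    (h : ∀ i, IsSmoothLimit (fun x => w x i) (gradComp G i)) :
    ∃ φ : ℕ → E n → E m, (∀ k, ContDiff ℝ ∞ (φ k)) ∧
      Tendsto (fun k => w12Norm (w - φ k)) atTop (𝓝 0) := by
  have hw : HasWeakGradient w G := hasWeakGradient_iff.2 fun i => (h i).hasScalarGradient
  obtain ⟨φ, hc, hφ⟩ := exists_smooth_seq h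
  refine ⟨φ, hc, (tendsto_w12Norm_iff fun k => hw.sub (hasWeakGradient_of_contDiff (hc k))).2 ?_⟩
  exact squeeze_zero (fun k => add_nonneg (integral_nonneg fun x => sq_nonneg _)
    (integral_nonneg fun x => sq_nonneg _)) hφ tendsto_one_div_add_atTop_nhds_zero_nat

/-- Cut off Sobolev functions vanish on the boundary. -/
theorem memW012_cutoff_smul {w : E n → E m} {G : E n → Grad n m}
    (h : ∀ i, IsSmoothLimit (fun x => w x i) (gradComp G i)) :
    MemW012 fun x => cutoff x • w x := by
  have hw : HasWeakGradient w G := hasWeakGradient_iff.2 fun i => (h i).hasScalarGradient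
  obtain ⟨φ, hc, hφ⟩ := exists_smooth_approx h
  refine ⟨hw.cutoff_smul.memW12, fun k x => cutoff x • φ k x, fun k => ⟨?_, ?_, ?_⟩,
    tendsto_w12Norm_cutoff hw hc hφ⟩
  · exact isTest_cutoff.1.smul (hc k)
  · exact isTest_cutoff.2.1.smul_right
  · exact (tsupport_smul_subset_left _ _).trans isTest_cutoff.2.2

/-- Adding a cut off function does not change the trace. -/
theorem IsTrace.add_cutoff {u w : E n → E m} {G : E n → Grad n m} {g : Metric.sphere (0 : E n) 1 → E m}
    (hu : IsTrace u g) (h : ∀ i, IsSmoothLimit (fun x => w x i) (gradComp G i)) :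
    IsTrace (u + fun x => cutoff x • w x) g := by
  have hw : HasWeakGradient w G := hasWeakGradient_iff.2 fun i => (h i).hasScalarGradient
  obtain ⟨φ, hc, hφ⟩ := exists_smooth_approx h
  obtain ⟨hm, hg, ψ, hψ, hlim, htr⟩ := hu
  have hu' := hm.hasWeakGradient
  have hcut : ∀ k, ContDiff ℝ ∞ fun x => cutoff x • φ k x := fun k => isTest_cutoff.1.smul (hc k)
  refine ⟨(hu'.add hw.cutoff_smul).memW12, hg, fun k => ψ k + fun x => cutoff x • φ k x,
    fun k => (hψ k).add (hcut k), ?_, ?_⟩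
  · have d1 := fun k => hu'.sub (hasWeakGradient_of_contDiff (hψ k))
    have d2 := fun k => hw.cutoff_smul.sub (hasWeakGradient_of_contDiff (hcut k))
    have e : ∀ k, (u + fun x => cutoff x • w x) - (ψ k + fun x => cutoff x • φ k x)
        = (u - ψ k) + ((fun x => cutoff x • w x) - fun x => cutoff x • φ k x) := fun k => by abel
    simp only [e]
    have l1 := (tendsto_w12Norm_iff d1).1 hlim
    have l2 := (tendsto_w12Norm_iff d2).1 (tendsto_w12Norm_cutoff hw hc hφ)
    refine (tendsto_w12Norm_iff fun k => (d1 k).add (d2 k)).2 ?_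
    have l3 := (l1.add l2).const_mul 2
    rw [add_zero, mul_zero] at l3
    refine squeeze_zero (fun k => add_nonneg (integral_nonneg fun x => sq_nonneg _)
      (integral_nonneg fun x => sq_nonneg _)) (fun k => ?_) l3
    have a1 := integral_add_sq_le (d1 k).1 (d2 k).1
    have a2 := integral_add_sq_le (d1 k).2.1 (d2 k).2.1
    refine (add_le_add a1 a2).trans_eq ?_
    ring
  · refine htr.congr fun k => ?_
    congr 1
    funext θ
    have hθ : ‖(θ : E n)‖ = 1 := by simp
    have h0 : cutoff (θ : E n) = 0 := by
      unfold cutoff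
      rw [hθ]
      exact radialBump_eq_zero (Or.inr (by norm_num))
    simp [h0]

/-- The energy of a perturbation by a cut off function. -/
theorem balancedEnergy_add_cutoff (hn : 0 < n) {u w : E n → E m} {G W : E n → Grad n m}
    (hu : ∀ i, IsSmoothLimit (fun x => u x i) (gradComp G i))
    (hw : ∀ i, IsSmoothLimit (fun x => w x i) (gradComp W i)) :
    balancedEnergy (u + fun x => cutoff x • w x) = balancedEnergy u
      + (∫ x, ‖G x + cutGrad w W x‖ ^ 2 ∂(ballMeasure n) - ∫ x, ‖G x‖ ^ 2 ∂(ballMeasure n))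
      + 2 * (∫ x, ‖u x + cutoff x • w x‖ ∂(ballMeasure n) - ∫ x, ‖u x‖ ∂(ballMeasure n)) := by
  have hu' : HasWeakGradient u G := hasWeakGradient_iff.2 fun i => (hu i).hasScalarGradient
  have hw' : HasWeakGradient w W := hasWeakGradient_iff.2 fun i => (hw i).hasScalarGradient
  obtain ⟨g, hg⟩ := exists_isTrace hn hu
  have hv := hu'.add hw'.cutoff_smul
  rw [balancedEnergy_eq hn hu' ⟨g, hg⟩, balancedEnergy_eq hn hv ⟨g, hg.add_cutoff hw⟩,
    ← hg.integral_norm_sq hn hu', ← (hg.add_cutoff hw).integral_norm_sq hn hv]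
  simp only [Pi.add_apply]
  ring

end Competitor

/-! ### The energy of homogeneous maps and its first variation -/

section HomogeneousMap
variable {n m : ℕ}

/-- A `2`-homogeneous Sobolev map with its gradient. -/
def IsHomogeneousMap (u : E n → E m) (G : E n → Grad n m) : Prop :=
  ∀ i, IsHomogeneousPair (fun x => u x i) (gradComp G i)

/-- The bilinear form of the balanced energy on `2`-homogeneous maps. -/
def energyPair (u : E n → E m) (G : E n → Grad n m) (w : E n → E m) (W : E n → Grad n m) : ℝ :=
  ∫ x, inner ℝ (G x) (W x) ∂(ballMeasure n)
    - 2 * ((n : ℝ) + 4) * ∫ x, inner ℝ (u x) (w x) ∂(ballMeasure n)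

theorem inner_grad_eq_sum (G W : E n → Grad n m) (x : E n) :
    inner ℝ (G x) (W x) = ∑ i, inner ℝ (gradComp G i x) (gradComp W i x) := by
  simp only [PiLp.inner_apply, gradComp]
  rw [Finset.sum_comm]

theorem IsHomogeneousMap.hasWeakGradient {u : E n → E m} {G : E n → Grad n m}
    (h : IsHomogeneousMap u G) : HasWeakGradient u G := hasWeakGradient_iff.2 fun i => (h i).1

theorem IsHomogeneousMap.isSmoothLimit (hn : 0 < n) {u : E n → E m} {G : E n → Grad n m}
    (h : IsHomogeneousMap u G) (i : Fin m) : IsSmoothLimit (fun x => u x i) (gradComp G i) :=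
  (h i).isSmoothLimit hn

theorem IsHomogeneousMap.sub {u w : E n → E m} {G W : E n → Grad n m}
    (h : IsHomogeneousMap u G) (h' : IsHomogeneousMap w W) : IsHomogeneousMap (u - w) (G - W) :=
  fun i => (h i).sub (h' i)

theorem IsHomogeneousMap.const_smul {u : E n → E m} {G : E n → Grad n m} (a : ℝ)
    (h : IsHomogeneousMap u G) : IsHomogeneousMap (a • u) (a • G) := fun i => (h i).const_mul a

theorem IsHomogeneousMap.aehomog {u : E n → E m} {G : E n → Grad n m} (h : IsHomogeneousMap u G) :
    AEHomog 2 u := fun t h0 h1 => by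
  filter_upwards [ae_all_iff.2 fun i => (h i).2 t h0 h1] with x hx
  ext i
  simpa using hx i

theorem IsHomogeneousTwo.isHomogeneousMap {u : E n → E m} {G : E n → Grad n m}
    (h : IsHomogeneousTwo u) (hG : HasWeakGradient u G) : IsHomogeneousMap u G := fun i =>
  ⟨hasWeakGradient_iff.1 hG i, fun t h0 h1 => by
    filter_upwards [ae_mem_unitBall n] with x hx
    simp [h x hx t h0 h1]⟩

theorem energyPair_eq_sum {u w : E n → E m} {G W : E n → Grad n m} (h : HasWeakGradient u G)
    (h' : HasWeakGradient w W) : energyPair u G w W =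
      ∑ i, (∫ x, inner ℝ (gradComp G i x) (gradComp W i x) ∂(ballMeasure n)
        - 2 * ((n : ℝ) + 4) * ∫ x, u x i * w x i ∂(ballMeasure n)) := by
  have h1 := hasWeakGradient_iff.1 h
  have h2 := hasWeakGradient_iff.1 h'
  have e : ∀ x, inner ℝ (u x) (w x) = ∑ i, u x i * w x i := fun x => by
    simp [PiLp.inner_apply, mul_comm]
  simp only [energyPair, inner_grad_eq_sum, e]
  rw [integral_finsetSum _ fun i _ => (h1 i).2.1.inner_integrable (h2 i).2.1,
    integral_finsetSum _ fun i _ => (h1 i).1.mul_integrable (h2 i).1, Finset.mul_sum,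
    Finset.sum_sub_distrib]

theorem energyPair_self_eq_sum {u : E n → E m} {G : E n → Grad n m} (h : HasWeakGradient u G) :
    energyPair u G u G = ∑ i, quad (fun x => u x i) (gradComp G i) := by
  rw [energyPair_eq_sum h h]
  simp only [quad, real_inner_self_eq_norm_sq, pow_two]

theorem energyPair_comm (u w : E n → E m) (G W : E n → Grad n m) :
    energyPair u G w W = energyPair w W u G := by
  simp only [energyPair, real_inner_comm]

theorem energyPair_add_left {u₁ u₂ w : E n → E m} {G₁ G₂ W : E n → Grad n m}
    (h₁ : HasWeakGradient u₁ G₁) (h₂ : HasWeakGradient u₂ G₂) (h : HasWeakGradient w W) :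
    energyPair (u₁ + u₂) (G₁ + G₂) w W = energyPair u₁ G₁ w W + energyPair u₂ G₂ w W := by
  simp only [energyPair, Pi.add_apply, inner_add_left]
  rw [integral_add (h₁.2.1.inner_integrable h.2.1) (h₂.2.1.inner_integrable h.2.1),
    integral_add (h₁.1.inner_integrable h.1) (h₂.1.inner_integrable h.1)]
  ring

theorem energyPair_smul_left (a : ℝ) (u w : E n → E m) (G W : E n → Grad n m) :
    energyPair (a • u) (a • G) w W = a * energyPair u G w W := by
  simp only [energyPair, Pi.smul_apply, real_inner_smul_left, integral_const_mul]
  ring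

theorem energyPair_add_right {u₁ u₂ w : E n → E m} {G₁ G₂ W : E n → Grad n m}
    (h₁ : HasWeakGradient u₁ G₁) (h₂ : HasWeakGradient u₂ G₂) (h : HasWeakGradient w W) :
    energyPair w W (u₁ + u₂) (G₁ + G₂) = energyPair w W u₁ G₁ + energyPair w W u₂ G₂ := by
  simp only [energyPair_comm w _ W _, energyPair_add_left h₁ h₂ h]

theorem energyPair_smul_right (a : ℝ) (u w : E n → E m) (G W : E n → Grad n m) :
    energyPair w W (a • u) (a • G) = a * energyPair w W u G := by
  simp only [energyPair_comm w _ W _, energyPair_smul_left]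

/-- The balanced energy of a `2`-homogeneous map. -/
theorem IsHomogeneousMap.balancedEnergy_eq (hn : 0 < n) {u : E n → E m} {G : E n → Grad n m}
    (h : IsHomogeneousMap u G) :
    balancedEnergy u = energyPair u G u G + 2 * ∫ x, ‖u x‖ ∂(ballMeasure n) := by
  have hw := h.hasWeakGradient
  rw [_root_.balancedEnergy_eq hn hw (exists_isTrace hn (h.isSmoothLimit hn))]
  -- By Euler's identity the radial derivative in `boundaryForm` is twice the function: `n + 2 · 2 =
  -- n + 4`.
  have e : boundaryForm u G = ((n : ℝ) + 4) * ∫ x, inner ℝ (u x) (u x) ∂(ballMeasure n) := by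
    simp only [real_inner_self_eq_norm_sq]
    rw [integral_norm_sq_eq_sum hw.1, Finset.mul_sum, boundaryForm]
    refine Finset.sum_congr rfl fun i _ => ?_
    have h1 : ∫ x, u x i * inner ℝ (gradComp G i x) x ∂(ballMeasure n)
        = 2 * ∫ x, u x i ^ 2 ∂(ballMeasure n) := by
      rw [← integral_const_mul]
      refine integral_congr_ae ?_
      filter_upwards [(h i).euler] with x hx
      rw [hx]; ring
    rw [h1]
    simp only [← pow_two]
    ring
  rw [e, energyPair]
  simp only [real_inner_self_eq_norm_sq]
  ring

/-- The product rule gives two terms: the cutoff itself multiplies a function of degree two, and its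
derivative, paired with `g` by Euler's identity, gives `2 f k` with the weight of mass `-(n + 4) *
cutoffMass n`. An interior variation thus sees the full form, boundary term included. -/
theorem IsHomogeneousPair.integral_inner_cutoff {f k : E n → ℝ} {g l : E n → E n}
    (h : IsHomogeneousPair f g) (h' : IsHomogeneousPair k l) :
    ∫ x, inner ℝ (g x) (cutoff x • l x + k x • cutoffGrad x) ∂(ballMeasure n)
      = cutoffMass n * (∫ x, inner ℝ (g x) (l x) ∂(ballMeasure n)
        - 2 * ((n : ℝ) + 4) * ∫ x, f x * k x ∂(ballMeasure n)) := by
  have i1 := h.1.2.1.inner_integrable h'.1.2.1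
  have i2 := h.1.1.mul_integrable h'.1.1
  simp only [inner_add_right]
  rw [integral_add (h.1.2.1.inner_integrable (memLp_cutoff_smul h'.1.2.1))
    (h.1.2.1.inner_integrable (memLp_smul_cutoffGrad h'.1.1))]
  have e1 : ∫ x, inner ℝ (g x) (cutoff x • l x) ∂(ballMeasure n)
      = cutoffMass n * ∫ x, inner ℝ (g x) (l x) ∂(ballMeasure n) := by
    simp only [real_inner_smul_right]
    exact integral_cutoff_mul (h.gradient_homog.inner h'.gradient_homog) i1
  have e2 : ∫ x, inner ℝ (g x) (k x • cutoffGrad x) ∂(ballMeasure n)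
      = 2 * ∫ x, 2 * deriv radialBump (‖x‖ ^ 2) * (f x * k x) ∂(ballMeasure n) := by
    rw [← integral_const_mul]
    refine integral_congr_ae ?_
    filter_upwards [h.euler] with x hx
    rw [cutoffGrad, real_inner_smul_right, real_inner_smul_right, hx]
    ring
  rw [e1, e2, integral_deriv_cutoff_mul (h.2.mul h'.2) i2]
  push_cast
  ring

theorem IsHomogeneousMap.integral_inner_cutGrad {u w : E n → E m} {G W : E n → Grad n m}
    (h : IsHomogeneousMap u G) (h' : IsHomogeneousMap w W) :
    ∫ x, inner ℝ (G x) (cutGrad w W x) ∂(ballMeasure n) = cutoffMass n * energyPair u G w W := by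
  rw [energyPair_eq_sum h.hasWeakGradient h'.hasWeakGradient, Finset.mul_sum]
  simp only [inner_grad_eq_sum]
  exact (integral_finsetSum _ fun i _ => (h i).1.2.1.inner_integrable (h' i).1.cutoff_mul.2.1).trans
    (Finset.sum_congr rfl fun i _ => (h i).integral_inner_cutoff (h' i))

theorem cutGrad_const_smul (a : ℝ) (w : E n → E m) (W : E n → Grad n m) :
    cutGrad (a • w) (a • W) = a • cutGrad w W := by
  funext x
  ext j i
  simp only [cutGrad, gradOfComp, gradComp, Pi.smul_apply, PiLp.smul_apply, PiLp.add_apply,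
    smul_eq_mul]
  ring

/-- Convexity of the norm: the perturbed value is a convex combination of `u` and `u + w` with
weight `ε * cutoff x`. The difference of the norms is homogeneous of degree two, so the cutoff again
factors out. -/
theorem IsHomogeneousMap.integral_norm_add_cutoff_le {u w : E n → E m} {G W : E n → Grad n m}
    (h : IsHomogeneousMap u G) (h' : IsHomogeneousMap w W) {ε : ℝ} (h0 : 0 ≤ ε) (h1 : ε ≤ 1) :
    ∫ x, ‖u x + cutoff x • (ε • w) x‖ ∂(ballMeasure n) ≤ ∫ x, ‖u x‖ ∂(ballMeasure n)
      + ε * cutoffMass n * (∫ x, ‖u x + w x‖ ∂(ballMeasure n) - ∫ x, ‖u x‖ ∂(ballMeasure n)) := by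
  have hu := h.hasWeakGradient.1
  have hw := h'.hasWeakGradient.1
  have iu : Integrable (fun x => ‖u x‖) (ballMeasure n) := (hu.integrable (by norm_num)).norm
  have iuw : Integrable (fun x => ‖u x + w x‖) (ballMeasure n) :=
    ((hu.add hw).integrable (by norm_num)).norm
  have hH : AEHomog 2 fun x => ‖u x + w x‖ - ‖u x‖ := (h.aehomog.add h'.aehomog).norm.sub h.aehomog.norm
  rw [← integral_sub iuw iu, mul_assoc, ← integral_cutoff_mul hH (iuw.sub iu), ← integral_const_mul]
  have ic : Integrable (fun x => ε * (cutoff x * (‖u x + w x‖ - ‖u x‖))) (ballMeasure n) := by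
    have m1 : MemLp (fun x => ‖u x + w x‖ - ‖u x‖) 2 (ballMeasure n) := (hu.add hw).norm.sub hu.norm
    exact ((memLp_cutoff_smul m1).integrable (by norm_num)).const_mul ε
  rw [← integral_add iu ic]
  refine integral_mono ((hu.add (memLp_cutoff_smul (hw.const_smul ε))).integrable
    (by norm_num)).norm (iu.add ic) fun x => ?_
  have c0 : 0 ≤ ε * cutoff x := mul_nonneg h0 (cutoff_nonneg x)
  have c1 : ε * cutoff x ≤ 1 := mul_le_one₀ h1 (cutoff_nonneg x) (cutoff_le_one x)
  have e : u x + cutoff x • (ε • w) x = (1 - ε * cutoff x) • u x + (ε * cutoff x) • (u x + w x) := by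
    simp only [Pi.smul_apply, smul_smul]
    module
  simp only [e]
  refine (norm_add_le _ _).trans (le_of_eq ?_)
  rw [norm_smul, norm_smul, Real.norm_of_nonneg c0, Real.norm_of_nonneg (sub_nonneg.2 c1)]
  ring

/-- The energy along a cut off direction, to second order. -/
theorem IsHomogeneousMap.balancedEnergy_add_cutoff_le (hn : 0 < n) {u w : E n → E m}
    {G W : E n → Grad n m} (h : IsHomogeneousMap u G) (h' : IsHomogeneousMap w W) {ε : ℝ}
    (h0 : 0 ≤ ε) (h1 : ε ≤ 1) :
    balancedEnergy (u + fun x => cutoff x • (ε • w) x) ≤ balancedEnergy u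
      + ε * cutoffMass n * (2 * energyPair u G w W
        + 2 * (∫ x, ‖u x + w x‖ ∂(ballMeasure n) - ∫ x, ‖u x‖ ∂(ballMeasure n)))
      + ε ^ 2 * ∫ x, ‖cutGrad w W x‖ ^ 2 ∂(ballMeasure n) := by
  rw [balancedEnergy_add_cutoff hn (h.isSmoothLimit hn) ((h'.const_smul ε).isSmoothLimit hn),
    integral_norm_add_sq h.hasWeakGradient.2.1 (h'.const_smul ε).hasWeakGradient.cutoff_smul.2.1,
    h.integral_inner_cutGrad (h'.const_smul ε), energyPair_smul_right, cutGrad_const_smul]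
  simp only [Pi.smul_apply, norm_smul, mul_pow, Real.norm_eq_abs, sq_abs]
  rw [integral_const_mul]
  have := h.integral_norm_add_cutoff_le h' h0 h1
  simp only [Pi.smul_apply] at this
  linarith

end HomogeneousMap

/-! ### Energy pairings with half-plane solutions -/

section HalfPlane
variable {n m : ℕ}

/-- The gradient of `halfPlane ν e`. -/
def halfPlaneGrad (ν : E n) (e : E m) : E n → Grad n m :=
  gradOfComp fun i x => e i • posInner ν x • ν

theorem halfPlane_apply (ν : E n) (e : E m) (x : E n) :
    halfPlane ν e x = (posInner ν x ^ 2 / 2) • e := rfl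

theorem isHomogeneousMap_halfPlane (ν : E n) (e : E m) :
    IsHomogeneousMap (halfPlane ν e) (halfPlaneGrad ν e) := fun i => by
  have h := (isHomogeneousPair_posInner_sq ν).const_mul (e i)
  have e1 : (fun x => halfPlane ν e x i) = fun x => e i * (posInner ν x ^ 2 / 2) := by
    funext x; simp [halfPlane_apply, mul_comm]
  rw [e1]
  exact h

theorem integral_halfInd_mul_inner {w : E n → E m} (hw : MemLp w 2 (ballMeasure n)) (ν : E n) (e : E m) :
    ∫ x, halfInd ν x * inner ℝ (w x) e ∂(ballMeasure n)
      = ∑ i, e i * ∫ x, halfInd ν x * w x i ∂(ballMeasure n) := by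
  have h : ∀ i, Integrable (fun x => halfInd ν x * w x i) (ballMeasure n) := fun i =>
    (memLp_halfInd_mul ν (memLp_piLp_iff.1 hw i)).integrable (by norm_num)
  simp only [← integral_const_mul]
  rw [← integral_finsetSum _ fun i _ => (h i).const_mul _]
  refine integral_congr_ae (ae_of_all _ fun x => ?_)
  simp only [PiLp.inner_apply, Finset.mul_sum]
  exact Finset.sum_congr rfl fun i _ => by simp; ring

/-- The scalar pairing applied to each component; this is the vector form of the equation satisfied
by the half-plane solution. -/
theorem IsHomogeneousMap.energyPair_halfPlane {w : E n → E m} {W : E n → Grad n m}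
    (h : IsHomogeneousMap w W) {ν : E n} (hν : ‖ν‖ = 1) (e : E m) :
    energyPair w W (halfPlane ν e) (halfPlaneGrad ν e)
      = - ∫ x, halfInd ν x * inner ℝ (w x) e ∂(ballMeasure n) := by
  rw [energyPair_eq_sum h.hasWeakGradient (isHomogeneousMap_halfPlane ν e).hasWeakGradient,
    integral_halfInd_mul_inner h.hasWeakGradient.1, ← Finset.sum_neg_distrib]
  refine Finset.sum_congr rfl fun i _ => ?_
  have h1 := quad_pairing (h i) hν
  have e1 : ∀ x, inner ℝ (gradComp W i x) (gradComp (halfPlaneGrad ν e) i x)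
      = e i * inner ℝ (gradComp W i x) (posInner ν x • ν) := fun x => by
    rw [← real_inner_smul_right]; rfl
  have e2 : ∀ x, w x i * halfPlane ν e x i = e i * (w x i * (posInner ν x ^ 2 / 2)) := fun x => by
    simp only [halfPlane_apply, PiLp.smul_apply, smul_eq_mul]; ring
  simp only [e1, e2, integral_const_mul]
  linear_combination e i * h1

theorem integral_halfInd_mul_posInner_sq (ν : E n) :
    ∫ x, halfInd ν x * (posInner ν x ^ 2 / 2) ∂(ballMeasure n) = halfMass ν := by
  refine integral_congr_ae (ae_of_all _ fun x => ?_)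
  simp only [← mul_div_assoc, halfInd_mul_posInner_sq]

theorem inner_halfPlane (ν : E n) {e : E m} (he : ‖e‖ = 1) (x : E n) :
    inner ℝ (halfPlane ν e x) e = posInner ν x ^ 2 / 2 := by
  rw [halfPlane_apply, real_inner_smul_left, real_inner_self_eq_norm_sq, he]; ring

theorem norm_halfPlane (ν : E n) {e : E m} (he : ‖e‖ = 1) (x : E n) :
    ‖halfPlane ν e x‖ = posInner ν x ^ 2 / 2 := by
  rw [halfPlane_apply, norm_smul, he, mul_one, Real.norm_of_nonneg (by positivity)]

theorem energyPair_halfPlane_self {ν : E n} (hν : ‖ν‖ = 1) {e : E m} (he : ‖e‖ = 1) :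
    energyPair (halfPlane ν e) (halfPlaneGrad ν e) (halfPlane ν e) (halfPlaneGrad ν e)
      = - halfMass ν := by
  rw [(isHomogeneousMap_halfPlane ν e).energyPair_halfPlane hν]
  simp only [inner_halfPlane ν he, integral_halfInd_mul_posInner_sq]

/-- The quadratic part contributes `-halfMass ν` and the term in the norm `2 * halfMass ν`. -/
theorem balancedEnergy_halfPlane (hn : 0 < n) {ν : E n} (hν : ‖ν‖ = 1) {e : E m} (he : ‖e‖ = 1) :
    balancedEnergy (halfPlane ν e) = halfMass ν := by
  rw [(isHomogeneousMap_halfPlane ν e).balancedEnergy_eq hn, energyPair_halfPlane_self hν he]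
  simp only [norm_halfPlane ν he]
  change -halfMass ν + 2 * halfMass ν = halfMass ν
  ring

end HalfPlane

/-! ### Rotational symmetry and moments of the half-plane profile -/

section Symmetry
variable {n : ℕ}

/-- The reflection across the hyperplane orthogonal to `ν - ν'` exchanges two vectors of equal
length and preserves the ball. -/
theorem integral_comp_inner {ν ν' : E n} (h : ‖ν‖ = ‖ν'‖) (F : ℝ → ℝ) :
    ∫ x, F (inner ℝ x ν) ∂(ballMeasure n) = ∫ x, F (inner ℝ x ν') ∂(ballMeasure n) := by
  rw [← integral_comp_isometry (mirror (ν - ν')) fun x => F (inner ℝ x ν')]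
  have : mirror (ν - ν') ν = ν' := Submodule.reflection_sub h
  have e : ∀ x, inner ℝ (mirror (ν - ν') x) ν' = inner ℝ x ν := fun x =>
    calc inner ℝ (mirror (ν - ν') x) ν' = inner ℝ (mirror (ν - ν') x) (mirror (ν - ν') ν) := by rw [this]
      _ = inner ℝ x ν := inner_mirror_mirror _ _
  simp only [e]

theorem halfMass_eq {ν ν' : E n} (hν : ‖ν‖ = 1) (hν' : ‖ν'‖ = 1) : halfMass ν = halfMass ν' :=
  integral_comp_inner (hν.trans hν'.symm) fun t => max t 0 ^ 2 / 2

/-- Minus the reflection across `ν` keeps `x·ν` and changes the sign of `x·τ`, so the integrand is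
odd under an isometry of the ball. -/
theorem integral_comp_inner_mul_orthogonal {ν τ : E n} (hν : ‖ν‖ = 1) (hτ : inner ℝ τ ν = 0)
    (F : ℝ → ℝ) : ∫ x, F (inner ℝ x ν) * inner ℝ x τ ∂(ballMeasure n) = 0 := by
  have h := integral_comp_isometry ((mirror ν).trans (LinearIsometryEquiv.neg ℝ))
    fun x => F (inner ℝ x ν) * inner ℝ x τ
  have e1 : mirror ν τ = τ := by rw [mirror_apply hν, hτ]; simp
  have e2 : ∀ x, F (inner ℝ (((mirror ν).trans (LinearIsometryEquiv.neg ℝ)) x) ν)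
      * inner ℝ (((mirror ν).trans (LinearIsometryEquiv.neg ℝ)) x) τ
      = - (F (inner ℝ x ν) * inner ℝ x τ) := fun x => by
    simp [inner_neg_left, inner_mirror_self hν, inner_mirror_left, e1]
  simp only [e2, integral_neg] at h
  linarith

theorem inner_sub_proj {ν : E n} (hν : ‖ν‖ = 1) (b : E n) : inner ℝ (b - inner ℝ ν b • ν) ν = 0 := by
  rw [inner_sub_left, real_inner_smul_left, real_inner_self_eq_norm_sq, hν, real_inner_comm]; ring

theorem shear_eq (ν b x : E n) : shear ν b x = posInner ν x * inner ℝ x (b - inner ℝ ν b • ν) := by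
  rw [shear, inner_sub_right, real_inner_smul_right]; ring

/-- Shows that subtracting a multiple of the profile of direction `ν` leaves the tangential moments
unchanged. -/
theorem integral_posInner_sq_mul_shear {ν : E n} (hν : ‖ν‖ = 1) (b : E n) :
    ∫ x, posInner ν x ^ 2 / 2 * shear ν b x ∂(ballMeasure n) = 0 := by
  rw [← integral_comp_inner_mul_orthogonal hν (inner_sub_proj hν b)
    fun t => max t 0 ^ 2 / 2 * max t 0]
  simp only [shear_eq, ← mul_assoc]
  rfl

/-- The normal moment of the half-plane solution. -/
def halfMoment (ν : E n) : ℝ := ∫ x, posInner ν x ^ 2 / 2 * inner ℝ x ν ∂(ballMeasure n)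

theorem halfMoment_eq {ν ν' : E n} (hν : ‖ν‖ = 1) (hν' : ‖ν'‖ = 1) : halfMoment ν = halfMoment ν' :=
  integral_comp_inner (hν.trans hν'.symm) fun t => max t 0 ^ 2 / 2 * t

theorem halfMoment_pos {ν : E n} (hν : ‖ν‖ = 1) : 0 < halfMoment ν := by
  have e : halfMoment ν = ∫ x, posInner ν x ^ 3 / 2 ∂(ballMeasure n) :=
    integral_congr_ae (ae_of_all _ fun x => by
      have := inner_mul_posInner ν x
      beta_reduce
      linear_combination posInner ν x / 2 * this)
  rw [e]
  refine integral_pos_of_posInner hν (((continuous_posInner ν).pow 3).div_const 2)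
    (fun x => by have := posInner_nonneg ν x; positivity) ?_
  rw [posInner_half hν]; norm_num

theorem integral_posInner_sq_mul_inner {ν : E n} (hν : ‖ν‖ = 1) (b : E n) :
    ∫ x, posInner ν x ^ 2 / 2 * inner ℝ x b ∂(ballMeasure n) = inner ℝ ν b * halfMoment ν := by
  have h := integral_comp_inner_mul_orthogonal hν (inner_sub_proj hν b) fun t => max t 0 ^ 2 / 2
  have hi : ∀ b : E n, Integrable (fun x => posInner ν x ^ 2 / 2 * inner ℝ x b) (ballMeasure n) :=
    fun b => ((Continuous.memLp_ball (((continuous_posInner ν).pow 2).div_const 2 |>.mul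
      (by fun_prop : Continuous fun x : E n => inner ℝ x b)) 1)).integrable le_rfl
  have e : ∀ x, max (inner ℝ x ν) 0 ^ 2 / 2 * inner ℝ x (b - inner ℝ ν b • ν)
      = posInner ν x ^ 2 / 2 * inner ℝ x b
        - inner ℝ ν b * (posInner ν x ^ 2 / 2 * inner ℝ x ν) := fun x => by
    rw [inner_sub_right, real_inner_smul_right, posInner]; ring
  simp only [e] at h
  rw [integral_sub (hi b) ((hi ν).const_mul _), integral_const_mul] at h
  rw [halfMoment]
  linarith

theorem abs_posInner_sub_le (ν ν' : E n) {x : E n} (hx : ‖x‖ ≤ 1) :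
    |posInner ν x - posInner ν' x| ≤ ‖ν - ν'‖ := by
  unfold posInner
  refine (abs_max_sub_max_le_abs _ _ _).trans ?_
  rw [← inner_sub_right]
  exact (abs_real_inner_le_norm _ _).trans (mul_le_of_le_one_left (norm_nonneg _) hx)

theorem abs_posInner_sq_sub_le {ν ν' : E n} (hν : ‖ν‖ = 1) (hν' : ‖ν'‖ = 1) {x : E n} (hx : ‖x‖ ≤ 1) :
    |posInner ν x ^ 2 / 2 - posInner ν' x ^ 2 / 2| ≤ ‖ν - ν'‖ := by
  have h := abs_posInner_sub_le ν ν' hx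
  have h1 := posInner_nonneg ν x
  have h2 := posInner_nonneg ν' x
  have h3 := (posInner_le hν x).trans hx
  have h4 := (posInner_le hν' x).trans hx
  have e : posInner ν x ^ 2 / 2 - posInner ν' x ^ 2 / 2
      = (posInner ν x - posInner ν' x) * ((posInner ν x + posInner ν' x) / 2) := by ring
  rw [e, abs_mul, abs_of_nonneg (by linarith : 0 ≤ (posInner ν x + posInner ν' x) / 2)]
  exact (mul_le_of_le_one_right (abs_nonneg _) (by linarith)).trans h

/-- The direction of a half-plane solution depends continuously on the solution. -/
theorem norm_sub_sq_mul_le {ν ν' : E n} (hν : ‖ν‖ = 1) (hν' : ‖ν'‖ = 1) :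
    ‖ν - ν'‖ ^ 2 * halfMoment ν ^ 2 ≤ (ballMeasure n).real Set.univ
      * ∫ x, (posInner ν x ^ 2 / 2 - posInner ν' x ^ 2 / 2) ^ 2 ∂(ballMeasure n) := by
  have c : ∀ ν : E n, Continuous fun x => posInner ν x ^ 2 / 2 := fun ν =>
    ((continuous_posInner ν).pow 2).div_const 2
  have cb : Continuous fun x : E n => inner ℝ x (ν - ν') := by fun_prop
  have h1 := sq_integral_mul_le (((c ν).sub (c ν')).memLp_ball 2) (cb.memLp_ball 2)
  -- The linear function `x·(ν - ν')` detects the difference of the profiles: their first moments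
  -- are `halfMoment` times their directions. Cauchy–Schwarz then concludes.
  have e1 : ∫ x, (posInner ν x ^ 2 / 2 - posInner ν' x ^ 2 / 2) * inner ℝ x (ν - ν') ∂(ballMeasure n)
      = ‖ν - ν'‖ ^ 2 * halfMoment ν := by
    simp only [sub_mul]
    have ci : ∀ ν₁ : E n, Integrable (fun x => posInner ν₁ x ^ 2 / 2 * inner ℝ x (ν - ν'))
        (ballMeasure n) := fun ν₁ => (((c ν₁).mul cb).memLp_ball 1).integrable le_rfl
    rw [integral_sub (ci ν) (ci ν'), integral_posInner_sq_mul_inner hν,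
      integral_posInner_sq_mul_inner hν', halfMoment_eq hν' hν, ← real_inner_self_eq_norm_sq,
      inner_sub_left]
    ring
  have h2 : ∫ x, inner ℝ x (ν - ν') ^ 2 ∂(ballMeasure n)
      ≤ (ballMeasure n).real Set.univ * ‖ν - ν'‖ ^ 2 := by
    have := integral_mono_ae (μ := ballMeasure n) (f := fun x => inner ℝ x (ν - ν') ^ 2)
      (g := fun _ => ‖ν - ν'‖ ^ 2) (((cb.pow 2).memLp_ball 1).integrable le_rfl)
      (integrable_const _) ?_
    · rwa [integral_const, smul_eq_mul] at this
    · filter_upwards [ae_norm_le_one n] with x hx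
      refine sq_le_sq' ?_ ?_
      · have := (abs_le.1 ((abs_real_inner_le_norm x (ν - ν')).trans
          (mul_le_of_le_one_left (norm_nonneg _) hx))).1
        exact this
      · exact (real_inner_le_norm _ _).trans (mul_le_of_le_one_left (norm_nonneg _) hx)
  simp only [Pi.sub_apply] at h1
  rw [e1] at h1
  rcases eq_or_ne ‖ν - ν'‖ 0 with h0 | h0
  · rw [h0]
    have : 0 ≤ ∫ x, (posInner ν x ^ 2 / 2 - posInner ν' x ^ 2 / 2) ^ 2 ∂(ballMeasure n) :=
      integral_nonneg fun x => sq_nonneg _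
    have := mul_nonneg (measureReal_nonneg (μ := ballMeasure n) (s := Set.univ)) this
    simpa using this
  · have hp : 0 < ‖ν - ν'‖ ^ 2 := by positivity
    refine le_of_mul_le_mul_left ?_ hp
    have h3 := mul_le_mul_of_nonneg_left h2 (integral_nonneg (μ := ballMeasure n)
      fun x => sq_nonneg (posInner ν x ^ 2 / 2 - posInner ν' x ^ 2 / 2))
    linarith

end Symmetry

/-! ### Choice of the adapted half-plane -/

section Direction
variable {n m : ℕ}

/-- The correlation of `f` with the half-plane solution of direction `ν`. -/
def halfCorr (f : E n → ℝ) (ν : E n) : ℝ := ∫ x, posInner ν x ^ 2 / 2 * f x ∂(ballMeasure n)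

theorem memLp_posInner_sq (ν : E n) : MemLp (fun x => posInner ν x ^ 2 / 2) 2 (ballMeasure n) :=
  Continuous.memLp_ball (((continuous_posInner ν).pow 2).div_const 2) 2

theorem posInner_sq_le {ν : E n} (hν : ‖ν‖ = 1) {x : E n} (hx : ‖x‖ ≤ 1) :
    posInner ν x ^ 2 / 2 ≤ 1 / 2 := by
  have h1 := posInner_nonneg ν x
  have h2 := (posInner_le hν x).trans hx
  nlinarith

theorem continuousOn_halfCorr {f : E n → ℝ} (hf : MemLp f 2 (ballMeasure n)) :
    ContinuousOn (halfCorr f) (Metric.sphere 0 1) := by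
  have hi : Integrable f (ballMeasure n) := hf.integrable (by norm_num)
  refine continuousOn_of_dominated (bound := fun x => ‖f x‖) (fun ν _ => ?_) (fun ν hν => ?_) hi.norm ?_
  · exact (memLp_posInner_sq ν).1.mul hf.1
  · filter_upwards [ae_norm_le_one n] with x hx
    have hν' : ‖ν‖ = 1 := by simpa using hν
    rw [norm_mul, Real.norm_of_nonneg (by positivity)]
    exact mul_le_of_le_one_left (norm_nonneg _) ((posInner_sq_le hν' hx).trans (by norm_num))
  · refine ae_of_all _ fun x => Continuous.continuousOn ?_
    unfold posInner
    fun_prop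

/-- The function `max u 0 ^ 2` has Lipschitz derivative, which gives a first order expansion with
quadratic error despite the kink. -/
theorem abs_max_sq_sub_le (u d : ℝ) : |max (u + d) 0 ^ 2 - max u 0 ^ 2 - 2 * (max u 0 * d)| ≤ d ^ 2 := by
  rw [abs_le]
  rcases le_total u 0 with h | h <;> rcases le_total (u + d) 0 with h' | h' <;>
    simp only [h, h', max_eq_left, max_eq_right] <;> constructor <;> nlinarith [sq_nonneg (u + d), sq_nonneg d]

theorem halfCorr_smul (f : E n → ℝ) (ν : E n) {t : ℝ} (ht : 0 ≤ t) :
    halfCorr f (t • ν) = t ^ 2 * halfCorr f ν := by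
  unfold halfCorr posInner
  rw [← integral_const_mul]
  refine integral_congr_ae (ae_of_all _ fun x => ?_)
  beta_reduce
  rw [real_inner_smul_right]
  have : max (t * inner ℝ x ν) 0 = t * max (inner ℝ x ν) 0 := by
    rw [mul_max_of_nonneg _ _ ht, mul_zero]
  rw [this]; ring

theorem integrable_mul_shear {f : E n → ℝ} (hf : MemLp f 2 (ballMeasure n)) (ν b : E n) :
    Integrable (fun x => f x * shear ν b x) (ballMeasure n) :=
  hf.mul_integrable ((continuous_shear ν b).memLp_ball 2)

/-- The derivative of the profile in a direction tangential to `ν` is exactly `shear`, so the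
tangential moments are the first variation of the correlation in `ν`. -/
theorem halfCorr_add_ge {f : E n → ℝ} (hf : MemLp f 2 (ballMeasure n)) (ν b : E n) (t : ℝ) :
    halfCorr f ν + t * ∫ x, f x * shear ν b x ∂(ballMeasure n)
      - t ^ 2 * (‖b - inner ℝ ν b • ν‖ ^ 2 * ∫ x, |f x| ∂(ballMeasure n))
      ≤ halfCorr f (ν + t • (b - inner ℝ ν b • ν)) := by
  have i1 : ∀ ν : E n, Integrable (fun x => posInner ν x ^ 2 / 2 * f x) (ballMeasure n) := fun ν =>
    (memLp_posInner_sq ν).mul_integrable hf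
  have i2 := (integrable_mul_shear hf ν b).const_mul t
  have i3 : Integrable (fun x => |f x|) (ballMeasure n) := (hf.integrable (by norm_num)).abs
  have i4 := (i3.const_mul (‖b - inner ℝ ν b • ν‖ ^ 2)).const_mul (t ^ 2)
  have i5 : Integrable (fun x => posInner ν x ^ 2 / 2 * f x + t * (f x * shear ν b x))
    (ballMeasure n) := (i1 ν).add i2
  unfold halfCorr
  rw [← integral_const_mul, ← integral_const_mul, ← integral_const_mul,
    ← integral_add (i1 ν) i2, ← integral_sub i5 i4]
  refine integral_mono_ae (i5.sub i4) (i1 _) ?_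
  filter_upwards [ae_norm_le_one n] with x hx
  have h1 := abs_max_sq_sub_le (inner ℝ x ν) (t * inner ℝ x (b - inner ℝ ν b • ν))
  have h2 : inner ℝ x (b - inner ℝ ν b • ν) ^ 2 ≤ ‖b - inner ℝ ν b • ν‖ ^ 2 := by
    rw [← sq_abs]
    have := (abs_real_inner_le_norm x (b - inner ℝ ν b • ν)).trans
      (mul_le_of_le_one_left (norm_nonneg _) hx)
    gcongr
  have e1 : posInner (ν + t • (b - inner ℝ ν b • ν)) x
      = max (inner ℝ x ν + t * inner ℝ x (b - inner ℝ ν b • ν)) 0 := by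
    rw [posInner, inner_add_right, real_inner_smul_right]
  have e2 : shear ν b x = max (inner ℝ x ν) 0 * inner ℝ x (b - inner ℝ ν b • ν) := shear_eq ν b x
  simp only [e1, e2]
  change max (inner ℝ x ν) 0 ^ 2 / 2 * f x + _ - _ ≤ _
  generalize max (inner ℝ x ν + t * inner ℝ x (b - inner ℝ ν b • ν)) 0 = P at h1 ⊢
  generalize max (inner ℝ x ν) 0 = p at h1 ⊢
  generalize inner ℝ x (b - inner ℝ ν b • ν) = d at h1 h2 ⊢
  have h3 : |(P ^ 2 - p ^ 2 - 2 * (p * (t * d))) * f x|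
      ≤ t ^ 2 * (‖b - inner ℝ ν b • ν‖ ^ 2 * |f x|) := by
    rw [abs_mul, ← mul_assoc (t ^ 2)]
    refine mul_le_mul_of_nonneg_right (h1.trans ?_) (abs_nonneg _)
    rw [mul_pow]
    exact mul_le_mul_of_nonneg_left h2 (sq_nonneg t)
  have h4 := (abs_le.1 h3).1
  have h5 : 0 ≤ t ^ 2 * (‖b - inner ℝ ν b • ν‖ ^ 2 * |f x|) := by positivity
  linarith

theorem eq_zero_of_forall_mul_le {B M : ℝ} (h : ∀ t : ℝ, t * B ≤ t ^ 2 * M) : B = 0 := by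
  by_contra hB
  have hM : 0 < |M| + 1 := by positivity
  have h1 := h (B / (|M| + 1))
  have h2 : 0 < B ^ 2 := by positivity
  have e1 : B / (|M| + 1) * B * (|M| + 1) ^ 2 = B ^ 2 * (|M| + 1) := by field_simp
  have e2 : (B / (|M| + 1)) ^ 2 * M * (|M| + 1) ^ 2 = B ^ 2 * M := by field_simp
  have h3 := mul_le_mul_of_nonneg_right h1 (sq_nonneg (|M| + 1))
  rw [e1, e2] at h3
  have h4 := le_of_mul_le_mul_left h3 h2
  have := le_abs_self M
  linarith

/-- The best half-plane direction makes the tangential moments vanish. -/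
theorem exists_best_direction (hn : 0 < n) {f : E n → ℝ} (hf : MemLp f 2 (ballMeasure n)) :
    ∃ ν : E n, ‖ν‖ = 1 ∧ (∀ ν' : E n, ‖ν'‖ = 1 → halfCorr f ν' ≤ halfCorr f ν) ∧
      ∀ b, ∫ x, f x * shear ν b x ∂(ballMeasure n) = 0 := by
  obtain ⟨ν, hν, hmax⟩ := (isCompact_sphere (0 : E n) 1).exists_isMaxOn
    ⟨EuclideanSpace.single ⟨0, hn⟩ 1, by simp⟩ (continuousOn_halfCorr hf)
  have hν1 : ‖ν‖ = 1 := by simpa using hν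
  have hmax' : ∀ ν' : E n, ‖ν'‖ = 1 → halfCorr f ν' ≤ halfCorr f ν := fun ν' h =>
    hmax (by simpa using h)
  refine ⟨ν, hν1, hmax', fun b => ?_⟩
  set τ := b - inner ℝ ν b • ν with hτ
  have horth : inner ℝ τ ν = 0 := inner_sub_proj hν1 b
  -- At a maximum the first order term is dominated by a multiple of `t ^ 2` for both signs of `t`.
  -- The constant collects the Taylor error and the growth of `‖ν + t • τ‖ ^ 2`.
  refine eq_zero_of_forall_mul_le
    (M := ‖τ‖ ^ 2 * halfCorr f ν + ‖τ‖ ^ 2 * ∫ x, |f x| ∂(ballMeasure n)) fun t => ?_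
  have h1 := halfCorr_add_ge hf ν b t
  rw [← hτ] at h1
  have hw : ‖ν + t • τ‖ ^ 2 = 1 + t ^ 2 * ‖τ‖ ^ 2 := by
    rw [norm_add_sq_real, real_inner_smul_right, real_inner_comm, horth, hν1, norm_smul, mul_pow,
      Real.norm_eq_abs, sq_abs]
    ring
  have hw0 : ‖ν + t • τ‖ ≠ 0 := fun h => by
    rw [h] at hw
    nlinarith [mul_nonneg (sq_nonneg t) (sq_nonneg ‖τ‖)]
  have h2 := hmax' (‖ν + t • τ‖⁻¹ • (ν + t • τ)) (by
    rw [norm_smul, norm_inv, norm_norm, inv_mul_cancel₀ hw0])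
  -- The vector `ν + t • τ` is not a unit vector; homogeneity of degree two of the correlation in
  -- its direction reduces to maximality on the sphere.
  have h3 : halfCorr f (ν + t • τ) ≤ (1 + t ^ 2 * ‖τ‖ ^ 2) * halfCorr f ν := by
    rw [← hw]
    have e := halfCorr_smul f (‖ν + t • τ‖⁻¹ • (ν + t • τ)) (norm_nonneg (ν + t • τ))
    rw [smul_smul, mul_inv_cancel₀ hw0, one_smul] at e
    rw [e]
    exact mul_le_mul_of_nonneg_left h2 (sq_nonneg _)
  linarith

/-- A maximizing direction cannot be far from `ν₀`: up to an error of order `δ`, the correlation of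
`f` is that of the profile of `ν₀`. Profiles have equal norms, so a nearly maximal correlation makes
their distance of order `√δ`, and `norm_sub_sq_mul_le` passes from profiles to directions. -/
theorem exists_close_direction (hn : 0 < n) : ∃ C : ℝ, 0 < C ∧ ∀ (f : E n → ℝ) (ν₀ : E n) (δ : ℝ),
    MemLp f 2 (ballMeasure n) → ‖ν₀‖ = 1 →
    (∀ᵐ x ∂(ballMeasure n), |f x - posInner ν₀ x ^ 2 / 2| ≤ δ) →
    ∃ ν : E n, ‖ν‖ = 1 ∧ ‖ν - ν₀‖ ^ 2 ≤ C * δ ∧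
      ∀ b, ∫ x, f x * shear ν b x ∂(ballMeasure n) = 0 := by
  obtain ⟨ν₁, hν₁⟩ : ∃ ν₁ : E n, ‖ν₁‖ = 1 := ⟨EuclideanSpace.single ⟨0, hn⟩ 1, by simp⟩
  have hI := halfMass_pos hν₁
  have hk := halfMoment_pos hν₁
  have hvol : 0 ≤ (ballMeasure n).real Set.univ := measureReal_nonneg
  refine ⟨4 * ((ballMeasure n).real Set.univ + 1) * halfMass ν₁ / halfMoment ν₁ ^ 2, by positivity,
    fun f ν₀ δ hf hν₀ hδ => ?_⟩
  obtain ⟨ν, hν, hmax, hsh⟩ := exists_best_direction hn hf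
  refine ⟨ν, hν, ?_, hsh⟩
  have hm := memLp_posInner_sq (n := n)
  have key : ∀ ν' : E n, ‖ν'‖ = 1 →
      |halfCorr f ν' - ∫ x, posInner ν' x ^ 2 / 2 * (posInner ν₀ x ^ 2 / 2) ∂(ballMeasure n)|
        ≤ δ * halfMass ν₁ := fun ν' hν' => by
    have i1 := (hm ν').mul_integrable hf
    have i2 := (hm ν').mul_integrable (hm ν₀)
    rw [halfCorr, ← integral_sub i1 i2, halfMass_eq hν₁ hν', halfMass, ← integral_const_mul]
    refine (abs_integral_le_integral_abs).trans ?_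
    refine integral_mono_ae (i1.sub i2).abs (((hm ν').integrable (by norm_num)).const_mul δ) ?_
    filter_upwards [hδ] with x hx
    rw [← mul_sub, abs_mul, abs_of_nonneg (by positivity : 0 ≤ posInner ν' x ^ 2 / 2), mul_comm]
    exact mul_le_mul_of_nonneg_right hx (by positivity)
  have k1 := (abs_le.1 (key ν hν)).2
  have k2 := (abs_le.1 (key ν₀ hν₀)).1
  have k3 := hmax ν₀ hν₀
  have e1 : ∫ x, (posInner ν x ^ 2 / 2 - posInner ν₀ x ^ 2 / 2) ^ 2 ∂(ballMeasure n)
      = ∫ x, (posInner ν₀ x ^ 2 / 2) ^ 2 ∂(ballMeasure n)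
        - 2 * ∫ x, posInner ν x ^ 2 / 2 * (posInner ν₀ x ^ 2 / 2) ∂(ballMeasure n)
        + ∫ x, (posInner ν₀ x ^ 2 / 2) ^ 2 ∂(ballMeasure n) := by
    have := integral_add_sq (hm ν) (hm ν₀).neg
    have e2 : ∫ x, (posInner ν x ^ 2 / 2) ^ 2 ∂(ballMeasure n)
        = ∫ x, (posInner ν₀ x ^ 2 / 2) ^ 2 ∂(ballMeasure n) :=
      integral_comp_inner (hν.trans hν₀.symm) fun t => (max t 0 ^ 2 / 2) ^ 2
    simp only [Pi.neg_apply, ← sub_eq_add_neg, neg_sq, mul_neg, integral_neg, e2] at this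
    exact this
  have e3 : ∫ x, posInner ν₀ x ^ 2 / 2 * (posInner ν₀ x ^ 2 / 2) ∂(ballMeasure n)
      = ∫ x, (posInner ν₀ x ^ 2 / 2) ^ 2 ∂(ballMeasure n) := by simp only [pow_two (_ / _ : ℝ)]
  rw [e3] at k2
  have hsq : ∫ x, (posInner ν x ^ 2 / 2 - posInner ν₀ x ^ 2 / 2) ^ 2 ∂(ballMeasure n)
      ≤ 4 * (δ * halfMass ν₁) := by rw [e1]; linarith
  have h4 := norm_sub_sq_mul_le hν hν₀
  rw [halfMoment_eq hν hν₁] at h4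
  rw [div_mul_eq_mul_div, le_div_iff₀ (by positivity)]
  have h0 : 0 ≤ ∫ x, (posInner ν x ^ 2 / 2 - posInner ν₀ x ^ 2 / 2) ^ 2 ∂(ballMeasure n) :=
    integral_nonneg fun x => sq_nonneg _
  have h5 := mul_le_mul_of_nonneg_left hsq hvol
  linarith

/-- Polar decomposition of the moment vector `V`: its direction is `e`, and its length, measured in
units of `I`, is `1 + a`. -/
theorem norm_sub_le_of_near {V e₀ : E m} {I ρ : ℝ} (hI : 0 < I) (he₀ : ‖e₀‖ = 1)
    (h : ‖V - I • e₀‖ ≤ ρ) (hρ : ρ ≤ I / 2) :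
    ∃ (e : E m) (a : ℝ), ‖e‖ = 1 ∧ V = ((1 + a) * I) • e ∧ |a| ≤ ρ / I ∧ ‖e - e₀‖ ≤ 4 * ρ / I := by
  have h1 : ‖I • e₀‖ = I := by rw [norm_smul, he₀, mul_one, Real.norm_of_nonneg hI.le]
  have h2 : |‖V‖ - I| ≤ ρ := by
    have := abs_norm_sub_norm_le V (I • e₀)
    rw [h1] at this
    exact this.trans h
  have hV : I / 2 ≤ ‖V‖ := by linarith [(abs_le.1 h2).1]
  have hV0 : 0 < ‖V‖ := by linarith
  refine ⟨‖V‖⁻¹ • V, ‖V‖ / I - 1, ?_, ?_, ?_, ?_⟩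
  · rw [norm_smul, norm_inv, norm_norm, inv_mul_cancel₀ hV0.ne']
  · have : (1 + (‖V‖ / I - 1)) * I = ‖V‖ := by field_simp; ring
    rw [this, smul_smul, mul_inv_cancel₀ hV0.ne', one_smul]
  · have : ‖V‖ / I - 1 = (‖V‖ - I) / I := by field_simp
    rw [this, abs_div, abs_of_pos hI]
    gcongr
  · have e1 : ‖V‖⁻¹ • V - e₀ = ‖V‖⁻¹ • ((V - I • e₀) + (I - ‖V‖) • e₀) := by
      rw [smul_add, smul_sub, sub_smul, smul_sub, smul_smul ‖V‖⁻¹ ‖V‖, inv_mul_cancel₀ hV0.ne', one_smul]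
      abel
    have h3 : ‖(V - I • e₀) + (I - ‖V‖) • e₀‖ ≤ 2 * ρ := by
      refine (norm_add_le _ _).trans ?_
      rw [norm_smul, he₀, mul_one, Real.norm_eq_abs, abs_sub_comm]
      linarith
    rw [e1, norm_smul, norm_inv, norm_norm, inv_mul_le_iff₀ hV0]
    have hρ0 : 0 ≤ ρ := (norm_nonneg _).trans h
    calc _ ≤ 2 * ρ := h3
      _ = I / 2 * (4 * ρ / I) := by field_simp; ring
      _ ≤ _ := by gcongr

/-- A map close to a half-plane solution is adapted to a nearby half-plane. -/
theorem exists_adapted (hn : 0 < n) {η : ℝ} (hη : 0 < η) : ∃ δ : ℝ, 0 < δ ∧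
    ∀ (m : ℕ) (c : E n → E m) (ν₀ : E n) (e₀ : E m), MemLp c 2 (ballMeasure n) → ‖ν₀‖ = 1 →
      ‖e₀‖ = 1 → (∀ᵐ x ∂(ballMeasure n), ‖c x - halfPlane ν₀ e₀ x‖ ≤ δ) →
      ∃ (ν : E n) (e : E m) (a : ℝ), ‖ν‖ = 1 ∧ ‖e‖ = 1 ∧ |a| ≤ 1 / 2 ∧ ‖e - e₀‖ ≤ η ∧
        (∀ᵐ x ∂(ballMeasure n), ‖c x - halfPlane ν e₀ x‖ ≤ η) ∧
        (∀ i, ∫ x, halfInd ν x * c x i ∂(ballMeasure n) = (1 + a) * halfMass ν * e i) ∧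
        ∀ b, ∫ x, inner ℝ (c x) e₀ * shear ν b x ∂(ballMeasure n) = 0 := by
  obtain ⟨C, hC, hdir⟩ := exists_close_direction hn
  obtain ⟨ν₁, hν₁⟩ : ∃ ν₁ : E n, ‖ν₁‖ = 1 := ⟨EuclideanSpace.single ⟨0, hn⟩ 1, by simp⟩
  have hI := halfMass_pos hν₁
  obtain ⟨I, hIdef⟩ : ∃ I, I = halfMass ν₁ := ⟨_, rfl⟩
  rw [← hIdef] at hI
  obtain ⟨vol, hvoldef⟩ : ∃ vol, vol = (ballMeasure n).real Set.univ := ⟨_, rfl⟩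
  have hvol : 0 ≤ vol := hvoldef ▸ measureReal_nonneg
  -- `ρ` is the admissible distance to the half-plane solution with the new direction; times the
  -- volume of the ball it bounds the error of the moment vector.
  obtain ⟨ρ, hρ, hρη, hρ1, hρ2⟩ : ∃ ρ : ℝ, 0 < ρ ∧ ρ ≤ η ∧ ρ * vol ≤ I / 2 ∧ 4 * (ρ * vol) / I ≤ η := by
    refine ⟨min η (min (I / (2 * (vol + 1))) (η * I / (4 * (vol + 1)))), by positivity,
      min_le_left _ _, ?_, ?_⟩
    · have : min η (min (I / (2 * (vol + 1))) (η * I / (4 * (vol + 1)))) ≤ I / (2 * (vol + 1)) :=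
        (min_le_right _ _).trans (min_le_left _ _)
      calc _ ≤ I / (2 * (vol + 1)) * (vol + 1) := by gcongr; linarith
        _ = I / 2 := by field_simp
    · have : min η (min (I / (2 * (vol + 1))) (η * I / (4 * (vol + 1)))) ≤ η * I / (4 * (vol + 1)) :=
        (min_le_right _ _).trans (min_le_right _ _)
      rw [div_le_iff₀ hI]
      calc _ ≤ 4 * (η * I / (4 * (vol + 1)) * (vol + 1)) := by gcongr; linarith
        _ = η * I := by field_simp
  refine ⟨min (ρ / 2) (ρ ^ 2 / (4 * C)), by positivity, fun m c ν₀ e₀ hc hν₀ he₀ hδ => ?_⟩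
  have hd1 : min (ρ / 2) (ρ ^ 2 / (4 * C)) ≤ ρ / 2 := min_le_left _ _
  have hd2 : C * min (ρ / 2) (ρ ^ 2 / (4 * C)) ≤ (ρ / 2) ^ 2 := by
    calc _ ≤ C * (ρ ^ 2 / (4 * C)) := by gcongr; exact min_le_right _ _
      _ = (ρ / 2) ^ 2 := by field_simp; ring
  generalize min (ρ / 2) (ρ ^ 2 / (4 * C)) = δ at hδ hd1 hd2
  -- The direction `ν` is optimized with `e₀` fixed, since `e` is only defined afterwards through
  -- `ν`. The discrepancy between `e` and `e₀` is small and is absorbed in `coercive_deficit`.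
  obtain ⟨ν, hν, hclose, hsh⟩ := hdir (fun x => inner ℝ (c x) e₀) ν₀ δ (hc.inner_const e₀) hν₀ (by
    filter_upwards [hδ] with x hx
    rw [← inner_halfPlane ν₀ he₀, ← inner_sub_left]
    refine (abs_real_inner_le_norm _ _).trans ?_
    rwa [he₀, mul_one])
  have hνρ : ‖ν - ν₀‖ ≤ ρ / 2 := abs_le_of_sq_le_sq' (hclose.trans hd2) (by positivity) |>.2
  have hcν : ∀ᵐ x ∂(ballMeasure n), ‖c x - halfPlane ν e₀ x‖ ≤ ρ := by
    filter_upwards [hδ, ae_norm_le_one n] with x hx hx1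
    have h1 : ‖halfPlane ν₀ e₀ x - halfPlane ν e₀ x‖ ≤ ρ / 2 := by
      rw [halfPlane_apply, halfPlane_apply, ← sub_smul, norm_smul, he₀, mul_one, Real.norm_eq_abs,
        abs_sub_comm]
      exact (abs_posInner_sq_sub_le hν hν₀ hx1).trans hνρ
    calc _ = ‖(c x - halfPlane ν₀ e₀ x) + (halfPlane ν₀ e₀ x - halfPlane ν e₀ x)‖ := by congr 1; abel
      _ ≤ _ := (norm_add_le _ _).trans (by linarith)
  have hci : ∀ (u : E n → E m), MemLp u 2 (ballMeasure n) →
      Integrable (fun x => halfInd ν x • u x) (ballMeasure n) := fun u hu =>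
    (hu.integrable (by norm_num)).bdd_smul 1 (measurable_halfInd ν).aestronglyMeasurable
      (ae_of_all _ fun x => abs_halfInd_le ν x)
  have hh := (isHomogeneousMap_halfPlane ν e₀).hasWeakGradient.1
  have hVh : ∫ x, halfInd ν x • halfPlane ν e₀ x ∂(ballMeasure n) = I • e₀ := by
    rw [hIdef, halfMass_eq hν₁ hν, ← integral_halfInd_mul_posInner_sq, ← integral_smul_const]
    simp only [halfPlane_apply, smul_smul]
  have hV : ‖∫ x, halfInd ν x • c x ∂(ballMeasure n) - I • e₀‖ ≤ ρ * vol := by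
    rw [← hVh, ← integral_sub (hci c hc) (hci _ hh), hvoldef]
    refine norm_integral_le_of_norm_le_const ?_
    filter_upwards [hcν] with x hx
    rw [← smul_sub, norm_smul]
    exact (mul_le_of_le_one_left (norm_nonneg _) (abs_halfInd_le ν x)).trans hx
  obtain ⟨e, a, he, hVe, ha, hee⟩ := norm_sub_le_of_near hI he₀ hV hρ1
  refine ⟨ν, e, a, hν, he, ha.trans ?_, hee.trans hρ2, hcν.mono fun x hx => hx.trans hρη,
    fun i => ?_, hsh⟩
  · rw [div_le_iff₀ hI]; linarith
  · have := congrArg (fun v : E m => v i) hVe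
    simp only at this
    rw [eval_integral_piLp fun i => Integrable.eval_piLp (hci c hc) i] at this
    simp only [PiLp.smul_apply, smul_eq_mul] at this
    rw [this, hIdef, halfMass_eq hν₁ hν]

end Direction

/-! ### Coercivity of the energy around the adapted half-plane -/

section Deficit
variable {n m : ℕ}

theorem halfInd_mul_shear (ν b x : E n) : halfInd ν x * shear ν b x = shear ν b x := by
  rw [shear, ← mul_assoc, halfInd_mul_posInner]

theorem integrable_halfInd_mul (ν : E n) {f : E n → ℝ} (hf : Integrable f (ballMeasure n)) :
    Integrable (fun x => halfInd ν x * f x) (ballMeasure n) :=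
  memLp_one_iff_integrable.1 (memLp_halfInd_mul ν (memLp_one_iff_integrable.2 hf))

/-- Cauchy–Schwarz; `shear` is bounded by `2` for a unit vector and vanishes outside the half-space,
so only the mass on the half-ball enters. -/
theorem tangential_le {ν : E n} (hν : ‖ν‖ = 1) {f : E n → ℝ} (hf : MemLp f 2 (ballMeasure n)) :
    tangential ν f ≤ 4 * n * ((ballMeasure n).real Set.univ + 1)
      * ∫ x, halfInd ν x * f x ^ 2 ∂(ballMeasure n) := by
  have hI : 0 ≤ ∫ x, halfInd ν x * f x ^ 2 ∂(ballMeasure n) :=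
    integral_nonneg fun x => mul_nonneg (halfInd_nonneg ν x) (sq_nonneg _)
  have key : ∀ i : Fin n, (∫ x, f x * shear ν (EuclideanSpace.single i 1) x ∂(ballMeasure n)) ^ 2
      ≤ 4 * ((ballMeasure n).real Set.univ + 1) * ∫ x, halfInd ν x * f x ^ 2 ∂(ballMeasure n) := by
    intro i
    obtain ⟨b, hb, hb1⟩ : ∃ b : E n, b = EuclideanSpace.single i 1 ∧ ‖b‖ = 1 := ⟨_, rfl, by simp⟩
    rw [← hb]
    have hs := continuous_shear ν b
    have h1 := sq_integral_mul_le (memLp_halfInd_mul ν hf) (hs.memLp_ball 2)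
    have e1 : ∫ x, halfInd ν x * f x * shear ν b x ∂(ballMeasure n)
        = ∫ x, f x * shear ν b x ∂(ballMeasure n) :=
      integral_congr_ae (ae_of_all _ fun x => by
        beta_reduce
        rw [mul_right_comm, halfInd_mul_shear, mul_comm])
    have e2 : ∫ x, (halfInd ν x * f x) ^ 2 ∂(ballMeasure n)
        = ∫ x, halfInd ν x * f x ^ 2 ∂(ballMeasure n) :=
      integral_congr_ae (ae_of_all _ fun x => by
        beta_reduce
        rw [mul_pow, pow_two (halfInd ν x), halfInd_sq])
    have h2 : ∫ x, shear ν b x ^ 2 ∂(ballMeasure n) ≤ 4 * (ballMeasure n).real Set.univ := by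
      have := integral_mono_ae (μ := ballMeasure n) (f := fun x => shear ν b x ^ 2)
        (g := fun _ => (4 : ℝ)) (((hs.pow 2).memLp_ball 1).integrable le_rfl) (integrable_const _) (by
          filter_upwards [ae_norm_le_one n] with x hx
          have := abs_shear_le hν b hx
          rw [hb1] at this
          rw [← sq_abs]
          nlinarith [abs_nonneg (shear ν b x)])
      rw [integral_const, smul_eq_mul] at this
      linarith
    rw [e1, e2] at h1
    nlinarith [mul_le_mul_of_nonneg_left h2 hI]
  refine (Finset.sum_le_sum fun i _ => key i).trans (le_of_eq ?_)
  rw [Finset.sum_const, Finset.card_univ, Fintype.card_fin, nsmul_eq_mul]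
  ring

theorem tangential_add_mul_le {f g : E n → ℝ} (hf : MemLp f 2 (ballMeasure n))
    (hg : MemLp g 2 (ballMeasure n)) (ν : E n) (a : ℝ) :
    tangential ν (fun x => f x + a * g x) ≤ 2 * tangential ν f + 2 * (a ^ 2 * tangential ν g) := by
  unfold tangential
  rw [Finset.mul_sum, Finset.mul_sum, Finset.mul_sum, ← Finset.sum_add_distrib]
  refine Finset.sum_le_sum fun i _ => ?_
  simp only [add_mul, mul_assoc a]
  rw [integral_add (integrable_mul_shear hf ν _) ((integrable_mul_shear hg ν _).const_mul a),
    integral_const_mul]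
  generalize ∫ x, f x * shear ν (EuclideanSpace.single i 1) x ∂(ballMeasure n) = s
  generalize ∫ x, g x * shear ν (EuclideanSpace.single i 1) x ∂(ballMeasure n) = t
  nlinarith [sq_nonneg (s - a * t)]

theorem norm_sq_sub_proj {e : E m} (he : ‖e‖ = 1) (v : E m) :
    ‖v - inner ℝ v e • e‖ ^ 2 = ‖v‖ ^ 2 - inner ℝ v e ^ 2 := by
  rw [norm_sub_sq_real, real_inner_smul_right, norm_smul, he, mul_one, Real.norm_eq_abs, sq_abs]
  ring

theorem memLp_sub_proj {c : E n → E m} (hc : MemLp c 2 (ballMeasure n)) {e : E m} (he : ‖e‖ = 1) :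
    MemLp (fun x => c x - inner ℝ (c x) e • e) 2 (ballMeasure n) := by
  refine hc.sub (MemLp.of_le hc ((hc.1.inner aestronglyMeasurable_const).smul_const e)
    (ae_of_all _ fun x => ?_))
  rw [norm_smul, he, mul_one]
  simpa [he] using norm_inner_le_norm (𝕜 := ℝ) (c x) e

/-- Separates the tangential moments into the part of `c` orthogonal to `e`, controlled by its mass
on the half-ball, and the component along `e`; the squares of the `e i` add up to one. -/
theorem sum_tangential_le {ν : E n} (hν : ‖ν‖ = 1) {e : E m} (he : ‖e‖ = 1) {c : E n → E m}
    (hc : MemLp c 2 (ballMeasure n)) {p : E n → ℝ} (hp : MemLp p 2 (ballMeasure n)) :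
    ∑ i, tangential ν (fun x => (c x - inner ℝ (c x) e • e) i + e i * p x)
      ≤ 2 * (4 * n * ((ballMeasure n).real Set.univ + 1)
        * ∫ x, halfInd ν x * ‖c x - inner ℝ (c x) e • e‖ ^ 2 ∂(ballMeasure n))
        + 2 * tangential ν p := by
  have hq := memLp_sub_proj hc he
  have hqi := fun i => memLp_piLp_iff.1 hq i
  have h1 : ∀ i, tangential ν (fun x => (c x - inner ℝ (c x) e • e) i + e i * p x)
      ≤ 2 * (4 * n * ((ballMeasure n).real Set.univ + 1)
        * ∫ x, halfInd ν x * (c x - inner ℝ (c x) e • e) i ^ 2 ∂(ballMeasure n))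
        + 2 * (e i ^ 2 * tangential ν p) := fun i =>
    (tangential_add_mul_le (hqi i) hp ν (e i)).trans
      (add_le_add_left (mul_le_mul_of_nonneg_left (tangential_le hν (hqi i)) zero_le_two) _)
  refine (Finset.sum_le_sum fun i _ => h1 i).trans (le_of_eq ?_)
  rw [Finset.sum_add_distrib, ← Finset.mul_sum, ← Finset.mul_sum, ← Finset.mul_sum, ← Finset.sum_mul]
  have e1 : ∑ i, e i ^ 2 = 1 := by
    have := EuclideanSpace.norm_sq_eq (𝕜 := ℝ) e
    rw [he] at this
    simpa using this.symm
  have e2 : ∑ i, ∫ x, halfInd ν x * (c x - inner ℝ (c x) e • e) i ^ 2 ∂(ballMeasure n)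
      = ∫ x, halfInd ν x * ‖c x - inner ℝ (c x) e • e‖ ^ 2 ∂(ballMeasure n) := by
    rw [← integral_finsetSum _ fun i _ => integrable_halfInd_mul ν (hqi i).integrable_sq']
    refine integral_congr_ae (ae_of_all _ fun x => ?_)
    simp only [EuclideanSpace.norm_sq_eq, Real.norm_eq_abs, sq_abs, Finset.mul_sum]
  rw [e1, e2]
  ring

/-- For `x·ν > 0` one has `‖v‖ ≤ 1` and `‖v‖² - (v·e)² = (‖v‖ - v·e)(‖v‖ + v·e) ≤ 2 (‖v‖ - v·e)`.
For `x·ν ≤ 0` the half-plane solution is zero and `‖v‖ ≤ η`, so the linear term beats `K ‖v‖²` once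
`K * η ≤ 1`. -/
theorem deficit_pointwise {K η : ℝ} (hη : η ≤ 1 / 2) (hK : K * η ≤ 1) (hK0 : 0 < K) {ν : E n}
    (hν : ‖ν‖ = 1) {e e₀ : E m} (he : ‖e‖ = 1) (he₀ : ‖e₀‖ = 1) (a : ℝ) {x : E n} (hx : ‖x‖ ≤ 1)
    {v : E m} (hv : ‖v - halfPlane ν e₀ x‖ ≤ η) :
    K * ((1 - halfInd ν x) * ‖v - (1 + a) • halfPlane ν e x‖ ^ 2)
      + 1 / 2 * (halfInd ν x * ‖v - inner ℝ v e • e‖ ^ 2) ≤ ‖v‖ - halfInd ν x * inner ℝ v e := by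
  have hs := posInner_sq_le hν hx
  have hv1 : ‖v‖ ≤ η + posInner ν x ^ 2 / 2 := by
    calc ‖v‖ = ‖(v - halfPlane ν e₀ x) + halfPlane ν e₀ x‖ := by rw [sub_add_cancel]
      _ ≤ _ := (norm_add_le _ _).trans (by rw [norm_halfPlane ν he₀]; linarith)
  have hin : inner ℝ v e ≤ ‖v‖ := by simpa [he] using real_inner_le_norm v e
  by_cases h : 0 < inner ℝ x ν
  · have h1 : halfInd ν x = 1 := if_pos h
    rw [h1, norm_sq_sub_proj he]
    nlinarith
  · have h1 : halfInd ν x = 0 := if_neg h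
    have h2 : posInner ν x = 0 := max_eq_right (not_lt.1 h)
    rw [h2] at hv1
    have h3 : ‖v‖ ≤ η := by simpa using hv1
    rw [h1, halfPlane_apply, h2]
    simp only [sub_zero, one_mul, zero_mul, mul_zero, add_zero, ne_eq, OfNat.ofNat_ne_zero,
      not_false_eq_true, zero_pow, zero_div, zero_smul, smul_zero]
    have h4 : K * ‖v‖ ≤ 1 := (mul_le_mul_of_nonneg_left h3 hK0.le).trans hK
    nlinarith [mul_le_mul_of_nonneg_right h4 (norm_nonneg v)]

/-- The remainder of `c` after subtracting a multiple of a half-plane solution. -/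
def remainder (c : E n → E m) (ν : E n) (e : E m) (a : ℝ) : E n → E m :=
  c - (1 + a) • halfPlane ν e

/-- The gradient of the remainder. -/
def remainderGrad (G : E n → Grad n m) (ν : E n) (e : E m) (a : ℝ) : E n → Grad n m :=
  G - (1 + a) • halfPlaneGrad ν e

theorem IsHomogeneousMap.remainder {c : E n → E m} {G : E n → Grad n m} (h : IsHomogeneousMap c G)
    (ν : E n) (e : E m) (a : ℝ) :
    IsHomogeneousMap (_root_.remainder c ν e a) (remainderGrad G ν e a) :=
  h.sub ((isHomogeneousMap_halfPlane ν e).const_smul _)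

/-- The component of the remainder along `e₀` has no tangential moments, by the choice of `ν` and
because the profile has none. Only the component along `e - e₀` is left. -/
theorem tangential_remainder_le {c : E n → E m} (hc : MemLp c 2 (ballMeasure n)) {ν : E n}
    (hν : ‖ν‖ = 1) {e e₀ : E m} (a : ℝ)
    (hsh : ∀ b, ∫ x, inner ℝ (c x) e₀ * shear ν b x ∂(ballMeasure n) = 0) :
    tangential ν (fun x => inner ℝ (remainder c ν e a x) e)
      ≤ 4 * n * ((ballMeasure n).real Set.univ + 1)
        * (‖e - e₀‖ ^ 2 * ∫ x, ‖remainder c ν e a x‖ ^ 2 ∂(ballMeasure n)) := by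
  have hh := (isHomogeneousMap_halfPlane ν e).hasWeakGradient.1
  have hψ : MemLp (remainder c ν e a) 2 (ballMeasure n) := hc.sub (hh.const_smul _)
  have h0 : ∀ b, ∫ x, inner ℝ (remainder c ν e a x) e₀ * shear ν b x ∂(ballMeasure n) = 0 := fun b => by
    have e1 : ∀ x, inner ℝ (remainder c ν e a x) e₀ * shear ν b x
        = inner ℝ (c x) e₀ * shear ν b x
          - (1 + a) * inner ℝ e e₀ * (posInner ν x ^ 2 / 2 * shear ν b x) := fun x => by
      simp only [remainder, Pi.sub_apply, Pi.smul_apply, halfPlane_apply, inner_sub_left,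
        real_inner_smul_left]
      ring
    simp only [e1]
    rw [integral_sub (integrable_mul_shear (hc.inner_const e₀) ν b)
      ((integrable_mul_shear (memLp_posInner_sq ν) ν b).const_mul _), hsh, integral_const_mul,
      integral_posInner_sq_mul_shear hν]
    simp
  have h1 : tangential ν (fun x => inner ℝ (remainder c ν e a x) e)
      = tangential ν (fun x => inner ℝ (remainder c ν e a x) (e - e₀)) := by
    unfold tangential
    refine Finset.sum_congr rfl fun i _ => ?_
    simp only [inner_sub_right, sub_mul]
    rw [integral_sub (integrable_mul_shear (hψ.inner_const e) ν _)
      (integrable_mul_shear (hψ.inner_const e₀) ν _), h0, sub_zero]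
  rw [h1]
  refine (tangential_le hν (hψ.inner_const _)).trans
    (mul_le_mul_of_nonneg_left ?_ (by have := measureReal_nonneg (μ := ballMeasure n) (s := Set.univ); positivity))
  rw [← integral_const_mul]
  refine integral_mono (integrable_halfInd_mul ν (hψ.inner_const _).integrable_sq')
    (hψ.integrable_norm_sq.const_mul _) fun x => ?_
  have h2 : inner ℝ (remainder c ν e a x) (e - e₀) ^ 2
      ≤ ‖e - e₀‖ ^ 2 * ‖remainder c ν e a x‖ ^ 2 := by
    rw [← mul_pow, ← sq_abs, mul_comm]
    have := abs_real_inner_le_norm (remainder c ν e a x) (e - e₀)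
    gcongr
  exact (mul_le_of_le_one_left (sq_nonneg _) (halfInd_le_one ν x)).trans h2

/-- The coercivity of the deficit around the adapted half-plane solution. -/
theorem coercive_deficit (hn : 0 < n) : ∃ c₁ : ℝ, 0 < c₁ ∧ ∃ η : ℝ, 0 < η ∧
    ∀ (m : ℕ) (c : E n → E m) (G : E n → Grad n m) (ν : E n) (e e₀ : E m) (a : ℝ),
      IsHomogeneousMap c G → ‖ν‖ = 1 → ‖e‖ = 1 → ‖e₀‖ = 1 → ‖e - e₀‖ ≤ η →
      (∀ᵐ x ∂(ballMeasure n), ‖c x - halfPlane ν e₀ x‖ ≤ η) →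
      (∀ i, ∫ x, halfInd ν x * c x i ∂(ballMeasure n) = (1 + a) * halfMass ν * e i) →
      (∀ b, ∫ x, inner ℝ (c x) e₀ * shear ν b x ∂(ballMeasure n) = 0) →
      c₁ * ∫ x, ‖remainder c ν e a x‖ ^ 2 ∂(ballMeasure n)
        ≤ energyPair (remainder c ν e a) (remainderGrad G ν e a) (remainder c ν e a)
            (remainderGrad G ν e a)
          + ∫ x, (‖c x‖ - halfInd ν x * inner ℝ (c x) e) ∂(ballMeasure n) := by
  obtain ⟨C, hCdef, hC⟩ : ∃ C : ℝ, C = 4 * n * ((ballMeasure n).real Set.univ + 1) ∧ 0 < C := by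
    refine ⟨_, rfl, ?_⟩
    have := measureReal_nonneg (μ := ballMeasure n) (s := Set.univ)
    have : (0 : ℝ) < n := by exact_mod_cast hn
    positivity
  -- The weight `1 / (4C)` is such that the tangential term costs at most half of the mass
  -- orthogonal to `e` on the half-ball, which is what `deficit_pointwise` provides. The constant
  -- `K` it produces then dictates `η`.
  obtain ⟨K, hK, c₀, hc₀, hco⟩ := coercivity (n := n) hn (by positivity : 0 < 1 / (4 * C))
  obtain ⟨η, hη, hη1, hηK, hηc⟩ : ∃ η : ℝ, 0 < η ∧ η ≤ 1 / 2 ∧ K * η ≤ 1 ∧ η ^ 2 ≤ c₀ := by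
    refine ⟨min (1 / 2) (min (1 / K) (√c₀)), by positivity, min_le_left _ _, ?_, ?_⟩
    · have : min (1 / 2) (min (1 / K) (√c₀)) ≤ 1 / K := (min_le_right _ _).trans (min_le_left _ _)
      calc _ ≤ K * (1 / K) := by gcongr
        _ = 1 := by field_simp
    · have : min (1 / 2) (min (1 / K) (√c₀)) ≤ √c₀ := (min_le_right _ _).trans (min_le_right _ _)
      calc _ ≤ √c₀ ^ 2 := by gcongr
        _ = c₀ := Real.sq_sqrt hc₀.le
  refine ⟨c₀ / 2, by positivity, η, hη, fun m c G ν e e₀ a h hν he he₀ hee hclose hmom hsh => ?_⟩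
  have hψ := h.remainder ν e a
  have hcm := h.hasWeakGradient.1
  have hψm := hψ.hasWeakGradient.1
  have hψi := fun i => memLp_piLp_iff.1 hψm i
  have hq := memLp_sub_proj hcm he
  -- The moments of `c` on the half-ball are those of `(1 + a)` times the half-plane solution, so
  -- each component of the remainder satisfies the zero mean condition of `coercivity`.
  have hzero : ∀ i, ∫ x, halfInd ν x * remainder c ν e a x i ∂(ballMeasure n) = 0 := fun i => by
    have e1 : ∀ x, halfInd ν x * remainder c ν e a x i = halfInd ν x * c x i
        - (1 + a) * e i * (halfInd ν x * (posInner ν x ^ 2 / 2)) := fun x => by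
      simp only [remainder, Pi.sub_apply, Pi.smul_apply, halfPlane_apply, PiLp.sub_apply,
        PiLp.smul_apply, smul_eq_mul]
      ring
    simp only [e1]
    rw [integral_sub ((memLp_halfInd_mul ν (memLp_piLp_iff.1 hcm i)).integrable (by norm_num))
      (((memLp_halfInd_mul ν (memLp_posInner_sq ν)).integrable (by norm_num)).const_mul _), hmom,
      integral_const_mul, integral_halfInd_mul_posInner_sq]
    ring
  have hsum := Finset.sum_le_sum fun i (_ : i ∈ Finset.univ) => hco ν hν _ _ (hψ i) (hzero i)
  rw [Finset.sum_add_distrib, Finset.sum_add_distrib, ← Finset.mul_sum, ← Finset.mul_sum,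
    ← Finset.mul_sum, ← integral_norm_sq_eq_sum hψm, ← energyPair_self_eq_sum hψ.hasWeakGradient]
    at hsum
  -- The subtracted half-plane solution points along `e`, so the part of the remainder orthogonal to
  -- `e` is that of `c`.
  have hdec : ∀ i, (fun x => remainder c ν e a x i)
      = fun x => (c x - inner ℝ (c x) e • e) i + e i * inner ℝ (remainder c ν e a x) e := fun i => by
    funext x
    simp only [remainder, Pi.sub_apply, Pi.smul_apply, inner_sub_left, real_inner_smul_left,
      halfPlane_apply, real_inner_self_eq_norm_sq, he, one_pow, PiLp.sub_apply, PiLp.smul_apply, smul_eq_mul]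
    ring
  have htan : ∑ i, tangential ν (fun x => remainder c ν e a x i)
      ≤ 2 * (C * ∫ x, halfInd ν x * ‖c x - inner ℝ (c x) e • e‖ ^ 2 ∂(ballMeasure n))
        + 2 * (C * (‖e - e₀‖ ^ 2 * ∫ x, ‖remainder c ν e a x‖ ^ 2 ∂(ballMeasure n))) := by
    simp only [hdec]
    have h1 := sum_tangential_le hν he hcm (hψm.inner_const e)
    have h2 := tangential_remainder_le hcm hν (e := e) a hsh
    rw [← hCdef] at h1 h2
    linarith
  have hneg : ∑ i, ∫ x, (1 - halfInd ν x) * remainder c ν e a x i ^ 2 ∂(ballMeasure n)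
      = ∫ x, (1 - halfInd ν x) * ‖remainder c ν e a x‖ ^ 2 ∂(ballMeasure n) := by
    rw [← integral_finsetSum _ fun i _ => memLp_one_iff_integrable.1
      (memLp_one_sub_halfInd_mul ν (memLp_one_iff_integrable.2 (hψi i).integrable_sq'))]
    refine integral_congr_ae (ae_of_all _ fun x => ?_)
    simp only [EuclideanSpace.norm_sq_eq, Real.norm_eq_abs, sq_abs, Finset.mul_sum]
  have i1 := (memLp_one_iff_integrable.1
      (memLp_one_sub_halfInd_mul ν (memLp_one_iff_integrable.2 hψm.integrable_norm_sq))).const_mul K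
  have i2 := (integrable_halfInd_mul ν hq.integrable_norm_sq).const_mul (1 / 2)
  have i3 : Integrable (fun x => ‖c x‖ - halfInd ν x * inner ℝ (c x) e) (ballMeasure n) :=
    (hcm.integrable (by norm_num)).norm.sub
      (integrable_halfInd_mul ν ((hcm.inner_const e).integrable (by norm_num)))
  have hpt : K * ∫ x, (1 - halfInd ν x) * ‖remainder c ν e a x‖ ^ 2 ∂(ballMeasure n)
      + 1 / 2 * ∫ x, halfInd ν x * ‖c x - inner ℝ (c x) e • e‖ ^ 2 ∂(ballMeasure n)
      ≤ ∫ x, (‖c x‖ - halfInd ν x * inner ℝ (c x) e) ∂(ballMeasure n) := by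
    rw [← integral_const_mul, ← integral_const_mul, ← integral_add i1 i2]
    refine integral_mono_ae (i1.add i2) i3 ?_
    filter_upwards [hclose, ae_norm_le_one n] with x hx hx1
    exact deficit_pointwise hη1 hηK hK hν he he₀ a hx1 hx
  rw [hneg] at hsum
  have hS : 0 ≤ ∫ x, ‖remainder c ν e a x‖ ^ 2 ∂(ballMeasure n) := integral_nonneg fun x => sq_nonneg _
  have hee2 : ‖e - e₀‖ ^ 2 ≤ c₀ := (pow_le_pow_left₀ (norm_nonneg _) hee 2).trans hηc
  have h6 := mul_le_mul_of_nonneg_right hee2 hS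
  -- The error from `e - e₀` is at most `c₀ / 2` times the mass of the remainder, hence the final
  -- constant `c₀ / 2`.
  have h7 : 1 / (4 * C) * ∑ i, tangential ν (fun x => remainder c ν e a x i)
      ≤ 1 / 2 * ∫ x, halfInd ν x * ‖c x - inner ℝ (c x) e • e‖ ^ 2 ∂(ballMeasure n)
        + 1 / 2 * (‖e - e₀‖ ^ 2 * ∫ x, ‖remainder c ν e a x‖ ^ 2 ∂(ballMeasure n)) := by
    refine (mul_le_mul_of_nonneg_left htan (by positivity)).trans (le_of_eq ?_)
    field_simp
    ring
  linarith

end Deficit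

/-! ### The competitor and the improvement of energy -/

section Competitor
variable {n m : ℕ}

/-- The direction in which the energy of `c` decreases. -/
def descent (c : E n → E m) (ν : E n) (e : E m) (a : ℝ) : E n → E m :=
  a • halfPlane ν e - remainder c ν e a

/-- The gradient of the descent direction. -/
def descentGrad (G : E n → Grad n m) (ν : E n) (e : E m) (a : ℝ) : E n → Grad n m :=
  a • halfPlaneGrad ν e - remainderGrad G ν e a

theorem IsHomogeneousMap.descent {c : E n → E m} {G : E n → Grad n m} (h : IsHomogeneousMap c G)
    (ν : E n) (e : E m) (a : ℝ) :
    IsHomogeneousMap (_root_.descent c ν e a) (descentGrad G ν e a) :=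
  ((isHomogeneousMap_halfPlane ν e).const_smul a).sub (h.remainder ν e a)

theorem integral_halfInd_inner_of_moment {c : E n → E m} (hc : MemLp c 2 (ballMeasure n)) {ν : E n}
    {e : E m} (he : ‖e‖ = 1) {a : ℝ}
    (hmom : ∀ i, ∫ x, halfInd ν x * c x i ∂(ballMeasure n) = (1 + a) * halfMass ν * e i) :
    ∫ x, halfInd ν x * inner ℝ (c x) e ∂(ballMeasure n) = (1 + a) * halfMass ν := by
  rw [integral_halfInd_mul_inner hc]
  simp only [hmom]
  have e1 : ∑ i, e i ^ 2 = 1 := by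
    have := EuclideanSpace.norm_sq_eq (𝕜 := ℝ) e
    rw [he] at this
    simpa using this.symm
  calc _ = (1 + a) * halfMass ν * ∑ i, e i ^ 2 := by
        rw [Finset.mul_sum]; exact Finset.sum_congr rfl fun i _ => by ring
    _ = _ := by rw [e1, mul_one]

/-- The energy of an adapted map and its first variation along the descent direction. -/
theorem adapted_energies (hn : 0 < n) {c : E n → E m} {G : E n → Grad n m}
    (h : IsHomogeneousMap c G) {ν : E n} (hν : ‖ν‖ = 1) {e : E m} (he : ‖e‖ = 1) {a : ℝ}
    (ha : |a| ≤ 1 / 2)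
    (hmom : ∀ i, ∫ x, halfInd ν x * c x i ∂(ballMeasure n) = (1 + a) * halfMass ν * e i)
    {Q P : ℝ}
    (hQ : Q = energyPair (remainder c ν e a) (remainderGrad G ν e a) (remainder c ν e a)
      (remainderGrad G ν e a))
    (hP : P = ∫ x, (‖c x‖ - halfInd ν x * inner ℝ (c x) e) ∂(ballMeasure n)) :
    balancedEnergy c = halfMass ν - a ^ 2 * halfMass ν + Q + 2 * P ∧
      2 * energyPair c G (descent c ν e a) (descentGrad G ν e a)
        + 2 * (∫ x, ‖c x + descent c ν e a x‖ ∂(ballMeasure n) - ∫ x, ‖c x‖ ∂(ballMeasure n))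
      = - (2 * (a ^ 2 * halfMass ν) + 2 * (Q + P)) := by
  have hcm := h.hasWeakGradient.1
  have hH := isHomogeneousMap_halfPlane ν e
  have hψ := h.remainder ν e a
  have hwψ := hψ.hasWeakGradient
  have hwH := hH.hasWeakGradient
  have hPc : ∫ x, ‖c x‖ ∂(ballMeasure n) = P + (1 + a) * halfMass ν := by
    rw [hP, integral_sub (hcm.integrable (by norm_num)).norm
      (integrable_halfInd_mul ν ((hcm.inner_const e).integrable (by norm_num))),
      integral_halfInd_inner_of_moment hcm he hmom]
    ring
  have hHH := energyPair_halfPlane_self hν he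
  have hdec : c = (1 + a) • halfPlane ν e + remainder c ν e a := by
    unfold remainder; abel
  have hdecG : G = (1 + a) • halfPlaneGrad ν e + remainderGrad G ν e a := by
    unfold remainderGrad; abel
  have hcH : energyPair c G (halfPlane ν e) (halfPlaneGrad ν e) = - ((1 + a) * halfMass ν) := by
    rw [h.energyPair_halfPlane hν, integral_halfInd_inner_of_moment hcm he hmom]
  have hsplit : ∀ (w : E n → E m) (W : E n → Grad n m), HasWeakGradient w W →
      energyPair c G w W = (1 + a) * energyPair (halfPlane ν e) (halfPlaneGrad ν e) w W
        + energyPair (remainder c ν e a) (remainderGrad G ν e a) w W := fun w W hw => by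
    conv_lhs => rw [hdec, hdecG]
    rw [energyPair_add_left (hwH.const_smul _) hwψ hw, energyPair_smul_left]
  -- The zero means of the remainder make it orthogonal to the half-plane solution for the energy
  -- form, so the energy splits without cross terms.
  have hψH : energyPair (remainder c ν e a) (remainderGrad G ν e a) (halfPlane ν e)
      (halfPlaneGrad ν e) = 0 := by
    have := hsplit _ _ hwH
    rw [hcH, hHH] at this
    linarith
  have hHψ := (energyPair_comm (remainder c ν e a) (halfPlane ν e) (remainderGrad G ν e a)
    (halfPlaneGrad ν e)).symm.trans hψH
  have hcψ : energyPair c G (remainder c ν e a) (remainderGrad G ν e a) = Q := by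
    rw [hsplit _ _ hwψ, hHψ, ← hQ]; ring
  have hcc : energyPair c G c G = - ((1 + a) ^ 2 * halfMass ν) + Q := by
    conv_lhs => enter [3]; rw [hdec]
    conv_lhs => enter [4]; rw [hdecG]
    rw [energyPair_add_right (hwH.const_smul _) hwψ h.hasWeakGradient, energyPair_smul_right, hcH, hcψ]
    ring
  have hcd : energyPair c G (descent c ν e a) (descentGrad G ν e a)
      = - (a * ((1 + a) * halfMass ν)) - Q := by
    have e1 : descent c ν e a = a • halfPlane ν e + (-1 : ℝ) • remainder c ν e a := by
      rw [descent, neg_one_smul, sub_eq_add_neg]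
    have e2 : descentGrad G ν e a = a • halfPlaneGrad ν e + (-1 : ℝ) • remainderGrad G ν e a := by
      rw [descentGrad, neg_one_smul, sub_eq_add_neg]
    rw [e1, e2, energyPair_add_right (hwH.const_smul _) (hwψ.const_smul _) h.hasWeakGradient,
      energyPair_smul_right, energyPair_smul_right, hcH, hcψ]
    ring
  -- The end point of the descent is `(1 + 2a)` times the half-plane solution, with nonnegative
  -- factor because `|a| ≤ 1 / 2`. The terms linear in `a` cancel in the first variation.
  have hnorm : ∫ x, ‖c x + descent c ν e a x‖ ∂(ballMeasure n) = (1 + 2 * a) * halfMass ν := by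
    have e1 : ∀ x, ‖c x + descent c ν e a x‖ = (1 + 2 * a) * (posInner ν x ^ 2 / 2) := fun x => by
      have e2 : c x + descent c ν e a x = (1 + 2 * a) • halfPlane ν e x := by
        simp only [descent, remainder, Pi.sub_apply, Pi.smul_apply]
        module
      rw [e2, norm_smul, norm_halfPlane ν he, Real.norm_of_nonneg (by linarith [(abs_le.1 ha).1])]
    simp only [e1, integral_const_mul]
    rfl
  constructor
  · rw [h.balancedEnergy_eq hn, hcc, hPc]; ring
  · rw [hcd, hnorm, hPc]; ring

theorem integral_halfPlane_sq_le {ν : E n} (hν : ‖ν‖ = 1) {e : E m} (he : ‖e‖ = 1) :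
    ∫ x, ‖halfPlane ν e x‖ ^ 2 ∂(ballMeasure n) ≤ halfMass ν / 2 := by
  rw [halfMass, ← integral_div]
  refine integral_mono_ae (isHomogeneousMap_halfPlane ν e).hasWeakGradient.1.integrable_norm_sq
    (((memLp_posInner_sq ν).integrable (by norm_num)).div_const 2) ?_
  filter_upwards [ae_norm_le_one n] with x hx
  rw [norm_halfPlane ν he]
  have h1 := posInner_sq_le hν hx
  have h2 : 0 ≤ posInner ν x ^ 2 / 2 := by positivity
  nlinarith

theorem integral_grad_sq_eq {u : E n → E m} {G : E n → Grad n m} :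
    ∫ x, ‖G x‖ ^ 2 ∂(ballMeasure n) = energyPair u G u G
      + 2 * ((n : ℝ) + 4) * ∫ x, ‖u x‖ ^ 2 ∂(ballMeasure n) := by
  simp only [energyPair, real_inner_self_eq_norm_sq]
  ring

/-- Controls the second order term in `ε`. Dirichlet integrals are rewritten through the energy
form, which brings in exactly the quantities of the first variation. -/
theorem descent_sq_le {c : E n → E m} {G : E n → Grad n m}
    (h : IsHomogeneousMap c G) {ν : E n} (hν : ‖ν‖ = 1) {e : E m} (he : ‖e‖ = 1) (a : ℝ) :
    ∫ x, ‖descent c ν e a x‖ ^ 2 ∂(ballMeasure n) + ∫ x, ‖descentGrad G ν e a x‖ ^ 2 ∂(ballMeasure n)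
      ≤ 2 * ((n : ℝ) + 5) * (a ^ 2 * halfMass ν)
        + 2 * (energyPair (remainder c ν e a) (remainderGrad G ν e a) (remainder c ν e a)
            (remainderGrad G ν e a)
          + (2 * (n : ℝ) + 9) * ∫ x, ‖remainder c ν e a x‖ ^ 2 ∂(ballMeasure n)) := by
  have hwH := (isHomogeneousMap_halfPlane ν e).hasWeakGradient
  have hwψ := (h.remainder ν e a).hasWeakGradient
  have hJ := integral_halfPlane_sq_le hν he
  have h1 := integral_add_sq_le (hwH.1.const_smul a) (hwψ.1.const_smul (-1 : ℝ))
  have h2 := integral_add_sq_le (hwH.2.1.const_smul a) (hwψ.2.1.const_smul (-1 : ℝ))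
  have hI : 0 ≤ halfMass ν := (halfMass_pos hν).le
  simp only [Pi.smul_apply, norm_smul, mul_pow, Real.norm_eq_abs, sq_abs, integral_const_mul,
    abs_neg, abs_one, one_mul] at h1 h2
  have e1 : ∀ x, descent c ν e a x = a • halfPlane ν e x + (-1 : ℝ) • remainder c ν e a x :=
    fun x => by simp only [descent, Pi.sub_apply, Pi.smul_apply]; module
  have e2 : ∀ x, descentGrad G ν e a x
      = a • halfPlaneGrad ν e x + (-1 : ℝ) • remainderGrad G ν e a x :=
    fun x => by simp only [descentGrad, Pi.sub_apply, Pi.smul_apply]; module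
  simp only [← e1, ← e2] at h1 h2
  rw [integral_grad_sq_eq (u := halfPlane ν e) (G := halfPlaneGrad ν e),
    integral_grad_sq_eq (u := remainder c ν e a) (G := remainderGrad G ν e a),
    energyPair_halfPlane_self hν he] at h2
  have hn0 : (0 : ℝ) ≤ n := Nat.cast_nonneg n
  have h3 := mul_le_mul_of_nonneg_left hJ (by positivity : 0 ≤ a ^ 2 * (2 * (2 * (n : ℝ) + 9)))
  have h4 : 0 ≤ a ^ 2 * halfMass ν := by positivity
  nlinarith

theorem ae_norm_le_of_supNorm_le {u : E n → E m} {δ : ℝ} (hδ : 0 ≤ δ)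
    (h : supNorm u ≤ ENNReal.ofReal δ) : ∀ᵐ x ∂(ballMeasure n), ‖u x‖ ≤ δ := by
  rw [supNorm, eLpNorm_exponent_top] at h
  filter_upwards [ae_le_eLpNormEssSup (f := u) (μ := ballMeasure n)] with x hx
  have h1 := hx.trans h
  rw [← ofReal_norm] at h1
  exact (ENNReal.ofReal_le_ofReal_iff hδ).1 h1

/-- The epiperimetric improvement for adapted maps. -/
theorem exists_improvement (hn : 0 < n) {c₁ : ℝ} (hc₁ : 0 < c₁) : ∃ κ : ℝ, 0 < κ ∧ κ < 1 ∧
    ∀ (m : ℕ) (c : E n → E m) (G : E n → Grad n m) (ν : E n) (e : E m) (a : ℝ),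
      IsHomogeneousMap c G → ‖ν‖ = 1 → ‖e‖ = 1 → |a| ≤ 1 / 2 →
      (∀ i, ∫ x, halfInd ν x * c x i ∂(ballMeasure n) = (1 + a) * halfMass ν * e i) →
      c₁ * ∫ x, ‖remainder c ν e a x‖ ^ 2 ∂(ballMeasure n)
        ≤ energyPair (remainder c ν e a) (remainderGrad G ν e a) (remainder c ν e a)
            (remainderGrad G ν e a)
          + ∫ x, (‖c x‖ - halfInd ν x * inner ℝ (c x) e) ∂(ballMeasure n) →
      ∃ v : E n → E m, MemW12 v ∧ MemW012 (v - c) ∧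
        balancedEnergy v ≤ (1 - κ) * balancedEnergy c + κ * halfMass ν := by
  obtain ⟨C, hC, hcut⟩ := exists_bound_cutGrad n
  have hA := cutoffMass_pos (n := n)
  obtain ⟨A, hAdef⟩ : ∃ A, A = cutoffMass n := ⟨_, rfl⟩
  rw [← hAdef] at hA
  -- `C₂` bounds the Sobolev norm squared of the descent direction, and `C₃` the excess of energy,
  -- both by the gain `2 T + 2 (Q + P)` with `T = a² * halfMass ν`.
  obtain ⟨C₂, hC₂def⟩ : ∃ C₂ : ℝ, C₂ = (n : ℝ) + 6 + (2 * n + 9) / c₁ := ⟨_, rfl⟩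
  have hC₂ : 0 < C₂ := by rw [hC₂def]; positivity
  obtain ⟨C₃, hC₃def⟩ : ∃ C₃ : ℝ, C₃ = 1 + ((n : ℝ) + 4) / c₁ := ⟨_, rfl⟩
  have hC₃ : 0 < C₃ := by rw [hC₃def]; positivity
  -- `ε` keeps the second order term below half of the first order gain.
  obtain ⟨ε, hε, hε1, hεC⟩ : ∃ ε : ℝ, 0 < ε ∧ ε ≤ 1 ∧ ε * (C * C₂) ≤ A / 2 := by
    refine ⟨min 1 (A / (2 * (C * C₂))), by positivity, min_le_left _ _, ?_⟩
    calc _ ≤ A / (2 * (C * C₂)) * (C * C₂) := by gcongr; exact min_le_right _ _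
      _ = A / 2 := by field_simp
  -- `κ` is such that `κ` times the excess of energy fits into the other half of the gain.
  obtain ⟨κ, hκ, hκ1, hκC⟩ : ∃ κ : ℝ, 0 < κ ∧ κ < 1 ∧ κ * C₃ ≤ ε * A / 2 := by
    refine ⟨min (1 / 2) (ε * A / (2 * C₃)), by positivity,
      (min_le_left _ _).trans_lt (by norm_num), ?_⟩
    calc _ ≤ ε * A / (2 * C₃) * C₃ := by gcongr; exact min_le_right _ _
      _ = ε * A / 2 := by field_simp
  refine ⟨κ, hκ, hκ1, fun m c G ν e a h hν he ha hmom hdef => ?_⟩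
  have hd := h.descent ν e a
  have hdε := hd.const_smul ε
  refine ⟨c + fun x => cutoff x • (ε • descent c ν e a) x,
    (h.hasWeakGradient.add hdε.hasWeakGradient.cutoff_smul).memW12, ?_, ?_⟩
  · rw [add_sub_cancel_left]
    exact memW012_cutoff_smul (hdε.isSmoothLimit hn)
  obtain ⟨Q, hQ⟩ : ∃ Q, Q = energyPair (remainder c ν e a) (remainderGrad G ν e a)
    (remainder c ν e a) (remainderGrad G ν e a) := ⟨_, rfl⟩
  obtain ⟨P, hP⟩ : ∃ P, P = ∫ x, (‖c x‖ - halfInd ν x * inner ℝ (c x) e) ∂(ballMeasure n) := ⟨_, rfl⟩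
  obtain ⟨S, hS⟩ : ∃ S, S = ∫ x, ‖remainder c ν e a x‖ ^ 2 ∂(ballMeasure n) := ⟨_, rfl⟩
  obtain ⟨hM, hvar⟩ := adapted_energies hn h hν he ha hmom hQ hP
  have hexp := h.balancedEnergy_add_cutoff_le hn hd hε.le hε1
  have hcutd := hcut m _ _ hd.hasWeakGradient
  have hsq := descent_sq_le h hν he a
  -- `Q` may be negative, but only by `2 (n + 4) S`. This bounds `P` by `Q + P` plus a multiple of
  -- `S`, and `S` is at most `(Q + P) / c₁`.
  have hgrad : 0 ≤ Q + 2 * ((n : ℝ) + 4) * S := by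
    rw [hQ, hS, ← integral_grad_sq_eq]
    exact integral_nonneg fun x => sq_nonneg _
  have hP0 : 0 ≤ P := by
    rw [hP]
    refine integral_nonneg fun x => ?_
    have h1 := halfInd_nonneg ν x
    have h2 := halfInd_le_one ν x
    have h3 : inner ℝ (c x) e ≤ ‖c x‖ := by simpa [he] using real_inner_le_norm (c x) e
    have h4 := norm_nonneg (c x)
    simp only [Pi.zero_apply]
    nlinarith [mul_le_mul_of_nonneg_left h3 h1]
  have hS0 : 0 ≤ S := by rw [hS]; exact integral_nonneg fun x => sq_nonneg _
  rw [hvar, ← hAdef] at hexp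
  rw [← hS, ← hQ] at hsq
  rw [← hS, ← hQ, ← hP] at hdef
  have hI := (halfMass_pos hν).le
  have hT : 0 ≤ a ^ 2 * halfMass ν := by positivity
  generalize a ^ 2 * halfMass ν = T at hM hexp hsq hT
  have hSD : S ≤ (Q + P) / c₁ := by rw [le_div_iff₀ hc₁]; linarith
  have hD : 0 ≤ Q + P := le_trans (by positivity) hdef
  have hn0 : (0 : ℝ) ≤ n := Nat.cast_nonneg n
  have b1 : 2 * ((n : ℝ) + 5) * T + 2 * (Q + (2 * (n : ℝ) + 9) * S) ≤ C₂ * (2 * T + 2 * (Q + P)) := by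
    have h1 := mul_le_mul_of_nonneg_left hSD (by positivity : 0 ≤ 2 * (n : ℝ) + 9)
    have h2 : (2 * (n : ℝ) + 9) * ((Q + P) / c₁) = (2 * n + 9) / c₁ * (Q + P) := by ring
    have h3 : 0 ≤ (2 * (n : ℝ) + 9) / c₁ * T := by positivity
    have h4 : 0 ≤ (n : ℝ) * (Q + P) := by positivity
    rw [hC₂def]
    rw [h2] at h1
    generalize (2 * (n : ℝ) + 9) / c₁ = d at h1 h3 ⊢
    linarith
  have b2 : Q + 2 * P ≤ C₃ * (2 * T + 2 * (Q + P)) := by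
    have h1 := mul_le_mul_of_nonneg_left hSD (by positivity : 0 ≤ 2 * ((n : ℝ) + 4))
    have h2 : 2 * ((n : ℝ) + 4) * ((Q + P) / c₁) = 2 * ((n + 4) / c₁ * (Q + P)) := by ring
    have h3 : 0 ≤ ((n : ℝ) + 4) / c₁ * T := by positivity
    rw [hC₃def]
    rw [h2] at h1
    generalize ((n : ℝ) + 4) / c₁ = d at h1 h3 ⊢
    linarith
  have hX : 0 ≤ 2 * T + 2 * (Q + P) := by positivity
  generalize 2 * T + 2 * (Q + P) = X at hexp b1 b2 hX
  have b3 : ε ^ 2 * ∫ x, ‖cutGrad (descent c ν e a) (descentGrad G ν e a) x‖ ^ 2 ∂(ballMeasure n)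
      ≤ ε * (A / 2) * X := by
    have h1 := mul_le_mul_of_nonneg_left (hcutd.trans (mul_le_mul_of_nonneg_left (hsq.trans b1) hC.le))
      (sq_nonneg ε)
    have h2 := mul_le_mul_of_nonneg_left (mul_le_mul_of_nonneg_right hεC hX) hε.le
    linarith
  have b4 : κ * (Q + 2 * P) ≤ ε * A / 2 * X := by
    have h1 := mul_le_mul_of_nonneg_left b2 hκ.le
    have h2 := mul_le_mul_of_nonneg_right hκC hX
    linarith
  have b5 : 0 ≤ κ * T := by positivity
  -- The term `-a² * halfMass ν` in the excess only helps here.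
  have b6 : κ * (balancedEnergy c - halfMass ν) ≤ ε * A / 2 * X := by
    rw [hM]; linarith
  linarith

end Competitor

end

/-! ### Assembly of the epiperimetric inequality -/

theorem mainTheorem2 (n m : ℕ) (hn : 2 ≤ n) (hm : 1 ≤ m) :
    ∃ κ : ℝ, 0 < κ ∧ κ < 1 ∧ ∃ δ : ℝ, 0 < δ ∧
      ∀ c : E n → E m, MemW12 c → IsHomogeneousTwo c →
        (∃ h ∈ halfPlaneSolutions n m,
          w12Norm (c - h) + supNorm (c - h) ≤ ENNReal.ofReal δ) →
        ∃ v : E n → E m, MemW12 v ∧ MemW012 (v - c) ∧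
          ∀ (ν : E n) (e : E m), ‖ν‖ = 1 → ‖e‖ = 1 →
            balancedEnergy v ≤ (1 - κ) * balancedEnergy c + κ * (alphaN ν e / 2) := by
  have hn0 : 0 < n := by omega
  obtain ⟨c₁, hc₁, η, hη, hco⟩ := coercive_deficit hn0
  obtain ⟨κ, hκ, hκ1, himp⟩ := exists_improvement hn0 hc₁
  obtain ⟨δ, hδ, had⟩ := exists_adapted hn0 hη
  refine ⟨κ, hκ, hκ1, δ, hδ, fun c hc hhom => ?_⟩
  rintro ⟨_, ⟨ν₀, e₀, hν₀, he₀, rfl⟩, hclose⟩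
  have hG := hc.hasWeakGradient
  have hmap := hhom.isHomogeneousMap hG
  obtain ⟨ν, e, a, hν, he, ha, hee, hnear, hmom, hsh⟩ := had m c ν₀ e₀ hG.1 hν₀ he₀
    (ae_norm_le_of_supNorm_le hδ.le (le_add_self.trans hclose))
  obtain ⟨v, hv, hvc, hE⟩ := himp m c _ ν e a hmap hν he ha hmom
    (hco m c _ ν e e₀ a hmap hν he he₀ hee hnear hmom hsh)
  refine ⟨v, hv, hvc, fun ν' e' hν' he' => ?_⟩
  -- The adapted direction differs from the one in the conclusion; rotational invariance of
  -- `halfMass` reconciles them.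
  have : alphaN ν' e' / 2 = halfMass ν := by
    rw [alphaN, balancedEnergy_halfPlane hn0 hν' he', halfMass_eq hν' hν]
    ring
  rw [this]
  exact hE
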